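/- **Definitions.** Strings are binary. $\Delta_H$ is Hamming distance and $\Delta_E(x,y)=|x|+|y|-2\,\mathrm{LCS}(x,y)$ is insertion–deletion distance. A channel is a map $\mathcal E:\{0,1\}^*\to\{0,1\}^*$ that is fixed before keys and codewords are sampled. It is a $p(\cdot)$-bounded Hamming channel if $|\mathcal E(x)|=|x|$ and $\Delta_H(x,\mathcal E(x))\le p(|x|)|x|$ for all $x$, and a $p(\cdot)$-bounded edit channel if $\Delta_E(x,\mathcal E(x))\le p(|x|)|x|$ for all $x$. A Hamming channel is *oblivious* if $\mathcal E(x)=x\oplus e_{|x|}$ for fixed patterns $e_m\in\{0,1\}^m$. A function of $\lambda$ is negligible if for every $c>0$ it is eventually at most $\lambda^{-c}$. A *binary zero-bit public-key PRC* robust to a class of channels consists of probabilistic polynomial-time algorithms: $\mathsf{KeyGen}(1^\lambda)$, which outputs keys $(\mathsf{pk},\mathsf{sk})$ of lengths determined by $\lambda$; $\mathsf{Enc}(1^\lambda,\mathsf{pk})$, which encodes the only message $1$ as a string of length $N(\lambda)$; and $\mathsf{Dec}(1^\lambda,\mathsf{sk},y)\in\{1,\bot\}$ for $y\in\{0,1\}^*$.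 They satisfy: - *robustness:* for every channel $\mathcal E$ of the class, $\Pr[\mathsf{Dec}(1^\lambda,\mathsf{sk},\mathcal E(\mathsf{Enc}(1^\lambda,\mathsf{pk})))=1]\ge1-\mathrm{negl}(\lambda)$; - *soundness:* for all fixed strings $c_\lambda$ of length at most polynomial in $\lambda$, $\Pr[\mathsf{Dec}(1^\lambda,\mathsf{sk},c_\lambda)=\bot]\ge1-\mathrm{negl}(\lambda)$; - *pseudorandomness:* no probabilistic polynomial-time oracle adversary that is given $(1^\lambda,\mathsf{pk})$ distinguishes, with non-negligible advantage, the oracle $\mathsf{Enc}(1^\lambda,\mathsf{pk})$ (fresh coins at each call) from an oracle that returns independent uniform strings of length $N(\lambda)$. In a *secret-key PRC*, $\mathsf{pk}=\mathsf{sk}$ and the adversary is given only $1^\lambda$. *CGK embedding.* A seed $r\in\{0,1\}^{2M}$ describes functions $h_1,\dots,h_M:\{0,1\}\to\{0,1\}$. For $x\in\{0,1\}^L$, $\mathsf{Emb}(x,r)\in\{0,1\}^M$ is produced as follows: start with $i=1$; at step $t=1,\dots,M$ output $x_i$ and add $h_t(x_i)$ to $i$ if $i\le L$, and output $0$ if $i>L$.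 For $a\in\{0,1\}^M$, $\mathsf{Emb}^{-1}(a,r)\in\{0,1\}^L$ is produced as follows: start with $i=1$ and all $x_j$ unassigned; at step $t$, if $i\le L$, set $x_i=a_t$ in case $x_i$ is still unassigned, and then add $h_t(x_i)$ to $i$. Finally fill the unassigned positions with independent uniform bits. *Construction.* Let $\mathsf{PRC}_h=(\mathsf{KeyGen}_h,\mathsf{Enc}_h,\mathsf{Dec}_h)$ be a zero-bit PRC with codeword length $M=M(\lambda)$. Put $n=\lceil 2M/3\rceil$ (so $M=1.5\,n$ whenever $3\mid M$), and let $\ell=\ell(\lambda)$ be a number of blocks. The scheme $\mathsf{PRC}_{\ell}$ is the following. $\mathsf{KeyGen}$ samples independently, for $t\le\ell$, a key pair $(\mathsf{pk}_t,\mathsf{sk}_t)\gets\mathsf{KeyGen}_h(1^\lambda)$, a uniform seed $r_t\in\{0,1\}^{2M}$ and a uniform mask $e_t\in\{0,1\}^{M}$; $\mathsf{pk}=(\mathsf{pk}_t,r_t,e_t)_{t\le\ell}$ and $\mathsf{sk}=(\mathsf{sk}_t,r_t,e_t)_{t\le\ell}$. $\mathsf{Enc}$ outputs $y_1\circ\dots\circ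 y_\ell$ with $y_t\gets\mathsf{Emb}^{-1}(\mathsf{Enc}_h(1^\lambda,\mathsf{pk}_t)\oplus e_t,\,r_t)\in\{0,1\}^n$. $\mathsf{Dec}(1^\lambda,\mathsf{sk},y')$ takes every non-empty contiguous substring $z$ of $y'$, truncates it or pads it with trailing zeros to length $n$, and outputs $1$ if $\mathsf{Dec}_h(1^\lambda,\mathsf{sk}_t,\mathsf{Emb}(z,r_t)\oplus e_t)\neq\bot$ for some such $z$ and some $t\le\ell$; otherwise it outputs $\bot$. Call $\ell$ *admissible* for $\gamma$ if $1^{\ell(\lambda)}$ is computable from $1^\lambda$ in polynomial time, $\ell(\lambda)\ge n(\lambda)^{\frac1{2\gamma}-1}$ for all $\lambda$, and $\ell(\lambda)/\log\lambda\to\infty$. **Theorem.** Let $0<c_1<1/4$. There is a constant $0<C_2\le1$, depending only on $c_1$, such that the following holds for every real $0<\gamma<1/2$. Let $\mathsf{PRC}_h$ be a binary zero-bit public-key (resp. secret-key) PRC that is robust to every oblivious $(\tfrac14+c_1)$-bounded Hamming channel. 1. For every admissible $\ell$ and every $0<c_2\le C_2$, the scheme $\mathsf{PRC}_\ell$ is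 a binary zero-bit public-key (resp. secret-key) PRC that is robust to every $p(\cdot)$-bounded edit channel with $p(x)=c_2/x^\gamma$. 2. If $\gamma$ is rational and $\ell(\lambda)=\bigl\lceil n(\lambda)^{\frac1{2\gamma}-1}\bigr\rceil$ satisfies $\ell(\lambda)/\log\lambda\to\infty$ (for instance, if $n(\lambda)\ge\lambda^{\varepsilon}$ for some $\varepsilon>0$ and all large $\lambda$), then this $\ell$ is admissible. 3. For every real $0<\gamma<1/2$ an admissible $\ell$ exists. -/

import Mathlib

open Filter

namespace EditPRC

noncomputable section

/-! ### Strings, distances and channels -/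

/-- The string `1^κ`. -/
def ones (κ : ℕ) : List Bool := List.replicate κ true

/-- Bitwise exclusive or of two strings (of equal length). -/
def xorStr (x y : List Bool) : List Bool := List.zipWith xor x y

/-- The number of positions at which two strings (of equal length) differ. -/
def hamDist (x y : List Bool) : ℕ := (xorStr x y).count true

/-- The length of a longest common subsequence. -/
def lcsLength (x y : List Bool) : ℕ :=
  sSup {k : ℕ | ∃ w : List Bool, w.Sublist x ∧ w.Sublist y ∧ w.length = k}

/-- Insertion-deletion distance. The subtraction never truncates, since a common subsequence is
at most as long as each of the two strings. -/
def editDist (x y : List Bool) : ℕ := x.length + y.length - 2 * lcsLength x y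

/-- A channel is a map on strings that is fixed before any key or codeword is sampled. -/
abbrev Channel : Type := List Bool → List Bool

/-- `p(·)`-bounded Hamming channels. -/
def HammingBounded (p : ℕ → ℝ) (E : Channel) : Prop :=
  ∀ x, (E x).length = x.length ∧ (hamDist x (E x) : ℝ) ≤ p x.length * x.length

/-- `p(·)`-bounded edit channels. -/
def EditBounded (p : ℕ → ℝ) (E : Channel) : Prop :=
  ∀ x, (editDist x (E x) : ℝ) ≤ p x.length * x.length

/-- A substitution channel is oblivious if it flips the positions marked by an error pattern which
depends only on the length of the transmitted string and not on its content. -/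
def ObliviousHamming (E : Channel) : Prop :=
  ∃ e : ℕ → List Bool, (∀ m, (e m).length = m) ∧ ∀ x, E x = xorStr x (e x.length)

/-! ### Negligible functions and sampling -/

/-- `f` is eventually below every inverse polynomial. -/
def Negligible (f : ℕ → ℝ) : Prop :=
  ∀ c : ℝ, 0 < c → ∃ N : ℕ, ∀ κ : ℕ, N ≤ κ → f κ ≤ (κ : ℝ) ^ (-c)

/-- `m` independent samples from `d`. -/
def iid {α : Type} (d : PMF α) : ℕ → PMF (List α)
  | 0 => PMF.pure []
  | m + 1 => d.bind fun a => (iid d m).map fun l => a :: l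

/-- A fair coin. -/
def coin : PMF Bool := PMF.uniformOfFintype Bool

/-- A uniformly random string of length `m`. -/
def uniformBits (m : ℕ) : PMF (List Bool) := iid coin m

/-- Run samplers of strings one after the other and concatenate their outputs. -/
def concatAll : List (PMF (List Bool)) → PMF (List Bool)
  | [] => PMF.pure []
  | d :: ds => d.bind fun x => (concatAll ds).map fun y => x ++ y

/-- Run randomized tests one after the other until the first one accepts; accept if one does. -/
def anyAccepts : List (PMF Bool) → PMF Bool
  | [] => PMF.pure false
  | d :: ds => d.bind fun b => if b then PMF.pure true else anyAccepts ds

/-! ### Probabilistic oracle machines with a step count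

A machine has finitely many stacks of bits (registers; the ones that its program mentions) and a
structured program. -/

/-- Programs. -/
inductive Prog : Type
  /-- do nothing -/
  | skip : Prog
  /-- push the bit `b` on register `r` -/
  | push (b : Bool) (r : ℕ) : Prog
  /-- remove the top bit of register `r` -/
  | pop (r : ℕ) : Prog
  /-- overwrite register `dst` by the content of register `src` -/
  | copy (src dst : ℕ) : Prog
  /-- push a fresh fair coin on register `r` -/
  | flip (r : ℕ) : Prog
  /-- call the oracle and overwrite register `r` by its answer -/
  | query (r : ℕ) : Prog
  /-- first `P`, then `Q` -/
  | seq (P Q : Prog) : Prog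
  /-- `P`, `Q` or `R`, when register `r` is empty, has top bit `0`, or has top bit `1` -/
  | branch (r : ℕ) (P Q R : Prog) : Prog
  /-- repeat `P` as long as register `r` is not empty -/
  | loop (r : ℕ) (P : Prog) : Prog

/-- The contents of the registers. -/
abbrev Store : Type := ℕ → List Bool

/-- The stack of programs that remain to be executed, and the contents of the registers. -/
abbrev Config : Type := List Prog × Store

/-- One step of computation. The oracle is sampled afresh at every call; it takes no argument,
since the oracles considered here have a single possible query. A register grows by at most one bit
in a step that is not an oracle call, so that the number of steps agrees with the running time of a
Turing machine up to a polynomial. -/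
def step (O : PMF (List Bool)) : Config → PMF Config
  | ([], s) => PMF.pure ([], s)
  | (.skip :: K, s) => PMF.pure (K, s)
  | (.push b r :: K, s) => PMF.pure (K, Function.update s r (b :: s r))
  | (.pop r :: K, s) => PMF.pure (K, Function.update s r (s r).tail)
  | (.copy src dst :: K, s) => PMF.pure (K, Function.update s dst (s src))
  | (.flip r :: K, s) => coin.map fun b => (K, Function.update s r (b :: s r))
  | (.query r :: K, s) => O.map fun a => (K, Function.update s r a)
  | (.seq P Q :: K, s) => PMF.pure (P :: Q :: K, s)
  | (.branch r P Q R :: K, s) =>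
      match s r with
      | [] => PMF.pure (P :: K, s)
      | false :: _ => PMF.pure (Q :: K, s)
      | true :: _ => PMF.pure (R :: K, s)
  | (.loop r P :: K, s) =>
      match s r with
      | [] => PMF.pure (K, s)
      | _ :: _ => PMF.pure (P :: .loop r P :: K, s)

/-- `T` steps of computation. -/
def run (O : PMF (List Bool)) : ℕ → Config → PMF Config
  | 0, c => PMF.pure c
  | T + 1, c => (step O c).bind (run O T)

/-- Every run of `P` on the registers `s`, with any coins and oracle answers, halts within `T`
steps. -/
def HaltsWithin (O : PMF (List Bool)) (P : Prog) (s : Store) (T : ℕ) : Prop :=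
  ∀ c ∈ (run O T ([P], s)).support, c.1 = []

/-- The distribution of the contents of the registers after `T` steps. -/
def finalStore (O : PMF (List Bool)) (P : Prog) (s : Store) (T : ℕ) : PMF Store :=
  (run O T ([P], s)).map Prod.snd

/-- The inputs are placed in the registers `0, 1, …`; the other registers are empty. -/
def load (inputs : List (List Bool)) : Store := fun i => inputs.getD i []

/-- A machine accepts if the top bit of register `0` is `1`. -/
def readBit (s : Store) : Bool := (s 0).headD false

/-- The program makes no oracle calls. -/
def OracleFree : Prog → Prop
  | .query _ => False
  | .seq P Q => OracleFree P ∧ OracleFree Q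
  | .branch _ P Q R => OracleFree P ∧ OracleFree Q ∧ OracleFree R
  | .loop _ P => OracleFree P
  | _ => True

/-- On the given inputs, `P` always halts within `T` steps, and its output, which is obtained
from the final registers by `read`, has the distribution `d`. -/
def Computes {α : Type} (P : Prog) (inputs : List (List Bool)) (T : ℕ) (read : Store → α)
    (d : PMF α) : Prop :=
  HaltsWithin (PMF.pure []) P (load inputs) T ∧
    (finalStore (PMF.pure []) P (load inputs) T).map read = d

/-- `1^(f κ)` can be computed from `1^κ` in polynomial time. -/
def UnaryPolyTime (f : ℕ → ℕ) : Prop :=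
  ∃ (P : Prog) (q : Polynomial ℕ), OracleFree P ∧
    ∀ κ, Computes P [ones κ] (q.eval κ) (fun s => s 0) (PMF.pure (ones (f κ)))

/-- A probabilistic polynomial-time oracle machine that expects an input `(1^κ, v)`. -/
structure Adversary where
  /-- the program -/
  prog : Prog
  /-- the bound on the running time -/
  time : Polynomial ℕ
  /-- the bound holds for every oracle -/
  halts : ∀ (O : PMF (List Bool)) (κ : ℕ) (v : List Bool),
    HaltsWithin O prog (load [ones κ, v]) (time.eval (κ + v.length))

/-- The distribution of the output bit of an adversary. -/
def Adversary.output (A : Adversary) (O : PMF (List Bool)) (κ : ℕ) (v : List Bool) : PMF Bool :=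
  (finalStore O A.prog (load [ones κ, v]) (A.time.eval (κ + v.length))).map readBit

/-! ### Binary zero-bit pseudorandom codes -/

/-- Public-key or secret-key. -/
inductive KeyKind : Type
  | publicKey
  | secretKey

/-- The syntax of a binary zero-bit code. `keyGen κ` samples a pair (key of the encoder, key of the
decoder): these are `(pk, sk)` in the public-key case and `(sk, sk)` in the secret-key case. The
single message is `1`; `dec` returns `true` for the message `1` and `false` for `⊥`. -/
structure Scheme where
  keyGen : ℕ → PMF (List Bool × List Bool)
  enc : ℕ → List Bool → PMF (List Bool)
  dec : ℕ → List Bool → List Bool → PMF Bool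
  /-- the length of the encoder's key -/
  encKeyLen : ℕ → ℕ
  /-- the length of the decoder's key -/
  decKeyLen : ℕ → ℕ
  /-- the codeword length -/
  len : ℕ → ℕ

/-- What the adversary is given in addition to `1^κ`, when the encoder's key is `ek`. -/
def KeyKind.view : KeyKind → List Bool → List Bool
  | .publicKey, ek => ek
  | .secretKey, _ => []

/-- The probability that a codeword which went through the channel `E` is decoded to `1`. -/
def Scheme.decodeProb (S : Scheme) (E : Channel) (κ : ℕ) : ℝ :=
  (((S.keyGen κ).bind fun k => (S.enc κ k.1).bind fun x => S.dec κ k.2 (E x)) true).toReal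

/-- The probability that the fixed string `c` is decoded to `⊥`. -/
def Scheme.rejectProb (S : Scheme) (c : List Bool) (κ : ℕ) : ℝ :=
  (((S.keyGen κ).bind fun k => S.dec κ k.2 c) false).toReal

/-- The probability that the adversary outputs `1` when its oracle is the encoder. -/
def Scheme.realProb (S : Scheme) (kind : KeyKind) (A : Adversary) (κ : ℕ) : ℝ :=
  (((S.keyGen κ).bind fun k => A.output (S.enc κ k.1) κ (kind.view k.1)) true).toReal

/-- The probability that the adversary outputs `1` when its oracle answers with independent
uniform strings. -/
def Scheme.idealProb (S : Scheme) (kind : KeyKind) (A : Adversary) (κ : ℕ) : ℝ :=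
  (((S.keyGen κ).bind fun k => A.output (uniformBits (S.len κ)) κ (kind.view k.1)) true).toReal

/-- `S` is a zero-bit public-key (secret-key) pseudorandom code that is robust to every channel
in `𝓔`. -/
structure IsPRC (kind : KeyKind) (S : Scheme) (𝓔 : Set Channel) : Prop where
  keyGen_length : ∀ κ, ∀ k ∈ (S.keyGen κ).support,
    k.1.length = S.encKeyLen κ ∧ k.2.length = S.decKeyLen κ
  enc_length : ∀ κ ek, ek.length = S.encKeyLen κ →
    ∀ x ∈ (S.enc κ ek).support, x.length = S.len κ
  /-- in the secret-key case the encoder and the decoder share one key -/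
  secret : kind = .secretKey → ∀ κ, ∀ k ∈ (S.keyGen κ).support, k.1 = k.2
  /-- the three algorithms run in probabilistic polynomial time -/
  keyGen_ppt : ∃ (P : Prog) (q : Polynomial ℕ), OracleFree P ∧
    ∀ κ, Computes P [ones κ] (q.eval κ) (fun s => (s 0, s 1)) (S.keyGen κ)
  enc_ppt : ∃ (P : Prog) (q : Polynomial ℕ), OracleFree P ∧
    ∀ κ ek, ek.length = S.encKeyLen κ →
      Computes P [ones κ, ek] (q.eval (κ + ek.length)) (fun s => s 0) (S.enc κ ek)
  dec_ppt : ∃ (P : Prog) (q : Polynomial ℕ), OracleFree P ∧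
    ∀ κ dk y, dk.length = S.decKeyLen κ →
      Computes P [ones κ, dk, y] (q.eval (κ + dk.length + y.length)) readBit (S.dec κ dk y)
  robust : ∀ E ∈ 𝓔, Negligible fun κ => 1 - S.decodeProb E κ
  /-- the fixed string may be chosen anew, of polynomial length, for each security parameter -/
  sound : ∀ c : ℕ → List Bool, (∃ q : Polynomial ℕ, ∀ κ, (c κ).length ≤ q.eval κ) →
    Negligible fun κ => 1 - S.rejectProb (c κ) κ
  pseudorandom : ∀ A : Adversary,
    Negligible fun κ => |S.realProb kind A κ - S.idealProb kind A κ|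

/-! ### The CGK embedding -/

/-- The function `h_t : {0,1} → {0,1}` (`t = 0, 1, …`) described by the seed `r`. -/
def seedFun (r : List Bool) (t : ℕ) (b : Bool) : Bool := r.getD (2 * t + b.toNat) false

/-- The steps `t, …, t + m - 1` of the embedding; the third argument is the part of the input that
starts at the current value of the counter. -/
def embFrom (r : List Bool) : ℕ → ℕ → List Bool → List Bool
  | _, 0, _ => []
  | t, m + 1, [] => false :: embFrom r (t + 1) m []
  | t, m + 1, b :: x =>
      b :: embFrom r (t + 1) m (if seedFun r t b then x else b :: x)

/-- The embedding of `x` under the seed `r` of length `2 * M` into the strings of length `M`. -/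
def emb (M : ℕ) (x r : List Bool) : List Bool := embFrom r 0 M x

/-- The walk of the decoding function from step `t` on, for outputs of length `L`. Its arguments
are `t`, the part `a` of the input which is still to be read, the number `i` of completed output
positions, and the bit in the current output position if one has been assigned. It returns the
assigned output bits from position `i` on. -/
def unembFrom (L : ℕ) (r : List Bool) : ℕ → List Bool → ℕ → Option Bool → List Bool
  | _, [], _, cur => cur.toList
  | t, a :: as, i, cur =>
      if i < L then
        if seedFun r t (cur.getD a) then
          cur.getD a :: unembFrom L r (t + 1) as (i + 1) none
        else
          unembFrom L r (t + 1) as i (some (cur.getD a))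
      else []

/-- The decoding function: positions which the walk did not assign receive independent fair
bits. -/
def unemb (L : ℕ) (a r : List Bool) : PMF (List Bool) :=
  (uniformBits (L - (unembFrom L r 0 a 0 none).length)).map fun w =>
    unembFrom L r 0 a 0 none ++ w

/-! ### The construction -/

/-- The block length `n`, for which the codeword length of the given code is `1.5 n`, rounded up. -/
def blockLen (H : Scheme) (κ : ℕ) : ℕ := (2 * H.len κ + 2) / 3

/-- The keys of one block: a key pair, a seed and a mask. -/
def blockKeyGen (H : Scheme) (κ : ℕ) :
    PMF ((List Bool × List Bool) × List Bool × List Bool) :=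
  (H.keyGen κ).bind fun k =>
    (uniformBits (2 * H.len κ)).bind fun r =>
      (uniformBits (H.len κ)).map fun e => (k, r, e)

/-- Each part of a key consists of a key of the given code, a seed and a mask. This is its
length. -/
def partLen (H : Scheme) (keyLen : ℕ) (κ : ℕ) : ℕ := keyLen + 2 * H.len κ + H.len κ

/-- Read the key, the seed and the mask in the `t`-th part (`t = 0, 1, …`) of a key. -/
def readPart (H : Scheme) (keyLen κ : ℕ) (key : List Bool) (t : ℕ) :
    List Bool × List Bool × List Bool :=
  let part := key.drop (t * partLen H keyLen κ)
  (part.take keyLen, (part.drop keyLen).take (2 * H.len κ),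
    (part.drop (keyLen + 2 * H.len κ)).take (H.len κ))

/-- All substrings `y_i … y_j` with `1 ≤ i ≤ j ≤ |y|`. -/
def windows (y : List Bool) : List (List Bool) :=
  (List.range y.length).flatMap fun i =>
    (List.range (y.length - i)).map fun d => (y.drop i).take (d + 1)

/-- Truncate to the first `n` bits, or pad with trailing zeros to length `n`. -/
def fit (n : ℕ) (z : List Bool) : List Bool := (z ++ List.replicate n false).take n

/-- The code with `ℓ κ` masked blocks which is built from the code `H` through the CGK embedding. -/
def cgkCode (H : Scheme) (ℓ : ℕ → ℕ) : Scheme where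
  keyGen κ := (iid (blockKeyGen H κ) (ℓ κ)).map fun ks =>
    ((ks.map fun k => k.1.1 ++ k.2.1 ++ k.2.2).flatten,
      (ks.map fun k => k.1.2 ++ k.2.1 ++ k.2.2).flatten)
  enc κ ek := concatAll ((List.range (ℓ κ)).map fun t =>
    let part := readPart H (H.encKeyLen κ) κ ek t
    (H.enc κ part.1).bind fun a => unemb (blockLen H κ) (xorStr a part.2.2) part.2.1)
  dec κ dk y := anyAccepts ((windows y).flatMap fun z => (List.range (ℓ κ)).map fun t =>
    let part := readPart H (H.decKeyLen κ) κ dk t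
    H.dec κ part.1 (xorStr (emb (H.len κ) (fit (blockLen H κ) z) part.2.1) part.2.2))
  encKeyLen κ := ℓ κ * partLen H (H.encKeyLen κ) κ
  decKeyLen κ := ℓ κ * partLen H (H.decKeyLen κ) κ
  len κ := ℓ κ * blockLen H κ

/-- The number of blocks `n ^ (1 / (2 γ) - 1)`, rounded up. -/
def standardBlocks (γ : ℝ) (H : Scheme) (κ : ℕ) : ℕ :=
  ⌈(blockLen H κ : ℝ) ^ (1 / (2 * γ) - 1)⌉₊

/-- The numbers of blocks that are admitted in the construction: computable in polynomial time,
at least `n ^ (1 / (2 γ) - 1)`, and of larger order than `log κ`. -/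
structure AdmissibleBlocks (γ : ℝ) (H : Scheme) (ℓ : ℕ → ℕ) : Prop where
  polyTime : UnaryPolyTime ℓ
  large : ∀ κ, standardBlocks γ H κ ≤ ℓ κ
  superlog : Tendsto (fun κ : ℕ => (ℓ κ : ℝ) / Real.log κ) atTop atTop

end

end EditPRC

open EditPRC

/-! ### Step semantics of programs: composition, time bounds, simulation of one machine inside
another. -/

namespace EditPRC
noncomputable section

/-! ### Probability mass functions -/

/-! Robustness rests on reversing the order of sampling. For fixed codeword $a$ the mask makes
$w=a\oplus e$ uniform, and for uniform $w$ the pair $(w,\mathsf{Emb}^{-1}(w,r))$ has the law of a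
uniform block $y$ together with a string $w$ that shows the current bit of $y$ whenever the walk
enters a new position and is a fair coin at every other step (`expect_unemb`). Hence all blocks are
uniform and independent of seeds, keys and codewords (`blockKeyGen_bind_encBlock`), and one may fix
the blocks, and with them the output of the channel, before anything else is drawn.

The received string is then cut into pieces $z_t$ such that the edit distances to the blocks add up
to at most the total distance (`exists_split_editDist`). Since $\ell n\ge n^{1/(2\gamma)}$, the
average distance per block is at most $c_2\sqrt n$, so at least half of the blocks have distance at
most $d=\lfloor 2c_2\sqrt n\rfloor$. For such a block the string given to the inner decoder differs
from the codeword in the pattern $w\oplus\mathsf{Emb}(z)$, whose weight has two sources. - Between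
$w$ and $\mathsf{Emb}(y)$ an error needs a step at an old position (about half of the steps) and a
wrong coin: rate $1/4$. An exponential moment bound gives at most $(1/4+c_1/2)M$ errors with
probability tending to one; the same bound covers the event that $1.5\,n$ steps exhaust the block
(`selfDistProb_le`). - Between $\mathsf{Emb}(y)$ and $\mathsf{Emb}(z)$ the remaining edit distance
is dominated by a lazy random walk absorbed at $0$, so the number of errors is $O(d^2)$ with
constant probability (`embDistProb_le`, `walkBound_le_quarter`). This is below $c_1M/2$ when $c_2$
is small.

So each of these blocks stays below the weight $(1/4+c_1)M$ with probability at least $1/4$,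
independently of the others, and all of them exceed it with probability at most
$(3/4)^{\lfloor\ell/2\rfloor}$, which is negligible. If one stays below it, its pattern was fixed
before the inner key and codeword, so oblivious robustness of the inner code applies. It applies
uniformly in the pattern by a diagonal argument, which needs that the codeword length tends to
infinity (`IsPRC.exists_patternFailProb_le`, `IsPRC.tendsto_len`).

Soundness is a union bound over windows and blocks: given seed and mask, each test runs the inner
decoder on a fixed string. Pseudorandomness is a hybrid argument over blocks: $\mathsf{Emb}^{-1}$
maps uniform strings to uniform strings, so a block built around a uniform oracle answer is uniform.
The reduction plants its challenge in a random block.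

Efficiency is proved in the concrete machine model, through a calculus in which programs are called
as subroutines and their output distributions and time bounds are composed. For rational $\gamma$
the number $\lceil n^{p/q}\rceil$ is found by an integer search; in general a power of $n$ with
natural exponent, plus $\lambda$, is admissible. -/

theorem bind_congr_support {α β : Type} (p : PMF α) {f g : α → PMF β}
    (h : ∀ a ∈ p.support, f a = g a) : p.bind f = p.bind g := by
  ext b
  rw [PMF.bind_apply, PMF.bind_apply]
  refine tsum_congr fun a => ?_
  by_cases ha : a ∈ p.support
  · rw [h a ha]
  · rw [PMF.mem_support_iff, not_not] at ha
    rw [ha, zero_mul, zero_mul]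

theorem map_eq_bind {α β : Type} (f : α → β) (p : PMF α) :
    p.map f = p.bind fun a => PMF.pure (f a) := rfl

/-! ### Halting computations -/

/-- The configuration `c` halts within `T` steps, and the final registers have the
distribution `d`. -/
def Evals (O : PMF (List Bool)) (c : Config) (T : ℕ) (d : PMF Store) : Prop :=
  run O T c = d.map fun s => (([], s) : Config)

variable {O : PMF (List Bool)}

theorem run_nil (O : PMF (List Bool)) (T : ℕ) (s : Store) :
    run O T ([], s) = PMF.pure ([], s) := by
  induction T with
  | zero => rfl
  | succ T ih => rw [run, step, PMF.pure_bind, ih]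

theorem run_add (O : PMF (List Bool)) (T T' : ℕ) (c : Config) :
    run O (T + T') c = (run O T c).bind (run O T') := by
  induction T generalizing c with
  | zero => rw [Nat.zero_add, run, PMF.pure_bind]
  | succ T ih =>
    rw [Nat.succ_add, run, run, PMF.bind_bind]
    exact congrArg _ (funext ih)

theorem Evals.mono {c : Config} {T T' : ℕ} {d : PMF Store} (h : Evals O c T d) (hT : T ≤ T') :
    Evals O c T' d := by
  obtain ⟨k, rfl⟩ := Nat.exists_eq_add_of_le hT
  rw [Evals, run_add, h, PMF.bind_map]
  conv_lhs => rw [show (run O k ∘ fun s => (([], s) : Config)) = fun s => PMF.pure ([], s) from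
    funext fun s => run_nil O k s]
  rfl

theorem evals_nil (T : ℕ) (s : Store) : Evals O ([], s) T (PMF.pure s) := by
  rw [Evals, run_nil, PMF.pure_map]

theorem Evals.of_step {c : Config} {T : ℕ} {F : Config → PMF Store}
    (h : ∀ c' ∈ (step O c).support, Evals O c' T (F c')) :
    Evals O c (T + 1) ((step O c).bind F) := by
  rw [Evals, run, PMF.map_bind]
  exact bind_congr_support _ h

theorem Evals.map_snd {c : Config} {T : ℕ} {d : PMF Store} (h : Evals O c T d) :
    (run O T c).map Prod.snd = d := by
  rw [h, PMF.map_comp]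
  exact PMF.map_id d

theorem evals_of_halts {c : Config} {T : ℕ} (h : ∀ c' ∈ (run O T c).support, c'.1 = []) :
    Evals O c T ((run O T c).map Prod.snd) := by
  rw [Evals, PMF.map_comp]
  conv_lhs => rw [← PMF.bind_pure (run O T c)]
  refine bind_congr_support _ fun c' hc' => ?_
  have := h c' hc'
  obtain ⟨K, s⟩ := c'
  simp only at this
  subst this
  rfl

theorem Evals.halts {c : Config} {T : ℕ} {d : PMF Store} (h : Evals O c T d) :
    ∀ c' ∈ (run O T c).support, c'.1 = [] := by
  intro c' hc'
  rw [h, PMF.mem_support_map_iff] at hc'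
  obtain ⟨s, -, rfl⟩ := hc'
  rfl

/-- Converse of `Evals.of_step`; it lets inductions over the running time peel off one step of an
arbitrary program. -/
theorem Evals.step_inv {c : Config} {T : ℕ} {d : PMF Store} (h : Evals O c (T + 1) d) :
    ∃ F : Config → PMF Store, (∀ c' ∈ (step O c).support, Evals O c' T (F c')) ∧
      d = (step O c).bind F := by
  refine ⟨fun c' => (run O T c').map Prod.snd, fun c' hc' => evals_of_halts fun c'' hc'' => ?_, ?_⟩
  · refine h.halts c'' ?_
    rw [run, PMF.mem_support_bind_iff]
    exact ⟨c', hc', hc''⟩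
  · rw [← h.map_snd, run, PMF.map_bind]

theorem evals_zero_inv {c : Config} {d : PMF Store} (h : Evals O c 0 d) :
    c.1 = [] ∧ d = PMF.pure c.2 := by
  refine ⟨h.halts c (by simp [run]), ?_⟩
  rw [← h.map_snd, run, PMF.pure_map]

/-- In the registers `s`, the program `P` terminates within `T` steps, whatever is executed
afterwards, and leads to the distribution `μ` of the registers. -/
def Big (O : PMF (List Bool)) (P : Prog) (s : Store) (T : ℕ) (μ : PMF Store) : Prop :=
  ∀ (K : List Prog) (T' : ℕ) (F : Store → PMF Store),
    (∀ s' ∈ μ.support, Evals O (K, s') T' (F s')) → Evals O (P :: K, s) (T + T') (μ.bind F)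

theorem Big.evals {P : Prog} {s : Store} {T : ℕ} {μ : PMF Store} (h : Big O P s T μ) :
    Evals O ([P], s) T μ := by
  have := h [] 0 PMF.pure fun s' _ => evals_nil 0 s'
  rwa [PMF.bind_pure] at this

theorem Big.mono {P : Prog} {s : Store} {T T' : ℕ} {μ : PMF Store} (h : Big O P s T μ)
    (hT : T ≤ T') : Big O P s T' μ :=
  fun K T'' F hF => (h K T'' F hF).mono (by omega)

theorem Big.congr_dist {P : Prog} {s : Store} {T : ℕ} {μ ν : PMF Store} (h : Big O P s T μ)
    (hμ : μ = ν) : Big O P s T ν := hμ ▸ h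

theorem big_of_step {P : Prog} {s : Store} {μ : PMF Store}
    (h : ∀ K, step O (P :: K, s) = μ.map fun s' => (K, s')) : Big O P s 1 μ := by
  intro K T F hF
  rw [Nat.add_comm, Evals, run, h, PMF.bind_map, PMF.map_bind]
  exact bind_congr_support _ fun s' hs' => hF s' hs'

theorem big_of_reduces {P Q : Prog} {s : Store} {T : ℕ} {μ : PMF Store}
    (h : ∀ K, step O (P :: K, s) = PMF.pure (Q :: K, s)) (hQ : Big O Q s T μ) :
    Big O P s (T + 1) μ := by
  intro K T' F hF
  have := hQ K T' F hF
  rw [Evals] at this ⊢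
  rw [show T + 1 + T' = (T + T') + 1 by omega, run, h, PMF.pure_bind, this]

/-- Because `Big` quantifies over whatever is executed afterwards, `Q` can be taken as the head of
the continuation of `P`, and the times add up. -/
theorem Big.seq {P Q : Prog} {s : Store} {T T' : ℕ} {μ : PMF Store} {ν : Store → PMF Store}
    (hP : Big O P s T μ) (hQ : ∀ s' ∈ μ.support, Big O Q s' T' (ν s')) :
    Big O (.seq P Q) s (T + T' + 1) (μ.bind ν) := by
  intro K T'' F hF
  have := hP (Q :: K) (T' + T'') (fun s' => (ν s').bind F) fun s' hs' =>
    hQ s' hs' K T'' F fun s'' hs'' => hF s'' (by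
      rw [PMF.mem_support_bind_iff]; exact ⟨s', hs', hs''⟩)
  rw [Evals] at this ⊢
  rw [show T + T' + 1 + T'' = (T + (T' + T'')) + 1 by omega, run, step, PMF.pure_bind, this,
    PMF.bind_bind]

theorem Big.seq_pure {P Q : Prog} {s s' : Store} {T T' : ℕ} {ν : PMF Store}
    (hP : Big O P s T (PMF.pure s')) (hQ : Big O Q s' T' ν) :
    Big O (.seq P Q) s (T + T' + 1) ν := by
  have := hP.seq (Q := Q) (T' := T') (ν := fun _ => ν) (by
    intro s'' h
    rw [PMF.support_pure, Set.mem_singleton_iff] at h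
    exact h ▸ hQ)
  rwa [PMF.pure_bind] at this

theorem Big.loop_nil {r : ℕ} {P : Prog} {s : Store} (h : s r = []) :
    Big O (.loop r P) s 1 (PMF.pure s) :=
  big_of_step fun K => by rw [step, h, PMF.pure_map]

/-- The loop on a non-empty register and the sequence of body and loop reduce in one step to the
same configuration, so they share the time bound. The bound is not `0`, since a non-empty stack of
programs has not halted. -/
theorem Big.loop_cons {r : ℕ} {P : Prog} {s : Store} {T : ℕ} {μ : PMF Store} (h : s r ≠ [])
    (hP : Big O (.seq P (.loop r P)) s T μ) : Big O (.loop r P) s T μ := by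
  obtain ⟨b, l, hbl⟩ := List.exists_cons_of_ne_nil h
  have hT : T ≠ 0 := by
    rintro rfl
    exact absurd (evals_zero_inv hP.evals).1 (by simp)
  obtain ⟨T, rfl⟩ := Nat.exists_eq_succ_of_ne_zero hT
  intro K T' F hF
  have := hP K T' F hF
  rw [Evals, Nat.succ_eq_add_one, Nat.add_right_comm, run] at this ⊢
  rw [step, PMF.pure_bind] at this
  rw [step, hbl]
  simpa only [PMF.pure_bind] using this

/-! ### Renaming of registers and substitution of the oracle -/

/-- All registers of the program are smaller than `b`. -/
def RegsBelow (b : ℕ) : Prog → Prop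
  | .skip => True
  | .push _ r => r < b
  | .pop r => r < b
  | .copy src dst => src < b ∧ dst < b
  | .flip r => r < b
  | .query r => r < b
  | .seq P Q => RegsBelow b P ∧ RegsBelow b Q
  | .branch r P Q R => r < b ∧ RegsBelow b P ∧ RegsBelow b Q ∧ RegsBelow b R
  | .loop r P => r < b ∧ RegsBelow b P

theorem RegsBelow.mono {b b' : ℕ} (h : b ≤ b') : ∀ {P : Prog}, RegsBelow b P → RegsBelow b' P
  | .skip, _ => trivial
  | .push _ _, hP => lt_of_lt_of_le hP h
  | .pop _, hP => lt_of_lt_of_le hP h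
  | .copy _ _, hP => ⟨lt_of_lt_of_le hP.1 h, lt_of_lt_of_le hP.2 h⟩
  | .flip _, hP => lt_of_lt_of_le hP h
  | .query _, hP => lt_of_lt_of_le hP h
  | .seq _ _, hP => ⟨hP.1.mono h, hP.2.mono h⟩
  | .branch _ _ _ _, hP =>
    ⟨lt_of_lt_of_le hP.1 h, hP.2.1.mono h, hP.2.2.1.mono h, hP.2.2.2.mono h⟩
  | .loop _ _, hP => ⟨lt_of_lt_of_le hP.1 h, hP.2.mono h⟩

/-- A bound on the registers of a program. -/
def regBound : Prog → ℕ
  | .skip => 0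
  | .push _ r => r + 1
  | .pop r => r + 1
  | .copy src dst => max (src + 1) (dst + 1)
  | .flip r => r + 1
  | .query r => r + 1
  | .seq P Q => max (regBound P) (regBound Q)
  | .branch r P Q R => max (r + 1) (max (regBound P) (max (regBound Q) (regBound R)))
  | .loop r P => max (r + 1) (regBound P)

theorem regsBelow_regBound : ∀ P : Prog, RegsBelow (regBound P) P
  | .skip => trivial
  | .push _ r => Nat.lt_succ_self r
  | .pop r => Nat.lt_succ_self r
  | .copy _ _ => ⟨by simp [regBound], by simp [regBound]⟩
  | .flip r => Nat.lt_succ_self r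
  | .query r => Nat.lt_succ_self r
  | .seq P Q => ⟨(regsBelow_regBound P).mono (le_max_left _ _),
      (regsBelow_regBound Q).mono (le_max_right _ _)⟩
  | .branch r P Q R => ⟨by simp [regBound],
      (regsBelow_regBound P).mono (by simp [regBound]),
      (regsBelow_regBound Q).mono (by simp [regBound]),
      (regsBelow_regBound R).mono (by simp [regBound])⟩
  | .loop r P => ⟨by simp [regBound], (regsBelow_regBound P).mono (by simp [regBound])⟩

/-- Shift all registers by `k`, and replace the oracle call with answer in register `r`
by `Q r`. -/
def Prog.embed (k : ℕ) (Q : ℕ → Prog) : Prog → Prog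
  | .skip => .skip
  | .push b r => .push b (k + r)
  | .pop r => .pop (k + r)
  | .copy src dst => .copy (k + src) (k + dst)
  | .flip r => .flip (k + r)
  | .query r => Q r
  | .seq P P' => .seq (P.embed k Q) (P'.embed k Q)
  | .branch r P P' P'' => .branch (k + r) (P.embed k Q) (P'.embed k Q) (P''.embed k Q)
  | .loop r P => .loop (k + r) (P.embed k Q)

/-- The registers of `x` below `k`, and the registers of `s` from `k` on. -/
def joinStore (k : ℕ) (x s : Store) : Store := fun r => if r < k then x r else s (r - k)

theorem joinStore_add (k : ℕ) (x s : Store) (r : ℕ) : joinStore k x s (k + r) = s r := by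
  simp [joinStore]

theorem joinStore_lt {k : ℕ} (x s : Store) {r : ℕ} (h : r < k) : joinStore k x s r = x r := by
  simp [joinStore, h]

theorem joinStore_update (k : ℕ) (x s : Store) (r : ℕ) (v : List Bool) :
    Function.update (joinStore k x s) (k + r) v = joinStore k x (Function.update s r v) := by
  funext i
  by_cases hi : i < k
  · rw [Function.update_of_ne (by omega), joinStore_lt _ _ hi, joinStore_lt _ _ hi]
  · obtain ⟨j, rfl⟩ := Nat.exists_eq_add_of_le (not_lt.1 hi)
    rw [joinStore_add]
    by_cases hj : j = r
    · subst hj; simp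
    · rw [Function.update_of_ne (by omega), Function.update_of_ne hj, joinStore_add]

theorem joinStore_update_lt {k : ℕ} (x s : Store) {r : ℕ} (h : r < k) (v : List Bool) :
    Function.update (joinStore k x s) r v = joinStore k (Function.update x r v) s := by
  funext i
  by_cases hi : i = r
  · subst hi; simp [joinStore, h]
  · rw [Function.update_of_ne hi, joinStore, joinStore, Function.update_of_ne hi]

/-- All registers from `b` on are empty. -/
def SuppBelow (b : ℕ) (s : Store) : Prop := ∀ r, b ≤ r → s r = []

theorem SuppBelow.update {b : ℕ} {s : Store} (h : SuppBelow b s) {r : ℕ} (hr : r < b)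
    (v : List Bool) : SuppBelow b (Function.update s r v) := fun i hi => by
  rw [Function.update_of_ne (by omega), h i hi]

/-- A machine with oracle `O'` is simulated inside one with oracle `O`: the registers are shifted by
`k` and each call is served by `Q` in time `C`, so each simulated step costs at most `C`. Registers
from `b` on stay empty, which leaves workspace for `Q`. There are two uses: subroutine calls, where
`Q` is the query itself, and the reduction, where `Q` is the hybrid encoder. -/
theorem Evals.embed {O' : PMF (List Bool)} {k b C : ℕ} {Q : ℕ → Prog} {x : Store} (hC : 1 ≤ C)
    (hQ : ∀ r < b, ∀ s, SuppBelow b s → Big O (Q r) (joinStore k x s) C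
      (O'.map fun a => joinStore k x (Function.update s r a)))
    {T : ℕ} {L : List Prog} {s : Store} {d : PMF Store} (h : Evals O' (L, s) T d)
    (hL : ∀ P ∈ L, RegsBelow b P) (hs : SuppBelow b s) (K : List Prog) (T' : ℕ)
    (F : Store → PMF Store)
    (hF : ∀ s' ∈ d.support, SuppBelow b s' → Evals O (K, joinStore k x s') T' (F s')) :
    Evals O (L.map (Prog.embed k Q) ++ K, joinStore k x s) (T * C + T') (d.bind F) := by
  induction T generalizing L s d F with
  | zero =>
    obtain ⟨h1, rfl⟩ := evals_zero_inv h
    simp only at h1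
    subst h1
    rw [PMF.pure_bind]
    exact (hF s (by simp) hs).mono (by omega)
  | succ T ih =>
    obtain ⟨G, hG, rfl⟩ := h.step_inv
    rw [PMF.bind_bind]
    have key : ∀ c' ∈ (step O' (L, s)).support, (∀ P ∈ c'.1, RegsBelow b P) → SuppBelow b c'.2 →
        Evals O (c'.1.map (Prog.embed k Q) ++ K, joinStore k x c'.2) (T * C + T')
          ((G c').bind F) := by
      intro c' hc' h1 h2
      refine ih (hG c' hc') h1 h2 F fun s' hs' hb => hF s' ?_ hb
      rw [PMF.mem_support_bind_iff]
      exact ⟨c', hc', hs'⟩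
    -- Covers all steps that are neither a coin flip nor a query: both machines make one
    -- deterministic step.
    have one : ∀ c' c'' , step O' (L, s) = PMF.pure c' → (∀ P ∈ c'.1, RegsBelow b P) →
        SuppBelow b c'.2 →
        c'' = (c'.1.map (Prog.embed k Q) ++ K, joinStore k x c'.2) →
        step O (L.map (Prog.embed k Q) ++ K, joinStore k x s) = PMF.pure c'' →
        Evals O (L.map (Prog.embed k Q) ++ K, joinStore k x s) ((T + 1) * C + T')
          ((step O' (L, s)).bind fun a => (G a).bind F) := by
      intro c' c'' e1 h1 h2 e2 e3
      have e4 := key c' (by simp [e1]) h1 h2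
      rw [← e2] at e4
      have := Evals.of_step (O := O) (c := (L.map (Prog.embed k Q) ++ K, joinStore k x s))
        (T := T * C + T') (F := fun _ => (G c').bind F) (by
          intro c hc
          rw [e3, PMF.support_pure, Set.mem_singleton_iff] at hc
          exact hc ▸ e4)
      rw [e3, PMF.pure_bind] at this
      rw [e1, PMF.pure_bind]
      exact this.mono (by nlinarith)
    rcases L with _ | ⟨P, L⟩
    · have e : step O' ([], s) = PMF.pure ([], s) := rfl
      rw [e, PMF.pure_bind]
      exact (key ([], s) (by simp [e]) (by simp) hs).mono (by nlinarith)
    have hP : RegsBelow b P := hL P (by simp)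
    have hL' : ∀ P ∈ L, RegsBelow b P := fun P hP => hL P (by simp [hP])
    have tl : ∀ R, RegsBelow b R → ∀ P ∈ R :: L, RegsBelow b P := by
      intro R hR P hP
      rcases List.mem_cons.1 hP with rfl | h
      · exact hR
      · exact hL' P h
    cases P with
    | skip => exact one (L, s) _ rfl hL' hs rfl rfl
    | push c r =>
      refine one (L, Function.update s r (c :: s r)) _ rfl hL' (hs.update hP _) rfl ?_
      simp only [List.map_cons, Prog.embed, List.cons_append, step, joinStore_add,
        joinStore_update]
    | pop r =>
      refine one (L, Function.update s r (s r).tail) _ rfl hL' (hs.update hP _) rfl ?_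
      simp only [List.map_cons, Prog.embed, List.cons_append, step, joinStore_add,
        joinStore_update]
    | copy r r' =>
      refine one (L, Function.update s r' (s r)) _ rfl hL' (hs.update hP.2 _) rfl ?_
      simp only [List.map_cons, Prog.embed, List.cons_append, step, joinStore_add,
        joinStore_update]
    | seq P1 P2 =>
      refine one (P1 :: P2 :: L, s) _ rfl ?_ hs rfl rfl
      intro R hR
      rcases List.mem_cons.1 hR with rfl | h
      · exact hP.1
      · exact tl P2 hP.2 R h
    | branch r P1 P2 P3 =>
      rcases hr : s r with _ | ⟨_ | _, l⟩
      · exact one (P1 :: L, s) _ (by simp [step, hr]) (tl _ hP.2.1) hs rfl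
          (by simp [Prog.embed, step, joinStore_add, hr])
      · exact one (P2 :: L, s) _ (by simp [step, hr]) (tl _ hP.2.2.1) hs rfl
          (by simp [Prog.embed, step, joinStore_add, hr])
      · exact one (P3 :: L, s) _ (by simp [step, hr]) (tl _ hP.2.2.2) hs rfl
          (by simp [Prog.embed, step, joinStore_add, hr])
    | loop r P1 =>
      rcases hr : s r with _ | ⟨c, l⟩
      · exact one (L, s) _ (by simp [step, hr]) hL' hs rfl
          (by simp [Prog.embed, step, joinStore_add, hr])
      · refine one (P1 :: .loop r P1 :: L, s) _ (by simp [step, hr]) ?_ hs rfl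
          (by simp [Prog.embed, step, joinStore_add, hr])
        intro R hR
        rcases List.mem_cons.1 hR with rfl | h
        · exact hP.2
        · exact tl _ hP R h
    | flip r =>
      have e : step O' (.flip r :: L, s) =
        coin.map fun c => (L, Function.update s r (c :: s r)) := rfl
      -- The continuation has to be a function of the simulating configuration, so the simulated
      -- registers are read back from the shifted ones.
      have := Evals.of_step (O := O) (c := ((Prog.flip r :: L).map (Prog.embed k Q) ++ K,
          joinStore k x s)) (T := T * C + T')
        (F := fun c => (G (L, fun i => c.2 (k + i))).bind F) (by
          intro c hc
          simp only [List.map_cons, Prog.embed, List.cons_append, step, joinStore_add,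
            joinStore_update, PMF.mem_support_map_iff] at hc
          obtain ⟨a, ha, rfl⟩ := hc
          simp only [joinStore_add]
          refine key (L, Function.update s r (a :: s r)) ?_ hL' (hs.update hP _)
          rw [e, PMF.mem_support_map_iff]
          exact ⟨a, ha, rfl⟩)
      refine (this.mono (T' := (T + 1) * C + T') (by nlinarith)).trans ?_
      congr 1
      simp only [List.map_cons, Prog.embed, List.cons_append, step, joinStore_add,
            joinStore_update, PMF.bind_map, Function.comp_def]
    | query r =>
      have e : step O' (.query r :: L, s) = O'.map fun a => (L, Function.update s r a) := rfl
      have := hQ r hP s hs (L.map (Prog.embed k Q) ++ K) (T * C + T')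
        (fun s' => (G (L, fun i => s' (k + i))).bind F) (by
          intro s' hs'
          rw [PMF.mem_support_map_iff] at hs'
          obtain ⟨a, ha, rfl⟩ := hs'
          simp only [joinStore_add]
          refine key (L, Function.update s r a) ?_ hL' (hs.update hP _)
          rw [e, PMF.mem_support_map_iff]
          exact ⟨a, ha, rfl⟩)
      refine (this.mono (T' := (T + 1) * C + T') (by nlinarith)).trans ?_
      congr 1
      rw [e, PMF.bind_map, PMF.bind_map]
      simp only [Function.comp_def, joinStore_add]

end
end EditPRC

/-! ### Subroutine calls and symbolic execution on finitely many registers. -/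

namespace EditPRC
noncomputable section

variable {O : PMF (List Bool)}

/-! ### Subroutine calls -/

theorem load_nil : load [] = fun _ => [] := by
  funext i; simp [load]

theorem load_apply (xs : List (List Bool)) (i : ℕ) : load xs i = xs.getD i [] := rfl

theorem suppBelow_load (xs : List (List Bool)) : SuppBelow xs.length (load xs) := fun i hi => by
  simp [load, hi]

theorem load_update {xs : List (List Bool)} {r : ℕ} (h : r < xs.length) (v : List Bool) :
    Function.update (load xs) r v = load (xs.set r v) := by
  funext i
  by_cases hi : i = r
  · subst hi; simp [load, h]
  · rw [Function.update_of_ne hi]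
    simp [load, Ne.symm hi]

theorem load_update_length (xs : List (List Bool)) (v : List Bool) :
    Function.update (load xs) xs.length v = load (xs ++ [v]) := by
  funext i
  rcases lt_trichotomy i xs.length with h | h | h
  · rw [Function.update_of_ne h.ne]
    simp [load, h, List.getElem?_append_left]
  · subst h; simp [load]
  · rw [Function.update_of_ne h.ne']
    simp only [load]
    rw [List.getD_eq_default _ _ h.le, List.getD_eq_default _ _ (by simp; omega)]

/-- Unused registers are empty anyway, so a program may be given any number of scratch registers
without changing its input. -/
theorem load_append_replicate (xs : List (List Bool)) (k : ℕ) :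
    load (xs ++ List.replicate k []) = load xs := by
  funext i
  by_cases h : i < xs.length
  · simp [load, h, List.getElem?_append_left]
  · simp only [load]
    rw [List.getD_append_right _ _ _ _ (not_lt.1 h), List.getD_eq_default xs _ (not_lt.1 h)]
    simp

/-- Copy the registers in the list to the registers `K + j, K + j + 1, …`. -/
def copyIn (K : ℕ) : ℕ → List ℕ → Prog
  | _, [] => .skip
  | j, i :: is => .seq (.copy i (K + j)) (copyIn K (j + 1) is)

/-- Copy the registers `K + j, K + j + 1, …` to the registers in the list. -/
def copyOut (K : ℕ) : ℕ → List ℕ → Prog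
  | _, [] => .skip
  | j, i :: is => .seq (.copy (K + j) i) (copyOut K (j + 1) is)

/-- Clear the registers `K, …, K + c - 1`, if register `K + b` is empty. -/
def clearRegs (K b : ℕ) : ℕ → Prog
  | 0 => .skip
  | c + 1 => .seq (.copy (K + b) (K + c)) (clearRegs K b c)

/-- The number of registers reserved for a call. -/
def frameSize (P : Prog) (ins outs : List ℕ) : ℕ :=
  max (regBound P) (max ins.length outs.length)

/-- Run `P` on the registers in `ins`, write its results to the registers in `outs`, and leave
all other registers below `K` unchanged. -/
def callProg (K : ℕ) (P : Prog) (ins outs : List ℕ) : Prog :=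
  .seq (copyIn K 0 ins) (.seq (P.embed K fun r => .query (K + r))
    (.seq (copyOut K 0 outs) (clearRegs K (frameSize P ins outs) (frameSize P ins outs))))

/-- The time for the administration of a call. -/
def callCost (P : Prog) (ins outs : List ℕ) : ℕ :=
  2 * ins.length + 2 * outs.length + 2 * frameSize P ins outs + 10

/-- The contents of the registers `j, …, j + m - 1`. -/
def readFrom : ℕ → ℕ → Store → List (List Bool)
  | _, 0, _ => []
  | j, m + 1, s => s j :: readFrom (j + 1) m s

/-- Write the values to the registers. -/
def assignStore : Store → List ℕ → List (List Bool) → Store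
  | x, i :: is, v :: vs => assignStore (Function.update x i v) is vs
  | x, _, _ => x

/-- Write the values to the entries of the list. -/
def assign : List (List Bool) → List ℕ → List (List Bool) → List (List Bool)
  | xs, i :: is, v :: vs => assign (xs.set i v) is vs
  | xs, _, _ => xs

theorem load_assign {xs : List (List Bool)} {is : List ℕ} (h : ∀ i ∈ is, i < xs.length)
    (vs : List (List Bool)) : load (assign xs is vs) = assignStore (load xs) is vs := by
  induction is generalizing xs vs with
  | nil => cases vs <;> rfl
  | cons i is ih =>
    rcases vs with _ | ⟨v, vs⟩
    · rfl
    · rw [assign, assignStore, load_update (h i (by simp))]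
      exact ih (fun j hj => by simpa using h j (by simp [hj])) vs

theorem big_copy (s : Store) (r r' : ℕ) :
    Big O (.copy r r') s 1 (PMF.pure (Function.update s r' (s r))) :=
  big_of_step fun K => by rw [PMF.pure_map]; rfl

theorem big_skip (s : Store) : Big O .skip s 1 (PMF.pure s) :=
  big_of_step fun K => by rw [PMF.pure_map]; rfl

theorem big_copyIn {K : ℕ} {x : Store} {is : List ℕ} (h : ∀ i ∈ is, i < K)
    (ys : List (List Bool)) :
    Big O (copyIn K ys.length is) (joinStore K x (load ys)) (2 * is.length + 1)
      (PMF.pure (joinStore K x (load (ys ++ is.map x)))) := by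
  induction is generalizing ys with
  | nil => simpa [copyIn] using big_skip _
  | cons i is ih =>
    have h1 := big_copy (O := O) (joinStore K x (load ys)) i (K + ys.length)
    rw [joinStore_update, load_update_length, joinStore_lt _ _ (h i (by simp))] at h1
    have h2 := ih (fun j hj => h j (by simp [hj])) (ys ++ [x i])
    rw [List.length_append, List.length_singleton, List.append_assoc] at h2
    exact (h1.seq_pure h2).mono (by simp; omega)

theorem big_copyOut {K : ℕ} {x s : Store} {is : List ℕ} (h : ∀ i ∈ is, i < K) (j : ℕ) :
    Big O (copyOut K j is) (joinStore K x s) (2 * is.length + 1)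
      (PMF.pure (joinStore K (assignStore x is (readFrom j is.length s)) s)) := by
  induction is generalizing x j with
  | nil => exact big_skip _
  | cons i is ih =>
    have h1 := big_copy (O := O) (joinStore K x s) (K + j) i
    rw [joinStore_add, joinStore_update_lt _ _ (h i (by simp))] at h1
    have h2 := ih (x := Function.update x i (s j)) (fun j hj => h j (by simp [hj])) (j + 1)
    exact (h1.seq_pure h2).mono (by simp; omega)

/-- Register `K + b` lies beyond the frame and is empty, so copying it erases. Clearing the frame
lets the next call start from empty registers. -/
theorem big_clearRegs {K b : ℕ} {x s : Store} {c : ℕ} (hc : c ≤ b) (hs : ∀ r, c ≤ r → s r = []) :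
    Big O (clearRegs K b c) (joinStore K x s) (2 * c + 1)
      (PMF.pure (joinStore K x (load []))) := by
  induction c generalizing s with
  | zero =>
    have : s = load [] := by rw [load_nil]; exact funext fun r => hs r r.zero_le
    rw [this]
    exact big_skip _
  | succ c ih =>
    have h1 := big_copy (O := O) (joinStore K x s) (K + b) (K + c)
    rw [joinStore_add, joinStore_update, hs b hc] at h1
    have h2 := ih (s := Function.update s c []) (by omega) fun r hr => by
      by_cases h : r = c
      · subst h; simp
      · rw [Function.update_of_ne h, hs r (by omega)]
    exact (h1.seq_pure h2).mono (by omega)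

/-- Started on the given inputs, `P` halts within `T` steps, and the joint distribution of its
first `m` registers is `μ`. -/
def Yields (O : PMF (List Bool)) (P : Prog) (ins : List (List Bool)) (T m : ℕ)
    (μ : PMF (List (List Bool))) : Prop :=
  ∃ d : PMF Store, Evals O ([P], load ins) T d ∧ d.map (readFrom 0 m) = μ

theorem Yields.mono {P : Prog} {ins : List (List Bool)} {T T' m : ℕ}
    {μ : PMF (List (List Bool))} (h : Yields O P ins T m μ) (hT : T ≤ T') :
    Yields O P ins T' m μ :=
  let ⟨d, h1, h2⟩ := h
  ⟨d, h1.mono hT, h2⟩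

theorem Yields.congr {P : Prog} {ins : List (List Bool)} {T T' m : ℕ}
    {μ ν : PMF (List (List Bool))} (h : Yields O P ins T m μ) (hT : T ≤ T') (hμ : μ = ν) :
    Yields O P ins T' m ν := hμ ▸ h.mono hT

theorem joinStore_eq_self {K : ℕ} {x : Store} (hx : SuppBelow K x) :
    joinStore K x (load []) = x := by
  funext r
  rw [load_nil, joinStore]
  split_ifs with h
  · rfl
  · exact (hx r (not_lt.1 h)).symm

theorem suppBelow_assignStore {K : ℕ} {x : Store} (hx : SuppBelow K x) {is : List ℕ}
    (h : ∀ i ∈ is, i < K) (vs : List (List Bool)) : SuppBelow K (assignStore x is vs) := by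
  induction is generalizing x vs with
  | nil => exact hx
  | cons i is ih =>
    rcases vs with _ | ⟨v, vs⟩
    · exact hx
    · exact ih (hx.update (h i (by simp)) v) (fun j hj => h j (by simp [hj])) vs

/-- The callee runs above register `K` and its frame is erased at the end, so the registers from `K`
on are empty again and calls can be chained. -/
theorem Yields.big_call {P : Prog} {ins outs : List ℕ} {x : Store} {K T : ℕ}
    {μ : PMF (List (List Bool))} (h : Yields O P (ins.map x) T outs.length μ)
    (hx : SuppBelow K x) (hi : ∀ i ∈ ins, i < K) (ho : ∀ i ∈ outs, i < K) :
    Big O (callProg K P ins outs) x (T + callCost P ins outs)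
      (μ.map (assignStore x outs)) := by
  obtain ⟨d, hd, rfl⟩ := h
  set b := frameSize P ins outs with hb
  have h1 := big_copyIn (O := O) (K := K) (x := x) hi []
  rw [joinStore_eq_self hx, List.length_nil, List.nil_append] at h1
  have h3 : ∀ s, SuppBelow b s → Big O (.seq (copyOut K 0 outs) (clearRegs K b b))
      (joinStore K x s) (2 * outs.length + 1 + (2 * b + 1) + 1)
      (PMF.pure (assignStore x outs (readFrom 0 outs.length s))) := by
    intro s hs
    have h4 := (big_copyOut (O := O) (x := x) (s := s) ho 0).seq_pure
      (big_clearRegs (b := b) le_rfl hs)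
    rwa [joinStore_eq_self (suppBelow_assignStore hx ho _)] at h4
  have h2 : Big O (.seq (P.embed K fun r => .query (K + r))
      (.seq (copyOut K 0 outs) (clearRegs K b b))) (joinStore K x (load (ins.map x)))
      (T + (2 * outs.length + 1 + (2 * b + 1) + 1) + 1)
      (d.map fun s => assignStore x outs (readFrom 0 outs.length s)) := by
    intro L T' F hF
    -- Here the oracle is not replaced: a query of the callee is the same query with a shifted
    -- register, which costs one step.
    have key := hd.embed (O := O) (k := K) (b := b) (C := 1) (Q := fun r => .query (K + r))
      (x := x) le_rfl (fun r _ s _ => big_of_step fun L => by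
        rw [step, PMF.map_comp]
        simp only [joinStore_update]
        rfl) (by
        intro R hR
        rw [List.mem_singleton] at hR
        subst hR
        exact (regsBelow_regBound R).mono (le_max_left _ _))
      (fun r hr => suppBelow_load _ r (by
        have : ins.length ≤ b := by simp [hb, frameSize]
        simp; omega)) (.seq (copyOut K 0 outs) (clearRegs K b b) :: L)
      (2 * outs.length + 1 + (2 * b + 1) + 1 + T')
      (fun s => F (assignStore x outs (readFrom 0 outs.length s))) (by
        intro s' hs' hb'
        have := h3 s' hb' L T' F (by
          intro s'' h
          rw [PMF.support_pure, Set.mem_singleton_iff] at h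
          subst h
          refine hF _ ?_
          rw [PMF.mem_support_map_iff]
          exact ⟨s', hs', rfl⟩)
        rwa [PMF.pure_bind] at this)
    rw [Evals] at key ⊢
    rw [show T + (2 * outs.length + 1 + (2 * b + 1) + 1) + 1 + T' =
      (T * 1 + (2 * outs.length + 1 + (2 * b + 1) + 1 + T')) + 1 by omega, run, step,
      PMF.pure_bind, PMF.bind_map]
    exact key
  have h5 := (h1.seq_pure h2).mono (T' := T + callCost P ins outs) (by
    rw [callCost, ← hb]; omega)
  rw [PMF.map_comp]
  exact h5

/-! ### Symbolic execution on finitely many registers -/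

/-- In the registers `xs` (the others being empty) `P` terminates within `T` steps and leads to
the distribution `μ` of the registers. -/
def Exec (O : PMF (List Bool)) (P : Prog) (xs : List (List Bool)) (T : ℕ)
    (μ : PMF (List (List Bool))) : Prop :=
  Big O P (load xs) T (μ.map load)

theorem Exec.mono {P : Prog} {xs : List (List Bool)} {T T' : ℕ} {μ : PMF (List (List Bool))}
    (h : Exec O P xs T μ) (hT : T ≤ T') : Exec O P xs T' μ := Big.mono h hT

theorem Exec.congr {P : Prog} {xs : List (List Bool)} {T T' : ℕ} {μ ν : PMF (List (List Bool))}
    (h : Exec O P xs T μ) (hT : T ≤ T') (hμ : μ = ν) : Exec O P xs T' ν := hμ ▸ h.mono hT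

/-- `load` forgets trailing empty registers, so `ν` need not factor through stores and `Big.seq`
does not apply directly. The run of the machine itself serves as the continuation on stores. -/
theorem Exec.seq {P Q : Prog} {xs : List (List Bool)} {T T' : ℕ} {μ : PMF (List (List Bool))}
    {ν : List (List Bool) → PMF (List (List Bool))} (hP : Exec O P xs T μ)
    (hQ : ∀ ys ∈ μ.support, Exec O Q ys T' (ν ys)) :
    Exec O (.seq P Q) xs (T + T' + 1) (μ.bind ν) := by
  intro K T'' F hF
  have := hP (Q :: K) (T' + T'') (fun s => (run O (T' + T'') (Q :: K, s)).map Prod.snd) (by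
    intro s' hs'
    rw [PMF.mem_support_map_iff] at hs'
    obtain ⟨ys, hys, rfl⟩ := hs'
    have h1 := hQ ys hys K T'' F (by
      intro s'' hs''
      refine hF s'' ?_
      rw [PMF.map_bind, PMF.mem_support_bind_iff]
      exact ⟨ys, hys, hs''⟩)
    rw [h1.map_snd]
    exact h1)
  rw [Evals] at this ⊢
  rw [show T + T' + 1 + T'' = (T + (T' + T'')) + 1 by omega, run, step, PMF.pure_bind, this]
  congr 1
  rw [PMF.bind_map, PMF.map_bind, PMF.bind_bind]
  refine bind_congr_support _ fun ys hys => ?_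
  refine (hQ ys hys K T'' F ?_).map_snd
  intro s'' hs''
  refine hF s'' ?_
  rw [PMF.map_bind, PMF.mem_support_bind_iff]
  exact ⟨ys, hys, hs''⟩

theorem Exec.seq_pure {P Q : Prog} {xs ys : List (List Bool)} {T T' : ℕ}
    {ν : PMF (List (List Bool))} (hP : Exec O P xs T (PMF.pure ys)) (hQ : Exec O Q ys T' ν) :
    Exec O (.seq P Q) xs (T + T' + 1) ν := by
  rw [Exec, PMF.pure_map] at hP
  exact Big.seq_pure hP hQ

theorem Exec.loop_nil {r : ℕ} {P : Prog} {xs : List (List Bool)} (h : xs.getD r [] = []) :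
    Exec O (.loop r P) xs 1 (PMF.pure xs) := by
  rw [Exec, PMF.pure_map]
  exact Big.loop_nil h

theorem Exec.loop_cons {r : ℕ} {P : Prog} {xs : List (List Bool)} {T T' : ℕ}
    {μ : PMF (List (List Bool))} {ν : List (List Bool) → PMF (List (List Bool))}
    (h : xs.getD r [] ≠ []) (hP : Exec O P xs T μ)
    (hQ : ∀ ys ∈ μ.support, Exec O (.loop r P) ys T' (ν ys)) :
    Exec O (.loop r P) xs (T + T' + 1) (μ.bind ν) :=
  Big.loop_cons h (hP.seq hQ)

theorem Exec.loop_cons_pure {r : ℕ} {P : Prog} {xs ys : List (List Bool)} {T T' : ℕ}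
    {ν : PMF (List (List Bool))} (h : xs.getD r [] ≠ []) (hP : Exec O P xs T (PMF.pure ys))
    (hQ : Exec O (.loop r P) ys T' ν) : Exec O (.loop r P) xs (T + T' + 1) ν :=
  Big.loop_cons h (hP.seq_pure hQ)

theorem Exec.branch_nil {r : ℕ} {P Q R : Prog} {xs : List (List Bool)} {T : ℕ}
    {μ : PMF (List (List Bool))} (h : xs.getD r [] = []) (hP : Exec O P xs T μ) :
    Exec O (.branch r P Q R) xs (T + 1) μ :=
  big_of_reduces (fun K => by simp only [step, load_apply, h]) hP

theorem Exec.branch_false {r : ℕ} {P Q R : Prog} {xs : List (List Bool)} {l : List Bool} {T : ℕ}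
    {μ : PMF (List (List Bool))} (h : xs.getD r [] = false :: l) (hQ : Exec O Q xs T μ) :
    Exec O (.branch r P Q R) xs (T + 1) μ :=
  big_of_reduces (fun K => by simp only [step, load_apply, h]) hQ

theorem Exec.branch_true {r : ℕ} {P Q R : Prog} {xs : List (List Bool)} {l : List Bool} {T : ℕ}
    {μ : PMF (List (List Bool))} (h : xs.getD r [] = true :: l) (hR : Exec O R xs T μ) :
    Exec O (.branch r P Q R) xs (T + 1) μ :=
  big_of_reduces (fun K => by simp only [step, load_apply, h]) hR

/-- The program has no loops, and its registers are smaller than `b`. -/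
def Straight (b : ℕ) : Prog → Prop
  | .skip => True
  | .push _ r => r < b
  | .pop r => r < b
  | .copy src dst => src < b ∧ dst < b
  | .flip r => r < b
  | .query r => r < b
  | .seq P Q => Straight b P ∧ Straight b Q
  | .branch r P Q R => r < b ∧ Straight b P ∧ Straight b Q ∧ Straight b R
  | .loop _ _ => False

/-- The effect of a program without loops. -/
def denote (O : PMF (List Bool)) : Prog → List (List Bool) → PMF (List (List Bool))
  | .skip, xs => PMF.pure xs
  | .push b r, xs => PMF.pure (xs.set r (b :: xs.getD r []))
  | .pop r, xs => PMF.pure (xs.set r (xs.getD r []).tail)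
  | .copy src dst, xs => PMF.pure (xs.set dst (xs.getD src []))
  | .flip r, xs => coin.map fun b => xs.set r (b :: xs.getD r [])
  | .query r, xs => O.map fun a => xs.set r a
  | .seq P Q, xs => (denote O P xs).bind (denote O Q)
  | .branch r P Q R, xs =>
      match xs.getD r [] with
      | [] => denote O P xs
      | false :: _ => denote O Q xs
      | true :: _ => denote O R xs
  | .loop _ _, xs => PMF.pure xs

/-- The running time of a program without loops. -/
def straightTime : Prog → ℕ
  | .seq P Q => straightTime P + straightTime Q + 1
  | .branch _ P Q R => max (straightTime P) (max (straightTime Q) (straightTime R)) + 1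
  | _ => 1

/-- Reduces loop-free code to a computation with `denote` that `simp` can carry out. The number of
registers is part of the induction because `Straight` is relative to it. -/
theorem exec_straight {P : Prog} {xs : List (List Bool)} (h : Straight xs.length P) :
    Exec O P xs (straightTime P) (denote O P xs) ∧
      ∀ ys ∈ (denote O P xs).support, ys.length = xs.length := by
  induction P generalizing xs with
  | skip => exact ⟨big_of_step fun K => by simp [denote, step, PMF.pure_map], by simp [denote]⟩
  | push b r =>
    refine ⟨big_of_step fun K => ?_, by simp [denote]⟩
    simp only [denote, step, PMF.pure_map]
    rw [load_update h, load_apply]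
  | pop r =>
    refine ⟨big_of_step fun K => ?_, by simp [denote]⟩
    simp only [denote, step, PMF.pure_map]
    rw [load_update h, load_apply]
  | copy r r' =>
    refine ⟨big_of_step fun K => ?_, by simp [denote]⟩
    simp only [denote, step, PMF.pure_map]
    rw [load_update h.2, load_apply]
  | flip r =>
    refine ⟨big_of_step fun K => ?_, ?_⟩
    · simp only [denote, step, PMF.map_comp, load_update h, load_apply]
      rfl
    · intro ys hys
      rw [denote, PMF.mem_support_map_iff] at hys
      obtain ⟨a, -, rfl⟩ := hys
      simp
  | query r =>
    refine ⟨big_of_step fun K => ?_, ?_⟩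
    · simp only [denote, step, PMF.map_comp, load_update h]
      rfl
    · intro ys hys
      rw [denote, PMF.mem_support_map_iff] at hys
      obtain ⟨a, -, rfl⟩ := hys
      simp
  | seq P Q ihP ihQ =>
    have hQ : ∀ ys ∈ (denote O P xs).support, Straight ys.length Q := fun ys hys => by
      rw [(ihP h.1).2 ys hys]; exact h.2
    refine ⟨(ihP h.1).1.seq fun ys hys => (ihQ (hQ ys hys)).1, ?_⟩
    intro ys hys
    rw [denote, PMF.mem_support_bind_iff] at hys
    obtain ⟨zs, hz, hy⟩ := hys
    rw [(ihQ (hQ zs hz)).2 ys hy, (ihP h.1).2 zs hz]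
  | branch r P Q R ihP ihQ ihR =>
    rcases hr : xs.getD r [] with _ | ⟨_ | _, l⟩
    · have := ihP h.2.1
      simp only [denote, hr]
      exact ⟨(Exec.branch_nil hr this.1).mono (by simp [straightTime]), this.2⟩
    · have := ihQ h.2.2.1
      simp only [denote, hr]
      exact ⟨(Exec.branch_false hr this.1).mono (by simp [straightTime]), this.2⟩
    · have := ihR h.2.2.2
      simp only [denote, hr]
      exact ⟨(Exec.branch_true hr this.1).mono (by simp [straightTime]), this.2⟩
  | loop r P => exact h.elim

theorem Exec.straight {P : Prog} {xs : List (List Bool)} {μ : PMF (List (List Bool))}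
    (h : Straight xs.length P) (hμ : denote O P xs = μ) : Exec O P xs (straightTime P) μ :=
  hμ ▸ (exec_straight h).1

theorem Yields.call {P : Prog} {ins outs : List ℕ} {xs : List (List Bool)} {K T : ℕ}
    {μ : PMF (List (List Bool))}
    (h : Yields O P (ins.map fun i => xs.getD i []) T outs.length μ)
    (hi : ∀ i ∈ ins, i < xs.length) (ho : ∀ i ∈ outs, i < xs.length) (hK : xs.length ≤ K) :
    Exec O (callProg K P ins outs) xs (T + callCost P ins outs) (μ.map (assign xs outs)) := by
  have := h.big_call (x := load xs) (K := K) (fun r hr => suppBelow_load xs r (hK.trans hr))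
    (fun i hh => (hi i hh).trans_le hK) fun i hh => (ho i hh).trans_le hK
  rw [Exec, PMF.map_comp]
  convert this using 2
  funext vs
  exact load_assign ho vs

theorem Yields.call_pure {P : Prog} {ins outs : List ℕ} {xs vs : List (List Bool)} {K T : ℕ}
    (h : Yields O P (ins.map fun i => xs.getD i []) T outs.length (PMF.pure vs))
    (hi : ∀ i ∈ ins, i < xs.length) (ho : ∀ i ∈ outs, i < xs.length) (hK : xs.length ≤ K) :
    Exec O (callProg K P ins outs) xs (T + callCost P ins outs)
      (PMF.pure (assign xs outs vs)) := by
  have := h.call hi ho hK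
  rwa [PMF.pure_map] at this

theorem Exec.yields {P : Prog} {ins : List (List Bool)} {T m : ℕ} (k : ℕ)
    {μ : PMF (List (List Bool))} (h : Exec O P (ins ++ List.replicate k []) T μ) :
    Yields O P ins T m (μ.map fun ys => readFrom 0 m (load ys)) := by
  rw [Exec, load_append_replicate] at h
  exact ⟨_, Big.evals h, by rw [PMF.map_comp]; rfl⟩

theorem Exec.yields_pure {P : Prog} {ins ys : List (List Bool)} {T m : ℕ} (k : ℕ)
    (h : Exec O P (ins ++ List.replicate k []) T (PMF.pure ys)) :
    Yields O P ins T m (PMF.pure (readFrom 0 m (load ys))) := by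
  have := h.yields (m := m) k
  rwa [PMF.pure_map] at this

/-! ### Oracle-free programs -/

theorem OracleFree.embed {P : Prog} (h : OracleFree P) (k : ℕ) (Q : ℕ → Prog) :
    OracleFree (P.embed k Q) := by
  induction P with
  | query r => exact h.elim
  | seq P Q ih ih' => exact ⟨ih h.1, ih' h.2⟩
  | branch r P Q R ih ih' ih'' => exact ⟨ih h.1, ih' h.2.1, ih'' h.2.2⟩
  | loop r P ih => exact ih h
  | _ => trivial

theorem oracleFree_copyIn (K j : ℕ) (is : List ℕ) : OracleFree (copyIn K j is) := by
  induction is generalizing j with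
  | nil => trivial
  | cons i is ih => exact ⟨trivial, ih _⟩

theorem oracleFree_copyOut (K j : ℕ) (is : List ℕ) : OracleFree (copyOut K j is) := by
  induction is generalizing j with
  | nil => trivial
  | cons i is ih => exact ⟨trivial, ih _⟩

theorem oracleFree_clearRegs (K b c : ℕ) : OracleFree (clearRegs K b c) := by
  induction c with
  | zero => trivial
  | succ c ih => exact ⟨trivial, ih⟩

theorem OracleFree.callProg {P : Prog} (h : OracleFree P) (K : ℕ) (ins outs : List ℕ) :
    OracleFree (callProg K P ins outs) :=
  ⟨oracleFree_copyIn _ _ _, h.embed _ _, oracleFree_copyOut _ _ _, oracleFree_clearRegs _ _ _⟩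

end
end EditPRC

/-! ### Machine programs for elementary string operations. -/

namespace EditPRC
noncomputable section

variable {O : PMF (List Bool)}

/-! ### Basic procedures -/

/-- Move the top bit of register `a` to register `t`. -/
def moveBit (a t : ℕ) : Prog :=
  .branch a .skip (.seq (.pop a) (.push false t)) (.seq (.pop a) (.push true t))

theorem denote_moveBit_cons {xs : List (List Bool)} {a t : ℕ} {b : Bool} {l : List Bool}
    (hl : xs.getD a [] = b :: l) :
    denote O (moveBit a t) xs =
      PMF.pure ((xs.set a l).set t (b :: (xs.set a l).getD t [])) := by
  cases b <;> simp only [moveBit, denote, hl, PMF.pure_bind, List.tail_cons]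

theorem straight_moveBit {b a t : ℕ} (ha : a < b) (ht : t < b) : Straight b (moveBit a t) :=
  ⟨ha, trivial, ⟨ha, ht⟩, ha, ht⟩

theorem straightTime_moveBit (a t : ℕ) : straightTime (moveBit a t) = 4 := rfl

/-- Move register `a` to register `t`, which reverses it. -/
def moveAll (a t : ℕ) : Prog := .loop a (moveBit a t)

theorem exec_moveAll {a t : ℕ} {xs : List (List Bool)} (ha : a < xs.length) (ht : t < xs.length)
    (hat : a ≠ t) {l m : List Bool} (hl : xs.getD a [] = l) (hm : xs.getD t [] = m) :
    Exec O (moveAll a t) xs (l.length * 5 + 1)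
      (PMF.pure ((xs.set a []).set t (l.reverse ++ m))) := by
  induction l generalizing xs m with
  | nil =>
    have h1 : xs.set a [] = xs := by
      rw [← hl, List.getD_eq_getElem _ _ ha]; exact List.set_getElem_self ha
    have h2 : xs.set t m = xs := by
      rw [← hm, List.getD_eq_getElem _ _ ht]; exact List.set_getElem_self ht
    rw [h1, List.reverse_nil, List.nil_append, h2, List.length_nil]
    exact Exec.loop_nil hl
  | cons b l ih =>
    refine Exec.congr (Exec.loop_cons_pure (by rw [hl]; simp) (Exec.straight (straight_moveBit ha ht)
      (denote_moveBit_cons hl)) (ih (by simpa using ha) (by simpa using ht) (m := b :: m) ?_ ?_)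
      ) ?_ ?_
    · simp [hat.symm, ha]
    · rw [List.getD_eq_getElem _ _ ht] at hm
      simp [ht, hat, hm]
    · rw [straightTime_moveBit, List.length_cons]; omega
    · rw [List.set_comm _ _ hat.symm, List.set_set, List.set_set, List.reverse_cons,
        List.append_assoc, List.singleton_append, List.set_comm _ _ hat]

/-- Concatenation. -/
def appendProg : Prog := .seq (moveAll 0 2) (.seq (moveAll 2 1) (.copy 1 0))

/-- Moving `a` through an auxiliary stack reverses it twice. The constant is generous, as in the
procedures below; only the order of growth is used later. -/
theorem yields_append : ∃ C, ∀ (O : PMF (List Bool)) (a b : List Bool),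
    Yields O appendProg [a, b] (C * (a.length + 1)) 1 (PMF.pure [a ++ b]) := by
  refine ⟨20, fun O a b => ?_⟩
  have h1 := exec_moveAll (O := O) (xs := [a, b, []]) (a := 0) (t := 2) (by simp) (by simp)
    (by simp) rfl rfl
  have h2 := exec_moveAll (O := O) (xs := [[], b, a.reverse ++ []]) (a := 2) (t := 1) (by simp)
    (by simp) (by simp) rfl rfl
  have h3 := Exec.straight (O := O) (P := .copy 1 0)
    (xs := [[], (a.reverse ++ []).reverse ++ b, []]) (by simp [Straight]) rfl
  have := (h1.seq_pure (h2.seq_pure h3)).yields_pure (m := 1) (ins := [a, b]) 1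
  refine this.congr ?_ ?_
  · simp [straightTime]; omega
  · simp [readFrom, load]

/-- Split off a prefix, whose length is that of the first argument. -/
def splitProg : Prog :=
  .seq (.loop 0 (.seq (.pop 0) (moveBit 1 2))) (.seq (moveAll 2 3) (.copy 3 0))

/-- The loop runs through the whole counter, even after `y` is exhausted, when `moveBit` does
nothing; this agrees with `take` and `drop` on short strings. Applied to unary numbers the procedure
also compares and subtracts. -/
theorem yields_split : ∃ C, ∀ (O : PMF (List Bool)) (k y : List Bool),
    Yields O splitProg [k, y] (C * (k.length + 1)) 2
      (PMF.pure [y.take k.length, y.drop k.length]) := by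
  refine ⟨20, fun O k y => ?_⟩
  have h1 : ∀ acc, Exec O (.loop 0 (.seq (.pop 0) (moveBit 1 2))) [k, y, acc, []]
      (k.length * 7 + 1)
      (PMF.pure [[], y.drop k.length, (y.take k.length).reverse ++ acc, []]) := by
    induction k generalizing y with
    | nil => intro acc; simpa using Exec.loop_nil rfl
    | cons b k ih =>
      intro acc
      rcases y with _ | ⟨c, y⟩
      · refine Exec.congr (Exec.loop_cons_pure (ys := [k, [], acc, []]) (by simp) (Exec.straight ?_ ?_)
          (ih [] acc)) ?_ ?_
        · simp [Straight, moveBit]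
        · simp [denote, moveBit]
        · simp [straightTime, moveBit]; omega
        · simp
      · refine Exec.congr (Exec.loop_cons_pure (ys := [k, y, c :: acc, []]) (by simp) (Exec.straight ?_ ?_)
          (ih y (c :: acc))) ?_ ?_
        · simp [Straight, moveBit]
        · cases c <;> simp [denote, moveBit]
        · simp [straightTime, moveBit]; omega
        · simp
  have h2 := exec_moveAll (O := O) (xs := [[], y.drop k.length, (y.take k.length).reverse ++ [], []])
    (a := 2) (t := 3) (by simp) (by simp) (by simp) rfl rfl
  have h3 := Exec.straight (O := O) (P := .copy 3 0)
    (xs := [[], y.drop k.length, [], ((y.take k.length).reverse ++ []).reverse ++ []])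
    (by simp [Straight]) rfl
  have := ((h1 []).seq_pure (h2.seq_pure h3)).yields_pure (m := 2) (ins := [k, y]) 2
  refine this.congr ?_ ?_
  · simp [straightTime]; omega
  · simp [readFrom, load]

/-- Reversal. -/
def reverseProg : Prog := .seq (moveAll 0 1) (.copy 1 0)

theorem yields_reverse : ∃ C, ∀ (O : PMF (List Bool)) (x : List Bool),
    Yields O reverseProg [x] (C * (x.length + 1)) 1 (PMF.pure [x.reverse]) := by
  refine ⟨20, fun O x => ?_⟩
  have h1 := exec_moveAll (O := O) (xs := [x, []]) (a := 0) (t := 1) (by simp) (by simp)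
    (by simp) rfl rfl
  have h3 := Exec.straight (O := O) (P := .copy 1 0) (xs := [[], x.reverse ++ []])
    (by simp [Straight]) rfl
  have := (h1.seq_pure h3).yields_pure (m := 1) (ins := [x]) 1
  refine this.congr ?_ ?_
  · simp [straightTime]; omega
  · simp [readFrom, load]

/-- The length in unary. -/
def lengthProg : Prog := .seq (.loop 0 (.seq (.pop 0) (.push true 1))) (.copy 1 0)

theorem yields_length : ∃ C, ∀ (O : PMF (List Bool)) (x : List Bool),
    Yields O lengthProg [x] (C * (x.length + 1)) 1 (PMF.pure [ones x.length]) := by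
  refine ⟨20, fun O x => ?_⟩
  have h1 : ∀ j, Exec O (.loop 0 (.seq (.pop 0) (.push true 1))) [x, ones j]
      (x.length * 4 + 1) (PMF.pure [[], ones (x.length + j)]) := by
    induction x with
    | nil => intro j; simpa using Exec.loop_nil rfl
    | cons b x ih =>
      intro j
      refine Exec.congr (Exec.loop_cons_pure (ys := [x, ones (j + 1)]) (by simp) (Exec.straight ?_ ?_)
          (ih (j + 1))) ?_ ?_
      · simp [Straight]
      · simp [denote, ones, List.replicate_succ]
      · simp [straightTime]; omega
      · rw [List.length_cons, show x.length + (j + 1) = x.length + 1 + j by omega]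
  have h3 := Exec.straight (O := O) (P := .copy 1 0) (xs := [[], ones (x.length + 0)])
    (by simp [Straight]) rfl
  have := ((h1 0).seq_pure h3).yields_pure (m := 1) (ins := [x]) 1
  refine this.congr ?_ ?_
  · simp [straightTime]; omega
  · simp [readFrom, load]

/-- Fair coins. -/
def coinsProg : Prog :=
  .seq (.loop 0 (.seq (.pop 0) (.flip 1))) (.seq (moveAll 1 2) (.copy 2 0))

theorem uniformBits_succ (m : ℕ) :
    uniformBits (m + 1) = coin.bind fun a => (uniformBits m).map fun l => a :: l := rfl

theorem exec_flip_loop (x acc : List Bool) :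
    Exec O (.loop 0 (.seq (.pop 0) (.flip 1))) [x, acc, []] (x.length * 4 + 1)
      ((uniformBits x.length).map fun w => [[], w.reverse ++ acc, []]) := by
  induction x generalizing acc with
  | nil =>
    rw [List.length_nil, uniformBits, iid, PMF.pure_map]
    exact Exec.loop_nil rfl
  | cons b x ih =>
    have h1 : Exec O (.seq (.pop 0) (.flip 1)) [b :: x, acc, []] 3
        (coin.map fun c => [x, c :: acc, []]) :=
      Exec.straight (by simp [Straight]) (by simp [denote])
    have h2 := Exec.loop_cons (r := 0) (xs := [b :: x, acc, []]) (T' := x.length * 4 + 1)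
      (ν := fun ys => (uniformBits x.length).map fun w => [[], w.reverse ++ ys.getD 1 [], []])
      (by simp) h1 (by
        intro ys hys
        rw [PMF.mem_support_map_iff] at hys
        obtain ⟨c, -, rfl⟩ := hys
        exact ih (c :: acc))
    refine h2.congr ?_ ?_
    · simp; omega
    · rw [List.length_cons, uniformBits_succ, PMF.map_bind, PMF.bind_map]
      congr 2
      funext c
      simp [PMF.map_comp, Function.comp_def]

theorem length_of_mem_iid {α : Type} {d : PMF α} {m : ℕ} {w : List α}
    (h : w ∈ (iid d m).support) : w.length = m := by
  induction m generalizing w with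
  | zero => simp only [iid, PMF.support_pure, Set.mem_singleton_iff] at h; simp [h]
  | succ m ih =>
    rw [iid, PMF.mem_support_bind_iff] at h
    obtain ⟨a, -, h⟩ := h
    rw [PMF.mem_support_map_iff] at h
    obtain ⟨l, hl, rfl⟩ := h
    simp [ih hl]

theorem length_of_mem_uniformBits {m : ℕ} {w : List Bool} (h : w ∈ (uniformBits m).support) :
    w.length = m := length_of_mem_iid h

theorem yields_coins : ∃ C, ∀ (O : PMF (List Bool)) (k : List Bool),
    Yields O coinsProg [k] (C * (k.length + 1)) 1
      ((uniformBits k.length).map fun w => [w]) := by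
  refine ⟨20, fun O k => ?_⟩
  have h1 := exec_flip_loop (O := O) k []
  have h2 := h1.seq (Q := .seq (moveAll 1 2) (.copy 2 0)) (T' := k.length * 5 + 3)
    (ν := fun ys => PMF.pure [(ys.getD 1 []).reverse, [], (ys.getD 1 []).reverse]) (by
      intro ys hys
      rw [PMF.mem_support_map_iff] at hys
      obtain ⟨w, hw, rfl⟩ := hys
      have h2 := exec_moveAll (O := O) (xs := [[], w.reverse ++ [], []])
        (a := 1) (t := 2) (by simp) (by simp) (by simp) rfl rfl
      have h3 := Exec.straight (O := O) (P := .copy 2 0)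
        (xs := [[], [], (w.reverse ++ []).reverse ++ []])
        (by simp [Straight]) rfl
      refine (h2.seq_pure h3).congr ?_ ?_
      · simp [straightTime, length_of_mem_uniformBits hw]
      · simp [denote])
  refine (h2.yields (m := 1) (ins := [k]) 2).congr ?_ ?_
  · omega
  · rw [PMF.bind_map, PMF.map_bind]
    simp [readFrom, load, map_eq_bind]

end
end EditPRC

/-! ### Machine programs for exclusive or, the two CGK maps and unary arithmetic. -/

namespace EditPRC
noncomputable section

variable {O : PMF (List Bool)}

/-- Increasing the step counter amounts to discarding two seed bits, so the programs consume the
seed as a stack and need not store the counter. -/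
theorem seedFun_succ (r : List Bool) (t : ℕ) (b : Bool) :
    seedFun r (t + 1) b = seedFun r.tail.tail t b := by
  simp only [seedFun, List.getD_eq_getElem?_getD, List.getElem?_tail]
  congr 2
  omega

theorem embFrom_succ (r : List Bool) (t m : ℕ) (x : List Bool) :
    embFrom r (t + 1) m x = embFrom r.tail.tail t m x := by
  induction m generalizing t x with
  | zero => rfl
  | succ m ih => rcases x with _ | ⟨b, x⟩ <;> simp only [embFrom, ih, seedFun_succ]

theorem unembFrom_succ (L : ℕ) (r : List Bool) (t : ℕ) (a : List Bool) (i : ℕ)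
    (cur : Option Bool) :
    unembFrom L r (t + 1) a i cur = unembFrom L r.tail.tail t a i cur := by
  induction a generalizing t i cur with
  | nil => rfl
  | cons b a ih => simp only [unembFrom, ih, seedFun_succ]

/-- Only the number `L - i` of remaining positions matters, and the program keeps that number in
unary. -/
theorem unembFrom_index_succ (L : ℕ) (r : List Bool) (t : ℕ) (a : List Bool) (i : ℕ)
    (cur : Option Bool) :
    unembFrom (L + 1) r t a (i + 1) cur = unembFrom L r t a i cur := by
  induction a generalizing t i cur with
  | nil => rfl
  | cons b a ih => simp only [unembFrom, ih, Nat.add_lt_add_iff_right]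

/-- Bitwise exclusive or. -/
def xorProg : Prog :=
  .seq (.loop 1 (.branch 0 (.pop 1)
    (.seq (.pop 0) (moveBit 1 2))
    (.seq (.pop 0) (.branch 1 .skip (.seq (.pop 1) (.push true 2))
      (.seq (.pop 1) (.push false 2)))))) (.seq (moveAll 2 3) (.copy 3 0))

theorem yields_xor : ∃ C, ∀ (O : PMF (List Bool)) (a e : List Bool),
    Yields O xorProg [a, e] (C * (e.length + 1)) 1 (PMF.pure [xorStr a e]) := by
  refine ⟨50, fun O a e => ?_⟩
  -- The unread rest `a'` of the first string is overwritten by the final copy, so its value is left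
  -- open.
  have h1 : ∀ acc, ∃ a', Exec O (.loop 1 (.branch 0 (.pop 1)
      (.seq (.pop 0) (moveBit 1 2))
      (.seq (.pop 0) (.branch 1 .skip (.seq (.pop 1) (.push true 2))
        (.seq (.pop 1) (.push false 2)))))) [a, e, acc, []] (e.length * 8 + 1)
        (PMF.pure [a', [], (xorStr a e).reverse ++ acc, []]) := by
    induction e generalizing a with
    | nil =>
      intro acc
      refine ⟨a, ?_⟩
      simpa [xorStr] using Exec.loop_nil rfl
    | cons c e ih =>
      intro acc
      rcases a with _ | ⟨b, a⟩
      · obtain ⟨a', h⟩ := ih [] acc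
        refine ⟨a', Exec.congr (Exec.loop_cons_pure (by simp) (Exec.straight ?_ ?_) h) ?_ ?_⟩
        · simp [Straight, moveBit]
        · simp [denote]
        · simp [straightTime, moveBit]; omega
        · simp [xorStr]
      · obtain ⟨a', h⟩ := ih a ((b ^^ c) :: acc)
        refine ⟨a', Exec.congr (Exec.loop_cons_pure (by simp) (Exec.straight ?_ ?_) h) ?_ ?_⟩
        · simp [Straight, moveBit]
        · cases b <;> cases c <;> simp [denote, moveBit]
        · simp [straightTime, moveBit]; omega
        · simp [xorStr]
  obtain ⟨a', h1⟩ := h1 []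
  have h2 := exec_moveAll (O := O) (xs := [a', [], (xorStr a e).reverse ++ [], []])
    (a := 2) (t := 3) (by simp) (by simp) (by simp) rfl rfl
  have h3 := Exec.straight (O := O) (P := .copy 3 0)
    (xs := [a', [], [], ((xorStr a e).reverse ++ []).reverse ++ []]) (by simp [Straight]) rfl
  have := (h1.seq_pure (h2.seq_pure h3)).yields_pure (m := 1) (ins := [a, e]) 2
  refine this.congr ?_ ?_
  · simp [straightTime, xorStr]; omega
  · simp [readFrom, load]

theorem length_embFrom (r : List Bool) (t m : ℕ) (x : List Bool) :
    (embFrom r t m x).length = m := by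
  induction m generalizing t x with
  | zero => rfl
  | succ m ih => rcases x with _ | ⟨b, x⟩ <;> simp [embFrom, ih]

/-- One step of the embedding of register `1` with seed in register `2`. -/
def embStep : Prog :=
  .seq (.pop 0) (.branch 1
    (.seq (.push false 3) (.seq (.pop 2) (.pop 2)))
    (.seq (.push false 3) (.seq (.branch 2 .skip .skip (.pop 1)) (.seq (.pop 2) (.pop 2))))
    (.seq (.push true 3) (.seq (.pop 2) (.seq (.branch 2 .skip .skip (.pop 1)) (.pop 2)))))

theorem denote_embStep_nil (c : Bool) (k r out : List Bool) :
    denote O embStep [c :: k, [], r, out, []] =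
      PMF.pure [k, [], r.tail.tail, false :: out, []] := by
  simp [embStep, denote]

/-- Missing seed bits count as `false` in `seedFun`, and on an empty seed register the program does
not advance either; hence no hypothesis on the length of the seed. -/
theorem denote_embStep_cons (c : Bool) (k r out : List Bool) (b : Bool) (x : List Bool) :
    denote O embStep [c :: k, b :: x, r, out, []] =
      PMF.pure [k, if seedFun r 0 b then x else b :: x, r.tail.tail, b :: out, []] := by
  rcases r with _ | ⟨h0, _ | ⟨h1, r⟩⟩
  · cases b <;> simp [embStep, denote, seedFun]
  · cases b <;> cases h0 <;> simp [embStep, denote, seedFun]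
  · cases b <;> cases h0 <;> cases h1 <;> simp [embStep, denote, seedFun]

/-- The embedding into strings whose length is that of the first argument. -/
def embProg : Prog := .seq (.loop 0 embStep) (.seq (moveAll 3 4) (.copy 4 0))

theorem yields_emb : ∃ C, ∀ (O : PMF (List Bool)) (k x r : List Bool),
    Yields O embProg [k, x, r] (C * (k.length + 1)) 1 (PMF.pure [emb k.length x r]) := by
  refine ⟨100, fun O k x r => ?_⟩
  have h1 : ∀ out, ∃ x' r', Exec O (.loop 0 embStep) [k, x, r, out, []]
      (k.length * (straightTime embStep + 1) + 1)
      (PMF.pure [[], x', r', (embFrom r 0 k.length x).reverse ++ out, []]) := by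
    induction k generalizing x r with
    | nil =>
      intro out
      exact ⟨x, r, Exec.congr (Exec.loop_nil rfl) (by simp) (by simp [embFrom])⟩
    | cons c k ih =>
      intro out
      rcases x with _ | ⟨b, x⟩
      · obtain ⟨x', r', h⟩ := ih [] r.tail.tail (false :: out)
        refine ⟨x', r', Exec.congr (Exec.loop_cons_pure (by simp) (Exec.straight ?_
          (denote_embStep_nil _ _ _ _)) h) ?_ ?_⟩
        · simp [Straight, embStep]
        · simp only [List.length_cons]; exact le_of_eq (by ring)
        · simp [embFrom, embFrom_succ]
      · obtain ⟨x', r', h⟩ := ih (if seedFun r 0 b then x else b :: x) r.tail.tail (b :: out)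
        refine ⟨x', r', Exec.congr (Exec.loop_cons_pure (by simp) (Exec.straight ?_
          (denote_embStep_cons _ _ _ _ _ _)) h) ?_ ?_⟩
        · simp [Straight, embStep]
        · simp only [List.length_cons]; exact le_of_eq (by ring)
        · simp [embFrom, embFrom_succ]
  obtain ⟨x', r', h1⟩ := h1 []
  have h2 := exec_moveAll (O := O)
    (xs := [[], x', r', (embFrom r 0 k.length x).reverse ++ [], []])
    (a := 3) (t := 4) (by simp) (by simp) (by simp) rfl rfl
  have h3 := Exec.straight (O := O) (P := .copy 4 0)
    (xs := [[], x', r', [], ((embFrom r 0 k.length x).reverse ++ []).reverse ++ []])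
    (by simp [Straight]) rfl
  have := (h1.seq_pure (h2.seq_pure h3)).yields_pure (m := 1) (ins := [k, x, r]) 2
  refine this.congr ?_ ?_
  · simp [straightTime, embStep, length_embFrom]; omega
  · simp [readFrom, load, emb]

/-- Truncate or pad with zeros to the length of the first argument. -/
def fitProg : Prog :=
  .seq (.loop 0 (.seq (.pop 0) (.branch 1 (.push false 2) (moveBit 1 2) (moveBit 1 2))))
    (.seq (moveAll 2 3) (.copy 3 0))

theorem length_fit (n : ℕ) (z : List Bool) : (fit n z).length = n := by
  simp [fit]

theorem fit_succ_cons (n : ℕ) (b : Bool) (z : List Bool) :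
    fit (n + 1) (b :: z) = b :: fit n z := by
  simp only [fit, List.cons_append, List.take_succ_cons, List.replicate_succ']
  rw [← List.append_assoc, List.take_append_of_le_length]
  simp

theorem fit_nil (n : ℕ) : fit n [] = List.replicate n false := by simp [fit]

theorem yields_fit : ∃ C, ∀ (O : PMF (List Bool)) (k z : List Bool),
    Yields O fitProg [k, z] (C * (k.length + 1)) 1 (PMF.pure [fit k.length z]) := by
  refine ⟨50, fun O k z => ?_⟩
  have h1 : ∀ acc, ∃ z', Exec O
      (.loop 0 (.seq (.pop 0) (.branch 1 (.push false 2) (moveBit 1 2) (moveBit 1 2))))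
      [k, z, acc, []] (k.length * 8 + 1)
        (PMF.pure [[], z', (fit k.length z).reverse ++ acc, []]) := by
    induction k generalizing z with
    | nil =>
      intro acc
      exact ⟨z, Exec.congr (Exec.loop_nil rfl) (by simp) (by simp [fit])⟩
    | cons c k ih =>
      intro acc
      rcases z with _ | ⟨b, z⟩
      · obtain ⟨z', h⟩ := ih [] (false :: acc)
        refine ⟨z', Exec.congr (Exec.loop_cons_pure (by simp) (Exec.straight ?_ ?_) h) ?_ ?_⟩
        · simp [Straight, moveBit]
        · simp [denote]
        · simp [straightTime, moveBit]; omega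
        · simp [fit_nil, List.replicate_succ]
      · obtain ⟨z', h⟩ := ih z (b :: acc)
        refine ⟨z', Exec.congr (Exec.loop_cons_pure (by simp) (Exec.straight ?_ ?_) h) ?_ ?_⟩
        · simp [Straight, moveBit]
        · cases b <;> simp [denote, moveBit]
        · simp [straightTime, moveBit]; omega
        · simp [fit_succ_cons]
  obtain ⟨z', h1⟩ := h1 []
  have h2 := exec_moveAll (O := O) (xs := [[], z', (fit k.length z).reverse ++ [], []])
    (a := 2) (t := 3) (by simp) (by simp) (by simp) rfl rfl
  have h3 := Exec.straight (O := O) (P := .copy 3 0)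
    (xs := [[], z', [], ((fit k.length z).reverse ++ []).reverse ++ []]) (by simp [Straight]) rfl
  have := (h1.seq_pure (h2.seq_pure h3)).yields_pure (m := 1) (ins := [k, z]) 2
  refine this.congr ?_ ?_
  · simp [straightTime, length_fit]; omega
  · simp [readFrom, load]

/-- Assign the next bit of the input to the current output position, if this is unassigned. -/
def unembRead : Prog := .branch 3 (moveBit 1 3) (.pop 1) (.pop 1)

/-- Advance to the next output position if the seed says so. -/
def unembMove : Prog :=
  .branch 3 .skip
    (.seq (.branch 2 .skip .skip (.seq (.push false 4) (.seq (.pop 3) (.pop 0))))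
      (.seq (.pop 2) (.pop 2)))
    (.seq (.pop 2) (.seq (.branch 2 .skip .skip (.seq (.push true 4) (.seq (.pop 3) (.pop 0))))
      (.pop 2)))

/-- One step of the decoding walk. The registers contain the remaining output length in unary, the
remaining input, the seed, the assigned bit and the output in reversed order. -/
def unembStep : Prog := .branch 0 (.pop 1) (.seq unembRead unembMove) (.seq unembRead unembMove)

theorem straight_unembStep : Straight 6 unembStep := by
  simp [Straight, unembStep, unembRead, unembMove, moveBit]

theorem denote_unembStep_nil (b : Bool) (a r cur out : List Bool) :
    denote O unembStep [[], b :: a, r, cur, out, []] = PMF.pure [[], a, r, cur, out, []] := by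
  simp [unembStep, denote]

theorem denote_unembRead (k : List Bool) (b : Bool) (a r out : List Bool) (cur : Option Bool) :
    denote O unembRead [k, b :: a, r, cur.toList, out, []] =
      PMF.pure [k, a, r, [cur.getD b], out, []] := by
  rcases cur with _ | _ | _
  · cases b <;> simp [unembRead, denote, moveBit]
  · simp [unembRead, denote]
  · simp [unembRead, denote]

theorem denote_unembMove (c : Bool) (k a r out : List Bool) (b : Bool) :
    denote O unembMove [c :: k, a, r, [b], out, []] =
      PMF.pure (if seedFun r 0 b then [k, a, r.tail.tail, [], b :: out, []]
        else [c :: k, a, r.tail.tail, [b], out, []]) := by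
  rcases r with _ | ⟨h0, _ | ⟨h1, r⟩⟩
  · cases b <;> simp [unembMove, denote, seedFun]
  · cases b <;> cases h0 <;> simp [unembMove, denote, seedFun]
  · cases b <;> cases h0 <;> cases h1 <;> simp [unembMove, denote, seedFun]

theorem denote_unembStep_cons (c : Bool) (k : List Bool) (b : Bool) (a r out : List Bool)
    (cur : Option Bool) :
    denote O unembStep [c :: k, b :: a, r, cur.toList, out, []] =
      PMF.pure (if seedFun r 0 (cur.getD b) then
        [k, a, r.tail.tail, [], cur.getD b :: out, []]
        else [c :: k, a, r.tail.tail, [cur.getD b], out, []]) := by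
  cases c <;> simp only [unembStep, denote, List.getD_cons_zero, denote_unembRead,
    PMF.pure_bind, denote_unembMove]

/-- The bit of the current position is kept apart from the completed output until the walk leaves
the position. The counter still includes that position, which explains the correction by `cur'` in
the length identity and the condition that the counter is then non-empty. -/
theorem exec_unemb_loop (k a r : List Bool) (cur : Option Bool) (out : List Bool)
    (hk : cur.isSome → k ≠ []) :
    ∃ k' r' cur' out', Exec O (.loop 1 unembStep) [k, a, r, cur.toList, out, []]
        (a.length * (straightTime unembStep + 1) + 1)
        (PMF.pure [k', [], r', Option.toList cur', out', []]) ∧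
      (unembFrom k.length r 0 a 0 cur).reverse ++ out = cur'.toList ++ out' ∧
      k'.length + (unembFrom k.length r 0 a 0 cur).length = k.length + cur'.toList.length ∧
      (cur'.isSome → k' ≠ []) := by
  induction a generalizing k r cur out with
  | nil =>
    refine ⟨k, r, cur, out, Exec.congr (Exec.loop_nil rfl) (by simp) rfl, ?_, ?_, hk⟩
    · cases cur <;> simp [unembFrom]
    · simp [unembFrom]
  | cons b a ih =>
    rcases k with _ | ⟨c, k⟩
    -- All positions are completed; the loop only discards the rest of the input.
    · obtain rfl : cur = none := by simpa using hk
      obtain ⟨k', r', cur', out', h1, h2, h3, h4⟩ := ih [] r none out (by simp)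
      have e : unembFrom 0 r 0 a 0 none = [] := by cases a <;> simp [unembFrom]
      rw [List.length_nil, e] at h2 h3
      refine ⟨k', r', cur', out', Exec.congr (Exec.loop_cons_pure (by simp)
        (Exec.straight straight_unembStep (denote_unembStep_nil _ _ _ _ _)) h1) ?_ rfl, ?_, ?_, h4⟩
      · simp only [List.length_cons]; exact le_of_eq (by ring)
      · simpa [unembFrom] using h2
      · simpa [unembFrom] using h3
    · by_cases hs : seedFun r 0 (cur.getD b)
      · obtain ⟨k', r', cur', out', h1, h2, h3, h4⟩ :=
          ih k r.tail.tail none (cur.getD b :: out) (by simp)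
        refine ⟨k', r', cur', out', Exec.congr (Exec.loop_cons_pure (by simp)
          (Exec.straight straight_unembStep (denote_unembStep_cons _ _ _ _ _ _ _))
            (by rw [if_pos hs]; exact h1)) ?_ rfl, ?_, ?_, h4⟩
        · simp only [List.length_cons]; exact le_of_eq (by ring)
        · simpa [unembFrom, hs, unembFrom_succ, unembFrom_index_succ] using h2
        · simp [unembFrom, hs, unembFrom_succ, unembFrom_index_succ]; omega
      · obtain ⟨k', r', cur', out', h1, h2, h3, h4⟩ :=
          ih (c :: k) r.tail.tail (some (cur.getD b)) out (by simp)
        refine ⟨k', r', cur', out', Exec.congr (Exec.loop_cons_pure (by simp)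
          (Exec.straight straight_unembStep (denote_unembStep_cons _ _ _ _ _ _ _))
            (by rw [if_neg hs]; exact h1)) ?_ rfl, ?_, ?_, h4⟩
        · simp only [List.length_cons]; exact le_of_eq (by ring)
        · simpa [unembFrom, hs, unembFrom_succ, unembFrom_index_succ] using h2
        · simpa [unembFrom, hs, unembFrom_succ, unembFrom_index_succ] using h3

/-- The decoding function with outputs of the length of the first argument. -/
def unembProg : Prog :=
  .seq (.loop 1 unembStep)
    (.seq (.branch 3 .skip (.seq (.pop 0) (.push false 4)) (.seq (.pop 0) (.push true 4)))
      (.seq (callProg 6 reverseProg [4] [4])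
        (.seq (callProg 6 coinsProg [0] [5]) (callProg 6 appendProg [4, 5] [0]))))

theorem yields_unemb : ∃ C, ∀ (O : PMF (List Bool)) (k a r : List Bool),
    Yields O unembProg [k, a, r] (C * (k.length + a.length + 1)) 1
      ((unemb k.length a r).map fun x => [x]) := by
  obtain ⟨C₁, hC₁⟩ := yields_reverse
  obtain ⟨C₂, hC₂⟩ := yields_coins
  obtain ⟨C₃, hC₃⟩ := yields_append
  refine ⟨100 + (C₁ + callCost reverseProg [4] [4]) + (C₂ + callCost coinsProg [0] [5]) +
    (C₃ + callCost appendProg [4, 5] [0]), fun O k a r => ?_⟩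
  obtain ⟨k', r', cur', out', h1, h2, h3, h4⟩ :=
    exec_unemb_loop (O := O) k a r none [] (by simp)
  set W := unembFrom k.length r 0 a 0 none with hW
  -- A pending bit is assigned although the walk never left its position, so it joins the output.
  -- The counter `k''` then tells how many fair coins are missing.
  have hk' : ∃ k'', Exec O (.branch 3 .skip (.seq (.pop 0) (.push false 4))
      (.seq (.pop 0) (.push true 4))) [k', [], r', Option.toList cur', out', []] 4
      (PMF.pure [k'', [], r', Option.toList cur', W.reverse, []]) ∧
      k''.length + W.length = k.length := by
    rw [List.append_nil] at h2
    rw [h2]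
    rcases cur' with _ | c
    · exact ⟨k', Exec.congr (Exec.straight (by simp [Straight]) rfl) (by simp [straightTime])
        (by simp [denote]), by simpa using h3⟩
    · obtain ⟨d, k'', rfl⟩ := List.exists_cons_of_ne_nil (h4 rfl)
      refine ⟨k'', Exec.congr (Exec.straight (by simp [Straight]) rfl) (by simp [straightTime])
        ?_, by simp at h3; omega⟩
      cases c <;> simp [denote]
  obtain ⟨k'', h5, h6⟩ := hk'
  have h7 := (hC₁ O W.reverse).call_pure (K := 6) (ins := [4]) (outs := [4])
    (xs := [k'', [], r', Option.toList cur', W.reverse, []]) (by simp) (by simp) (by simp)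
  have h8 := (hC₂ O k'').call (K := 6) (ins := [0]) (outs := [5])
    (xs := [k'', [], r', Option.toList cur', W.reverse.reverse, []]) (by simp) (by simp) (by simp)
  have h9 := h8.seq (Q := callProg 6 appendProg [4, 5] [0])
    (T' := C₃ * (W.length + 1) + callCost appendProg [4, 5] [0])
    (ν := fun ys => PMF.pure (assign ys [0] [W ++ ys.getD 5 []])) (by
      intro ys hys
      simp only [PMF.mem_support_map_iff] at hys
      obtain ⟨_, ⟨w, -, rfl⟩, rfl⟩ := hys
      have := (hC₃ O W w).call_pure (K := 6) (ins := [4, 5]) (outs := [0])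
        (xs := [k'', [], r', Option.toList cur', W, w]) (by simp) (by simp) (by simp)
      simpa [assign] using this)
  have h10 := (h1.seq_pure (h5.seq_pure (h7.seq_pure h9))).yields (m := 1) (ins := [k, a, r]) 3
  refine h10.congr ?_ ?_
  · rw [List.length_reverse]
    simp only [unembStep, unembRead, unembMove, moveBit, straightTime]
    have : W.length ≤ k.length := by omega
    have h' : k''.length ≤ k.length := by omega
    norm_num
    have e1 : C₁ * (W.length + 1) ≤ C₁ * (k.length + a.length + 1) :=
      Nat.mul_le_mul_left _ (by omega)
    have e2 : C₂ * (k''.length + 1) ≤ C₂ * (k.length + a.length + 1) :=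
      Nat.mul_le_mul_left _ (by omega)
    have e3 : C₃ * (W.length + 1) ≤ C₃ * (k.length + a.length + 1) :=
      Nat.mul_le_mul_left _ (by omega)
    nlinarith [Nat.zero_le (k.length + a.length),
      Nat.zero_le (callCost reverseProg [4] [4] * (k.length + a.length)),
      Nat.zero_le (callCost coinsProg [0] [5] * (k.length + a.length)),
      Nat.zero_le (callCost appendProg [4, 5] [0] * (k.length + a.length))]
  · have e : k.length - W.length = k''.length := by omega
    rw [unemb, ← hW, e]
    simp only [map_eq_bind, PMF.bind_bind, PMF.pure_bind, assign, readFrom, load]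
    rfl

/-- The block length for the given codeword length, in unary. -/
def blockLenProg : Prog :=
  .seq (.loop 0 (.seq (.pop 0) (.seq (.push true 1) (.branch 0 .skip
    (.seq (.pop 0) (.seq (.push true 1) (.pop 0)))
    (.seq (.pop 0) (.seq (.push true 1) (.pop 0))))))) (.copy 1 0)

/-- A pass removes up to three marks and writes two, or one if a single mark was left. Remainders
one and two therefore contribute one and two, which is the rounding up. -/
theorem yields_blockLen : ∃ C, ∀ (O : PMF (List Bool)) (m : ℕ),
    Yields O blockLenProg [ones m] (C * (m + 1)) 1 (PMF.pure [ones ((2 * m + 2) / 3)]) := by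
  refine ⟨100, fun O m => ?_⟩
  have h1 : ∀ m j, Exec O (.loop 0 (.seq (.pop 0) (.seq (.push true 1) (.branch 0 .skip
      (.seq (.pop 0) (.seq (.push true 1) (.pop 0)))
      (.seq (.pop 0) (.seq (.push true 1) (.pop 0))))))) [ones m, ones j] (m * 20 + 1)
      (PMF.pure [[], ones ((2 * m + 2) / 3 + j)]) := by
    intro m
    induction m using Nat.strong_induction_on with
    | _ m ih =>
      intro j
      rcases m with _ | _ | _ | m
      · exact Exec.congr (Exec.loop_nil rfl) (by simp) (by simp [ones])
      · refine Exec.congr (Exec.loop_cons_pure (ys := [ones 0, ones (j + 1)]) (by simp [ones])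
          (Exec.straight ?_ ?_) (ih 0 (by simp) (j + 1))) ?_ ?_
        · simp [Straight]
        · simp [denote, ones, List.replicate_succ]
        · simp [straightTime]
        · simp [Nat.add_comm]
      · refine Exec.congr (Exec.loop_cons_pure (ys := [ones 0, ones (j + 2)]) (by simp [ones])
          (Exec.straight ?_ ?_) (ih 0 (by simp) (j + 2))) ?_ ?_
        · simp [Straight]
        · simp [denote, ones, List.replicate_succ]
        · simp [straightTime]
        · simp [Nat.add_comm]
      · refine Exec.congr (Exec.loop_cons_pure (ys := [ones m, ones (j + 2)]) (by simp [ones])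
          (Exec.straight ?_ ?_) (ih m (by omega) (j + 2))) ?_ ?_
        · simp [Straight]
        · simp [denote, ones, List.replicate_succ]
        · simp [straightTime]; omega
        · rw [show (2 * (m + 1 + 1 + 1) + 2) / 3 + j = (2 * m + 2) / 3 + (j + 2) by omega]
  have h3 := Exec.straight (O := O) (P := .copy 1 0) (xs := [[], ones ((2 * m + 2) / 3 + 0)])
    (by simp [Straight]) rfl
  have := ((h1 m 0).seq_pure h3).yields_pure (m := 1) (ins := [ones m]) 1
  refine this.congr ?_ ?_
  · simp [straightTime]; omega
  · simp [readFrom, load]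

/-- Halving in unary. -/
def halfProg : Prog :=
  .seq (.loop 0 (.seq (.pop 0) (.branch 0 .skip
    (.seq (.pop 0) (.push true 1)) (.seq (.pop 0) (.push true 1))))) (.copy 1 0)

theorem yields_half : ∃ C, ∀ (O : PMF (List Bool)) (m : ℕ),
    Yields O halfProg [ones m] (C * (m + 1)) 1 (PMF.pure [ones (m / 2)]) := by
  refine ⟨100, fun O m => ?_⟩
  have h1 : ∀ m j, Exec O (.loop 0 (.seq (.pop 0) (.branch 0 .skip
      (.seq (.pop 0) (.push true 1)) (.seq (.pop 0) (.push true 1))))) [ones m, ones j] (m * 20 + 1)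
      (PMF.pure [[], ones (m / 2 + j)]) := by
    intro m
    induction m using Nat.strong_induction_on with
    | _ m ih =>
      intro j
      rcases m with _ | _ | m
      · exact Exec.congr (Exec.loop_nil rfl) (by simp) (by simp [ones])
      · refine Exec.congr (Exec.loop_cons_pure (ys := [ones 0, ones j]) (by simp [ones])
          (Exec.straight ?_ ?_) (ih 0 (by simp) j)) ?_ ?_
        · simp [Straight]
        · simp [denote, ones]
        · simp [straightTime]
        · simp
      · refine Exec.congr (Exec.loop_cons_pure (ys := [ones m, ones (j + 1)]) (by simp [ones])
          (Exec.straight ?_ ?_) (ih m (by omega) (j + 1))) ?_ ?_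
        · simp [Straight]
        · simp [denote, ones, List.replicate_succ]
        · simp [straightTime]; omega
        · rw [show (m + 1 + 1) / 2 + j = m / 2 + (j + 1) by omega]
  have h3 := Exec.straight (O := O) (P := .copy 1 0) (xs := [[], ones (m / 2 + 0)])
    (by simp [Straight]) rfl
  have := ((h1 m 0).seq_pure h3).yields_pure (m := 1) (ins := [ones m]) 1
  refine this.congr ?_ ?_
  · simp [straightTime]; omega
  · simp [readFrom, load]

/-- Multiplication in unary. -/
def mulProg : Prog :=
  .seq (.loop 0 (.seq (.pop 0) (.seq (.copy 1 2) (.loop 2 (.seq (.pop 2) (.push true 3))))))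
    (.copy 3 0)

theorem yields_mul : ∃ C, ∀ (O : PMF (List Bool)) (x y : ℕ),
    Yields O mulProg [ones x, ones y] (C * (x + 1) * (y + 1)) 1
      (PMF.pure [ones (x * y)]) := by
  refine ⟨100, fun O x y => ?_⟩
  have h0 : ∀ x z j, Exec O (.loop 2 (.seq (.pop 2) (.push true 3)))
      [ones x, ones y, ones z, ones j] (z * 4 + 1)
      (PMF.pure [ones x, ones y, [], ones (z + j)]) := by
    intro x z
    induction z with
    | zero => intro j; exact Exec.congr (Exec.loop_nil rfl) (by simp) (by simp [ones])
    | succ z ih =>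
      intro j
      refine Exec.congr (Exec.loop_cons_pure (ys := [ones x, ones y, ones z, ones (j + 1)])
        (by simp [ones]) (Exec.straight ?_ ?_) (ih (j + 1))) ?_ ?_
      · simp [Straight]
      · simp [denote, ones, List.replicate_succ]
      · simp [straightTime]; omega
      · rw [show z + 1 + j = z + (j + 1) by omega]
  have h1 : ∀ x j, Exec O
      (.loop 0 (.seq (.pop 0) (.seq (.copy 1 2) (.loop 2 (.seq (.pop 2) (.push true 3))))))
      [ones x, ones y, [], ones j] (x * (y * 4 + 10) + 1)
      (PMF.pure [[], ones y, [], ones (x * y + j)]) := by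
    intro x
    induction x with
    | zero => intro j; exact Exec.congr (Exec.loop_nil rfl) (by simp) (by simp [ones])
    | succ x ih =>
      intro j
      have e1 : Exec O (.pop 0) [ones (x + 1), ones y, [], ones j] 1
        (PMF.pure [ones x, ones y, [], ones j]) :=
        Exec.straight (P := .pop 0) (by simp [Straight])
          (by simp [denote, ones, List.replicate_succ])
      have e2 : Exec O (.copy 1 2) [ones x, ones y, [], ones j] 1
        (PMF.pure [ones x, ones y, ones y, ones j]) :=
        Exec.straight (P := .copy 1 2) (by simp [Straight]) (by simp [denote])
      refine Exec.congr (Exec.loop_cons_pure (by simp [ones]) (e1.seq_pure (e2.seq_pure (h0 x y j)))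
        (ih (y + j))) ?_ ?_
      · nlinarith
      · rw [show (x + 1) * y + j = x * y + (y + j) by ring]
  have h3 := Exec.straight (O := O) (P := .copy 3 0) (xs := [[], ones y, [], ones (x * y + 0)])
    (by simp [Straight]) rfl
  have := ((h1 x 0).seq_pure h3).yields_pure (m := 1) (ins := [ones x, ones y]) 2
  refine this.congr ?_ ?_
  · simp only [straightTime]; nlinarith
  · simp [readFrom, load]

end
end EditPRC

/-! ### Polynomial time bounds, independence of the oracle, and counted loops. -/

namespace EditPRC
noncomputable section

variable {O : PMF (List Bool)}

/-! ### Polynomial bounds -/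

/-- `f` is bounded by a polynomial. -/
@[fun_prop]
def PolyBounded (f : ℕ → ℕ) : Prop := ∃ q : Polynomial ℕ, ∀ n, f n ≤ q.eval n

theorem polyEval_mono (q : Polynomial ℕ) : Monotone fun n => q.eval n := fun a b hab => by
  simp only [Polynomial.eval_eq_sum, Polynomial.sum]
  exact Finset.sum_le_sum fun i _ => Nat.mul_le_mul_left _ (Nat.pow_le_pow_left hab i)

@[fun_prop]
theorem polyBounded_id : PolyBounded fun n => n := ⟨Polynomial.X, fun n => by simp⟩

@[fun_prop]
theorem polyBounded_const (c : ℕ) : PolyBounded fun _ => c := ⟨Polynomial.C c, fun n => by simp⟩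

@[fun_prop]
theorem PolyBounded.add {f g : ℕ → ℕ} (hf : PolyBounded f) (hg : PolyBounded g) :
    PolyBounded fun n => f n + g n :=
  let ⟨p, hp⟩ := hf
  let ⟨q, hq⟩ := hg
  ⟨p + q, fun n => by rw [Polynomial.eval_add]; exact add_le_add (hp n) (hq n)⟩

@[fun_prop]
theorem PolyBounded.mul {f g : ℕ → ℕ} (hf : PolyBounded f) (hg : PolyBounded g) :
    PolyBounded fun n => f n * g n :=
  let ⟨p, hp⟩ := hf
  let ⟨q, hq⟩ := hg
  ⟨p * q, fun n => by rw [Polynomial.eval_mul]; exact Nat.mul_le_mul (hp n) (hq n)⟩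

@[fun_prop]
theorem PolyBounded.comp {f g : ℕ → ℕ} (hf : PolyBounded f) (hg : PolyBounded g) :
    PolyBounded fun n => f (g n) :=
  let ⟨p, hp⟩ := hf
  let ⟨q, hq⟩ := hg
  ⟨p.comp q, fun n => by
    rw [Polynomial.eval_comp]; exact (hp _).trans (polyEval_mono p (hq n))⟩

theorem PolyBounded.mono {f g : ℕ → ℕ} (hg : PolyBounded g) (h : ∀ n, f n ≤ g n) :
    PolyBounded f :=
  let ⟨q, hq⟩ := hg
  ⟨q, fun n => (h n).trans (hq n)⟩

@[fun_prop]
theorem polyBounded_eval (q : Polynomial ℕ) : PolyBounded fun n => q.eval n := ⟨q, fun _ => le_rfl⟩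

/-! ### Oracle-free programs and oracles -/

theorem oracleFree_step {c : Config} (h : ∀ P ∈ c.1, OracleFree P) (O O' : PMF (List Bool)) :
    step O c = step O' c ∧ ∀ c' ∈ (step O c).support, ∀ P ∈ c'.1, OracleFree P := by
  obtain ⟨_ | ⟨P, L⟩, s⟩ := c
  · exact ⟨rfl, by simp [step]⟩
  have hP : OracleFree P := h P (by simp)
  have hL : ∀ P ∈ L, OracleFree P := fun P hP => h P (by simp [hP])
  have tl : ∀ R, OracleFree R → ∀ P ∈ R :: L, OracleFree P := by
    intro R hR P hP
    rcases List.mem_cons.1 hP with rfl | h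
    · exact hR
    · exact hL P h
  cases P with
  | query r => exact hP.elim
  | skip => refine ⟨rfl, ?_⟩; simpa [step] using hL
  | push b r => refine ⟨rfl, ?_⟩; simpa [step] using hL
  | pop r => refine ⟨rfl, ?_⟩; simpa [step] using hL
  | copy a b => refine ⟨rfl, ?_⟩; simpa [step] using hL
  | flip r =>
    refine ⟨rfl, fun c' hc' => ?_⟩
    simp only [step, PMF.mem_support_map_iff] at hc'
    obtain ⟨b, -, rfl⟩ := hc'
    exact hL
  | seq P Q =>
    refine ⟨rfl, ?_⟩
    simp only [step, PMF.support_pure, Set.mem_singleton_iff, forall_eq]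
    intro R hR
    rcases List.mem_cons.1 hR with rfl | hR
    · exact hP.1
    · exact tl Q hP.2 R hR
  | branch r P Q R =>
    refine ⟨rfl, ?_⟩
    rcases hr : s r with _ | ⟨_ | _, l⟩ <;>
      simp only [step, hr, PMF.support_pure, Set.mem_singleton_iff, forall_eq]
    · exact tl P hP.1
    · exact tl Q hP.2.1
    · exact tl R hP.2.2
  | loop r P =>
    refine ⟨rfl, ?_⟩
    rcases hr : s r with _ | ⟨_, l⟩ <;>
      simp only [step, hr, PMF.support_pure, Set.mem_singleton_iff, forall_eq]
    · exact hL
    · intro R hR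
      rcases List.mem_cons.1 hR with rfl | hR
      · exact hP
      · exact tl (.loop r P) hP R hR

/-- The algorithms of a code are specified with a trivial oracle; this makes them available as
subroutines of the reduction, which has a real one. -/
theorem Evals.change_oracle {c : Config} {T : ℕ} {d : PMF Store} (h : Evals O c T d)
    (hc : ∀ P ∈ c.1, OracleFree P) (O' : PMF (List Bool)) : Evals O' c T d := by
  induction T generalizing c d with
  | zero =>
    obtain ⟨h1, rfl⟩ := evals_zero_inv h
    obtain ⟨L, s⟩ := c
    simp only at h1
    subst h1
    exact evals_nil 0 s
  | succ T ih =>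
    obtain ⟨F, hF, rfl⟩ := h.step_inv
    obtain ⟨h1, h2⟩ := oracleFree_step hc O O'
    rw [h1]
    exact Evals.of_step fun c' hc' => by
      rw [← h1] at hc'
      exact ih (hF c' hc') (h2 c' hc')

theorem length_step_le {c : Config} (h : ∀ P ∈ c.1, OracleFree P) {B : ℕ}
    (hB : ∀ r, (c.2 r).length ≤ B) :
    ∀ c' ∈ (step O c).support, ∀ r, (c'.2 r).length ≤ B + 1 := by
  obtain ⟨_ | ⟨P, L⟩, s⟩ := c
  · simpa [step] using fun r => (hB r).trans (Nat.le_succ B)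
  have hB' : ∀ r, (s r).length ≤ B + 1 := fun r => (hB r).trans (Nat.le_succ B)
  have upd : ∀ i v, List.length v ≤ B + 1 → ∀ r, (Function.update s i v r).length ≤ B + 1 := by
    intro i v hv r
    by_cases hr : r = i
    · subst hr; simpa using hv
    · rw [Function.update_of_ne hr]; exact hB' r
  have hP : OracleFree P := h P (by simp)
  cases P with
  | query r => exact hP.elim
  | skip => simpa [step] using hB'
  | push b r =>
    simp only [step, PMF.support_pure, Set.mem_singleton_iff, forall_eq]
    exact upd _ _ (by simpa using hB r)
  | pop r =>
    simp only [step, PMF.support_pure, Set.mem_singleton_iff, forall_eq]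
    exact upd _ _ (by simpa using by have := hB r; simp only at this; omega)
  | copy a b =>
    simp only [step, PMF.support_pure, Set.mem_singleton_iff, forall_eq]
    exact upd _ _ (hB' a)
  | flip r =>
    intro c' hc'
    simp only [step, PMF.mem_support_map_iff] at hc'
    obtain ⟨b, -, rfl⟩ := hc'
    exact upd _ _ (by simpa using hB r)
  | seq P Q => simpa [step] using hB'
  | branch r P Q R =>
    rcases hr : s r with _ | ⟨_ | _, l⟩ <;>
      simpa only [step, hr, PMF.support_pure, Set.mem_singleton_iff, forall_eq] using hB'
  | loop r P =>
    rcases hr : s r with _ | ⟨_, l⟩ <;>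
      simpa only [step, hr, PMF.support_pure, Set.mem_singleton_iff, forall_eq] using hB'

theorem Evals.length_le {c : Config} {T : ℕ} {d : PMF Store} (h : Evals O c T d)
    (hc : ∀ P ∈ c.1, OracleFree P) {B : ℕ} (hB : ∀ r, (c.2 r).length ≤ B) :
    ∀ s ∈ d.support, ∀ r, (s r).length ≤ B + T := by
  induction T generalizing c d B with
  | zero =>
    obtain ⟨h1, rfl⟩ := evals_zero_inv h
    simpa using hB
  | succ T ih =>
    obtain ⟨F, hF, rfl⟩ := h.step_inv
    intro s hs r
    rw [PMF.mem_support_bind_iff] at hs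
    obtain ⟨c', hc', hs⟩ := hs
    have := ih (hF c' hc') ((oracleFree_step hc O O).2 c' hc')
      (length_step_le hc hB c' hc') s hs r
    omega

/-- Without oracle calls a register grows by at most one bit per step, so a running time bounds the
output length. This yields the polynomial bounds on key and codeword lengths. -/
theorem Yields.length_le {P : Prog} {ins : List (List Bool)} {T m B : ℕ}
    {μ : PMF (List (List Bool))} (h : Yields O P ins T m μ) (hP : OracleFree P)
    (hB : ∀ v ∈ ins, v.length ≤ B) : ∀ vs ∈ μ.support, ∀ v ∈ vs, v.length ≤ B + T := by
  obtain ⟨d, h1, rfl⟩ := h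
  intro vs hvs
  rw [PMF.mem_support_map_iff] at hvs
  obtain ⟨s, hs, rfl⟩ := hvs
  have key := h1.length_le (by simpa using hP) (B := B) (by
    intro r
    change (load ins r).length ≤ B
    by_cases hr : r < ins.length
    · rw [load_apply, List.getD_eq_getElem _ _ hr]
      exact hB _ (List.getElem_mem hr)
    · rw [suppBelow_load ins r (not_lt.1 hr)]
      simp) s hs
  generalize 0 = j
  induction m generalizing j with
  | zero => simp [readFrom]
  | succ m ih =>
    intro v hv
    rw [readFrom, List.mem_cons] at hv
    rcases hv with rfl | hv
    · exact key j
    · exact ih _ v hv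

theorem Computes.evals {α : Type} {P : Prog} {inputs : List (List Bool)} {T : ℕ}
    {read : Store → α} {d : PMF α} (h : Computes P inputs T read d) :
    ∃ d', Evals (PMF.pure []) ([P], load inputs) T d' ∧ d'.map read = d :=
  ⟨_, evals_of_halts h.1, h.2⟩

theorem Evals.computes {α : Type} {P : Prog} {inputs : List (List Bool)} {T : ℕ}
    {read : Store → α} {d : PMF α} {d' : PMF Store}
    (h : Evals (PMF.pure []) ([P], load inputs) T d') (hd : d'.map read = d) :
    Computes P inputs T read d :=
  ⟨h.halts, by rw [finalStore, h.map_snd, hd]⟩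

theorem Computes.yields {P : Prog} {ins : List (List Bool)} {T : ℕ} {α : Type}
    {read : Store → α} {d : PMF α} (h : Computes P ins T read d) (hP : OracleFree P)
    (O : PMF (List Bool)) {m : ℕ} {out : α → List (List Bool)}
    (hr : ∀ s, readFrom 0 m s = out (read s)) : Yields O P ins T m (d.map out) := by
  obtain ⟨d', h1, rfl⟩ := h.evals
  refine ⟨d', h1.change_oracle (by simpa using hP) O, ?_⟩
  rw [PMF.map_comp]
  congr 1
  exact funext hr

theorem Yields.computes {P : Prog} {ins : List (List Bool)} {T m : ℕ} {α : Type}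
    {read : Store → α} {μ : PMF (List (List Bool))} {d : PMF α} {out : List (List Bool) → α}
    (h : Yields (PMF.pure []) P ins T m μ) (hr : ∀ s, read s = out (readFrom 0 m s))
    (hd : μ.map out = d) : Computes P ins T read d := by
  obtain ⟨d', h1, rfl⟩ := h
  refine h1.computes ?_
  rw [← hd, PMF.map_comp]
  congr 1
  exact funext hr

/-! ### Counting loops -/

theorem length_ones (m : ℕ) : (ones m).length = m := by simp [ones]

/-- Apply the kernels `k (m - 1), …, k 0` one after the other. -/
def iterKernel {β : Type} (k : ℕ → β → PMF β) : ℕ → β → PMF β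
  | 0, b => PMF.pure b
  | m + 1, b => (k m b).bind (iterKernel k m)

theorem Exec.seq_const {P Q : Prog} {xs : List (List Bool)} {T T' : ℕ}
    {μ ν : PMF (List (List Bool))} (hP : Exec O P xs T μ)
    (hQ : ∀ ys ∈ μ.support, Exec O Q ys T' ν) : Exec O (.seq P Q) xs (T + T' + 1) ν := by
  have := hP.seq hQ
  rwa [PMF.bind_const] at this

/-- Loops are analysed on an abstract state `b`, displayed in the registers by `S`. `Inv` carries
the length bounds that hold only along the run and that make the cost `C` of the body uniform. -/
theorem Exec.loop_iter {β : Type} {r : ℕ} {P : Prog} {S : ℕ → β → List (List Bool)}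
    {k : ℕ → β → PMF β} {Inv : ℕ → β → Prop} {C : ℕ} (h0 : ∀ b, Inv 0 b → (S 0 b).getD r [] = [])
    (h1 : ∀ m b, Inv (m + 1) b → (S (m + 1) b).getD r [] ≠ [])
    (hP : ∀ m b, Inv (m + 1) b → Exec O P (S (m + 1) b) C ((k m b).map (S m)))
    (hk : ∀ m b, Inv (m + 1) b → ∀ b' ∈ (k m b).support, Inv m b') (m : ℕ) (b : β)
    (hb : Inv m b) :
    Exec O (.loop r P) (S m b) (m * (C + 1) + 1) ((iterKernel k m b).map (S 0)) := by
  induction m generalizing b with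
  | zero => exact Exec.congr (Exec.loop_nil (h0 b hb)) (by simp) (by rw [iterKernel, PMF.pure_map])
  | succ m ih =>
    intro K T' F hF
    have key : Exec O (.seq P (.loop r P)) (S (m + 1) b) (C + (m * (C + 1) + 1) + 1)
        ((iterKernel k (m + 1) b).map (S 0)) := by
      have h2 := Big.seq (P := P) (Q := .loop r P) (O := O) (T' := m * (C + 1) + 1)
        (ν := fun s => (run O (m * (C + 1) + 1) ([.loop r P], s)).map Prod.snd)
        (hP m b hb) (by
          intro s hs
          rw [PMF.map_comp, PMF.mem_support_map_iff] at hs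
          obtain ⟨b', hb', rfl⟩ := hs
          have := ih b' (hk m b hb b' hb')
          simp only [Function.comp_apply]
          rw [(Big.evals this).map_snd]
          exact this)
      refine (Big.mono h2 le_rfl).congr_dist ?_
      rw [PMF.map_comp, PMF.bind_map, iterKernel, PMF.map_bind, PMF.map_bind]
      refine bind_congr_support _ fun b' hb' => ?_
      exact (Big.evals (ih b' (hk m b hb b' hb'))).map_snd
    refine (Big.loop_cons (h1 m b hb) key K T' F hF).mono (le_of_eq (by ring))

end
end EditPRC

/-! ### The algorithms and parameters of the inner code as subroutines. -/

namespace EditPRC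
noncomputable section

variable {kind : KeyKind} {H : Scheme} {𝓔 : Set Channel}

/-! ### The algorithms of the given code as procedures -/

theorem IsPRC.exists_keyGenProg (hH : IsPRC kind H 𝓔) : ∃ (P : Prog) (T : ℕ → ℕ),
    OracleFree P ∧ PolyBounded T ∧ ∀ (O : PMF (List Bool)) (κ : ℕ),
      Yields O P [ones κ] (T κ) 2 ((H.keyGen κ).map fun k => [k.1, k.2]) := by
  obtain ⟨P, q, hP, h⟩ := hH.keyGen_ppt
  exact ⟨P, fun κ => q.eval κ, hP, by fun_prop, fun O κ => (h κ).yields hP O fun s => rfl⟩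

theorem IsPRC.polyBounded_keyLen (hH : IsPRC kind H 𝓔) :
    PolyBounded H.encKeyLen ∧ PolyBounded H.decKeyLen := by
  obtain ⟨P, T, hP, hT, h⟩ := hH.exists_keyGenProg
  have key : ∀ κ, H.encKeyLen κ ≤ κ + T κ ∧ H.decKeyLen κ ≤ κ + T κ := by
    intro κ
    obtain ⟨k, hk⟩ := (H.keyGen κ).support_nonempty
    have h1 := (h (PMF.pure []) κ).length_le hP (B := κ) (by simp [ones]) [k.1, k.2] (by
      rw [PMF.mem_support_map_iff]; exact ⟨k, hk, rfl⟩)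
    rw [← (hH.keyGen_length κ k hk).1, ← (hH.keyGen_length κ k hk).2]
    simpa using h1
  exact ⟨PolyBounded.mono (g := fun κ => κ + T κ) (by fun_prop) fun κ => (key κ).1,
    PolyBounded.mono (g := fun κ => κ + T κ) (by fun_prop) fun κ => (key κ).2⟩

theorem IsPRC.exists_encProg (hH : IsPRC kind H 𝓔) : ∃ (P : Prog) (T : ℕ → ℕ),
    OracleFree P ∧ PolyBounded T ∧ ∀ (O : PMF (List Bool)) (κ : ℕ) (ek : List Bool),
      ek.length = H.encKeyLen κ →
      Yields O P [ones κ, ek] (T κ) 1 ((H.enc κ ek).map fun x => [x]) := by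
  obtain ⟨P, q, hP, h⟩ := hH.enc_ppt
  have := hH.polyBounded_keyLen.1
  refine ⟨P, fun κ => q.eval (κ + H.encKeyLen κ), hP,
    (polyBounded_eval q).comp (g := fun κ => κ + H.encKeyLen κ) (by fun_prop),
    fun O κ ek hek => ?_⟩
  have := (h κ ek hek).yields (m := 1) hP O (out := fun x => [x]) fun s => rfl
  rwa [hek] at this

theorem IsPRC.exists_encKey (hH : IsPRC kind H 𝓔) (κ : ℕ) :
    ∃ ek : List Bool, ek.length = H.encKeyLen κ :=
  let ⟨k, hk⟩ := (H.keyGen κ).support_nonempty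
  ⟨k.1, (hH.keyGen_length κ k hk).1⟩

theorem IsPRC.polyBounded_len (hH : IsPRC kind H 𝓔) : PolyBounded H.len := by
  obtain ⟨P, T, hP, hT, h⟩ := hH.exists_encProg
  have hk := hH.polyBounded_keyLen.1
  refine PolyBounded.mono (g := fun κ => κ + H.encKeyLen κ + T κ) (by fun_prop) fun κ => ?_
  obtain ⟨ek, hek⟩ := hH.exists_encKey κ
  obtain ⟨x, hx⟩ := (H.enc κ ek).support_nonempty
  have h1 := (h (PMF.pure []) κ ek hek).length_le hP (B := κ + H.encKeyLen κ)
    (by simp [ones]; omega) [x] (by rw [PMF.mem_support_map_iff]; exact ⟨x, hx, rfl⟩)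
  rw [← hH.enc_length κ ek hek x hx]
  simpa using h1

/-- Only the top bit of register `0` is specified for a decoder, so the law `μ` of the whole
register remains existential. Fixing the length of `y` turns the time bound into a function of the
security parameter alone. -/
theorem IsPRC.exists_decProg (hH : IsPRC kind H 𝓔) : ∃ (P : Prog) (T : ℕ → ℕ),
    OracleFree P ∧ PolyBounded T ∧ ∀ (O : PMF (List Bool)) (κ : ℕ) (dk y : List Bool),
      dk.length = H.decKeyLen κ → y.length = H.len κ → ∃ μ : PMF (List (List Bool)),
      Yields O P [ones κ, dk, y] (T κ) 1 μ ∧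
        μ.map (fun vs => (vs.headD []).headD false) = H.dec κ dk y := by
  obtain ⟨P, q, hP, h⟩ := hH.dec_ppt
  have h1 := hH.polyBounded_keyLen.2
  have h2 := hH.polyBounded_len
  refine ⟨P, fun κ => q.eval (κ + H.decKeyLen κ + H.len κ), hP,
    (polyBounded_eval q).comp (g := fun κ => κ + H.decKeyLen κ + H.len κ) (by fun_prop),
    fun O κ dk y hdk hy => ?_⟩
  obtain ⟨d, h1, h2⟩ := (h κ dk y hdk).evals
  rw [hdk, hy] at h1
  refine ⟨_, ⟨d, h1.change_oracle (by simpa using hP) O, rfl⟩, ?_⟩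
  rw [PMF.map_comp, ← h2]
  rfl

theorem polyBounded_blockLen (hH : PolyBounded H.len) : PolyBounded (blockLen H) :=
  PolyBounded.mono (g := fun κ => 2 * H.len κ + 2) (by fun_prop) fun κ => Nat.div_le_self _ _

/-- Procedures for the key lengths, the codeword length and the block length. -/
theorem IsPRC.exists_paramsProg (hH : IsPRC kind H 𝓔) : ∃ (P : Prog) (T : ℕ → ℕ),
    OracleFree P ∧ PolyBounded T ∧ ∀ (O : PMF (List Bool)) (κ : ℕ),
      Yields O P [ones κ] (T κ) 5 (PMF.pure [ones κ, ones (H.encKeyLen κ),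
        ones (H.decKeyLen κ), ones (H.len κ), ones (blockLen H κ)]) := by
  obtain ⟨PK, TK, hPK, hTK, hK⟩ := hH.exists_keyGenProg
  obtain ⟨PE, TE, hPE, hTE, hE⟩ := hH.exists_encProg
  obtain ⟨C₁, hC₁⟩ := yields_length
  obtain ⟨C₂, hC₂⟩ := yields_blockLen
  have hk := hH.polyBounded_keyLen
  have hk1 := hk.1
  have hk2 := hk.2
  have hl := hH.polyBounded_len
  -- The lengths are not assumed to be computable: the program samples keys and a codeword and
  -- measures them. The lengths do not depend on the sample, so the final state is deterministic and
  -- `Exec.seq_const` applies.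
  have key : ∀ O κ, Exec O (.seq (callProg 5 PK [0] [1, 2]) (.seq (callProg 5 PE [0, 1] [3])
      (.seq (callProg 5 lengthProg [1] [1]) (.seq (callProg 5 lengthProg [2] [2])
        (.seq (callProg 5 lengthProg [3] [3]) (callProg 5 blockLenProg [3] [4]))))))
      [ones κ, [], [], [], []] _ _ := fun O κ =>
    ((hK O κ).call (K := 5) (outs := [1, 2]) (ins := [0]) (xs := [ones κ, [], [], [], []])
      (by simp) (by simp) (by simp)).seq_const (ν := PMF.pure [ones κ, ones (H.encKeyLen κ),
        ones (H.decKeyLen κ), ones (H.len κ), ones (blockLen H κ)]) (T' := (TE κ +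
          callCost PE [0, 1] [3]) + ((C₁ * (H.encKeyLen κ + 1) + callCost lengthProg [1] [1]) +
          ((C₁ * (H.decKeyLen κ + 1) + callCost lengthProg [2] [2]) +
          ((C₁ * (H.len κ + 1) + callCost lengthProg [3] [3]) +
          (C₂ * (H.len κ + 1) + callCost blockLenProg [3] [4]) + 1) + 1) + 1) + 1) (by
      intro ys hys
      simp only [PMF.mem_support_map_iff] at hys
      obtain ⟨_, ⟨k, hk, rfl⟩, rfl⟩ := hys
      obtain ⟨hk1, hk2⟩ := hH.keyGen_length κ k hk
      refine ((hE O κ k.1 hk1).call (K := 5) (outs := [3]) (ins := [0, 1])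
        (xs := [ones κ, k.1, k.2, [], []]) (by simp) (by simp) (by simp)).seq_const ?_
      intro ys hys
      simp only [PMF.mem_support_map_iff] at hys
      obtain ⟨_, ⟨x, hx, rfl⟩, rfl⟩ := hys
      have hx := hH.enc_length κ k.1 hk1 x hx
      have e1 := (hC₁ O k.1).call_pure (K := 5) (outs := [1]) (ins := [1])
        (xs := [ones κ, k.1, k.2, x, []]) (by simp) (by simp) (by simp)
      have e2 := (hC₁ O k.2).call_pure (K := 5) (outs := [2]) (ins := [2])
        (xs := [ones κ, ones k.1.length, k.2, x, []]) (by simp) (by simp) (by simp)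
      have e3 := (hC₁ O x).call_pure (K := 5) (outs := [3]) (ins := [3])
        (xs := [ones κ, ones k.1.length, ones k.2.length, x, []]) (by simp) (by simp) (by simp)
      have e4 := (hC₂ O (H.len κ)).call_pure (K := 5) (outs := [4]) (ins := [3])
        (xs := [ones κ, ones k.1.length, ones k.2.length, ones (H.len κ), []])
        (by simp) (by simp) (by simp)
      rw [hk1] at e1 e2 e3 e4
      rw [hk2] at e2 e3 e4
      rw [hx] at e3
      exact e1.seq_pure (e2.seq_pure (e3.seq_pure e4)))
  refine ⟨_, _, ?_, ?_, fun O κ => (key O κ).yields_pure (ins := [ones κ]) 4⟩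
  · exact ⟨hPK.callProg _ _ _, hPE.callProg _ _ _, OracleFree.callProg (by
      simp [OracleFree, lengthProg]) _ _ _, OracleFree.callProg (by
      simp [OracleFree, lengthProg]) _ _ _, OracleFree.callProg (by
      simp [OracleFree, lengthProg]) _ _ _, OracleFree.callProg (by
      simp [OracleFree, blockLenProg]) _ _ _⟩
  · fun_prop

end
end EditPRC

/-! ### The key generator of the construction. -/

namespace EditPRC
noncomputable section

variable {kind : KeyKind} {H : Scheme} {𝓔 : Set Channel} {O : PMF (List Bool)}

/-- Variant of `Exec.seq` whose continuation is indexed by the sample instead of the register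
contents, so `f` need not be injective. -/
theorem Exec.seq_map {α : Type} {P Q : Prog} {xs : List (List Bool)} {T T' : ℕ} {d : PMF α}
    {f : α → List (List Bool)} {g : α → PMF (List (List Bool))}
    (hP : Exec O P xs T (d.map f)) (hQ : ∀ a ∈ d.support, Exec O Q (f a) T' (g a)) :
    Exec O (.seq P Q) xs (T + T' + 1) (d.bind g) := by
  have h := Big.seq (P := P) (Q := Q) (O := O) (T' := T')
    (ν := fun s => (run O T' ([Q], s)).map Prod.snd) hP (by
      intro s hs
      rw [PMF.map_comp, PMF.mem_support_map_iff] at hs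
      obtain ⟨a, ha, rfl⟩ := hs
      simp only [Function.comp_apply]
      rw [(Big.evals (hQ a ha)).map_snd]
      exact hQ a ha)
  refine h.congr_dist ?_
  rw [PMF.map_comp, PMF.bind_map, PMF.map_bind]
  exact bind_congr_support _ fun a ha => (Big.evals (hQ a ha)).map_snd

theorem oracleFree_appendProg : OracleFree appendProg := by
  simp [OracleFree, appendProg, moveAll, moveBit]

theorem oracleFree_splitProg : OracleFree splitProg := by
  simp [OracleFree, splitProg, moveAll, moveBit]

theorem oracleFree_reverseProg : OracleFree reverseProg := by
  simp [OracleFree, reverseProg, moveAll, moveBit]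

theorem oracleFree_coinsProg : OracleFree coinsProg := by
  simp [OracleFree, coinsProg, moveAll, moveBit]

theorem oracleFree_xorProg : OracleFree xorProg := by
  simp [OracleFree, xorProg, moveAll, moveBit]

theorem oracleFree_embProg : OracleFree embProg := by
  simp [OracleFree, embProg, embStep, moveAll, moveBit]

theorem oracleFree_fitProg : OracleFree fitProg := by
  simp [OracleFree, fitProg, moveAll, moveBit]

theorem oracleFree_unembProg : OracleFree unembProg := by
  refine ⟨?_, ?_, oracleFree_reverseProg.callProg _ _ _, oracleFree_coinsProg.callProg _ _ _,
    oracleFree_appendProg.callProg _ _ _⟩ <;>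
  simp [OracleFree, unembStep, unembRead, unembMove, moveBit]

/-! ### Key generation -/

/-- Sample the keys of one block. -/
def blockKeyProg (PK : Prog) : Prog :=
  .seq (callProg 7 PK [0] [3, 4]) (.seq (callProg 7 coinsProg [2] [5])
    (.seq (callProg 7 coinsProg [1] [6]) (.seq (callProg 7 appendProg [5, 6] [5])
      (.seq (callProg 7 appendProg [3, 5] [0]) (callProg 7 appendProg [4, 5] [1])))))

theorem exists_yields_blockKeyProg (hH : IsPRC kind H 𝓔) {PK : Prog} {TK : ℕ → ℕ}
    (hTK : PolyBounded TK)
    (hK : ∀ (O : PMF (List Bool)) (κ : ℕ),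
      Yields O PK [ones κ] (TK κ) 2 ((H.keyGen κ).map fun k => [k.1, k.2])) :
    ∃ T : ℕ → ℕ, PolyBounded T ∧ ∀ (O : PMF (List Bool)) (κ : ℕ),
      Yields O (blockKeyProg PK) [ones κ, ones (H.len κ), ones (2 * H.len κ)] (T κ) 2
        ((blockKeyGen H κ).map fun k => [k.1.1 ++ k.2.1 ++ k.2.2, k.1.2 ++ k.2.1 ++ k.2.2]) := by
  obtain ⟨C₁, hC₁⟩ := yields_append
  obtain ⟨C₂, hC₂⟩ := yields_coins
  have hl := hH.polyBounded_len
  have hk := hH.polyBounded_keyLen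
  have hk1 := hk.1
  have hk2 := hk.2
  refine ⟨_, ?_, fun O κ => Yields.congr (Exec.yields 4 (Exec.seq_map (d := H.keyGen κ)
    (f := fun k => [ones κ, ones (H.len κ), ones (2 * H.len κ), k.1, k.2, [], []])
    (g := fun k => (uniformBits (2 * H.len κ)).bind fun r => (uniformBits (H.len κ)).bind fun e =>
      PMF.pure [k.1 ++ (r ++ e), k.2 ++ (r ++ e), ones (2 * H.len κ), k.1, k.2, r ++ e, e])
    (T' := (C₂ * (2 * H.len κ + 1) + callCost coinsProg [2] [5]) +
      ((C₂ * (H.len κ + 1) + callCost coinsProg [1] [6]) +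
        ((C₁ * (2 * H.len κ + 1) + callCost appendProg [5, 6] [5]) +
          ((C₁ * (H.encKeyLen κ + 1) + callCost appendProg [3, 5] [0]) +
            (C₁ * (H.decKeyLen κ + 1) + callCost appendProg [4, 5] [1]) + 1) + 1) + 1) + 1)
    (((hK O κ).call (K := 7) (ins := [0]) (outs := [3, 4])
      (xs := [ones κ, ones (H.len κ), ones (2 * H.len κ), [], [], [], []]) (by simp) (by simp)
        (by simp)).congr le_rfl ?_) ?_)) le_rfl ?_⟩
  · fun_prop
  · rw [PMF.map_comp]; rfl
  · intro k hk
    obtain ⟨hk1, hk2⟩ := hH.keyGen_length κ k hk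
    refine Exec.seq_map (d := uniformBits (2 * H.len κ))
      (f := fun r => [ones κ, ones (H.len κ), ones (2 * H.len κ), k.1, k.2, r, []]) ?_ ?_
    · have := (hC₂ O (ones (2 * H.len κ))).call (K := 7) (ins := [2]) (outs := [5])
        (xs := [ones κ, ones (H.len κ), ones (2 * H.len κ), k.1, k.2, [], []]) (by simp) (by simp)
        (by simp)
      rw [PMF.map_comp, length_ones] at this
      exact this
    intro r hr
    refine Exec.seq_map (d := uniformBits (H.len κ))
      (f := fun e => [ones κ, ones (H.len κ), ones (2 * H.len κ), k.1, k.2, r, e]) ?_ ?_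
    · have := (hC₂ O (ones (H.len κ))).call (K := 7) (ins := [1]) (outs := [6])
        (xs := [ones κ, ones (H.len κ), ones (2 * H.len κ), k.1, k.2, r, []]) (by simp) (by simp)
        (by simp)
      rw [PMF.map_comp, length_ones] at this
      exact this
    intro e he
    have e1 := (hC₁ O r e).call_pure (K := 7) (ins := [5, 6]) (outs := [5])
      (xs := [ones κ, ones (H.len κ), ones (2 * H.len κ), k.1, k.2, r, e])
      (by simp) (by simp) (by simp)
    have e2 := (hC₁ O k.1 (r ++ e)).call_pure (K := 7) (ins := [3, 5]) (outs := [0])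
      (xs := [ones κ, ones (H.len κ), ones (2 * H.len κ), k.1, k.2, r ++ e, e])
      (by simp) (by simp) (by simp)
    have e3 := (hC₁ O k.2 (r ++ e)).call_pure (K := 7) (ins := [4, 5]) (outs := [1])
      (xs := [k.1 ++ (r ++ e), ones (H.len κ), ones (2 * H.len κ), k.1, k.2, r ++ e, e])
      (by simp) (by simp) (by simp)
    rw [length_of_mem_uniformBits hr] at e1
    rw [hk1] at e2
    rw [hk2] at e3
    exact e1.seq_pure (e2.seq_pure e3)
  · simp only [blockKeyGen, map_eq_bind, PMF.bind_bind, PMF.pure_bind, readFrom, load]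
    simp

theorem oracleFree_blockKeyProg {PK : Prog} (h : OracleFree PK) : OracleFree (blockKeyProg PK) :=
  ⟨h.callProg _ _ _, oracleFree_coinsProg.callProg _ _ _, oracleFree_coinsProg.callProg _ _ _,
    oracleFree_appendProg.callProg _ _ _, oracleFree_appendProg.callProg _ _ _,
    oracleFree_appendProg.callProg _ _ _⟩

/-- Sample the keys of one block and append them to the lists of keys. -/
def keyStepProg (PB : Prog) : Prog :=
  .seq (callProg 7 PB [0, 1, 2] [5, 6]) (.seq (callProg 7 appendProg [3, 5] [0])
    (callProg 7 appendProg [4, 6] [1]))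

theorem oracleFree_keyStepProg {PB : Prog} (h : OracleFree PB) : OracleFree (keyStepProg PB) :=
  ⟨h.callProg _ _ _, oracleFree_appendProg.callProg _ _ _, oracleFree_appendProg.callProg _ _ _⟩

/-- The key generation of the code. -/
def keyGenProg (PP PL PB : Prog) : Prog :=
  .seq (callProg 9 PP [0] [0, 1, 2, 3, 4]) (.seq (callProg 9 PL [0] [5])
    (.seq (callProg 9 appendProg [3, 3] [6])
      (.seq (.loop 5 (.seq (.pop 5) (callProg 9 (keyStepProg PB) [0, 3, 6, 7, 8] [7, 8])))
        (.seq (.copy 7 0) (.copy 8 1)))))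

/-- The two strings of keys, extended by the keys of a new block. -/
def keyKernel (H : Scheme) (κ : ℕ) (_ : ℕ) (b : List Bool × List Bool) :
    PMF (List Bool × List Bool) :=
  (blockKeyGen H κ).map fun k =>
    (b.1 ++ (k.1.1 ++ k.2.1 ++ k.2.2), b.2 ++ (k.1.2 ++ k.2.1 ++ k.2.2))

theorem iterKernel_keyKernel (H : Scheme) (κ m : ℕ) (b : List Bool × List Bool) :
    iterKernel (keyKernel H κ) m b = (iid (blockKeyGen H κ) m).map fun ks =>
      (b.1 ++ (ks.map fun k => k.1.1 ++ k.2.1 ++ k.2.2).flatten,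
        b.2 ++ (ks.map fun k => k.1.2 ++ k.2.1 ++ k.2.2).flatten) := by
  induction m generalizing b with
  | zero => simp [iterKernel, iid, PMF.pure_map]
  | succ m ih =>
    rw [iterKernel, keyKernel, iid, PMF.bind_map, PMF.map_bind]
    congr 1
    funext k
    rw [Function.comp_apply, ih, PMF.map_comp]
    congr 1
    funext ks
    simp

/-- The lengths of the parts of the key of a block. -/
theorem IsPRC.length_of_mem_blockKeyGen (hH : IsPRC kind H 𝓔) {κ : ℕ}
    {k : (List Bool × List Bool) × List Bool × List Bool}
    (hk : k ∈ (blockKeyGen H κ).support) :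
    k.1 ∈ (H.keyGen κ).support ∧ k.1.1.length = H.encKeyLen κ ∧ k.1.2.length = H.decKeyLen κ ∧
      k.2.1.length = 2 * H.len κ ∧ k.2.2.length = H.len κ := by
  simp only [blockKeyGen, PMF.mem_support_bind_iff, PMF.mem_support_map_iff] at hk
  obtain ⟨k', hk', r, hr, e, he, rfl⟩ := hk
  exact ⟨hk', (hH.keyGen_length κ k' hk').1, (hH.keyGen_length κ k' hk').2,
    length_of_mem_uniformBits hr, length_of_mem_uniformBits he⟩

theorem UnaryPolyTime.exists_prog {f : ℕ → ℕ} (hf : UnaryPolyTime f) :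
    ∃ (P : Prog) (T : ℕ → ℕ), OracleFree P ∧ PolyBounded T ∧
      ∀ (O : PMF (List Bool)) (κ : ℕ),
        Yields O P [ones κ] (T κ) 1 (PMF.pure [ones (f κ)]) := by
  obtain ⟨P, q, hP, h⟩ := hf
  refine ⟨P, fun κ => q.eval κ, hP, by fun_prop, fun O κ => ?_⟩
  have := (h κ).yields (m := 1) hP O (out := fun x => [x]) fun s => rfl
  rwa [PMF.pure_map] at this

theorem UnaryPolyTime.polyBounded {f : ℕ → ℕ} (hf : UnaryPolyTime f) : PolyBounded f := by
  obtain ⟨P, T, hP, hT, h⟩ := hf.exists_prog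
  refine PolyBounded.mono (g := fun κ => κ + T κ) (by fun_prop) fun κ => ?_
  have := (h (PMF.pure []) κ).length_le hP (B := κ) (by simp [ones]) _
    (by rw [PMF.support_pure]; rfl) (ones (f κ)) (by simp)
  rwa [length_ones] at this

theorem exists_cgkKeyGenProg (hH : IsPRC kind H 𝓔) {ℓ : ℕ → ℕ} (hℓ : UnaryPolyTime ℓ) :
    ∃ (P : Prog) (T : ℕ → ℕ), OracleFree P ∧ PolyBounded T ∧
      ∀ (O : PMF (List Bool)) (κ : ℕ), Yields O P [ones κ] (T κ) 2
        (((cgkCode H ℓ).keyGen κ).map fun k => [k.1, k.2]) := by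
  obtain ⟨PK, TK, hPK, hTK, hK⟩ := hH.exists_keyGenProg
  obtain ⟨PP, TP, hPP, hTP, hP⟩ := hH.exists_paramsProg
  obtain ⟨PL, TL, hPL, hTL, hL⟩ := hℓ.exists_prog
  obtain ⟨TB, hTB, hB⟩ := exists_yields_blockKeyProg hH hTK hK
  obtain ⟨C₁, hC₁⟩ := yields_append
  have hℓ' := hℓ.polyBounded
  have hl := hH.polyBounded_len
  have hk := hH.polyBounded_keyLen
  have hk1 := hk.1
  have hk2 := hk.2
  have hstep : ∀ O κ m (b : List Bool × List Bool), b.1.length ≤ ℓ κ * partLen H (H.encKeyLen κ) κ ∧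
      b.2.length ≤ ℓ κ * partLen H (H.decKeyLen κ) κ →
      Yields O (keyStepProg (blockKeyProg PK))
        [ones κ, ones (H.len κ), ones (2 * H.len κ), b.1, b.2]
        (TB κ + callCost (blockKeyProg PK) [0, 1, 2] [5, 6] +
          (C₁ * (ℓ κ * partLen H (H.encKeyLen κ) κ + 1) + callCost appendProg [3, 5] [0] +
          (C₁ * (ℓ κ * partLen H (H.decKeyLen κ) κ + 1) + callCost appendProg [4, 6] [1]) + 1) + 1) 2
        ((keyKernel H κ m b).map fun b => [b.1, b.2]) := by
    intro O κ m b hb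
    refine Yields.congr (Exec.yields 2 (Exec.seq_map (d := blockKeyGen H κ)
      (f := fun k => [ones κ, ones (H.len κ), ones (2 * H.len κ), b.1, b.2,
        k.1.1 ++ k.2.1 ++ k.2.2, k.1.2 ++ k.2.1 ++ k.2.2]) (g := fun k => PMF.pure
        [b.1 ++ (k.1.1 ++ k.2.1 ++ k.2.2), b.2 ++ (k.1.2 ++ k.2.1 ++ k.2.2),
          ones (2 * H.len κ), b.1, b.2, k.1.1 ++ k.2.1 ++ k.2.2, k.1.2 ++ k.2.1 ++ k.2.2])
        (((hB O κ).call (K := 7) (ins := [0, 1, 2])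
        (outs := [5, 6]) (xs := [ones κ, ones (H.len κ), ones (2 * H.len κ), b.1, b.2, [], []])
        (by simp) (by simp) (by simp)).congr le_rfl ?_) ?_)) le_rfl ?_
    · rw [PMF.map_comp]; rfl
    · intro k hk
      have e1 := (hC₁ O b.1 (k.1.1 ++ k.2.1 ++ k.2.2)).call_pure (K := 7) (ins := [3, 5])
        (outs := [0]) (xs := [ones κ, ones (H.len κ), ones (2 * H.len κ), b.1, b.2,
        k.1.1 ++ k.2.1 ++ k.2.2, k.1.2 ++ k.2.1 ++ k.2.2]) (by simp) (by simp) (by simp)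
      have e2 := (hC₁ O b.2 (k.1.2 ++ k.2.1 ++ k.2.2)).call_pure (K := 7) (ins := [4, 6])
        (outs := [1]) (xs := [b.1 ++ (k.1.1 ++ k.2.1 ++ k.2.2), ones (H.len κ),
        ones (2 * H.len κ), b.1, b.2, k.1.1 ++ k.2.1 ++ k.2.2, k.1.2 ++ k.2.1 ++ k.2.2])
        (by simp) (by simp) (by simp)
      have e3 := e1.seq_pure e2
      refine e3.congr ?_ rfl
      have h1 : C₁ * (b.1.length + 1) ≤ C₁ * (ℓ κ * partLen H (H.encKeyLen κ) κ + 1) :=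
        Nat.mul_le_mul_left _ (Nat.add_le_add_right hb.1 1)
      have h2 : C₁ * (b.2.length + 1) ≤ C₁ * (ℓ κ * partLen H (H.decKeyLen κ) κ + 1) :=
        Nat.mul_le_mul_left _ (Nat.add_le_add_right hb.2 1)
      omega
    · simp only [keyKernel, map_eq_bind, PMF.bind_bind, PMF.pure_bind, readFrom, load]
      rfl
  -- The invariant says that the length so far and the parts still to come add up to the final key
  -- length; this bounds the cost of each concatenation uniformly.
  have hloop : ∀ O κ, Exec O
      (.loop 5 (.seq (.pop 5) (callProg 9 (keyStepProg (blockKeyProg PK)) [0, 3, 6, 7, 8] [7, 8])))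
      [ones κ, ones (H.encKeyLen κ), ones (H.decKeyLen κ), ones (H.len κ), ones (blockLen H κ),
        ones (ℓ κ), ones (2 * H.len κ), [], []] _ _ := fun O κ =>
    Exec.loop_iter (r := 5) (k := keyKernel H κ) (S := fun m b =>
      [ones κ, ones (H.encKeyLen κ), ones (H.decKeyLen κ), ones (H.len κ), ones (blockLen H κ),
        ones m, ones (2 * H.len κ), b.1, b.2])
      (Inv := fun m b => b.1.length + m * partLen H (H.encKeyLen κ) κ =
        ℓ κ * partLen H (H.encKeyLen κ) κ ∧ b.2.length + m * partLen H (H.decKeyLen κ) κ =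
        ℓ κ * partLen H (H.decKeyLen κ) κ)
      (fun b _ => rfl) (fun m b _ => by simp [ones])
      (fun m b hb => Exec.seq_pure (Exec.straight (by simp [Straight]) rfl)
        (((hstep O κ m b ⟨by omega, by omega⟩).call (K := 9) (ins := [0, 3, 6, 7, 8])
          (outs := [7, 8]) (xs := [ones κ, ones (H.encKeyLen κ), ones (H.decKeyLen κ),
          ones (H.len κ), ones (blockLen H κ), ones m, ones (2 * H.len κ), b.1, b.2])
          (by simp) (by simp) (by simp)).congr le_rfl (by rw [PMF.map_comp]; rfl)))
      (fun m b hb b' hb' => by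
        rw [keyKernel, PMF.mem_support_map_iff] at hb'
        obtain ⟨k, hk, rfl⟩ := hb'
        obtain ⟨-, h1, h2, h3, h4⟩ := hH.length_of_mem_blockKeyGen hk
        obtain ⟨hb1, hb2⟩ := hb
        rw [← hb1, ← hb2]
        simp only [List.length_append, h1, h2, h3, h4, partLen]
        constructor <;> ring) (ℓ κ) ([], []) (by simp)
  have hpart : ∀ {g : ℕ → ℕ}, PolyBounded g → PolyBounded fun κ => partLen H (g κ) κ := by
    intro g hg; simp only [partLen]; fun_prop
  have hp1 := hpart hk1
  have hp2 := hpart hk2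
  refine ⟨keyGenProg PP PL (blockKeyProg PK), _, ?_, ?_, fun O κ => Yields.congr
    (Exec.yields 8 (Exec.seq_pure ((hP O κ).call_pure (K := 9) (ins := [0])
    (outs := [0, 1, 2, 3, 4]) (xs := [ones κ, [], [], [], [], [], [], [], []])
    (by simp) (by simp) (by simp)) (Exec.seq_pure ((hL O κ).call_pure (K := 9) (ins := [0])
    (outs := [5]) (xs := [ones κ, ones (H.encKeyLen κ), ones (H.decKeyLen κ), ones (H.len κ),
    ones (blockLen H κ), [], [], [], []]) (by simp) (by simp) (by simp))
    (Exec.seq_pure ((hC₁ O (ones (H.len κ)) (ones (H.len κ))).call_pure (K := 9) (ins := [3, 3])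
    (outs := [6]) (xs := [ones κ, ones (H.encKeyLen κ), ones (H.decKeyLen κ), ones (H.len κ),
    ones (blockLen H κ), ones (ℓ κ), [], [], []]) (by simp) (by simp) (by simp) |>.congr
      (le_of_eq (by rw [length_ones])) (show _ = PMF.pure [ones κ, ones (H.encKeyLen κ),
        ones (H.decKeyLen κ), ones (H.len κ), ones (blockLen H κ), ones (ℓ κ),
        ones (2 * H.len κ), [], []] by simp [assign, ones, two_mul]))
    (Exec.seq_map (d := iterKernel (keyKernel H κ) (ℓ κ) ([], [])) (T' := 3)
      (g := fun b => PMF.pure [b.1, b.2, ones (H.decKeyLen κ), ones (H.len κ),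
        ones (blockLen H κ), [], ones (2 * H.len κ), b.1, b.2])
      (hloop O κ) ?_))))) le_rfl ?_⟩
  · exact ⟨hPP.callProg _ _ _, hPL.callProg _ _ _, oracleFree_appendProg.callProg _ _ _,
      ⟨trivial, (oracleFree_keyStepProg (oracleFree_blockKeyProg hPK)).callProg _ _ _⟩,
      trivial, trivial⟩
  · fun_prop
  · intro b _
    exact Exec.straight (by simp [Straight]) (by simp [denote, ones])
  · rw [iterKernel_keyKernel]
    simp only [cgkCode, map_eq_bind, PMF.bind_bind, PMF.pure_bind, readFrom, load]
    rfl

end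
end EditPRC

/-! ### The encoder of the construction. -/

namespace EditPRC
noncomputable section

variable {kind : KeyKind} {H : Scheme} {𝓔 : Set Channel} {O : PMF (List Bool)}

/-! ### Encoding -/

theorem yields_split_ones : ∃ C, ∀ (O : PMF (List Bool)) (m : ℕ) (y : List Bool),
    Yields O splitProg [ones m, y] (C * (m + 1)) 2 (PMF.pure [y.take m, y.drop m]) :=
  let ⟨C, hC⟩ := yields_split
  ⟨C, fun O m y => by simpa only [length_ones] using hC O (ones m) y⟩

/-- One block of the encoder: the rest of the key, the counter, and the output so far. -/
def encKernel (H : Scheme) (κ : ℕ)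
    (D : ℕ → List Bool × List Bool × List Bool → PMF (List Bool)) (_ : ℕ)
    (b : List Bool × ℕ × List Bool) : PMF (List Bool × ℕ × List Bool) :=
  (D b.2.1 (readPart H (H.encKeyLen κ) κ b.1 0)).map fun y =>
    (b.1.drop (partLen H (H.encKeyLen κ) κ), b.2.1 - 1, b.2.2 ++ y)

theorem readPart_drop (H : Scheme) (k κ : ℕ) (key : List Bool) (t : ℕ) :
    readPart H k κ (key.drop (partLen H k κ)) t = readPart H k κ key (t + 1) := by
  simp only [readPart, List.drop_drop]
  rw [show partLen H k κ + t * partLen H k κ = (t + 1) * partLen H k κ by ring]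

theorem iterKernel_encKernel (H : Scheme) (κ : ℕ)
    (D : ℕ → List Bool × List Bool × List Bool → PMF (List Bool)) (m : ℕ)
    (b : List Bool × ℕ × List Bool) :
    iterKernel (encKernel H κ D) m b =
      (concatAll ((List.range m).map fun t =>
        D (b.2.1 - t) (readPart H (H.encKeyLen κ) κ b.1 t))).map fun y =>
          (b.1.drop (m * partLen H (H.encKeyLen κ) κ), b.2.1 - m, b.2.2 ++ y) := by
  induction m generalizing b with
  | zero => simp [iterKernel, concatAll, PMF.pure_map]
  | succ m ih =>
    rw [iterKernel, encKernel, List.range_succ_eq_map, List.map_cons, concatAll, PMF.bind_map,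
      PMF.map_bind, List.map_map]
    congr 1
    funext y
    rw [Function.comp_apply, ih, PMF.map_comp]
    have e1 : ((fun t => D (b.2.1 - t) (readPart H (H.encKeyLen κ) κ b.1 t)) ∘ Nat.succ) =
        fun t => D (b.2.1 - 1 - t) (readPart H (H.encKeyLen κ) κ
          (b.1.drop (partLen H (H.encKeyLen κ) κ)) t) := by
      funext t
      rw [Function.comp_apply, readPart_drop, Nat.sub_sub, Nat.add_comm 1 t]
    rw [e1]
    congr 1
    funext ys
    simp only [Function.comp_apply, List.drop_drop, List.append_assoc]
    rw [show partLen H (H.encKeyLen κ) κ + m * partLen H (H.encKeyLen κ) κ =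
      (m + 1) * partLen H (H.encKeyLen κ) κ by ring, Nat.sub_sub, Nat.add_comm 1 m]

/-- Split off the key of one block, encode it and append the result to the output. -/
def encStepProg (BP : Prog) : Prog :=
  .seq (callProg 12 splitProg [2, 5] [8, 5]) (.seq (callProg 12 splitProg [3, 5] [9, 5])
    (.seq (callProg 12 splitProg [4, 5] [10, 5]) (.seq (callProg 12 BP [0, 1, 8, 9, 10, 6] [11])
      (.seq (callProg 12 appendProg [7, 11] [7])
        (.seq (.copy 5 0) (.seq (.pop 6) (.seq (.copy 6 1) (.copy 7 2))))))))

/-- Encode all blocks. -/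
def encLoopProg (PP PL BP : Prog) : Prog :=
  .seq (callProg 10 PP [0] [0, 3, 4, 5, 6]) (.seq (callProg 10 PL [0] [7])
    (.seq (callProg 10 appendProg [5, 5] [8])
      (.seq (.loop 7 (.seq (.pop 7)
          (callProg 10 (encStepProg BP) [0, 6, 3, 8, 5, 1, 2, 9] [1, 2, 9])))
        (.copy 9 0))))

/-- The block encoder `D` and the decreasing index are parameters because the loop serves twice: for
the real encoder, which ignores the index, and for the hybrid encoder of the reduction, whose block
program may query. Hence freedom from oracle calls is only an implication. -/
theorem exists_encLoopProg (hH : IsPRC kind H 𝓔) {ℓ : ℕ → ℕ} (hℓ : UnaryPolyTime ℓ) (BP : Prog)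
    {TB : ℕ → ℕ} (hTB : PolyBounded TB) :
    ∃ (P : Prog) (T : ℕ → ℕ), (OracleFree BP → OracleFree P) ∧ PolyBounded T ∧
      ∀ (O : PMF (List Bool)) (κ : ℕ)
        (D : ℕ → List Bool × List Bool × List Bool → PMF (List Bool)),
        (∀ i key r e, key.length = H.encKeyLen κ → r.length = 2 * H.len κ →
          e.length = H.len κ →
          Yields O BP [ones κ, ones (blockLen H κ), key, r, e, ones i] (TB κ) 1
            ((D i (key, r, e)).map fun y => [y])) →
        (∀ i key r e, key.length = H.encKeyLen κ → r.length = 2 * H.len κ →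
          e.length = H.len κ → ∀ y ∈ (D i (key, r, e)).support, y.length ≤ blockLen H κ) →
        ∀ key i, key.length = ℓ κ * partLen H (H.encKeyLen κ) κ →
          Yields O P [ones κ, key, ones i] (T κ) 1
            ((concatAll ((List.range (ℓ κ)).map fun t =>
              D (i - t) (readPart H (H.encKeyLen κ) κ key t))).map fun y => [y]) := by
  obtain ⟨PP, TP, hPP, hTP, hP⟩ := hH.exists_paramsProg
  obtain ⟨PL, TL, hPL, hTL, hL⟩ := hℓ.exists_prog
  obtain ⟨C₁, hC₁⟩ := yields_append
  obtain ⟨C₂, hC₂⟩ := yields_split_ones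
  have hℓ' := hℓ.polyBounded
  have hl := hH.polyBounded_len
  have hk1 := hH.polyBounded_keyLen.1
  have hn := polyBounded_blockLen hl
  have hstep : ∃ T : ℕ → ℕ, PolyBounded T ∧ ∀ (O : PMF (List Bool)) (κ : ℕ)
        (D : ℕ → List Bool × List Bool × List Bool → PMF (List Bool)),
        (∀ i key r e, key.length = H.encKeyLen κ → r.length = 2 * H.len κ →
          e.length = H.len κ →
          Yields O BP [ones κ, ones (blockLen H κ), key, r, e, ones i] (TB κ) 1
            ((D i (key, r, e)).map fun y => [y])) →
        ∀ m key i acc, partLen H (H.encKeyLen κ) κ ≤ key.length →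
          acc.length ≤ ℓ κ * blockLen H κ →
          Yields O (encStepProg BP) [ones κ, ones (blockLen H κ), ones (H.encKeyLen κ),
            ones (2 * H.len κ), ones (H.len κ), key, ones i, acc] (T κ) 3
            ((encKernel H κ D m (key, i, acc)).map fun b => [b.1, ones b.2.1, b.2.2]) := by
    refine ⟨fun κ => C₂ * (H.encKeyLen κ + 1) + callCost splitProg [2, 5] [8, 5] +
        (C₂ * (2 * H.len κ + 1) + callCost splitProg [3, 5] [9, 5] +
          (C₂ * (H.len κ + 1) + callCost splitProg [4, 5] [10, 5] +
            (TB κ + callCost BP [0, 1, 8, 9, 10, 6] [11] +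
              (C₁ * (ℓ κ * blockLen H κ + 1) + callCost appendProg [7, 11] [7] + 7 + 1) + 1) + 1) +
          1) + 1, by fun_prop, fun O κ D hBP m key i acc hkey hacc => ?h⟩
    case h =>
      have hpart : (readPart H (H.encKeyLen κ) κ key 0) = (key.take (H.encKeyLen κ),
          (key.drop (H.encKeyLen κ)).take (2 * H.len κ),
          ((key.drop (H.encKeyLen κ)).drop (2 * H.len κ)).take (H.len κ)) := by
        simp [readPart, List.drop_drop]
      have hdrop : ((key.drop (H.encKeyLen κ)).drop (2 * H.len κ)).drop (H.len κ) =
          key.drop (partLen H (H.encKeyLen κ) κ) := by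
        simp only [List.drop_drop, partLen, Nat.add_assoc]
      rw [partLen] at hkey
      have e1 := (hC₂ O (H.encKeyLen κ) key).call_pure (K := 12) (ins := [2, 5]) (outs := [8, 5])
        (xs := [ones κ, ones (blockLen H κ), ones (H.encKeyLen κ), ones (2 * H.len κ),
          ones (H.len κ), key, ones i, acc, [], [], [], []]) (by simp) (by simp) (by simp)
      have e2 := (hC₂ O (2 * H.len κ) (key.drop (H.encKeyLen κ))).call_pure (K := 12)
        (ins := [3, 5]) (outs := [9, 5])
        (xs := [ones κ, ones (blockLen H κ), ones (H.encKeyLen κ), ones (2 * H.len κ),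
          ones (H.len κ), key.drop (H.encKeyLen κ), ones i, acc, key.take (H.encKeyLen κ),
          [], [], []]) (by simp) (by simp) (by simp)
      have e3 := (hC₂ O (H.len κ) ((key.drop (H.encKeyLen κ)).drop (2 * H.len κ))).call_pure
        (K := 12) (ins := [4, 5]) (outs := [10, 5])
        (xs := [ones κ, ones (blockLen H κ), ones (H.encKeyLen κ), ones (2 * H.len κ),
          ones (H.len κ), (key.drop (H.encKeyLen κ)).drop (2 * H.len κ), ones i, acc,
          key.take (H.encKeyLen κ), (key.drop (H.encKeyLen κ)).take (2 * H.len κ),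
          [], []]) (by simp) (by simp) (by simp)
      rw [hdrop] at e3
      set pk := key.take (H.encKeyLen κ)
      set r := (key.drop (H.encKeyLen κ)).take (2 * H.len κ)
      set e := ((key.drop (H.encKeyLen κ)).drop (2 * H.len κ)).take (H.len κ)
      have e4 := (hBP i pk r e (by simp [pk]; omega) (by simp [r]; omega)
        (by simp [e]; omega)).call (K := 12) (ins := [0, 1, 8, 9, 10, 6]) (outs := [11])
        (xs := [ones κ, ones (blockLen H κ), ones (H.encKeyLen κ), ones (2 * H.len κ),
          ones (H.len κ), key.drop (partLen H (H.encKeyLen κ) κ), ones i, acc, pk, r, e, []])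
        (by simp) (by simp) (by simp)
      rw [PMF.map_comp] at e4
      have e5 := e4.seq_map (Q := .seq (callProg 12 appendProg [7, 11] [7])
          (.seq (.copy 5 0) (.seq (.pop 6) (.seq (.copy 6 1) (.copy 7 2)))))
        (T' := C₁ * (ℓ κ * blockLen H κ + 1) + callCost appendProg [7, 11] [7] + 7 + 1)
        (g := fun y => PMF.pure [key.drop (partLen H (H.encKeyLen κ) κ), ones (i - 1), acc ++ y,
          ones (2 * H.len κ), ones (H.len κ), key.drop (partLen H (H.encKeyLen κ) κ),
          ones (i - 1), acc ++ y, pk, r, e, y]) (by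
          intro y _
          refine (Exec.seq_pure (((hC₁ O acc y).call_pure (K := 12) (ins := [7, 11]) (outs := [7])
            (xs := [ones κ, ones (blockLen H κ), ones (H.encKeyLen κ), ones (2 * H.len κ),
              ones (H.len κ), key.drop (partLen H (H.encKeyLen κ) κ), ones i, acc, pk, r, e, y])
            (by simp) (by simp) (by simp)).mono ?_)
            (Exec.straight (by simp [Straight, assign]) ?_))
          · exact Nat.add_le_add_right (Nat.mul_le_mul_left _ (Nat.add_le_add_right hacc 1)) _
          · simp [denote, assign, ones])
      refine Yields.congr (Exec.yields 4 (e1.seq_pure (e2.seq_pure (e3.seq_pure e5)))) le_rfl ?_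
      rw [encKernel, hpart]
      simp only [map_eq_bind, PMF.bind_bind, PMF.pure_bind, readFrom, load]
      rfl
  obtain ⟨TS, hTS, hS⟩ := hstep
  refine ⟨encLoopProg PP PL BP, fun κ => TP κ + callCost PP [0] [0, 3, 4, 5, 6] +
      (TL κ + callCost PL [0] [7] + (C₁ * (H.len κ + 1) + callCost appendProg [5, 5] [8] +
        (ℓ κ * ((1 + (TS κ + callCost (encStepProg BP) [0, 6, 3, 8, 5, 1, 2, 9] [1, 2, 9]) + 1) +
          1) + 1 + 1 + 1) + 1) + 1) + 1, fun hBP => ?_, ?_, fun O κ D hBP hD key i hkey => ?_⟩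
  rotate_left 2
  · have hloop : Exec O (.loop 7 (.seq (.pop 7)
          (callProg 10 (encStepProg BP) [0, 6, 3, 8, 5, 1, 2, 9] [1, 2, 9])))
        [ones κ, key, ones i, ones (H.encKeyLen κ), ones (H.decKeyLen κ), ones (H.len κ),
          ones (blockLen H κ), ones (ℓ κ), ones (2 * H.len κ), []] _ _ :=
      Exec.loop_iter (r := 7) (k := encKernel H κ D) (S := fun m b =>
        [ones κ, b.1, ones b.2.1, ones (H.encKeyLen κ), ones (H.decKeyLen κ), ones (H.len κ),
          ones (blockLen H κ), ones m, ones (2 * H.len κ), b.2.2])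
        (Inv := fun m b => b.1.length = m * partLen H (H.encKeyLen κ) κ ∧
          b.2.2.length + m * blockLen H κ ≤ ℓ κ * blockLen H κ)
        (fun b _ => rfl) (fun m b _ => by simp [ones])
        (fun m b hb => Exec.seq_pure (Exec.straight (by simp [Straight]) rfl)
          (((hS O κ D hBP m b.1 b.2.1 b.2.2 (by
              rw [hb.1]; exact Nat.le_mul_of_pos_left _ (Nat.succ_pos m))
              (le_trans (Nat.le_add_right _ _) hb.2)).call (K := 10)
            (ins := [0, 6, 3, 8, 5, 1, 2, 9])
            (outs := [1, 2, 9]) (xs := [ones κ, b.1, ones b.2.1, ones (H.encKeyLen κ),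
              ones (H.decKeyLen κ), ones (H.len κ), ones (blockLen H κ), ones m,
              ones (2 * H.len κ), b.2.2])
            (by simp) (by simp) (by simp)).congr le_rfl (by rw [PMF.map_comp]; rfl)))
        (fun m b hb b' hb' => by
          rw [encKernel, PMF.mem_support_map_iff] at hb'
          obtain ⟨y, hy, rfl⟩ := hb'
          obtain ⟨hb1, hb2⟩ := hb
          rw [Nat.succ_mul] at hb1 hb2
          have hy' := hD _ _ _ _ (by simp [hb1, partLen]; omega) (by simp [hb1, partLen]; omega)
            (by simp [hb1, partLen]; omega) y hy
          constructor
          · simp [hb1]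
          · simp only [List.length_append]; omega)
        (ℓ κ) (key, i, []) ⟨hkey, by simp⟩
    refine Yields.congr
      (Exec.yields 7 (Exec.seq_pure ((hP O κ).call_pure (K := 10) (ins := [0])
      (outs := [0, 3, 4, 5, 6]) (xs := [ones κ, key, ones i, [], [], [], [], [], [], []])
      (by simp) (by simp) (by simp)) (Exec.seq_pure ((hL O κ).call_pure (K := 10) (ins := [0])
      (outs := [7]) (xs := [ones κ, key, ones i, ones (H.encKeyLen κ), ones (H.decKeyLen κ),
      ones (H.len κ), ones (blockLen H κ), [], [], []]) (by simp) (by simp) (by simp))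
      (Exec.seq_pure ((hC₁ O (ones (H.len κ)) (ones (H.len κ))).call_pure (K := 10)
      (ins := [5, 5]) (outs := [8]) (xs := [ones κ, key, ones i, ones (H.encKeyLen κ),
      ones (H.decKeyLen κ), ones (H.len κ), ones (blockLen H κ), ones (ℓ κ), [], []])
      (by simp) (by simp) (by simp) |>.congr
        (le_of_eq (by rw [length_ones])) (show _ = PMF.pure [ones κ, key, ones i,
        ones (H.encKeyLen κ), ones (H.decKeyLen κ), ones (H.len κ), ones (blockLen H κ),
        ones (ℓ κ), ones (2 * H.len κ), []] by simp [assign, ones, two_mul]))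
      (Exec.seq_map (d := iterKernel (encKernel H κ D) (ℓ κ) (key, i, [])) (T' := 1)
        (g := fun b => PMF.pure [b.2.2, b.1, ones b.2.1, ones (H.encKeyLen κ),
          ones (H.decKeyLen κ), ones (H.len κ), ones (blockLen H κ), [],
          ones (2 * H.len κ), b.2.2])
        hloop fun b _ => Exec.straight (by simp [Straight]) (by simp [denote, ones])))))) le_rfl ?_
    rw [iterKernel_encKernel]
    simp only [map_eq_bind, PMF.bind_bind, PMF.pure_bind, readFrom, load]
    rfl
  · exact ⟨hPP.callProg _ _ _, hPL.callProg _ _ _, oracleFree_appendProg.callProg _ _ _,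
      ⟨trivial, OracleFree.callProg (P := encStepProg BP) ⟨oracleFree_splitProg.callProg _ _ _,
        oracleFree_splitProg.callProg _ _ _, oracleFree_splitProg.callProg _ _ _,
        hBP.callProg _ _ _, oracleFree_appendProg.callProg _ _ _,
        ⟨trivial, trivial, trivial, trivial⟩⟩ _ _ _⟩, trivial⟩
  · fun_prop

/-- The encoding of one block. -/
def encBlock (H : Scheme) (κ : ℕ) (part : List Bool × List Bool × List Bool) :
    PMF (List Bool) :=
  (H.enc κ part.1).bind fun a => unemb (blockLen H κ) (xorStr a part.2.2) part.2.1

/-- Encode one block, where `PE` produces the codeword in register `2`. -/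
def maskedBlockProg (PE : Prog) : Prog :=
  .seq PE (.seq (callProg 6 xorProg [2, 4] [2]) (callProg 6 unembProg [1, 2, 3] [0]))

theorem length_xorStr_le (a e : List Bool) : (xorStr a e).length ≤ e.length := by
  simp [xorStr]

theorem exists_yields_maskedBlockProg (hl : PolyBounded H.len) {PE : Prog}
    {TE : ℕ → ℕ} (hTE : PolyBounded TE) :
    ∃ T : ℕ → ℕ, PolyBounded T ∧ ∀ (O : PMF (List Bool)) (κ : ℕ) (key r e c : List Bool)
      (d : PMF (List Bool)), e.length = H.len κ →
      Exec O PE [ones κ, ones (blockLen H κ), key, r, e, c] (TE κ)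
        (d.map fun a => [ones κ, ones (blockLen H κ), a, r, e, c]) →
      Exec O (maskedBlockProg PE) [ones κ, ones (blockLen H κ), key, r, e, c] (T κ)
        ((d.bind fun a => (unemb (blockLen H κ) (xorStr a e) r).map fun y =>
          [y, ones (blockLen H κ), xorStr a e, r, e, c])) := by
  obtain ⟨C₁, hC₁⟩ := yields_xor
  obtain ⟨C₂, hC₂⟩ := yields_unemb
  have hn := polyBounded_blockLen hl
  refine ⟨_, ?_, fun O κ key r e c d he h => h.seq_map (T' := (C₁ * (H.len κ + 1) +
    callCost xorProg [2, 4] [2]) + (C₂ * (blockLen H κ + H.len κ + 1) +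
    callCost unembProg [1, 2, 3] [0]) + 1) fun a _ => ?_⟩
  · fun_prop
  have e1 := (hC₁ O a e).call_pure (K := 6) (ins := [2, 4]) (outs := [2])
    (xs := [ones κ, ones (blockLen H κ), a, r, e, c]) (by simp) (by simp) (by simp)
  have e2 := ((hC₂ O (ones (blockLen H κ)) (xorStr a e) r).call (K := 6) (ins := [1, 2, 3])
    (outs := [0]) (xs := [ones κ, ones (blockLen H κ), xorStr a e, r, e, c]) (by simp) (by simp)
    (by simp))
  refine (e1.seq_pure e2).congr ?_ ?_
  · have := length_xorStr_le a e
    rw [length_ones, he]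
    have h1 : C₂ * (blockLen H κ + (xorStr a e).length + 1) ≤
      C₂ * (blockLen H κ + H.len κ + 1) := Nat.mul_le_mul_left _ (by omega)
    omega
  · rw [PMF.map_comp, length_ones]
    rfl

theorem length_unembFrom_le (L : ℕ) (r : List Bool) (t : ℕ) (a : List Bool) (i : ℕ)
    (cur : Option Bool) (h : i + cur.toList.length ≤ L) :
    (unembFrom L r t a i cur).length + i ≤ L := by
  induction a generalizing t i cur with
  | nil => simp only [unembFrom]; omega
  | cons b a ih =>
    simp only [unembFrom]
    split_ifs with h1 h2
    · have := ih (t + 1) (i + 1) none (by simpa using h1)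
      simp only [List.length_cons]; omega
    · exact ih _ _ _ (by simpa using h1)
    · simp only [List.length_nil]; omega

theorem length_of_mem_unemb {n : ℕ} {a r x : List Bool} (h : x ∈ (unemb n a r).support) :
    x.length = n := by
  rw [unemb, PMF.mem_support_map_iff] at h
  obtain ⟨w, hw, rfl⟩ := h
  rw [List.length_append, length_of_mem_uniformBits hw]
  have := length_unembFrom_le n r 0 a 0 none (by simp)
  omega

theorem length_of_mem_concatAll {ds : List (PMF (List Bool))} {n : ℕ}
    (h : ∀ d ∈ ds, ∀ x ∈ d.support, x.length = n) {x : List Bool}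
    (hx : x ∈ (concatAll ds).support) : x.length = ds.length * n := by
  induction ds generalizing x with
  | nil => simp only [concatAll, PMF.support_pure, Set.mem_singleton_iff] at hx; simp [hx]
  | cons d ds ih =>
    rw [concatAll, PMF.mem_support_bind_iff] at hx
    obtain ⟨y, hy, hx⟩ := hx
    rw [PMF.mem_support_map_iff] at hx
    obtain ⟨z, hz, rfl⟩ := hx
    rw [List.length_append, h d (by simp) y hy, ih (fun d hd => h d (by simp [hd])) hz,
      List.length_cons]
    ring

theorem length_of_mem_encBlock {κ : ℕ} {part : List Bool × List Bool × List Bool} {x : List Bool}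
    (h : x ∈ (encBlock H κ part).support) : x.length = blockLen H κ := by
  rw [encBlock, PMF.mem_support_bind_iff] at h
  obtain ⟨a, -, h⟩ := h
  exact length_of_mem_unemb h

theorem exists_cgkEncProg (hH : IsPRC kind H 𝓔) {ℓ : ℕ → ℕ} (hℓ : UnaryPolyTime ℓ) :
    ∃ (P : Prog) (T : ℕ → ℕ), OracleFree P ∧ PolyBounded T ∧
      ∀ (O : PMF (List Bool)) (κ : ℕ) (ek : List Bool),
        ek.length = (cgkCode H ℓ).encKeyLen κ →
        Yields O P [ones κ, ek] (T κ) 1 (((cgkCode H ℓ).enc κ ek).map fun y => [y]) := by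
  obtain ⟨PE, TE, hPE, hTE, hE⟩ := hH.exists_encProg
  obtain ⟨TB, hTB, hB⟩ := exists_yields_maskedBlockProg (PE := callProg 6 PE [0, 2] [2])
    (TE := fun κ => TE κ + callCost PE [0, 2] [2]) hH.polyBounded_len (by fun_prop)
  obtain ⟨P, T, hP, hT, h⟩ := exists_encLoopProg hH hℓ
    (maskedBlockProg (callProg 6 PE [0, 2] [2])) hTB
  refine ⟨P, T, hP ⟨hPE.callProg _ _ _, oracleFree_xorProg.callProg _ _ _,
    oracleFree_unembProg.callProg _ _ _⟩, hT, fun O κ ek hek => ?_⟩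
  have := h O κ (fun _ part => encBlock H κ part) (by
      intro i key r e h1 h2 h3
      refine Yields.congr (Exec.yields 0 (hB O κ key r e (ones i) (H.enc κ key) h3 ?_)) le_rfl ?_
      · refine Exec.congr ((hE O κ key h1).call (K := 6) (ins := [0, 2]) (outs := [2])
          (xs := [ones κ, ones (blockLen H κ), key, r, e, ones i]) (by simp) (by simp)
          (by simp)) le_rfl ?_
        rw [PMF.map_comp]
        rfl
      · simp only [encBlock, map_eq_bind, PMF.bind_bind, PMF.pure_bind, readFrom, load]
        rfl) (fun i key r e _ _ _ y hy => (length_of_mem_encBlock hy).le) ek 0 hek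
  -- With index `0` the third input register is empty, so the program takes just the two inputs of
  -- an encoder.
  have e0 : ones 0 = [] := rfl
  rw [e0] at this
  obtain ⟨d, h1, h2⟩ := this
  exact ⟨d, by rwa [show [ones κ, ek, []] = [ones κ, ek] ++ List.replicate 1 [] from rfl,
    load_append_replicate] at h1, h2⟩

end
end EditPRC

/-! ### The decoder: testing one window with all parts of the key. -/

namespace EditPRC
noncomputable section

variable {kind : KeyKind} {H : Scheme} {𝓔 : Set Channel} {O : PMF (List Bool)}

/-! ### Decoding -/

/-- The program runs every test and accumulates a disjunction, whereas `anyAccepts` stops at the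
first acceptance. The laws agree, because after an acceptance the remaining tests cannot change the
result. -/
theorem map_or_anyAccepts_cons (b : Bool) (d : PMF Bool) (ds : List (PMF Bool)) :
    (anyAccepts (d :: ds)).map (b || ·) =
      d.bind fun b' => (anyAccepts ds).map ((b || b') || ·) := by
  rw [anyAccepts, PMF.map_bind]
  congr 1
  funext b'
  cases b'
  · simp
  · simp [PMF.pure_map, PMF.map_const, Function.const_def]

theorem map_or_anyAccepts_append (b : Bool) (ds es : List (PMF Bool)) :
    (anyAccepts (ds ++ es)).map (b || ·) =
      (anyAccepts ds).bind fun b' => (anyAccepts es).map ((b || b') || ·) := by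
  have key : ∀ b, (anyAccepts (ds ++ es)).map (b || ·) =
      ((anyAccepts ds).map (b || ·)).bind fun b' => (anyAccepts es).map (b' || ·) := by
    induction ds with
    | nil => intro b; simp [anyAccepts, PMF.pure_map]
    | cons d ds ih =>
      intro b
      rw [List.cons_append, map_or_anyAccepts_cons, map_or_anyAccepts_cons, PMF.bind_bind]
      congr 1
      funext b'
      exact ih (b || b')
  rw [key, PMF.bind_map]
  rfl

/-- A bit as a register. -/
def flagStr (b : Bool) : List Bool := if b then [true] else []

/-- The test of a window with one part of the key. -/
def windowTest (H : Scheme) (κ : ℕ) (z : List Bool) (part : List Bool × List Bool × List Bool) :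
    PMF Bool :=
  H.dec κ part.1 (xorStr (emb (H.len κ) (fit (blockLen H κ) z) part.2.1) part.2.2)

/-- The tests of a window with all parts of the key. -/
def windowTests (H : Scheme) (κ m : ℕ) (key z : List Bool) : List (PMF Bool) :=
  (List.range m).map fun t => windowTest H κ z (readPart H (H.decKeyLen κ) κ key t)

theorem cgkCode_dec (H : Scheme) (ℓ : ℕ → ℕ) (κ : ℕ) (dk y : List Bool) :
    (cgkCode H ℓ).dec κ dk y =
      anyAccepts ((windows y).flatMap fun z => windowTests H κ (ℓ κ) dk z) := rfl

/-- Test a window with one part of the key. -/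
def testProg (PD : Prog) : Prog :=
  .seq (callProg 9 fitProg [1, 6] [6]) (.seq (callProg 9 embProg [2, 6, 4] [6])
    (.seq (callProg 9 xorProg [6, 5] [6]) (.seq (callProg 9 PD [0, 3, 6] [8])
      (.seq (.branch 8 .skip .skip (.branch 7 (.push true 7) .skip .skip)) (.copy 7 0)))))

theorem exists_testProg (hH : IsPRC kind H 𝓔) : ∃ (P : Prog) (T : ℕ → ℕ),
    OracleFree P ∧ PolyBounded T ∧ ∀ (O : PMF (List Bool)) (κ : ℕ) (key r e z : List Bool)
      (b : Bool), key.length = H.decKeyLen κ → e.length = H.len κ →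
      Yields O P [ones κ, ones (blockLen H κ), ones (H.len κ), key, r, e, z, flagStr b] (T κ) 1
        ((windowTest H κ z (key, r, e)).map fun b' => [flagStr (b || b')]) := by
  obtain ⟨PD, TD, hPD, hTD, hD⟩ := hH.exists_decProg
  obtain ⟨C₁, hC₁⟩ := yields_fit
  obtain ⟨C₂, hC₂⟩ := yields_emb
  obtain ⟨C₃, hC₃⟩ := yields_xor
  have hl := hH.polyBounded_len
  have hn := polyBounded_blockLen hl
  refine ⟨testProg PD, fun κ => (C₁ * (blockLen H κ + 1) + callCost fitProg [1, 6] [6]) +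
    ((C₂ * (H.len κ + 1) + callCost embProg [2, 6, 4] [6]) + ((C₃ * (H.len κ + 1) +
      callCost xorProg [6, 5] [6]) + ((TD κ + callCost PD [0, 3, 6] [8]) + 10 + 1) + 1) + 1) + 1,
    ⟨oracleFree_fitProg.callProg _ _ _, oracleFree_embProg.callProg _ _ _,
      oracleFree_xorProg.callProg _ _ _, hPD.callProg _ _ _, by simp [OracleFree]⟩,
    by fun_prop, fun O κ key r e z b hkey he => ?_⟩
  set y := xorStr (emb (H.len κ) (fit (blockLen H κ) z) r) e with hy
  have hyl : y.length = H.len κ := by simp [hy, xorStr, emb, length_embFrom, he]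
  obtain ⟨μ, h1, h2⟩ := hD O κ key y hkey hyl
  have e1 := (hC₁ O (ones (blockLen H κ)) z).call_pure (K := 9) (ins := [1, 6]) (outs := [6])
    (xs := [ones κ, ones (blockLen H κ), ones (H.len κ), key, r, e, z, flagStr b, []])
    (by simp) (by simp) (by simp)
  have e2 := (hC₂ O (ones (H.len κ)) (fit (blockLen H κ) z) r).call_pure (K := 9)
    (ins := [2, 6, 4]) (outs := [6])
    (xs := [ones κ, ones (blockLen H κ), ones (H.len κ), key, r, e, fit (blockLen H κ) z,
      flagStr b, []]) (by simp) (by simp) (by simp)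
  have e3 := (hC₃ O (emb (H.len κ) (fit (blockLen H κ) z) r) e).call_pure (K := 9)
    (ins := [6, 5]) (outs := [6])
    (xs := [ones κ, ones (blockLen H κ), ones (H.len κ), key, r, e,
      emb (H.len κ) (fit (blockLen H κ) z) r, flagStr b, []]) (by simp) (by simp) (by simp)
  have e4 := h1.call (K := 9) (ins := [0, 3, 6]) (outs := [8])
    (xs := [ones κ, ones (blockLen H κ), ones (H.len κ), key, r, e, y, flagStr b, []])
    (by simp) (by simp) (by simp)
  rw [length_ones] at e1 e2
  rw [he] at e3
  have e5 := e4.seq_map (Q := .seq (.branch 8 .skip .skip (.branch 7 (.push true 7) .skip .skip))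
    (.copy 7 0)) (T' := 10) (g := fun vs => PMF.pure
      [flagStr (b || (vs.headD []).headD false), ones (blockLen H κ), ones (H.len κ), key, r, e, y,
        flagStr (b || (vs.headD []).headD false), vs.headD []]) (by
      intro vs hvs
      refine (Exec.straight ?_ ?_).mono (T' := 10) ?_
      · cases vs <;> simp [Straight, assign]
      · rcases vs with _ | ⟨_ | ⟨_ | _, l⟩, vs⟩ <;> cases b <;> simp [denote, assign, flagStr]
      · simp [straightTime])
  refine Yields.congr (Exec.yields 1 (e1.seq_pure (e2.seq_pure (e3.seq_pure e5)))) le_rfl ?_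
  rw [windowTest, ← hy, ← h2]
  simp only [map_eq_bind, PMF.bind_bind, PMF.pure_bind, readFrom, load]
  rfl

/-- One test: the rest of the key, and whether some test has accepted so far. -/
def decKernel (H : Scheme) (κ : ℕ) (z : List Bool) (_ : ℕ) (b : List Bool × Bool) :
    PMF (List Bool × Bool) :=
  (windowTest H κ z (readPart H (H.decKeyLen κ) κ b.1 0)).map fun b' =>
    (b.1.drop (partLen H (H.decKeyLen κ) κ), b.2 || b')

theorem iterKernel_decKernel (H : Scheme) (κ : ℕ) (z : List Bool) (m : ℕ) (b : List Bool × Bool) :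
    iterKernel (decKernel H κ z) m b = (anyAccepts (windowTests H κ m b.1 z)).map fun b' =>
      (b.1.drop (m * partLen H (H.decKeyLen κ) κ), b.2 || b') := by
  induction m generalizing b with
  | zero => simp [iterKernel, anyAccepts, windowTests, PMF.pure_map]
  | succ m ih =>
    have e : windowTests H κ (m + 1) b.1 z =
        windowTest H κ z (readPart H (H.decKeyLen κ) κ b.1 0) ::
          windowTests H κ m (b.1.drop (partLen H (H.decKeyLen κ) κ)) z := by
      simp only [windowTests, List.range_succ_eq_map, List.map_cons, List.map_map, readPart_drop]
      rfl
    have h := map_or_anyAccepts_cons b.2 (windowTest H κ z (readPart H (H.decKeyLen κ) κ b.1 0))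
      (windowTests H κ m (b.1.drop (partLen H (H.decKeyLen κ) κ)) z)
    have h' := congrArg (PMF.map fun b' =>
      (b.1.drop ((m + 1) * partLen H (H.decKeyLen κ) κ), b')) h
    rw [PMF.map_comp] at h'
    rw [iterKernel, decKernel, e, PMF.bind_map]
    refine Eq.trans ?_ h'.symm
    rw [PMF.map_bind]
    congr 1
    funext b'
    rw [Function.comp_apply, ih, PMF.map_comp, List.drop_drop,
      show partLen H (H.decKeyLen κ) κ + m * partLen H (H.decKeyLen κ) κ =
      (m + 1) * partLen H (H.decKeyLen κ) κ by ring]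
    rfl

/-- Split off the next part of the key and test a window with it. -/
def decStepProg (PT : Prog) : Prog :=
  .seq (callProg 11 splitProg [3, 5] [8, 5]) (.seq (callProg 11 splitProg [4, 5] [9, 5])
    (.seq (callProg 11 splitProg [2, 5] [10, 5])
      (.seq (callProg 11 PT [0, 1, 2, 8, 9, 10, 6, 7] [7]) (.seq (.copy 5 0) (.copy 7 1)))))

/-- Test a window with all parts of the key. -/
def decPartsProg (PS : Prog) : Prog :=
  .seq (.loop 5 (.seq (.pop 5) (callProg 9 PS [0, 1, 2, 3, 4, 6, 7, 8] [6, 8]))) (.copy 8 0)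

theorem exists_decPartsProg (hH : IsPRC kind H 𝓔) {ℓ : ℕ → ℕ} (hℓ : UnaryPolyTime ℓ) :
    ∃ (P : Prog) (T : ℕ → ℕ), OracleFree P ∧ PolyBounded T ∧
      ∀ (O : PMF (List Bool)) (κ : ℕ) (key z : List Bool) (b : Bool),
        key.length = ℓ κ * partLen H (H.decKeyLen κ) κ →
        Yields O P [ones κ, ones (blockLen H κ), ones (H.len κ), ones (H.decKeyLen κ),
          ones (2 * H.len κ), ones (ℓ κ), key, z, flagStr b] (T κ) 1
          ((anyAccepts (windowTests H κ (ℓ κ) key z)).map fun b' => [flagStr (b || b')]) := by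
  obtain ⟨PT, TT, hPT, hTT, hT⟩ := exists_testProg hH
  obtain ⟨C₂, hC₂⟩ := yields_split_ones
  have hℓ' := hℓ.polyBounded
  have hl := hH.polyBounded_len
  have hk2 := hH.polyBounded_keyLen.2
  have hstep : ∃ T : ℕ → ℕ, PolyBounded T ∧ ∀ (O : PMF (List Bool)) (κ m : ℕ) (key z : List Bool)
      (b : Bool), partLen H (H.decKeyLen κ) κ ≤ key.length →
      Yields O (decStepProg PT) [ones κ, ones (blockLen H κ), ones (H.len κ),
        ones (H.decKeyLen κ), ones (2 * H.len κ), key, z, flagStr b] (T κ) 2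
        ((decKernel H κ z m (key, b)).map fun b => [b.1, flagStr b.2]) := by
    refine ⟨fun κ => C₂ * (H.decKeyLen κ + 1) + callCost splitProg [3, 5] [8, 5] +
        (C₂ * (2 * H.len κ + 1) + callCost splitProg [4, 5] [9, 5] +
          (C₂ * (H.len κ + 1) + callCost splitProg [2, 5] [10, 5] +
            (TT κ + callCost PT [0, 1, 2, 8, 9, 10, 6, 7] [7] + 3 + 1) + 1) +
          1) + 1, by fun_prop, fun O κ m key z b hkey => ?_⟩
    have hpart : (readPart H (H.decKeyLen κ) κ key 0) = (key.take (H.decKeyLen κ),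
        (key.drop (H.decKeyLen κ)).take (2 * H.len κ),
        ((key.drop (H.decKeyLen κ)).drop (2 * H.len κ)).take (H.len κ)) := by
      simp [readPart, List.drop_drop]
    have hdrop : ((key.drop (H.decKeyLen κ)).drop (2 * H.len κ)).drop (H.len κ) =
        key.drop (partLen H (H.decKeyLen κ) κ) := by
      simp only [List.drop_drop, partLen, Nat.add_assoc]
    rw [partLen] at hkey
    have e1 := (hC₂ O (H.decKeyLen κ) key).call_pure (K := 11) (ins := [3, 5]) (outs := [8, 5])
      (xs := [ones κ, ones (blockLen H κ), ones (H.len κ),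
        ones (H.decKeyLen κ), ones (2 * H.len κ), key, z, flagStr b, [], [], []])
      (by simp) (by simp) (by simp)
    have e2 := (hC₂ O (2 * H.len κ) (key.drop (H.decKeyLen κ))).call_pure (K := 11)
      (ins := [4, 5]) (outs := [9, 5])
      (xs := [ones κ, ones (blockLen H κ), ones (H.len κ),
        ones (H.decKeyLen κ), ones (2 * H.len κ), key.drop (H.decKeyLen κ), z, flagStr b,
        key.take (H.decKeyLen κ), [], []]) (by simp) (by simp) (by simp)
    have e3 := (hC₂ O (H.len κ) ((key.drop (H.decKeyLen κ)).drop (2 * H.len κ))).call_pure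
      (K := 11) (ins := [2, 5]) (outs := [10, 5])
      (xs := [ones κ, ones (blockLen H κ), ones (H.len κ),
        ones (H.decKeyLen κ), ones (2 * H.len κ), (key.drop (H.decKeyLen κ)).drop (2 * H.len κ), z,
        flagStr b, key.take (H.decKeyLen κ), (key.drop (H.decKeyLen κ)).take (2 * H.len κ), []])
      (by simp) (by simp) (by simp)
    rw [hdrop] at e3
    set sk := key.take (H.decKeyLen κ)
    set r := (key.drop (H.decKeyLen κ)).take (2 * H.len κ)
    set e := ((key.drop (H.decKeyLen κ)).drop (2 * H.len κ)).take (H.len κ)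
    have e4 := (hT O κ sk r e z b (by simp [sk]; omega) (by simp [e]; omega)).call (K := 11)
      (ins := [0, 1, 2, 8, 9, 10, 6, 7]) (outs := [7])
      (xs := [ones κ, ones (blockLen H κ), ones (H.len κ),
        ones (H.decKeyLen κ), ones (2 * H.len κ), key.drop (partLen H (H.decKeyLen κ) κ), z,
        flagStr b, sk, r, e]) (by simp) (by simp) (by simp)
    rw [PMF.map_comp] at e4
    have e5 := e4.seq_map (Q := .seq (.copy 5 0) (.copy 7 1)) (T' := 3)
      (g := fun b' => PMF.pure [key.drop (partLen H (H.decKeyLen κ) κ), flagStr (b || b'),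
        ones (H.len κ), ones (H.decKeyLen κ), ones (2 * H.len κ),
        key.drop (partLen H (H.decKeyLen κ) κ), z, flagStr (b || b'), sk, r, e]) (by
        intro b' _
        exact Exec.straight (by simp [Straight, assign]) (by simp [denote, assign]))
    refine Yields.congr (Exec.yields 3 (e1.seq_pure (e2.seq_pure (e3.seq_pure e5)))) le_rfl ?_
    rw [decKernel, hpart]
    simp only [map_eq_bind, PMF.bind_bind, PMF.pure_bind, readFrom, load]
    rfl
  obtain ⟨TS, hTS, hS⟩ := hstep
  refine ⟨decPartsProg (decStepProg PT), fun κ =>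
    (ℓ κ * ((1 + (TS κ + callCost (decStepProg PT) [0, 1, 2, 3, 4, 6, 7, 8] [6, 8]) + 1) + 1) + 1) +
      1 + 1, ?_, by fun_prop, fun O κ key z b hkey => ?_⟩
  · exact ⟨⟨trivial, OracleFree.callProg (P := decStepProg PT)
      ⟨oracleFree_splitProg.callProg _ _ _, oracleFree_splitProg.callProg _ _ _,
        oracleFree_splitProg.callProg _ _ _, hPT.callProg _ _ _, trivial, trivial⟩ _ _ _⟩, trivial⟩
  have hloop : Exec O (.loop 5 (.seq (.pop 5)
      (callProg 9 (decStepProg PT) [0, 1, 2, 3, 4, 6, 7, 8] [6, 8])))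
      [ones κ, ones (blockLen H κ), ones (H.len κ), ones (H.decKeyLen κ),
          ones (2 * H.len κ), ones (ℓ κ), key, z, flagStr b] _ _ :=
    Exec.loop_iter (r := 5) (k := decKernel H κ z) (S := fun m b =>
      [ones κ, ones (blockLen H κ), ones (H.len κ), ones (H.decKeyLen κ),
          ones (2 * H.len κ), ones m, b.1, z, flagStr b.2])
      (Inv := fun m b => b.1.length = m * partLen H (H.decKeyLen κ) κ)
      (fun b _ => rfl) (fun m b _ => by simp [ones])
      (fun m b hb => Exec.seq_pure (Exec.straight (by simp [Straight]) rfl)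
        (((hS O κ m b.1 z b.2 (by
            rw [hb]; exact Nat.le_mul_of_pos_left _ (Nat.succ_pos m))).call (K := 9)
          (ins := [0, 1, 2, 3, 4, 6, 7, 8])
          (outs := [6, 8]) (xs := [ones κ, ones (blockLen H κ), ones (H.len κ),
            ones (H.decKeyLen κ), ones (2 * H.len κ), ones m, b.1, z, flagStr b.2])
          (by simp) (by simp) (by simp)).congr le_rfl (by rw [PMF.map_comp]; rfl)))
      (fun m b hb b' hb' => by
        rw [decKernel, PMF.mem_support_map_iff] at hb'
        obtain ⟨y, hy, rfl⟩ := hb'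
        rw [Nat.succ_mul] at hb
        simp [hb])
      (ℓ κ) (key, b) hkey
  refine Yields.congr (Exec.yields 0 (Exec.seq_map (d := iterKernel (decKernel H κ z) (ℓ κ) (key, b))
    (T' := 1) (g := fun b => PMF.pure [flagStr b.2, ones (blockLen H κ), ones (H.len κ),
      ones (H.decKeyLen κ), ones (2 * H.len κ), [], b.1, z, flagStr b.2])
    hloop fun b _ => Exec.straight (by simp [Straight]) (by simp [denote, ones]))) le_rfl ?_
  rw [iterKernel_decKernel]
  simp only [map_eq_bind, PMF.bind_bind, PMF.pure_bind, readFrom, load]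
  rfl

end
end EditPRC

/-! ### The decoder: enumeration of all windows, and the polynomial time bounds. -/

namespace EditPRC
noncomputable section

variable {kind : KeyKind} {H : Scheme} {𝓔 : Set Channel} {O : PMF (List Bool)}

/-- Test the next prefix: the rest of the string, the reversed prefix, and whether some test has
accepted so far. -/
def prefixKernel (W : List Bool → List (PMF Bool)) (_ : ℕ)
    (b : List Bool × List Bool × Bool) : PMF (List Bool × List Bool × Bool) :=
  (anyAccepts (W (b.1.headD false :: b.2.1).reverse)).map fun b' =>
    (b.1.tail, b.1.headD false :: b.2.1, b.2.2 || b')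

theorem iterKernel_prefixKernel (W : List Bool → List (PMF Bool)) (m : ℕ) (v w : List Bool)
    (b : Bool) (hv : v.length = m) :
    iterKernel (prefixKernel W) m (v, w, b) =
      (anyAccepts (((List.range m).map fun d => w.reverse ++ v.take (d + 1)).flatMap W)).map
        fun b' => ([], v.reverse ++ w, b || b') := by
  induction m generalizing v w b with
  | zero =>
    rw [List.length_eq_zero_iff] at hv
    simp [hv, iterKernel, anyAccepts, PMF.pure_map]
  | succ m ih =>
    obtain ⟨c, v, rfl⟩ := List.exists_cons_of_length_eq_add_one hv
    have e : ((List.range (m + 1)).map fun d => w.reverse ++ (c :: v).take (d + 1)) =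
        (c :: w).reverse :: (List.range m).map fun d => (c :: w).reverse ++ v.take (d + 1) := by
      rw [List.range_succ_eq_map, List.map_cons, List.map_map]
      simp [Function.comp_def]
    have h := congrArg (PMF.map fun b' => (([] : List Bool), (c :: v).reverse ++ w, b'))
      (map_or_anyAccepts_append b (W (c :: w).reverse)
        (((List.range m).map fun d => (c :: w).reverse ++ v.take (d + 1)).flatMap W))
    rw [PMF.map_comp] at h
    rw [e, List.flatMap_cons]
    refine Eq.trans ?_ h.symm
    rw [iterKernel, prefixKernel, PMF.bind_map, PMF.map_bind]
    congr 1
    funext b'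
    rw [Function.comp_apply, List.headD_cons, List.tail_cons,
      ih v (c :: w) _ (by simpa using hv), PMF.map_comp]
    congr 1
    funext b''
    simp

/-- Test all prefixes starting at the next position. -/
def windowKernel (W : List Bool → List (PMF Bool)) (_ : ℕ) (b : List Bool × Bool) :
    PMF (List Bool × Bool) :=
  (anyAccepts (((List.range b.1.length).map fun d => b.1.take (d + 1)).flatMap W)).map fun b' =>
    (b.1.tail, b.2 || b')

/-- The recursion behind the double loop: windows are prefixes of suffixes. -/
theorem windows_cons (c : Bool) (u : List Bool) :
    windows (c :: u) =
      ((List.range (u.length + 1)).map fun d => (c :: u).take (d + 1)) ++ windows u := by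
  simp only [windows, List.length_cons]
  rw [List.range_succ_eq_map, List.flatMap_cons, List.flatMap_map]
  simp [List.range_succ_eq_map]

theorem iterKernel_windowKernel (W : List Bool → List (PMF Bool)) (m : ℕ) (u : List Bool)
    (b : Bool) (hu : u.length = m) :
    iterKernel (windowKernel W) m (u, b) =
      (anyAccepts ((windows u).flatMap W)).map fun b' => ([], b || b') := by
  induction m generalizing u b with
  | zero =>
    rw [List.length_eq_zero_iff] at hu
    simp [hu, iterKernel, anyAccepts, PMF.pure_map, windows]
  | succ m ih =>
    obtain ⟨c, u, rfl⟩ := List.exists_cons_of_length_eq_add_one hu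
    have h := congrArg (PMF.map fun b' => (([] : List Bool), b'))
      (map_or_anyAccepts_append b
        (((List.range (u.length + 1)).map fun d => (c :: u).take (d + 1)).flatMap W)
        ((windows u).flatMap W))
    rw [PMF.map_comp] at h
    rw [windows_cons, List.flatMap_append]
    refine Eq.trans ?_ h.symm
    rw [iterKernel, windowKernel, PMF.bind_map, PMF.map_bind]
    simp only [List.length_cons]
    congr 1
    funext b'
    rw [Function.comp_apply, List.tail_cons, ih u _ (by simpa using hu), PMF.map_comp]
    rfl

/-- Test all prefixes of the string in register `8`. -/
def decPrefixesProg (PQ : Prog) : Prog :=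
  .seq (.loop 8 (.seq (moveBit 8 9) (.seq (callProg 11 reverseProg [9] [10])
    (callProg 11 PQ [0, 1, 2, 3, 4, 5, 6, 10, 7] [7])))) (.copy 7 0)

/-- `PolyBounded` concerns functions of one variable, so a single `N` dominates both the security
parameter and the length of the string. -/
theorem exists_decPrefixesProg (hH : IsPRC kind H 𝓔) {ℓ : ℕ → ℕ} (hℓ : UnaryPolyTime ℓ) :
    ∃ (P : Prog) (T : ℕ → ℕ), OracleFree P ∧ PolyBounded T ∧
      ∀ (O : PMF (List Bool)) (κ N : ℕ) (key v : List Bool) (b : Bool), κ ≤ N → v.length ≤ N →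
        key.length = ℓ κ * partLen H (H.decKeyLen κ) κ →
        Yields O P [ones κ, ones (blockLen H κ), ones (H.len κ), ones (H.decKeyLen κ),
          ones (2 * H.len κ), ones (ℓ κ), key, flagStr b, v] (T N) 1
          ((anyAccepts (((List.range v.length).map fun d => v.take (d + 1)).flatMap
            (windowTests H κ (ℓ κ) key))).map fun b' => [flagStr (b || b')]) := by
  obtain ⟨PQ, TQ, hPQ, ⟨q, hq⟩, hQ⟩ := exists_decPartsProg hH hℓ
  obtain ⟨C, hC⟩ := yields_reverse
  refine ⟨decPrefixesProg PQ, fun N => (N * ((4 + (C * (N + 1) + callCost reverseProg [9] [10] +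
    (q.eval N + callCost PQ [0, 1, 2, 3, 4, 5, 6, 10, 7] [7]) + 1) + 1) + 1) + 1) + 1 + 1,
    ?_, by fun_prop, fun O κ N key v b hκ hv hkey => ?_⟩
  · exact ⟨⟨by simp [OracleFree, moveBit], oracleFree_reverseProg.callProg _ _ _,
      hPQ.callProg _ _ _⟩, trivial⟩
  have hloop : Exec O (.loop 8 (.seq (moveBit 8 9) (.seq (callProg 11 reverseProg [9] [10])
      (callProg 11 PQ [0, 1, 2, 3, 4, 5, 6, 10, 7] [7]))))
      [ones κ, ones (blockLen H κ), ones (H.len κ), ones (H.decKeyLen κ),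
        ones (2 * H.len κ), ones (ℓ κ), key, flagStr b, v, [], [].reverse] _ _ :=
    Exec.loop_iter (r := 8) (k := prefixKernel (windowTests H κ (ℓ κ) key))
      (C := 4 + (C * (N + 1) + callCost reverseProg [9] [10] +
        (q.eval N + callCost PQ [0, 1, 2, 3, 4, 5, 6, 10, 7] [7]) + 1) + 1)
      (S := fun m b =>
      [ones κ, ones (blockLen H κ), ones (H.len κ), ones (H.decKeyLen κ),
          ones (2 * H.len κ), ones (ℓ κ), key, flagStr b.2.2, b.1, b.2.1, b.2.1.reverse])
      (Inv := fun m b => b.1.length = m ∧ b.2.1.length + m = v.length)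
      (fun b hb => List.length_eq_zero_iff.1 hb.1) (fun m b hb => by
        have := hb.1
        simp only [List.getD_cons_zero, List.getD_cons_succ]
        exact List.ne_nil_of_length_eq_add_one this)
      (fun m b hb => by
        obtain ⟨v', w, b⟩ := b
        obtain ⟨hv', hw⟩ := hb
        obtain ⟨c, v', rfl⟩ := List.exists_cons_of_length_eq_add_one hv'
        simp only at hw
        have e2 := (hC O (c :: w)).call_pure (K := 11) (ins := [9]) (outs := [10])
          (xs := [ones κ, ones (blockLen H κ), ones (H.len κ), ones (H.decKeyLen κ),
            ones (2 * H.len κ), ones (ℓ κ), key, flagStr b, v', c :: w, w.reverse])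
          (by simp) (by simp) (by simp)
        have e3 := (hQ O κ key (c :: w).reverse b hkey).call (K := 11)
          (ins := [0, 1, 2, 3, 4, 5, 6, 10, 7]) (outs := [7])
          (xs := [ones κ, ones (blockLen H κ), ones (H.len κ), ones (H.decKeyLen κ),
            ones (2 * H.len κ), ones (ℓ κ), key, flagStr b, v', c :: w, (c :: w).reverse])
          (by simp) (by simp) (by simp)
        have e1 : Exec O (moveBit 8 9) [ones κ, ones (blockLen H κ), ones (H.len κ),
            ones (H.decKeyLen κ), ones (2 * H.len κ), ones (ℓ κ), key, flagStr b, c :: v', w,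
            w.reverse] 4 (PMF.pure [ones κ, ones (blockLen H κ), ones (H.len κ),
            ones (H.decKeyLen κ), ones (2 * H.len κ), ones (ℓ κ), key, flagStr b, v', c :: w,
            w.reverse]) :=
          Exec.straight (straight_moveBit (by simp) (by simp)) (denote_moveBit_cons rfl)
        refine (e1.seq_pure (e2.seq_pure e3)).congr ?_ ?_
        · have h1 : C * ((c :: w).length + 1) ≤ C * (N + 1) :=
            Nat.mul_le_mul_left _ (by simp; omega)
          have h2 := (hq κ).trans (polyEval_mono q hκ)
          simp only at h2
          omega
        · rw [PMF.map_comp, prefixKernel, PMF.map_comp]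
          rfl)
      (fun m b hb b' hb' => by
        rw [prefixKernel, PMF.mem_support_map_iff] at hb'
        obtain ⟨y, hy, rfl⟩ := hb'
        obtain ⟨hb1, hb2⟩ := hb
        refine ⟨by simp [hb1], ?_⟩
        simp only [List.length_cons]; omega)
      v.length (v, [], b) ⟨rfl, by simp⟩
  refine Yields.congr (Exec.yields 2 (Exec.seq_map
    (d := iterKernel (prefixKernel (windowTests H κ (ℓ κ) key)) v.length (v, [], b))
    (T' := 1) (g := fun b => PMF.pure [flagStr b.2.2, ones (blockLen H κ), ones (H.len κ),
      ones (H.decKeyLen κ), ones (2 * H.len κ), ones (ℓ κ), key, flagStr b.2.2, b.1, b.2.1,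
      b.2.1.reverse])
    hloop fun b _ => Exec.straight (by simp [Straight]) (by simp [denote]))) ?_ ?_
  · have := Nat.mul_le_mul_right (4 + (C * (N + 1) + callCost reverseProg [9] [10] +
      (q.eval N + callCost PQ [0, 1, 2, 3, 4, 5, 6, 10, 7] [7]) + 1) + 1 + 1) hv
    beta_reduce
    omega
  rw [iterKernel_prefixKernel _ _ _ _ _ rfl]
  simp only [map_eq_bind, PMF.bind_bind, PMF.pure_bind, readFrom, load]
  simp

/-- The decoder. -/
def decProg (PP PL PW : Prog) : Prog :=
  .seq (callProg 10 PP [0] [0, 3, 4, 5, 6]) (.seq (callProg 10 PL [0] [7])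
    (.seq (callProg 10 appendProg [5, 5] [8])
      (.seq (.loop 2 (.seq (callProg 10 PW [0, 6, 5, 4, 8, 7, 1, 9, 2] [9]) (.pop 2)))
        (.copy 9 0))))

theorem exists_cgkDecProg (hH : IsPRC kind H 𝓔) {ℓ : ℕ → ℕ} (hℓ : UnaryPolyTime ℓ) :
    ∃ (P : Prog) (T : ℕ → ℕ), OracleFree P ∧ PolyBounded T ∧
      ∀ (O : PMF (List Bool)) (κ N : ℕ) (dk y : List Bool), κ ≤ N → y.length ≤ N →
        dk.length = (cgkCode H ℓ).decKeyLen κ →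
        Yields O P [ones κ, dk, y] (T N) 1
          (((cgkCode H ℓ).dec κ dk y).map fun b => [flagStr b]) := by
  obtain ⟨PP, TP, hPP, ⟨qP, hqP⟩, hP⟩ := hH.exists_paramsProg
  obtain ⟨PL, TL, hPL, ⟨qL, hqL⟩, hL⟩ := hℓ.exists_prog
  obtain ⟨PW, TW, hPW, hTW, hW⟩ := exists_decPrefixesProg hH hℓ
  obtain ⟨C₁, hC₁⟩ := yields_append
  obtain ⟨qM, hqM⟩ := hH.polyBounded_len
  refine ⟨decProg PP PL PW, fun N => qP.eval N + callCost PP [0] [0, 3, 4, 5, 6] +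
      (qL.eval N + callCost PL [0] [7] + (C₁ * (qM.eval N + 1) + callCost appendProg [5, 5] [8] +
        (N * ((TW N + callCost PW [0, 6, 5, 4, 8, 7, 1, 9, 2] [9] + 1 + 1) +
          1) + 1 + 1 + 1) + 1) + 1) + 1, ?_, by fun_prop, fun O κ N dk y hκ hy hdk => ?_⟩
  · exact ⟨hPP.callProg _ _ _, hPL.callProg _ _ _, oracleFree_appendProg.callProg _ _ _,
      ⟨hPW.callProg _ _ _, trivial⟩, trivial⟩
  have hloop : Exec O (.loop 2 (.seq (callProg 10 PW [0, 6, 5, 4, 8, 7, 1, 9, 2] [9]) (.pop 2)))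
      [ones κ, dk, y, ones (H.encKeyLen κ), ones (H.decKeyLen κ), ones (H.len κ),
        ones (blockLen H κ), ones (ℓ κ), ones (2 * H.len κ), flagStr false] _ _ :=
    Exec.loop_iter (r := 2) (k := windowKernel (windowTests H κ (ℓ κ) dk))
      (S := fun m b =>
        [ones κ, dk, b.1, ones (H.encKeyLen κ), ones (H.decKeyLen κ), ones (H.len κ),
        ones (blockLen H κ), ones (ℓ κ), ones (2 * H.len κ), flagStr b.2])
      (Inv := fun m b => b.1.length = m ∧ m ≤ N)
      (C := TW N + callCost PW [0, 6, 5, 4, 8, 7, 1, 9, 2] [9] + 1 + 1)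
      (fun b hb => List.length_eq_zero_iff.1 hb.1) (fun m b hb =>
        List.ne_nil_of_length_eq_add_one hb.1)
      (fun m b hb => by
        have e1 := (hW O κ N dk b.1 b.2 hκ (by rw [hb.1]; exact hb.2) hdk).call (K := 10)
          (ins := [0, 6, 5, 4, 8, 7, 1, 9, 2]) (outs := [9])
          (xs := [ones κ, dk, b.1, ones (H.encKeyLen κ), ones (H.decKeyLen κ), ones (H.len κ),
            ones (blockLen H κ), ones (ℓ κ), ones (2 * H.len κ), flagStr b.2])
          (by simp) (by simp) (by simp)
        rw [PMF.map_comp] at e1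
        refine (e1.seq_map (Q := .pop 2) (T' := 1) (g := fun b' => PMF.pure [ones κ, dk, b.1.tail,
          ones (H.encKeyLen κ), ones (H.decKeyLen κ), ones (H.len κ), ones (blockLen H κ),
          ones (ℓ κ), ones (2 * H.len κ), flagStr (b.2 || b')]) fun b' _ =>
          Exec.straight (P := .pop 2) (by simp [Straight, assign])
            (by simp [denote, assign])).congr le_rfl ?_
        rw [windowKernel, PMF.map_comp]
        rfl)
      (fun m b hb b' hb' => by
        rw [windowKernel, PMF.mem_support_map_iff] at hb'
        obtain ⟨_, _, rfl⟩ := hb'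
        obtain ⟨hb1, hb2⟩ := hb
        exact ⟨by simp [hb1], by omega⟩)
      y.length (y, false) ⟨rfl, hy⟩
  refine Yields.congr
    (Exec.yields 7 (Exec.seq_pure ((hP O κ).call_pure (K := 10) (ins := [0])
    (outs := [0, 3, 4, 5, 6]) (xs := [ones κ, dk, y, [], [], [], [], [], [], []])
    (by simp) (by simp) (by simp)) (Exec.seq_pure ((hL O κ).call_pure (K := 10) (ins := [0])
    (outs := [7]) (xs := [ones κ, dk, y, ones (H.encKeyLen κ), ones (H.decKeyLen κ),
    ones (H.len κ), ones (blockLen H κ), [], [], []]) (by simp) (by simp) (by simp))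
    (Exec.seq_pure ((hC₁ O (ones (H.len κ)) (ones (H.len κ))).call_pure (K := 10)
    (ins := [5, 5]) (outs := [8]) (xs := [ones κ, dk, y, ones (H.encKeyLen κ),
    ones (H.decKeyLen κ), ones (H.len κ), ones (blockLen H κ), ones (ℓ κ), [], []])
    (by simp) (by simp) (by simp) |>.congr
      (le_of_eq (by rw [length_ones])) (show _ = PMF.pure [ones κ, dk, y,
      ones (H.encKeyLen κ), ones (H.decKeyLen κ), ones (H.len κ), ones (blockLen H κ),
      ones (ℓ κ), ones (2 * H.len κ), []] by simp [assign, ones, two_mul]))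
    (Exec.seq_map (d := iterKernel (windowKernel (windowTests H κ (ℓ κ) dk)) y.length (y, false))
      (T' := 1) (g := fun b => PMF.pure [flagStr b.2, dk, b.1, ones (H.encKeyLen κ),
        ones (H.decKeyLen κ), ones (H.len κ), ones (blockLen H κ), ones (ℓ κ),
        ones (2 * H.len κ), flagStr b.2])
      hloop fun b _ => Exec.straight (by simp [Straight]) (by simp [denote])))))) ?_ ?_
  · have h1 := (hqP κ).trans (polyEval_mono qP hκ)
    have h2 := (hqL κ).trans (polyEval_mono qL hκ)
    have h3 := (hqM κ).trans (polyEval_mono qM hκ)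
    simp only at h1 h2 h3
    have h4 := Nat.mul_le_mul_left C₁ (Nat.succ_le_succ h3)
    have h5 := Nat.mul_le_mul_right (TW N + callCost PW [0, 6, 5, 4, 8, 7, 1, 9, 2] [9] + 1 + 1 + 1)
      hy
    simp only [Nat.succ_eq_add_one] at h4
    beta_reduce
    omega
  rw [iterKernel_windowKernel _ _ _ _ rfl, cgkCode_dec]
  simp only [map_eq_bind, PMF.bind_bind, PMF.pure_bind, readFrom, load]
  simp

/-! ### The construction runs in polynomial time -/

theorem cgkCode_keyGen_length (hH : IsPRC kind H 𝓔) (ℓ : ℕ → ℕ) (κ : ℕ) :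
    ∀ k ∈ ((cgkCode H ℓ).keyGen κ).support,
      k.1.length = (cgkCode H ℓ).encKeyLen κ ∧ k.2.length = (cgkCode H ℓ).decKeyLen κ := by
  intro k hk
  have key : ∀ m, ∀ ks ∈ (iid (blockKeyGen H κ) m).support,
      ((ks.map fun k => k.1.1 ++ k.2.1 ++ k.2.2).flatten).length =
        m * partLen H (H.encKeyLen κ) κ ∧
      ((ks.map fun k => k.1.2 ++ k.2.1 ++ k.2.2).flatten).length =
        m * partLen H (H.decKeyLen κ) κ := by
    intro m
    induction m with
    | zero => simp [iid]
    | succ m ih =>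
      intro ks hks
      rw [iid, PMF.mem_support_bind_iff] at hks
      obtain ⟨a, ha, hks⟩ := hks
      rw [PMF.mem_support_map_iff] at hks
      obtain ⟨l, hl, rfl⟩ := hks
      obtain ⟨-, h1, h2, h3, h4⟩ := hH.length_of_mem_blockKeyGen ha
      simp only [List.map_cons, List.flatten_cons, List.length_append, (ih l hl).1, (ih l hl).2,
        h1, h2, h3, h4, partLen]
      constructor <;> ring
  simp only [cgkCode, PMF.mem_support_map_iff] at hk
  obtain ⟨ks, hks, rfl⟩ := hk
  exact key _ ks hks

theorem cgkCode_enc_length (H : Scheme) (ℓ : ℕ → ℕ) (κ : ℕ) (ek : List Bool) :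
    ∀ x ∈ ((cgkCode H ℓ).enc κ ek).support, x.length = (cgkCode H ℓ).len κ := by
  intro x hx
  have := length_of_mem_concatAll (n := blockLen H κ) (ds := (List.range (ℓ κ)).map fun t =>
    encBlock H κ (readPart H (H.encKeyLen κ) κ ek t)) (by
      intro d hd y hy
      rw [List.mem_map] at hd
      obtain ⟨t, -, rfl⟩ := hd
      exact length_of_mem_encBlock hy) hx
  change x.length = ℓ κ * blockLen H κ
  simpa using this

theorem cgkCode_ppt (hH : IsPRC kind H 𝓔) {ℓ : ℕ → ℕ} (hℓ : UnaryPolyTime ℓ) :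
    (∃ (P : Prog) (q : Polynomial ℕ), OracleFree P ∧
      ∀ κ, Computes P [ones κ] (q.eval κ) (fun s => (s 0, s 1)) ((cgkCode H ℓ).keyGen κ)) ∧
    (∃ (P : Prog) (q : Polynomial ℕ), OracleFree P ∧
      ∀ κ ek, ek.length = (cgkCode H ℓ).encKeyLen κ →
        Computes P [ones κ, ek] (q.eval (κ + ek.length)) (fun s => s 0)
          ((cgkCode H ℓ).enc κ ek)) ∧
    ∃ (P : Prog) (q : Polynomial ℕ), OracleFree P ∧
      ∀ κ dk y, dk.length = (cgkCode H ℓ).decKeyLen κ →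
        Computes P [ones κ, dk, y] (q.eval (κ + dk.length + y.length)) readBit
          ((cgkCode H ℓ).dec κ dk y) := by
  refine ⟨?_, ?_, ?_⟩
  · obtain ⟨P, T, hP, ⟨q, hq⟩, h⟩ := exists_cgkKeyGenProg hH hℓ
    refine ⟨P, q, hP, fun κ => ((h _ κ).mono (hq κ)).computes
      (out := fun vs => (vs.getD 0 [], vs.getD 1 [])) (fun s => rfl) ?_⟩
    rw [PMF.map_comp]
    exact PMF.map_id _
  · obtain ⟨P, T, hP, ⟨q, hq⟩, h⟩ := exists_cgkEncProg hH hℓ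
    refine ⟨P, q, hP, fun κ ek hek => ((h _ κ ek hek).mono ((hq κ).trans
      (polyEval_mono q (Nat.le_add_right _ _)))).computes
      (out := fun vs => vs.getD 0 []) (fun s => rfl) ?_⟩
    rw [PMF.map_comp]
    exact PMF.map_id _
  · obtain ⟨P, T, hP, ⟨q, hq⟩, h⟩ := exists_cgkDecProg hH hℓ
    refine ⟨P, q, hP, fun κ dk y hdk => ((h _ κ (κ + dk.length + y.length) dk y (by omega)
      (by omega) hdk).mono (hq _)).computes
      (out := fun vs => (vs.getD 0 []).headD false) (fun s => rfl) ?_⟩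
    rw [PMF.map_comp]
    refine (congrArg (fun f => PMF.map f _) (funext fun b => ?_)).trans (PMF.map_id _)
    cases b <;> rfl

end
end EditPRC

/-! ### Expectations and independent sampling. -/

namespace EditPRC
noncomputable section

open scoped ENNReal

/-! ### Expectations -/

section Expect

variable {α β γ : Type}

/-- The expectation of `f` under `p`. -/
def expect (p : PMF α) (f : α → ℝ≥0∞) : ℝ≥0∞ := ∑' a, p a * f a

theorem bind_apply_eq_expect (p : PMF α) (f : α → PMF β) (b : β) :
    (p.bind f) b = expect p fun a => f a b := rfl

theorem expect_pure (a : α) (f : α → ℝ≥0∞) : expect (PMF.pure a) f = f a := by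
  rw [expect, tsum_eq_single a]
  · simp
  · intro b hb; simp [hb]

theorem expect_bind (p : PMF α) (g : α → PMF β) (f : β → ℝ≥0∞) :
    expect (p.bind g) f = expect p fun a => expect (g a) f := by
  simp only [expect, PMF.bind_apply, ← ENNReal.tsum_mul_right, ← ENNReal.tsum_mul_left]
  rw [ENNReal.tsum_comm]
  simp only [mul_assoc]

theorem expect_map (p : PMF α) (g : α → β) (f : β → ℝ≥0∞) :
    expect (p.map g) f = expect p fun a => f (g a) := by
  rw [map_eq_bind, expect_bind]
  simp only [expect_pure]

theorem expect_mono_support {p : PMF α} {f g : α → ℝ≥0∞} (h : ∀ a ∈ p.support, f a ≤ g a) :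
    expect p f ≤ expect p g := by
  refine ENNReal.tsum_le_tsum fun a => ?_
  by_cases ha : a ∈ p.support
  · exact mul_le_mul_right (h a ha) _
  · rw [PMF.mem_support_iff, not_not] at ha
    simp [ha]

theorem expect_congr_support {p : PMF α} {f g : α → ℝ≥0∞} (h : ∀ a ∈ p.support, f a = g a) :
    expect p f = expect p g :=
  le_antisymm (expect_mono_support fun a ha => (h a ha).le)
    (expect_mono_support fun a ha => (h a ha).ge)

theorem expect_const (p : PMF α) (c : ℝ≥0∞) : expect p (fun _ => c) = c := by
  rw [expect, ENNReal.tsum_mul_right, p.tsum_coe, one_mul]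

theorem expect_le_of_support {p : PMF α} {f : α → ℝ≥0∞} {c : ℝ≥0∞}
    (h : ∀ a ∈ p.support, f a ≤ c) : expect p f ≤ c :=
  (expect_mono_support h).trans_eq (expect_const p c)

theorem expect_add (p : PMF α) (f g : α → ℝ≥0∞) :
    (expect p fun a => f a + g a) = expect p f + expect p g := by
  simp only [expect, mul_add, ENNReal.tsum_add]

theorem expect_mul_left (p : PMF α) (c : ℝ≥0∞) (f : α → ℝ≥0∞) :
    (expect p fun a => c * f a) = c * expect p f := by
  simp only [expect, ← ENNReal.tsum_mul_left, mul_left_comm]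

theorem expect_mul_right (p : PMF α) (c : ℝ≥0∞) (f : α → ℝ≥0∞) :
    (expect p fun a => f a * c) = expect p f * c := by
  simp only [mul_comm _ c, expect_mul_left]

theorem expect_finsetSum {ι : Type} (p : PMF α) (s : Finset ι) (f : ι → α → ℝ≥0∞) :
    (expect p fun a => ∑ i ∈ s, f i a) = ∑ i ∈ s, expect p (f i) := by
  classical
  induction s using Finset.induction_on with
  | empty => simp [expect]
  | insert i s hi ih => simp only [Finset.sum_insert hi, expect_add, ih]

/-- Tonelli: with values in `ℝ≥0∞` no summability is needed. Independent samples are reordered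
through this lemma. -/
theorem expect_comm (p : PMF α) (q : PMF β) (f : α → β → ℝ≥0∞) :
    (expect p fun a => expect q (f a)) = expect q fun b => expect p fun a => f a b := by
  simp only [expect, ← ENNReal.tsum_mul_left]
  rw [ENNReal.tsum_comm]
  simp only [mul_left_comm]

theorem pmf_bool_add (d : PMF Bool) : d true + d false = 1 := by
  have := d.tsum_coe
  rwa [tsum_bool, add_comm] at this

theorem toReal_bool_false (d : PMF Bool) : (d false).toReal = 1 - (d true).toReal := by
  have h := congrArg ENNReal.toReal (pmf_bool_add d)
  rw [ENNReal.toReal_add (PMF.apply_ne_top _ _) (PMF.apply_ne_top _ _), ENNReal.toReal_one] at h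
  linarith

theorem expect_coin (f : Bool → ℝ≥0∞) : expect coin f = 2⁻¹ * (f true + f false) := by
  rw [expect, tsum_bool, coin]
  simp only [PMF.uniformOfFintype_apply, Fintype.card_bool, Nat.cast_ofNat]
  ring

theorem expect_coin_le {f : Bool → ℝ≥0∞} {a b : ℝ} (h1 : f true ≤ ENNReal.ofReal a)
    (h0 : f false ≤ ENNReal.ofReal b) (ha : 0 ≤ a) (hb : 0 ≤ b) :
    expect coin f ≤ ENNReal.ofReal ((a + b) / 2) := by
  rw [expect_coin, div_eq_inv_mul, ENNReal.ofReal_mul (by norm_num), ENNReal.ofReal_add ha hb,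
    ENNReal.ofReal_inv_of_pos (by norm_num)]
  simp only [ENNReal.ofReal_ofNat]
  gcongr

/-! ### Independent samples -/

/-- Independent samples from the given distributions. -/
def indep : List (PMF α) → PMF (List α)
  | [] => PMF.pure []
  | d :: ds => d.bind fun a => (indep ds).map fun l => a :: l

theorem iid_eq_indep (d : PMF α) (m : ℕ) : iid d m = indep (List.replicate m d) := by
  induction m with
  | zero => rfl
  | succ m ih => rw [iid, List.replicate_succ, indep, ih]

theorem concatAll_eq_indep (ds : List (PMF (List Bool))) :
    concatAll ds = (indep ds).map List.flatten := by
  induction ds with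
  | nil => simp [concatAll, indep, PMF.pure_map]
  | cons d ds ih =>
    rw [concatAll, indep, PMF.map_bind, ih]
    simp only [PMF.map_comp]
    rfl

theorem length_of_mem_indep {ds : List (PMF α)} {l : List α} (h : l ∈ (indep ds).support) :
    l.length = ds.length := by
  induction ds generalizing l with
  | nil => simpa [indep] using h
  | cons d ds ih =>
    rw [indep, PMF.mem_support_bind_iff] at h
    obtain ⟨a, -, h⟩ := h
    rw [PMF.mem_support_map_iff] at h
    obtain ⟨l, hl, rfl⟩ := h
    simp [ih hl]

theorem forall_of_mem_iid {d : PMF α} {P : α → Prop} (hP : ∀ a ∈ d.support, P a) {m : ℕ}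
    {l : List α} (h : l ∈ (iid d m).support) : ∀ a ∈ l, P a := by
  induction m generalizing l with
  | zero => simp_all [iid]
  | succ m ih =>
    rw [iid, PMF.mem_support_bind_iff] at h
    obtain ⟨a, ha, h⟩ := h
    rw [PMF.mem_support_map_iff] at h
    obtain ⟨l, hl, rfl⟩ := h
    exact List.forall_mem_cons.2 ⟨hP a ha, ih hl⟩

theorem expect_iid_succ (d : PMF α) (m : ℕ) (F : List α → ℝ≥0∞) :
    expect (iid d (m + 1)) F = expect d fun a => expect (iid d m) fun l => F (a :: l) := by
  simp only [iid, expect_bind, expect_map]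

theorem expect_indep_cons (d : PMF α) (ds : List (PMF α)) (F : List α → ℝ≥0∞) :
    expect (indep (d :: ds)) F = expect d fun a => expect (indep ds) fun l => F (a :: l) := by
  simp only [indep, expect_bind, expect_map]

/-- Sampling two-stage experiments independently amounts to sampling all first stages first. -/
theorem expect_iid_bind_map (d : PMF α) (D : α → PMF β) (φ : α → β → γ) (m : ℕ)
    (F : List γ → ℝ≥0∞) :
    expect (iid (d.bind fun a => (D a).map (φ a)) m) F =
      expect (iid d m) fun as => expect (indep (as.map D)) fun bs =>
        F (List.zipWith φ as bs) := by
  induction m generalizing F with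
  | zero => simp [iid, indep, expect_pure]
  | succ m ih =>
    simp only [expect_iid_succ, expect_bind, expect_map, ih, List.map_cons, expect_indep_cons,
      List.zipWith_cons_cons]
    congr 1
    funext a
    rw [expect_comm]

theorem expect_iid_getElem? (d : PMF α) {m t : ℕ} (ht : t < m) (g : Option α → ℝ≥0∞) :
    (expect (iid d m) fun l => g l[t]?) = expect d fun a => g (some a) := by
  induction m generalizing t with
  | zero => omega
  | succ m ih =>
    rw [expect_iid_succ]
    cases t with
    | zero => simp [expect_const]
    | succ t => simp only [List.getElem?_cons_succ, ih (Nat.lt_of_succ_lt_succ ht), expect_const]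

/-- Independence of the blocks enters robustness here: the probability that all blocks fail is a
product. -/
theorem expect_indep_prod (ps : List α) (D : α → PMF β) (g : α → β → ℝ≥0∞) :
    (expect (indep (ps.map D)) fun bs => (List.zipWith g ps bs).prod) =
      (ps.map fun p => expect (D p) (g p)).prod := by
  induction ps with
  | nil => simp [indep, expect_pure]
  | cons p ps ih =>
    simp only [List.map_cons, expect_indep_cons, List.zipWith_cons_cons, List.prod_cons,
      expect_mul_left, expect_mul_right, ih]

/-! ### Repeated tests -/

theorem anyAccepts_false_le {ds : List (PMF Bool)} {d : PMF Bool} (h : d ∈ ds) :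
    anyAccepts ds false ≤ d false := by
  induction ds with
  | nil => simp at h
  | cons d' ds ih =>
    rw [anyAccepts, bind_apply_eq_expect, expect, tsum_bool]
    simp only [Bool.false_eq_true, if_false, if_true, PMF.pure_apply_of_ne true false (by simp), mul_zero, add_zero]
    rcases List.mem_cons.1 h with rfl | h
    · exact mul_le_of_le_one_right' (PMF.coe_le_one _ _)
    · exact (mul_le_of_le_one_left' (PMF.coe_le_one _ _)).trans (ih h)

/-- The union bound, used for soundness; the preceding lemma is its counterpart for robustness. -/
theorem anyAccepts_true_le (ds : List (PMF Bool)) :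
    anyAccepts ds true ≤ (ds.map fun d => d true).sum := by
  induction ds with
  | nil => simp [anyAccepts]
  | cons d ds ih =>
    rw [anyAccepts, bind_apply_eq_expect, expect, tsum_bool, List.map_cons, List.sum_cons,
      add_comm]
    simp only [Bool.false_eq_true, if_false, if_true, PMF.pure_apply_self, mul_one]
    gcongr
    exact (mul_le_of_le_one_left' (PMF.coe_le_one _ _)).trans ih

end Expect

end
end EditPRC

/-! ### Negligible functions, keys as lists of parts, and soundness. -/

namespace EditPRC
noncomputable section

open scoped ENNReal

variable {kind : KeyKind} {H : Scheme} {𝓔 : Set Channel}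

/-! ### Negligible functions -/

theorem Negligible.mono {f g : ℕ → ℝ} (hg : Negligible g) (h : ∀ᶠ κ in atTop, f κ ≤ g κ) :
    Negligible f := by
  intro c hc
  obtain ⟨N, hN⟩ := hg c hc
  obtain ⟨N', hN'⟩ := eventually_atTop.1 h
  exact ⟨max N N', fun κ hκ => (hN' κ (le_trans (le_max_right _ _) hκ)).trans
    (hN κ (le_trans (le_max_left _ _) hκ))⟩

theorem negligible_iff {f : ℕ → ℝ} :
    Negligible f ↔ ∀ c : ℝ, 0 < c → ∀ᶠ κ : ℕ in atTop, f κ ≤ (κ : ℝ) ^ (-c) := by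
  simp only [Negligible, eventually_atTop]

theorem PolyBounded.eventually_le_pow {T : ℕ → ℕ} (hT : PolyBounded T) :
    ∃ d : ℕ, ∀ᶠ κ in atTop, T κ ≤ κ ^ d := by
  obtain ⟨q, hq⟩ := hT
  refine ⟨q.natDegree + 1, ?_⟩
  -- `q.eval 1` is the sum of the coefficients; beyond it, one extra factor `κ` absorbs them all.
  filter_upwards [eventually_ge_atTop (max 1 (q.eval 1))] with κ hκ
  refine (hq κ).trans ?_
  have h1 : 1 ≤ κ := le_trans (le_max_left _ _) hκ
  calc q.eval κ = ∑ i ∈ Finset.range (q.natDegree + 1), q.coeff i * κ ^ i :=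
        Polynomial.eval_eq_sum_range κ
    _ ≤ ∑ i ∈ Finset.range (q.natDegree + 1), q.coeff i * κ ^ q.natDegree := by
        refine Finset.sum_le_sum fun i hi => Nat.mul_le_mul_left _ (Nat.pow_le_pow_right h1 ?_)
        exact Nat.lt_succ_iff.1 (Finset.mem_range.1 hi)
    _ = q.eval 1 * κ ^ q.natDegree := by
        rw [Polynomial.eval_eq_sum_range, Finset.sum_mul]
        simp
    _ ≤ κ * κ ^ q.natDegree := Nat.mul_le_mul_right _ (le_trans (le_max_right _ _) hκ)
    _ = κ ^ (q.natDegree + 1) := by ring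

theorem Negligible.poly_mul {f : ℕ → ℝ} (hf : Negligible f) {T : ℕ → ℕ} (hT : PolyBounded T) :
    Negligible fun κ => T κ * f κ := by
  obtain ⟨d, hd⟩ := hT.eventually_le_pow
  rw [negligible_iff] at *
  intro c hc
  filter_upwards [hd, hf (c + d) (by positivity), eventually_gt_atTop 0] with κ h1 h2 h3
  have h3' : (0 : ℝ) < κ := by exact_mod_cast h3
  calc (T κ : ℝ) * f κ ≤ T κ * (κ : ℝ) ^ (-(c + d)) := by gcongr
    _ ≤ (κ ^ d : ℕ) * (κ : ℝ) ^ (-(c + d)) := by gcongr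
    _ = (κ : ℝ) ^ (-c) := by
        rw [Nat.cast_pow, ← Real.rpow_natCast, ← Real.rpow_add h3']
        congr 1; ring

theorem Negligible.add {f g : ℕ → ℝ} (hf : Negligible f) (hg : Negligible g) :
    Negligible fun κ => f κ + g κ := by
  rw [negligible_iff] at *
  intro c hc
  filter_upwards [hf (c + 1) (by positivity), hg (c + 1) (by positivity),
    eventually_ge_atTop 2] with κ h1 h2 h3
  have h3' : (2 : ℝ) ≤ κ := by exact_mod_cast h3
  calc f κ + g κ ≤ 2 * (κ : ℝ) ^ (-(c + 1)) := by linarith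
    _ ≤ κ * (κ : ℝ) ^ (-(c + 1)) := by gcongr
    _ = (κ : ℝ) ^ (-c) := by
        nth_rewrite 1 [← Real.rpow_one (κ : ℝ)]
        rw [← Real.rpow_add (by positivity)]
        congr 1; ring

theorem Negligible.eventually_le {f : ℕ → ℝ} (hf : Negligible f) {ε : ℝ} (hε : 0 < ε) :
    ∀ᶠ κ in atTop, f κ ≤ ε := by
  have h1 : Tendsto (fun κ : ℕ => (κ : ℝ) ^ (-(1 : ℝ))) atTop (nhds 0) :=
    (tendsto_rpow_neg_atTop one_pos).comp tendsto_natCast_atTop_atTop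
  filter_upwards [(negligible_iff.1 hf) 1 one_pos, h1.eventually_le_const hε] with κ h2 h3
  exact h2.trans h3

/-! ### The keys of the construction -/

/-- The encoder's part of the key of a block. -/
def encPart (k : (List Bool × List Bool) × List Bool × List Bool) :
    List Bool × List Bool × List Bool := (k.1.1, k.2.1, k.2.2)

/-- The decoder's part of the key of a block. -/
def decPart (k : (List Bool × List Bool) × List Bool × List Bool) :
    List Bool × List Bool × List Bool := (k.1.2, k.2.1, k.2.2)

/-- The key that consists of the given parts. -/
def joinParts (ps : List (List Bool × List Bool × List Bool)) : List Bool :=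
  (ps.map fun p => p.1 ++ p.2.1 ++ p.2.2).flatten

theorem map_readPart_joinParts (H : Scheme) (k κ : ℕ)
    (ps : List (List Bool × List Bool × List Bool))
    (h : ∀ p ∈ ps, p.1.length = k ∧ p.2.1.length = 2 * H.len κ ∧ p.2.2.length = H.len κ) :
    (List.range ps.length).map (readPart H k κ (joinParts ps)) = ps := by
  induction ps with
  | nil => rfl
  | cons p ps ih =>
    obtain ⟨⟨h1, h2, h3⟩, h'⟩ := List.forall_mem_cons.1 h
    obtain ⟨a, b, c⟩ := p
    simp only at h1 h2 h3
    rw [List.length_cons, List.range_succ_eq_map, List.map_cons, List.map_map]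
    have hd : (joinParts ((a, b, c) :: ps)).drop (partLen H k κ) = joinParts ps := by
      rw [joinParts, List.map_cons, List.flatten_cons]
      exact List.drop_left' (by simp [partLen, h1, h2, h3, Nat.add_assoc])
    congr 1
    · simp only [readPart, joinParts, List.map_cons, List.flatten_cons, zero_mul, List.drop_zero,
        List.append_assoc]
      subst h1
      rw [List.take_left, List.drop_left, ← h2, List.take_left, ← h3, ← List.drop_drop,
        List.drop_left, List.drop_left, List.take_left]
    · refine Eq.trans ?_ (ih h')
      refine List.map_congr_left fun t _ => ?_
      rw [Function.comp_apply, ← readPart_drop, hd]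

theorem expect_cgkCode_keyGen (H : Scheme) (ℓ : ℕ → ℕ) (κ : ℕ)
    (F : List Bool × List Bool → ℝ≥0∞) :
    expect ((cgkCode H ℓ).keyGen κ) F = expect (iid (blockKeyGen H κ) (ℓ κ)) fun ks =>
      F (joinParts (ks.map encPart), joinParts (ks.map decPart)) := by
  simp only [cgkCode, expect_map, joinParts, List.map_map]
  rfl

theorem cgkCode_dec_joinParts (hH : IsPRC kind H 𝓔) {ℓ : ℕ → ℕ} {κ : ℕ}
    {ks : List ((List Bool × List Bool) × List Bool × List Bool)}
    (hks : ks ∈ (iid (blockKeyGen H κ) (ℓ κ)).support) (y : List Bool) :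
    (cgkCode H ℓ).dec κ (joinParts (ks.map decPart)) y =
      anyAccepts ((windows y).flatMap fun z => ks.map fun k => windowTest H κ z (decPart k)) := by
  have h := map_readPart_joinParts H (H.decKeyLen κ) κ (ks.map decPart) (by
    intro p hp
    rw [List.mem_map] at hp
    obtain ⟨k, hk, rfl⟩ := hp
    exact (forall_of_mem_iid (fun _ => hH.length_of_mem_blockKeyGen) hks k hk).2.2)
  rw [List.length_map, length_of_mem_iid hks] at h
  rw [cgkCode_dec]
  congr 2
  funext z
  simpa only [windowTests, List.map_map, Function.comp_def] using
    congrArg (List.map (windowTest H κ z)) h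

theorem readPart_encKey (hH : IsPRC kind H 𝓔) {ℓ : ℕ → ℕ} {κ : ℕ}
    {ks : List ((List Bool × List Bool) × List Bool × List Bool)}
    (hks : ks ∈ (iid (blockKeyGen H κ) (ℓ κ)).support) :
    (List.range (ℓ κ)).map (readPart H (H.encKeyLen κ) κ (joinParts (ks.map encPart))) =
      ks.map encPart := by
  have h := map_readPart_joinParts H (H.encKeyLen κ) κ (ks.map encPart) (by
    intro p hp
    rw [List.mem_map] at hp
    obtain ⟨k, hk, rfl⟩ := hp
    have := (forall_of_mem_iid (fun _ => hH.length_of_mem_blockKeyGen) hks k hk).2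
    exact ⟨this.1, this.2.2⟩)
  rwa [List.length_map, length_of_mem_iid hks] at h

theorem cgkCode_enc_joinParts (hH : IsPRC kind H 𝓔) {ℓ : ℕ → ℕ} {κ : ℕ}
    {ks : List ((List Bool × List Bool) × List Bool × List Bool)}
    (hks : ks ∈ (iid (blockKeyGen H κ) (ℓ κ)).support) :
    (cgkCode H ℓ).enc κ (joinParts (ks.map encPart)) =
      (indep (ks.map fun k => encBlock H κ (encPart k))).map List.flatten := by
  rw [← concatAll_eq_indep]
  change concatAll ((List.range (ℓ κ)).map fun t => encBlock H κ (readPart H _ κ _ t)) = _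
  have := congrArg (List.map (encBlock H κ)) (readPart_encKey hH hks)
  simp only [List.map_map, Function.comp_def] at this
  rw [this]

/-! ### Soundness -/

/-- The probability that the fixed string `c` is decoded to `1`. -/
def acceptProb (H : Scheme) (κ : ℕ) (c : List Bool) : ℝ≥0∞ :=
  expect (H.keyGen κ) fun k => H.dec κ k.2 c true

theorem one_sub_rejectProb (H : Scheme) (κ : ℕ) (c : List Bool) :
    1 - H.rejectProb c κ = (acceptProb H κ c).toReal := by
  rw [Scheme.rejectProb, toReal_bool_false]
  simp only [bind_apply_eq_expect, acceptProb]
  ring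

theorem acceptProb_ne_top (H : Scheme) (κ : ℕ) (c : List Bool) : acceptProb H κ c ≠ ⊤ := by
  rw [acceptProb, ← bind_apply_eq_expect]
  exact PMF.apply_ne_top _ _

theorem acceptProb_eq_ofReal (H : Scheme) (κ : ℕ) (c : List Bool) :
    acceptProb H κ c = ENNReal.ofReal (1 - H.rejectProb c κ) := by
  rw [one_sub_rejectProb, ENNReal.ofReal_toReal (acceptProb_ne_top H κ c)]

/-- All strings of the codeword length are decoded to `1` with uniformly negligible
probability. -/
theorem IsPRC.exists_acceptProb_le (hH : IsPRC kind H 𝓔) :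
    ∃ σ : ℕ → ℝ, Negligible σ ∧ (∀ κ, 0 ≤ σ κ) ∧
      ∀ κ c, c.length = H.len κ → acceptProb H κ c ≤ ENNReal.ofReal (σ κ) := by
  -- There are finitely many strings of each length, so a worst one exists; soundness applied to the
  -- sequence of worst strings is uniform.
  have h : ∀ κ, ∃ c : List Bool, c.length = H.len κ ∧
      ∀ c', c'.length = H.len κ → acceptProb H κ c' ≤ acceptProb H κ c := fun κ =>
    Set.exists_max_image {c : List Bool | c.length = H.len κ} (acceptProb H κ)
      (List.finite_length_eq Bool _) ⟨List.replicate (H.len κ) false, List.length_replicate⟩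
  choose c hc hmax using h
  refine ⟨fun κ => 1 - H.rejectProb (c κ) κ, hH.sound c ?_, fun κ => ?_, fun κ c' hc' => ?_⟩
  · obtain ⟨q, hq⟩ := hH.polyBounded_len
    exact ⟨q, fun κ => (hc κ).trans_le (hq κ)⟩
  · exact (one_sub_rejectProb H κ (c κ)).ge.trans' ENNReal.toReal_nonneg
  · exact (hmax κ c' hc').trans_eq (acceptProb_eq_ofReal H κ (c κ))

theorem expect_listSum {α β : Type} (p : PMF α) (l : List β) (f : β → α → ℝ≥0∞) :
    (expect p fun a => (l.map fun b => f b a).sum) = (l.map fun b => expect p (f b)).sum := by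
  induction l with
  | nil => simp [expect]
  | cons b l ih => simp only [List.map_cons, List.sum_cons, expect_add, ih]

theorem length_windows_le (y : List Bool) : (windows y).length ≤ y.length * y.length := by
  rw [windows, List.length_flatMap]
  refine (List.sum_le_card_nsmul _ y.length ?_).trans (by simp)
  simp only [List.length_map, List.length_range, List.mem_map, List.mem_range]
  rintro _ ⟨i, -, rfl⟩
  exact Nat.sub_le _ _

theorem length_emb (m : ℕ) (x r : List Bool) : (emb m x r).length = m := length_embFrom r 0 m x

/-- Once seed and mask are fixed, the tested string is fixed too, and the inner key pair is
independent of it. -/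
theorem expect_windowTest_le {κ : ℕ} {σ : ℝ≥0∞}
    (hσ : ∀ c, c.length = H.len κ → acceptProb H κ c ≤ σ) (z : List Bool) :
    (expect (blockKeyGen H κ) fun k => windowTest H κ z (decPart k) true) ≤ σ := by
  simp only [blockKeyGen, expect_bind, expect_map]
  rw [expect_comm]
  refine expect_le_of_support fun r hr => ?_
  rw [expect_comm]
  refine expect_le_of_support fun e he =>
    hσ (xorStr (emb (H.len κ) (fit (blockLen H κ) z) r) e) ?_
  rw [xorStr, List.length_zipWith, length_emb, length_of_mem_uniformBits he, min_self]

/-- A union bound over polynomially many pairs of a window and a block, each accepted with the same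
negligible probability. -/
theorem cgkCode_sound (hH : IsPRC kind H 𝓔) {ℓ : ℕ → ℕ} (hℓ : UnaryPolyTime ℓ)
    (c : ℕ → List Bool) (hc : ∃ q : Polynomial ℕ, ∀ κ, (c κ).length ≤ q.eval κ) :
    Negligible fun κ => 1 - (cgkCode H ℓ).rejectProb (c κ) κ := by
  obtain ⟨σ, hσ, hσ0, hacc⟩ := hH.exists_acceptProb_le
  obtain ⟨q, hq⟩ := hc
  have hℓ' := hℓ.polyBounded
  refine (hσ.poly_mul (T := fun κ => q.eval κ * q.eval κ * ℓ κ) (by fun_prop)).mono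
    (Eventually.of_forall fun κ => ?_)
  rw [one_sub_rejectProb]
  refine ENNReal.toReal_le_of_le_ofReal (mul_nonneg (Nat.cast_nonneg _) (hσ0 κ)) ?_
  rw [acceptProb, expect_cgkCode_keyGen]
  -- The sum runs over block indices instead of the random keys, so that its index set is
  -- deterministic and the expectation can be taken termwise.
  have key : ∀ ks ∈ (iid (blockKeyGen H κ) (ℓ κ)).support,
      (cgkCode H ℓ).dec κ (joinParts (ks.map decPart)) (c κ) true ≤
        (((windows (c κ)) ×ˢ (List.range (ℓ κ))).map fun p =>
          ((ks[p.2]?).elim 0 fun k => windowTest H κ p.1 (decPart k) true)).sum := by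
    intro ks hks
    rw [cgkCode_dec_joinParts hH hks]
    refine (anyAccepts_true_le _).trans_eq ?_
    have e : ∀ z, (ks.map fun k => windowTest H κ z (decPart k)) =
        (List.range (ℓ κ)).map fun t =>
          ((ks[t]?).elim (PMF.pure false) fun k => windowTest H κ z (decPart k)) := by
      intro z
      refine List.ext_getElem (by simp [length_of_mem_iid hks]) fun t h1 h2 => ?_
      rw [List.length_map] at h1
      simp [h1]
    simp only [e, SProd.sprod, List.product, List.map_flatMap, List.map_map]
    congr 1
    refine List.flatMap_congr fun z _ => List.map_congr_left fun t _ => ?_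
    simp only [Function.comp_apply]
    cases ks[t]? <;> simp
  refine (expect_mono_support key).trans ?_
  rw [expect_listSum]
  refine (List.sum_le_card_nsmul _ (ENNReal.ofReal (σ κ)) ?_).trans ?_
  · intro x hx
    rw [List.mem_map] at hx
    obtain ⟨⟨z, t⟩, hp, rfl⟩ := hx
    have ht : t < ℓ κ := by simpa using (List.mem_product.1 hp).2
    simp only
    rw [expect_iid_getElem? _ ht (fun o => o.elim 0 fun k => windowTest H κ z (decPart k) true)]
    exact expect_windowTest_le (hacc κ) z
  · rw [List.length_map, List.length_product, List.length_range, ENNReal.ofReal_mul (by positivity),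
      ENNReal.ofReal_natCast, nsmul_eq_mul]
    gcongr
    exact (length_windows_le _).trans (Nat.mul_le_mul (hq κ) (hq κ))

end
end EditPRC

/-! ### Edit distance and Hamming distance. -/

namespace EditPRC
noncomputable section

open scoped ENNReal

/-! ### Edit distance -/

theorem lcsLength_bddAbove (x y : List Bool) :
    BddAbove {k : ℕ | ∃ w : List Bool, w.Sublist x ∧ w.Sublist y ∧ w.length = k} :=
  ⟨x.length, by rintro k ⟨w, hx, -, rfl⟩; exact hx.length_le⟩

/-- Together with `exists_commonSublist` this characterises the distance: any common subsequence
bounds it and some common subsequence attains it. The facts below are read off from such witnesses.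
-/
theorem editDist_add_le {w x y : List Bool} (hx : w.Sublist x) (hy : w.Sublist y) :
    editDist x y + 2 * w.length ≤ x.length + y.length := by
  have h1 : w.length ≤ lcsLength x y := le_csSup (lcsLength_bddAbove x y) ⟨w, hx, hy, rfl⟩
  have h2 := hx.length_le
  have h3 := hy.length_le
  rw [editDist]
  omega

theorem exists_commonSublist (x y : List Bool) : ∃ w : List Bool, w.Sublist x ∧ w.Sublist y ∧
    editDist x y + 2 * w.length = x.length + y.length := by
  obtain ⟨w, hx, hy, hw⟩ : lcsLength x y ∈
      {k : ℕ | ∃ w : List Bool, w.Sublist x ∧ w.Sublist y ∧ w.length = k} :=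
    Nat.sSup_mem ⟨0, [], by simp⟩ (lcsLength_bddAbove x y)
  have h2 := hx.length_le
  have h3 := hy.length_le
  refine ⟨w, hx, hy, ?_⟩
  rw [editDist, ← hw]
  omega

theorem editDist_comm (x y : List Bool) : editDist x y = editDist y x := by
  obtain ⟨w, hx, hy, h⟩ := exists_commonSublist x y
  obtain ⟨w', hy', hx', h'⟩ := exists_commonSublist y x
  have := editDist_add_le hy hx
  have := editDist_add_le hx' hy'
  omega

theorem editDist_nil (x : List Bool) : editDist x [] = x.length := by
  obtain ⟨w, hx, hy, h⟩ := exists_commonSublist x []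
  have := hy.length_le
  simp only [List.length_nil] at this h
  omega

theorem editDist_le_cons_cons (b : Bool) (x z : List Bool) :
    editDist x z ≤ editDist (b :: x) (b :: z) := by
  obtain ⟨w, hx, hz, h⟩ := exists_commonSublist (b :: x) (b :: z)
  have := editDist_add_le hx.tail hz.tail
  simp only [List.length_tail, List.tail_cons, List.length_cons] at this h
  omega

theorem editDist_le_cons_left (b : Bool) (x z : List Bool) :
    editDist x z ≤ editDist (b :: x) z + 1 := by
  obtain ⟨w, hx, hz, h⟩ := exists_commonSublist (b :: x) z
  have := editDist_add_le hx.tail ((List.tail_sublist w).trans hz)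
  simp only [List.length_tail, List.tail_cons, List.length_cons] at this h
  omega

theorem editDist_le_cons_right (b : Bool) (x z : List Bool) :
    editDist x z ≤ editDist x (b :: z) + 1 := by
  rw [editDist_comm x z, editDist_comm x]
  exact editDist_le_cons_left b z x

/-- A common subsequence cannot use both of two different leading bits, so an optimal alignment
deletes one of them. The random walk gets its downward step from this. -/
theorem editDist_cons_cons_of_ne {b c : Bool} (hbc : b ≠ c) (x z : List Bool) :
    editDist x (c :: z) + 1 = editDist (b :: x) (c :: z) ∨
      editDist (b :: x) z + 1 = editDist (b :: x) (c :: z) := by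
  have h1 := editDist_le_cons_left b x (c :: z)
  have h2 := editDist_le_cons_right c (b :: x) z
  obtain ⟨w, hx, hz, h⟩ := exists_commonSublist (b :: x) (c :: z)
  have key : w.Sublist x ∨ w.Sublist z := by
    rcases List.sublist_cons_iff.1 hx with h | ⟨r, rfl, h⟩
    · exact .inl h
    · rcases List.sublist_cons_iff.1 hz with h' | ⟨r', hr', h'⟩
      · exact .inr h'
      · simp [hbc] at hr'
  obtain ⟨w', hx', hz', h'⟩ := exists_commonSublist x (c :: z)
  obtain ⟨w'', hx'', hz'', h''⟩ := exists_commonSublist (b :: x) z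
  have h3 := editDist_add_le (hx'.cons b) hz'
  have h4 := editDist_add_le hx'' (hz''.cons c)
  simp only [List.length_cons] at *
  rcases key with hk | hk
  · have := editDist_add_le hk hz
    simp only [List.length_cons] at this
    omega
  · have := editDist_add_le hx hk
    simp only [List.length_cons] at this
    omega

/-- If the first string is cut into blocks, the second one can be cut accordingly. -/
theorem exists_split_editDist (ys : List (List Bool)) (y' : List Bool) :
    ∃ (zs : List (List Bool)) (z' : List Bool), zs.length = ys.length ∧ zs.flatten ++ z' = y' ∧
      (List.zipWith editDist ys zs).sum ≤ editDist ys.flatten y' := by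
  induction ys generalizing y' with
  | nil => exact ⟨[], y', rfl, rfl, by simp⟩
  | cons y ys ih =>
    rw [List.flatten_cons]
    obtain ⟨w, hy, hy', h⟩ := exists_commonSublist (y ++ ys.flatten) y'
    -- An optimal common subsequence is cut at the end of the first block; its two parts determine
    -- where the second string is cut.
    obtain ⟨w₁, w₂, rfl, h1, h2⟩ := List.sublist_append_iff.1 hy
    obtain ⟨z, z', rfl, h3, h4⟩ := List.append_sublist_iff.1 hy'
    obtain ⟨zs, z'', hzs, rfl, hsum⟩ := ih z'
    refine ⟨z :: zs, z'', by simp [hzs], by simp, ?_⟩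
    have h5 := editDist_add_le h1 h3
    have h6 := editDist_add_le h2 h4
    simp only [List.zipWith_cons_cons, List.sum_cons]
    simp only [List.length_append] at h h6
    omega

/-- Truncating or padding changes $||z|-n|$ bits. Since $|y|=n$, this is at most the edit distance
already present. -/
theorem editDist_fit_le {n : ℕ} {y z : List Bool} (hy : y.length = n) :
    editDist y (fit n z) ≤ 2 * editDist y z := by
  obtain ⟨w, h1, h2, h⟩ := exists_commonSublist y z
  have hl := length_fit n z
  have := h1.length_le
  have := h2.length_le
  rcases le_total z.length n with hz | hz
  · have h3 : w.Sublist (fit n z) := by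
      rw [fit, List.take_append, List.take_of_length_le hz]
      exact h2.trans (List.sublist_append_left _ _)
    have := editDist_add_le h1 h3
    omega
  · rw [fit, List.take_append_of_le_length hz] at *
    rw [← List.take_append_drop n z] at h2
    obtain ⟨w₁, w₂, rfl, h3, h4⟩ := List.sublist_append_iff.1 h2
    have h5 := editDist_add_le ((List.sublist_append_left _ _).trans h1) h3
    have h6 := h4.length_le
    simp only [List.length_append, List.length_drop] at *
    omega

theorem mem_windows {p z q : List Bool} (hz : z ≠ []) : z ∈ windows (p ++ z ++ q) := by
  have hz' := List.length_pos_of_ne_nil hz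
  simp only [windows, List.mem_flatMap, List.mem_range, List.mem_map, List.length_append]
  refine ⟨p.length, by omega, z.length - 1, by omega, ?_⟩
  rw [List.append_assoc, List.drop_left, Nat.sub_add_cancel hz', List.take_left]

theorem mem_windows_flatten {zs : List (List Bool)} {z' z : List Bool} (h : z ∈ zs) (hz : z ≠ []) :
    z ∈ windows (zs.flatten ++ z') := by
  obtain ⟨s, t, rfl⟩ := List.append_of_mem h
  simpa using mem_windows (p := s.flatten) (q := t.flatten ++ z') hz

/-! ### Hamming distance -/

theorem xorStr_comm (x y : List Bool) : xorStr x y = xorStr y x :=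
  List.zipWith_comm_of_comm Bool.xor_comm

theorem xorStr_assoc (x y z : List Bool) : xorStr (xorStr x y) z = xorStr x (xorStr y z) := by
  induction x generalizing y z with
  | nil => simp [xorStr]
  | cons a x ih =>
    cases y with
    | nil => simp [xorStr]
    | cons b y =>
      cases z with
      | nil => simp [xorStr]
      | cons c z =>
        have := ih y z
        simp only [xorStr] at this
        simp [xorStr, this]

theorem xorStr_self_left {x y : List Bool} (h : x.length = y.length) :
    xorStr x (xorStr x y) = y := by
  induction x generalizing y with
  | nil => simp [xorStr, List.length_eq_zero_iff.1 h.symm]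
  | cons a x ih =>
    obtain ⟨b, y, rfl⟩ := List.exists_cons_of_length_eq_add_one h.symm
    have := ih (y := y) (by simpa using h)
    simp only [xorStr] at this
    simp [xorStr, this]

theorem length_xorStr {x y : List Bool} (h : x.length = y.length) :
    (xorStr x y).length = y.length := by simp [xorStr, h]

theorem hamDist_nil (x : List Bool) : hamDist [] x = 0 := by simp [hamDist, xorStr]

theorem hamDist_cons_self (a : Bool) (x y : List Bool) :
    hamDist (a :: x) (a :: y) = hamDist x y := by simp [hamDist, xorStr]

theorem hamDist_cons_ne {a b : Bool} (h : a ≠ b) (x y : List Bool) :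
    hamDist (a :: x) (b :: y) = hamDist x y + 1 := by
  cases a <;> cases b <;> simp_all [hamDist, xorStr]

theorem hamDist_comm (x y : List Bool) : hamDist x y = hamDist y x := by
  rw [hamDist, hamDist, xorStr_comm]

theorem hamDist_triangle {x y z : List Bool} (hxy : x.length = y.length)
    (hyz : y.length = z.length) : hamDist x z ≤ hamDist x y + hamDist y z := by
  induction x generalizing y z with
  | nil => simp [hamDist_nil]
  | cons a x ih =>
    obtain ⟨b, y, rfl⟩ := List.exists_cons_of_length_eq_add_one hxy.symm
    obtain ⟨c, z, rfl⟩ := List.exists_cons_of_length_eq_add_one hyz.symm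
    have := ih (y := y) (z := z) (by simpa using hxy) (by simpa using hyz)
    cases a <;> cases b <;> cases c <;>
      simp only [hamDist_cons_self, hamDist_cons_ne, ne_eq, reduceCtorEq, not_false_eq_true] <;>
      omega

end
end EditPRC

/-! ### Hamming distance of two embeddings with a common seed. -/

namespace EditPRC
noncomputable section

open scoped ENNReal

/-! ### The random walk that dominates the embedding -/

/-- The probability that a lazy random walk, which starts at `k` and moves up or down with
probability `1/4` each, makes at least `K` steps before it reaches `0`. -/
def walkBound : ℕ → ℕ → ℝ
  | 0, _ => 1
  | _ + 1, 0 => 0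
  | K + 1, k + 1 => (walkBound K k + 2 * walkBound K (k + 1) + walkBound K (k + 2)) / 4

theorem walkBound_nonneg (K k : ℕ) : 0 ≤ walkBound K k := by
  induction K generalizing k with
  | zero => simp [walkBound]
  | succ K ih =>
    cases k with
    | zero => simp [walkBound]
    | succ k =>
      have := ih k; have := ih (k + 1); have := ih (k + 2)
      rw [walkBound]; positivity

theorem walkBound_le_one (K k : ℕ) : walkBound K k ≤ 1 := by
  induction K generalizing k with
  | zero => simp [walkBound]
  | succ K ih =>
    cases k with
    | zero => simp [walkBound]
    | succ k =>
      have := ih k; have := ih (k + 1); have := ih (k + 2)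
      rw [walkBound]; linarith

theorem walkBound_mono (K : ℕ) : Monotone (walkBound K) := by
  induction K with
  | zero => exact fun _ _ _ => le_of_eq (by simp [walkBound])
  | succ K ih =>
    refine monotone_nat_of_le_succ fun k => ?_
    cases k with
    | zero => exact (le_of_eq (by simp [walkBound])).trans (walkBound_nonneg _ _)
    | succ k =>
      have h1 := ih (Nat.le_succ k)
      have h2 := ih (Nat.le_succ (k + 1))
      have h3 := ih (Nat.le_succ (k + 2))
      simp only [walkBound]
      simp only [Nat.succ_eq_add_one] at h1 h2 h3
      linarith

/-- Either the walk reaches `R` before `0`, with probability `k / R`, or it stays inside the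
interval, where the expected exit time of the lazy walk is `2k(R - k)` and Markov's inequality
applies. The right-hand side satisfies the recursion of `walkBound` with equality inside the
interval and dominates it on the boundary. -/
theorem walkBound_le {R K₀ : ℕ} (hR : 0 < R) (hK : 0 < K₀) {k j : ℕ} (hk : k ≤ R) (hj : j ≤ K₀) :
    walkBound j k ≤ k / R + (2 * k * (R - k) + K₀ - j) / K₀ := by
  have hR' : (0 : ℝ) < R := by exact_mod_cast hR
  have hK' : (0 : ℝ) < K₀ := by exact_mod_cast hK
  induction j generalizing k with
  | zero =>
    have hk' : (k : ℝ) ≤ R := by exact_mod_cast hk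
    have : (1 : ℝ) ≤ (2 * k * (R - k) + K₀ - (0 : ℕ)) / K₀ := by
      rw [le_div_iff₀ hK']
      have : (0 : ℝ) ≤ 2 * k * (R - k) := mul_nonneg (by positivity) (by linarith)
      push_cast; linarith
    have h0 : (0 : ℝ) ≤ k / R := by positivity
    simp only [walkBound]; linarith
  | succ j ih =>
    have hj' : (j : ℝ) + 1 ≤ K₀ := by exact_mod_cast hj
    cases k with
    | zero =>
      simp only [walkBound, Nat.cast_zero, zero_div, mul_zero, zero_mul, zero_add]
      push_cast
      exact div_nonneg (by linarith) hK'.le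
    | succ k =>
      rcases hk.eq_or_lt with rfl | hk
      · refine (walkBound_le_one _ _).trans ?_
        rw [div_self hR'.ne', sub_self, mul_zero, zero_add]
        push_cast
        have : (0 : ℝ) ≤ (K₀ - (j + 1)) / K₀ := div_nonneg (by linarith) hK'.le
        linarith
      · have h1 := ih (k := k) (by omega) (by omega)
        have h2 := ih (k := k + 1) (by omega) (by omega)
        have h3 := ih (k := k + 2) (by omega) (by omega)
        rw [walkBound]
        refine (div_le_div_of_nonneg_right (add_le_add (add_le_add h1
          (mul_le_mul_of_nonneg_left h2 zero_le_two)) h3) (by norm_num)).trans (le_of_eq ?_)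
        push_cast
        field_simp
        ring

theorem walkBound_le_quarter {k K : ℕ} (h : 112 * k ^ 2 ≤ K) (hK : 0 < K) :
    walkBound K k ≤ 1 / 4 := by
  rcases Nat.eq_zero_or_pos k with rfl | hk
  · obtain ⟨K, rfl⟩ := Nat.exists_eq_add_of_lt hK
    simp [walkBound]
  -- With `R = 8k` the first term is `1/8` and the second is `14k² / K`, which is at most `1/8`
  -- exactly when `K ≥ 112k²`.
  · refine (walkBound_le (R := 8 * k) (by omega) hK (by omega) le_rfl).trans ?_
    have hk' : (0 : ℝ) < k := by exact_mod_cast hk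
    have hK' : (0 : ℝ) < K := by exact_mod_cast hK
    have h' : 112 * (k : ℝ) ^ 2 ≤ K := by exact_mod_cast h
    push_cast
    have h1 : (k : ℝ) / (8 * k) = 1 / 8 := by field_simp
    have h2 : (2 * k * (8 * k - k) + K - K : ℝ) / K ≤ 1 / 8 := by
      rw [div_le_iff₀ hK']; nlinarith
    rw [h1]; linarith

/-! ### The embedding expands distances by little -/

/-- The rest of the input after one step whose seed bits are `a` and `b`. -/
def advance (a b : Bool) : List Bool → List Bool
  | [] => []
  | c :: x => if (bif c then b else a) then x else c :: x

theorem embFrom_cons_cons (a b : Bool) (r : List Bool) (m : ℕ) (x : List Bool) :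
    embFrom (a :: b :: r) 0 (m + 1) x = x.headD false :: embFrom r 0 m (advance a b x) := by
  rcases x with _ | ⟨_ | _, x⟩ <;> simp [embFrom, embFrom_succ, seedFun, advance]

/-- The probability that the embeddings of two strings differ in at least `K` positions. -/
def embDistProb (m : ℕ) (x z : List Bool) (K : ℕ) : ℝ≥0∞ :=
  expect (uniformBits (2 * m)) fun r =>
    if K ≤ hamDist (embFrom r 0 m x) (embFrom r 0 m z) then 1 else 0

theorem embDistProb_comm (m : ℕ) (x z : List Bool) (K : ℕ) :
    embDistProb m x z K = embDistProb m z x K := by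
  simp only [embDistProb, hamDist_comm]

theorem expect_uniformBits_two_mul_succ (m : ℕ) (F : List Bool → ℝ≥0∞) :
    expect (uniformBits (2 * (m + 1))) F = expect coin fun a => expect coin fun b =>
      expect (uniformBits (2 * m)) fun r => F (a :: b :: r) := by
  rw [show 2 * (m + 1) = 2 * m + 1 + 1 by ring]
  simp only [uniformBits, expect_iid_succ]

theorem embDistProb_succ_of_eq (m : ℕ) {x z : List Bool} (h : x.headD false = z.headD false)
    (K : ℕ) : embDistProb (m + 1) x z K = expect coin fun a => expect coin fun b =>
      embDistProb m (advance a b x) (advance a b z) K := by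
  simp only [embDistProb, expect_uniformBits_two_mul_succ, embFrom_cons_cons, h,
    hamDist_cons_self]

theorem embDistProb_succ_of_ne (m : ℕ) {x z : List Bool} (h : x.headD false ≠ z.headD false)
    (K : ℕ) : embDistProb (m + 1) x z (K + 1) = expect coin fun a => expect coin fun b =>
      embDistProb m (advance a b x) (advance a b z) K := by
  simp only [embDistProb, expect_uniformBits_two_mul_succ, embFrom_cons_cons,
    hamDist_cons_ne h, Nat.add_le_add_iff_right]

theorem expect_ite_le_one {α : Type} (p : PMF α) (P : α → Prop) [DecidablePred P] :
    (expect p fun a => if P a then 1 else 0) ≤ 1 :=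
  expect_le_of_support fun a _ => by split_ifs <;> simp

/-- The CGK coupling. While the current bits agree, both walks use the same seed bit, no error
occurs and the distance of the remaining strings does not grow. When they differ, one error is
counted and the walks move independently. The move that deletes the right bit lowers the distance by
one, the opposite move raises it by at most one, and otherwise it does not exceed its old value. By
monotonicity in the distance, the lazy walk dominates. -/
theorem embDistProb_le (m : ℕ) (x z : List Bool) (K : ℕ) :
    embDistProb m x z K ≤ ENNReal.ofReal (walkBound K (editDist x z)) := by
  induction m generalizing x z K with
  | zero =>
    cases K with
    | zero => exact (expect_ite_le_one _ _).trans (by simp [walkBound])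
    | succ K => simp [embDistProb, embFrom, hamDist_nil, expect_const]
  | succ m ih =>
    cases K with
    | zero => exact (expect_ite_le_one _ _).trans (by simp [walkBound])
    | succ K =>
      have step : ∀ {x' z' : List Bool} {K d : ℕ}, editDist x' z' ≤ d →
          embDistProb m x' z' K ≤ ENNReal.ofReal (walkBound K d) := fun h =>
        (ih _ _ _).trans (ENNReal.ofReal_le_ofReal (walkBound_mono _ h))
      have key : ∀ x z : List Bool,
          embDistProb (m + 1) (true :: x) (false :: z) (K + 1) ≤
            ENNReal.ofReal (walkBound (K + 1) (editDist (true :: x) (false :: z))) := by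
        intro x z
        have h1 := editDist_le_cons_left true x (false :: z)
        have h2 := editDist_le_cons_right false (true :: x) z
        have h3 := editDist_le_cons_left true x z
        have h4 := editDist_le_cons_right false x z
        have h5 := editDist_cons_cons_of_ne (b := true) (c := false) (by simp) x z
        rw [embDistProb_succ_of_ne _ (by simp)]
        obtain ⟨d, hd⟩ : ∃ d, editDist (true :: x) (false :: z) = d + 1 := by
          rcases h5 with h | h <;> exact ⟨_, h.symm⟩
        rw [hd]
        have hnn := walkBound_nonneg K
        rcases h5 with h5 | h5
        · refine (expect_coin_le (expect_coin_le (a := walkBound K (d + 1))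
            (b := walkBound K (d + 2)) (step ?_) (step ?_) (hnn _) (hnn _))
            (expect_coin_le (a := walkBound K d) (b := walkBound K (d + 1))
              (step ?_) (step ?_) (hnn _) (hnn _)) ?_ ?_).trans (ENNReal.ofReal_le_ofReal ?_)
          · simp only [advance, cond_true, cond_false, if_true]; omega
          · simp only [advance, cond_true, cond_false, if_true, Bool.false_eq_true, if_false]; omega
          · simp only [advance, cond_true, cond_false, if_true, Bool.false_eq_true, if_false]; omega
          · simp only [advance, cond_true, cond_false, Bool.false_eq_true, if_false]; omega
          · have := hnn (d + 1); have := hnn (d + 2); positivity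
          · have := hnn (d + 1); have := hnn d; positivity
          · rw [walkBound]; linarith
        · refine (expect_coin_le (expect_coin_le (a := walkBound K (d + 1))
            (b := walkBound K d) (step ?_) (step ?_) (hnn _) (hnn _))
            (expect_coin_le (a := walkBound K (d + 2)) (b := walkBound K (d + 1))
              (step ?_) (step ?_) (hnn _) (hnn _)) ?_ ?_).trans (ENNReal.ofReal_le_ofReal ?_)
          · simp only [advance, cond_true, cond_false, if_true]; omega
          · simp only [advance, cond_true, cond_false, if_true, Bool.false_eq_true, if_false]; omega
          · simp only [advance, cond_true, cond_false, if_true, Bool.false_eq_true, if_false]; omega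
          · simp only [advance, cond_true, cond_false, Bool.false_eq_true, if_false]; omega
          · have := hnn (d + 1); have := hnn d; positivity
          · have := hnn (d + 1); have := hnn (d + 2); positivity
          · rw [walkBound]; linarith
      -- An exhausted string keeps showing `false`. Against a bit `true` only one walk moves, and
      -- the average of the bounds at `l` and `l + 1` is below that of the lazy walk.
      have key' : ∀ x : List Bool, embDistProb (m + 1) x [] (K + 1) ≤
          ENNReal.ofReal (walkBound (K + 1) (editDist x [])) := by
        intro x
        rcases x with _ | ⟨_ | _, x⟩
        · rw [embDistProb_succ_of_eq _ rfl]
          exact expect_le_of_support fun a _ => expect_le_of_support fun b _ => step le_rfl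
        · rw [embDistProb_succ_of_eq _ (by simp)]
          refine expect_le_of_support fun a _ => expect_le_of_support fun b _ => step ?_
          cases a <;> simp [advance, editDist_nil]
        · rw [embDistProb_succ_of_ne _ (by simp)]
          refine expect_le_of_support fun a _ => (expect_coin_le (a := walkBound K x.length)
            (b := walkBound K (x.length + 1)) (step (by simp [advance, editDist_nil]))
            (step (by simp [advance, editDist_nil])) (walkBound_nonneg _ _)
            (walkBound_nonneg _ _)).trans (ENNReal.ofReal_le_ofReal ?_)
          rw [editDist_nil, List.length_cons, walkBound]
          have := walkBound_mono K (show x.length ≤ x.length + 2 by omega)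
          linarith
      rcases z with _ | ⟨c, z⟩
      · exact key' x
      · rcases x with _ | ⟨b, x⟩
        · rw [embDistProb_comm, editDist_comm]
          exact key' _
        · by_cases hbc : b = c
          · subst hbc
            rw [embDistProb_succ_of_eq _ (by simp)]
            refine expect_le_of_support fun a _ => expect_le_of_support fun b' _ => step ?_
            simp only [advance]
            split_ifs
            · exact editDist_le_cons_cons b x z
            · exact le_rfl
          · cases b <;> cases c <;> simp only [not_true_eq_false, reduceCtorEq] at hbc
            · rw [embDistProb_comm, editDist_comm]
              exact key z x
            · exact key x z

end
end EditPRC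

/-! ### The decoding map run backwards, and its errors against the embedding. -/

namespace EditPRC
noncomputable section

open scoped ENNReal

/-! ### The decoding function run backwards -/

/-- The input of the decoding function given its output: the value of the current output bit is
read when its position is fresh, and all other input bits are fair coins. -/
def embNoisy : ℕ → List Bool → List Bool → Bool → PMF (List Bool)
  | 0, _, _, _ => PMF.pure []
  | m + 1, r, [], fresh => coin.bind fun c => (embNoisy m r.tail.tail [] fresh).map (c :: ·)
  | m + 1, r, b :: x, fresh => (if fresh then PMF.pure b else coin).bind fun c =>
      (embNoisy m r.tail.tail (if seedFun r 0 b then x else b :: x) (seedFun r 0 b)).map (c :: ·)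

theorem length_of_mem_embNoisy {m : ℕ} {r x : List Bool} {fresh : Bool} {w : List Bool}
    (h : w ∈ (embNoisy m r x fresh).support) : w.length = m := by
  induction m generalizing r x fresh w with
  | zero => simpa [embNoisy] using h
  | succ m ih =>
    cases x <;>
    · rw [embNoisy, PMF.mem_support_bind_iff] at h
      obtain ⟨c, -, h⟩ := h
      rw [PMF.mem_support_map_iff] at h
      obtain ⟨w, hw, rfl⟩ := h
      simp [ih hw]

theorem embNoisy_nil (m : ℕ) (r : List Bool) (fresh : Bool) :
    embNoisy m r [] fresh = uniformBits m := by
  induction m generalizing r with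
  | zero => rfl
  | succ m ih => simp only [embNoisy, ih]; rfl

theorem expect_uniformBits_succ (m : ℕ) (F : List Bool → ℝ≥0∞) :
    expect (uniformBits (m + 1)) F = expect coin fun a => expect (uniformBits m) fun l =>
      F (a :: l) := expect_iid_succ coin m F

/-- Equality of the joint laws of input and output, proved together for the two states of the walk.
At a fresh position the coin read from the input becomes the output bit; at an assigned one the coin
read is ignored and stays an independent error. In the second statement one output bit is already
`b`, so `L` free positions remain. -/
theorem expect_uniformBits_unembFrom (m : ℕ) :
    (∀ (L : ℕ) (r : List Bool) (F : List Bool → List Bool → ℝ≥0∞),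
      (expect (uniformBits m) fun w => expect (uniformBits (L - (unembFrom L r 0 w 0 none).length))
        fun v => F w (unembFrom L r 0 w 0 none ++ v)) =
      expect (uniformBits L) fun x => expect (embNoisy m r x true) fun w => F w x) ∧
    ∀ (L : ℕ) (r : List Bool) (b : Bool) (F : List Bool → List Bool → ℝ≥0∞),
      (expect (uniformBits m) fun w =>
        expect (uniformBits (L + 1 - (unembFrom (L + 1) r 0 w 0 (some b)).length))
        fun v => F w (unembFrom (L + 1) r 0 w 0 (some b) ++ v)) =
      expect (uniformBits L) fun x => expect (embNoisy m r (b :: x) false) fun w =>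
        F w (b :: x) := by
  induction m with
  | zero => exact ⟨fun L r F => by simp [uniformBits, iid, expect_pure, unembFrom, embNoisy],
      fun L r b F => by simp [uniformBits, iid, expect_pure, unembFrom, embNoisy]⟩
  | succ m ih =>
    obtain ⟨ih1, ih2⟩ := ih
    have key : ∀ (L : ℕ) (r : List Bool) (b : Bool) (F : List Bool → List Bool → ℝ≥0∞),
        (expect (uniformBits m) fun w => expect (uniformBits (L + 1 -
          (if seedFun r 0 b then b :: unembFrom (L + 1) r 1 w 1 none else
            unembFrom (L + 1) r 1 w 0 (some b)).length)) fun v => F w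
          ((if seedFun r 0 b then b :: unembFrom (L + 1) r 1 w 1 none else
            unembFrom (L + 1) r 1 w 0 (some b)) ++ v)) =
        expect (uniformBits L) fun x => expect (embNoisy m r.tail.tail
          (if seedFun r 0 b then x else b :: x) (seedFun r 0 b)) fun w => F w (b :: x) := by
      intro L r b F
      cases seedFun r 0 b
      · simp only [Bool.false_eq_true, if_false, unembFrom_succ _ r 0]
        exact ih2 L _ b F
      · have hi : ∀ w, unembFrom (L + 1) r.tail.tail 0 w 1 none =
            unembFrom L r.tail.tail 0 w 0 none := fun w => unembFrom_index_succ L _ 0 w 0 none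
        simp only [if_true, unembFrom_succ _ r 0, hi, List.length_cons, Nat.add_sub_add_right,
          List.cons_append]
        exact ih1 L _ fun w x => F w (b :: x)
    refine ⟨fun L r F => ?_, fun L r b F => ?_⟩
    · cases L with
      | zero =>
        -- The walk has completed the output; the rest of the input is unconstrained, hence uniform
        -- in `embNoisy` as well.
        have hu : ∀ w, unembFrom 0 r 0 w 0 none = [] := fun w => by cases w <;> simp [unembFrom]
        simp [hu, uniformBits, iid, expect_pure, embNoisy_nil]
      | succ L =>
        rw [expect_uniformBits_succ, expect_uniformBits_succ]
        congr 1
        funext b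
        simp only [unembFrom, Nat.zero_lt_succ, if_true, Option.getD_none, zero_add, embNoisy,
          PMF.pure_bind, expect_map]
        exact key L r b fun w x => F (b :: w) x
    · rw [expect_uniformBits_succ]
      simp only [unembFrom, Nat.zero_lt_succ, if_true, Option.getD_some, zero_add, embNoisy,
        Bool.false_eq_true, if_false, expect_bind, expect_map]
      refine Eq.trans (congrArg (expect coin) (funext fun c =>
        key L r b fun w x => F (c :: w) x)) (expect_comm _ _ _)

/-- A uniform string together with its image under the decoding function. -/
theorem expect_unemb (m L : ℕ) (r : List Bool) (F : List Bool → List Bool → ℝ≥0∞) :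
    (expect (uniformBits m) fun w => expect (unemb L w r) fun x => F w x) =
      expect (uniformBits L) fun x => expect (embNoisy m r x true) fun w => F w x := by
  simp only [unemb, expect_map]
  exact (expect_uniformBits_unembFrom m).1 L r F

/-- The decoding function maps uniform strings to uniform strings. -/
theorem uniformBits_bind_unemb (m L : ℕ) (r : List Bool) :
    ((uniformBits m).bind fun w => unemb L w r) = uniformBits L := by
  ext x
  have := expect_unemb m L r fun _ y => if y = x then 1 else 0
  have h : ∀ p : PMF (List Bool), (expect p fun y => if y = x then 1 else 0) = p x := by
    intro p
    rw [expect, tsum_eq_single x (by intro y hy; simp [hy])]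
    simp
  simp only [expect_const, h] at this
  exact this

/-! ### The embedding inverts the decoding function approximately -/

/-- The probability of at least `K` errors. -/
def selfDistProb (m : ℕ) (x : List Bool) (fresh : Bool) (K : ℕ) : ℝ≥0∞ :=
  expect (uniformBits (2 * m)) fun r => expect (embNoisy m r x fresh) fun w =>
    if K ≤ hamDist w (embFrom r 0 m x) then 1 else 0

theorem selfDistProb_le_one (m : ℕ) (x : List Bool) (fresh : Bool) (K : ℕ) :
    selfDistProb m x fresh K ≤ 1 :=
  expect_le_of_support fun _ _ => expect_ite_le_one _ _

theorem embNoisy_cons_cons (a b : Bool) (r : List Bool) (m : ℕ) (c : Bool) (x : List Bool)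
    (fresh : Bool) : embNoisy (m + 1) (a :: b :: r) (c :: x) fresh =
      (if fresh then PMF.pure c else coin).bind fun c' =>
        (embNoisy m r (if (bif c then b else a) then x else c :: x) (bif c then b else a)).map
          (c' :: ·) := by
  cases c <;> simp [embNoisy, seedFun]

/-- Of the two seed bits of a step only the one selected by the current character is consulted, and
it is a fair coin whatever the character is. -/
theorem expect_coin_coin (c : Bool) (G : Bool → ℝ≥0∞) :
    (expect coin fun a => expect coin fun b => G (bif c then b else a)) = expect coin G := by
  cases c
  · simp only [cond_false, expect_const]
  · simp only [cond_true, expect_const]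

theorem selfDistProb_true_succ (m : ℕ) (c : Bool) (x : List Bool) (K : ℕ) :
    selfDistProb (m + 1) (c :: x) true K = expect coin fun h =>
      selfDistProb m (if h then x else c :: x) h K := by
  simp only [selfDistProb, expect_uniformBits_two_mul_succ, embNoisy_cons_cons, embFrom_cons_cons,
    advance, if_true, PMF.pure_bind, expect_map, List.headD_cons, hamDist_cons_self]
  exact expect_coin_coin c fun h => expect (uniformBits (2 * m)) fun r =>
    expect (embNoisy m r (if h then x else c :: x) h) fun w =>
      if K ≤ hamDist w (embFrom r 0 m (if h then x else c :: x)) then 1 else 0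

/-- A step at an old position behaves like a fresh one, except that its coin disagrees with `c` with
probability one half and then uses up one of the `K + 1` errors. -/
theorem selfDistProb_false_succ (m : ℕ) (c : Bool) (x : List Bool) (K : ℕ) :
    selfDistProb (m + 1) (c :: x) false (K + 1) = expect coin fun b =>
      selfDistProb (m + 1) (c :: x) true (if b then K + 1 else K) := by
  have h : ∀ (p : Bool → ℝ≥0∞), expect coin p = expect coin fun b => p (if b then c else !c) := by
    intro p
    cases c <;> simp [expect_coin, add_comm]
  simp only [selfDistProb_true_succ]
  simp only [selfDistProb, expect_uniformBits_two_mul_succ, embNoisy_cons_cons, embFrom_cons_cons,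
    advance, Bool.false_eq_true, if_false, expect_bind, expect_map, List.headD_cons]
  have e : ∀ a b r, (expect coin fun c' => expect (embNoisy m r
      (if (bif c then b else a) then x else c :: x) (bif c then b else a)) fun w =>
        (if K + 1 ≤ hamDist (c' :: w) (c :: embFrom r 0 m
          (if (bif c then b else a) then x else c :: x)) then (1 : ℝ≥0∞) else 0)) =
      expect coin fun d => expect (embNoisy m r
      (if (bif c then b else a) then x else c :: x) (bif c then b else a)) fun w =>
        (if (if d then K + 1 else K) ≤ hamDist w (embFrom r 0 m
          (if (bif c then b else a) then x else c :: x)) then (1 : ℝ≥0∞) else 0) := by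
    intro a b r
    rw [h]
    congr 1
    funext d
    cases d <;> simp [hamDist_cons_self, hamDist_cons_ne]
  simp only [e]
  have e2 : ∀ G : Bool → Bool → List Bool → ℝ≥0∞,
      (expect coin fun a => expect coin fun b => expect (uniformBits (2 * m)) fun r =>
        expect coin fun d => G (bif c then b else a) d r) =
      expect coin fun d => expect coin fun h => expect (uniformBits (2 * m)) fun r => G h d r := by
    intro G
    have : ∀ h, (expect (uniformBits (2 * m)) fun r => expect coin fun d => G h d r) =
        expect coin fun d => expect (uniformBits (2 * m)) fun r => G h d r := fun h =>
      expect_comm _ _ _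
    simp only [this]
    rw [expect_coin_coin c fun h => expect coin fun d =>
      expect (uniformBits (2 * m)) fun r => G h d r]
    exact expect_comm _ _ _
  exact e2 fun h d r => expect (embNoisy m r (if h then x else c :: x) h) fun w =>
        (if (if d then K + 1 else K) ≤ hamDist w (embFrom r 0 m (if h then x else c :: x)) then
          (1 : ℝ≥0∞) else 0)

/-- The bound on the probability of `K` errors, with a parameter `u > 1`. -/
def selfBound (u : ℝ) (m L : ℕ) (fresh : Bool) (K : ℕ) : ℝ :=
  (if fresh then 1 else (1 + u) / 2) * ((3 + u) / 4) ^ m * u⁻¹ ^ K + 2⁻¹ ^ L * (3 / 2) ^ m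

/-- Markov's inequality for $u^{\#\mathrm{errors}}$: a step at an old position multiplies the moment
by `(1 + u) / 2` relative to a fresh one, and a step is followed by a fresh one with probability one
half, so each step contributes the average `(3 + u) / 4`. The second term bounds the probability of
leaving the string, from the moment `(3/2)^m` of $2^{\#\mathrm{advances}}$. Both terms satisfy the
recursion with equality. -/
theorem selfDistProb_le {u : ℝ} (hu : 1 ≤ u) (m : ℕ) (x : List Bool) (fresh : Bool) (K : ℕ) :
    selfDistProb m x fresh K ≤ ENNReal.ofReal (selfBound u m x.length fresh K) := by
  have hu0 : 0 < u := by linarith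
  have hc : ∀ fresh : Bool, (1 : ℝ) ≤ if fresh then 1 else (1 + u) / 2 := by
    intro fresh; split_ifs <;> linarith
  have hA : ∀ m : ℕ, (1 : ℝ) ≤ ((3 + u) / 4) ^ m := fun m => one_le_pow₀ (by linarith)
  have hnn : ∀ m L fresh K, 0 ≤ selfBound u m L fresh K := by
    intro m L fresh K
    have := hc fresh
    rw [selfBound]
    positivity
  have h0 : ∀ m L fresh, 1 ≤ selfBound u m L fresh 0 := by
    intro m L fresh
    have h1 := one_le_mul_of_one_le_of_one_le (hc fresh) (hA m)
    have h2 : (0 : ℝ) ≤ 2⁻¹ ^ L * (3 / 2) ^ m := by positivity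
    rw [selfBound, pow_zero, mul_one]
    linarith
  induction m generalizing x fresh K with
  | zero =>
    cases K with
    | zero => exact (selfDistProb_le_one _ _ _ _).trans (by simpa using h0 _ _ _)
    | succ K => simp [selfDistProb, embFrom, embNoisy, expect_pure, hamDist_nil, expect_const]
  | succ m ih =>
    cases K with
    | zero => exact (selfDistProb_le_one _ _ _ _).trans (by simpa using h0 _ _ _)
    | succ K =>
      rcases x with _ | ⟨c, x⟩
      · refine (selfDistProb_le_one _ _ _ _).trans ?_
        have h1 : (1 : ℝ) ≤ (3 / 2) ^ (m + 1) := one_le_pow₀ (by norm_num)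
        have h2 := hc fresh
        have h3 : 0 ≤ (if fresh then 1 else (1 + u) / 2) * ((3 + u) / 4) ^ (m + 1) *
          u⁻¹ ^ (K + 1) := by positivity
        rw [selfBound, List.length_nil, pow_zero, one_mul, ← ENNReal.ofReal_one]
        exact ENNReal.ofReal_le_ofReal (by linarith)
      · have htrue : ∀ K, selfDistProb (m + 1) (c :: x) true K ≤
            ENNReal.ofReal (selfBound u (m + 1) (c :: x).length true K) := by
          intro K
          rw [selfDistProb_true_succ]
          refine (expect_coin_le (ih x true K) (ih (c :: x) false K) (hnn _ _ _ _)
            (hnn _ _ _ _)).trans (ENNReal.ofReal_le_ofReal (le_of_eq ?_))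
          simp only [selfBound, List.length_cons, if_true, Bool.false_eq_true, if_false]
          ring
        cases fresh with
        | true => exact htrue _
        | false =>
          rw [selfDistProb_false_succ]
          refine (expect_coin_le (htrue (K + 1)) (htrue K) (hnn _ _ _ _)
            (hnn _ _ _ _)).trans (ENNReal.ofReal_le_ofReal (le_of_eq ?_))
          simp only [selfBound, if_true, Bool.false_eq_true, if_false, pow_succ u⁻¹ K]
          field_simp
          ring

end
end EditPRC

/-! ### The failure probability of a single block. -/

namespace EditPRC
noncomputable section

open scoped ENNReal

/-! ### The error rate of one block -/

/-- Both terms decay geometrically for `u = 1 + c`. The first because $\log(1+c/4)\le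
c/4<(1/4+c/2)\,c/(1+c)\le(1/4+c/2)\log(1+c)$: the tolerated error rate exceeds `1/4` by a constant.
The second because the block has length at least `2M/3`, while about `M/2` positions are expected to
be completed. -/
theorem tendsto_selfBound {c : ℝ} (hc : 0 < c) :
    Tendsto (fun M : ℕ => selfBound (1 + c) M ((2 * M + 2) / 3) true ⌈(1 / 4 + c / 2) * M⌉₊)
      atTop (nhds 0) := by
  have hu : (0 : ℝ) < 1 + c := by linarith
  set ρ : ℝ := (3 + (1 + c)) / 4 * ((1 + c)⁻¹) ^ (1 / 4 + c / 2) with hρ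
  set τ : ℝ := (2⁻¹ : ℝ) ^ (2 / 3 : ℝ) * (3 / 2) with hτ
  have hρ0 : 0 < ρ := by positivity
  have hτ0 : 0 < τ := by positivity
  have hρ1 : ρ < 1 := by
    rw [← Real.log_neg_iff hρ0, hρ, Real.log_mul (by positivity) (by positivity),
      Real.log_rpow (by positivity), Real.log_inv]
    have h1 := Real.log_le_sub_one_of_pos (show (0 : ℝ) < (3 + (1 + c)) / 4 by positivity)
    have h2 := Real.one_sub_inv_le_log_of_pos hu
    have h3 : c / 4 < (1 / 4 + c / 2) * (1 - (1 + c)⁻¹) := by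
      have : 1 - (1 + c)⁻¹ = c / (1 + c) := by field_simp; ring
      rw [this, ← mul_div_assoc, lt_div_iff₀ hu]
      nlinarith [mul_pos hc hc]
    have h4 := mul_le_mul_of_nonneg_left h2 (show (0 : ℝ) ≤ 1 / 4 + c / 2 by positivity)
    linarith
  have hτ1 : τ < 1 := by
    -- The cube is the rational number `27/32`.
    have h1 : τ ^ 3 < 1 ^ 3 := by
      rw [hτ, mul_pow, ← Real.rpow_natCast, ← Real.rpow_mul (by norm_num)]
      norm_num
    exact lt_of_pow_lt_pow_left₀ 3 zero_le_one h1
  have h := (tendsto_pow_atTop_nhds_zero_of_lt_one hρ0.le hρ1).add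
    (tendsto_pow_atTop_nhds_zero_of_lt_one hτ0.le hτ1)
  rw [add_zero] at h
  refine squeeze_zero (fun M => by rw [selfBound]; simp only [if_true]; positivity)
    (fun M => ?_) h
  have hr0 : (0 : ℝ) < (1 + c)⁻¹ := by positivity
  have hr1 : (1 + c)⁻¹ ≤ 1 := inv_le_one_of_one_le₀ (by linarith)
  have e1 : (1 + c)⁻¹ ^ ⌈(1 / 4 + c / 2) * (M : ℝ)⌉₊ ≤ (((1 + c)⁻¹) ^ (1 / 4 + c / 2)) ^ M := by
    rw [← Real.rpow_natCast, ← Real.rpow_natCast, ← Real.rpow_mul hr0.le]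
    exact Real.rpow_le_rpow_of_exponent_ge hr0 hr1 (Nat.le_ceil _)
  have e2 : (2⁻¹ : ℝ) ^ ((2 * M + 2) / 3) ≤ ((2⁻¹ : ℝ) ^ (2 / 3 : ℝ)) ^ M := by
    rw [← Real.rpow_natCast, ← Real.rpow_natCast, ← Real.rpow_mul (by norm_num)]
    refine Real.rpow_le_rpow_of_exponent_ge (by norm_num) (by norm_num) ?_
    have : 2 * M ≤ 3 * ((2 * M + 2) / 3) := by omega
    have : (2 * M : ℝ) ≤ 3 * ((2 * M + 2) / 3 : ℕ) := by exact_mod_cast this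
    linarith
  rw [selfBound, if_pos rfl, one_mul, hρ, hτ, mul_pow, mul_pow]
  gcongr

/-- The probability that the errors of a block exceed the threshold `K`, when the block `y` is
received as `z`. -/
def blockFailProb (M : ℕ) (y z : List Bool) (K : ℕ) : ℝ≥0∞ :=
  expect (uniformBits (2 * M)) fun r => expect (embNoisy M r y true) fun w =>
    if hamDist w (emb M z r) ≤ K then 0 else 1

/-- The error budget `(1/4 + c)M` is split by the triangle inequality at `emb M y r`: a share `1/4 +
c/2` for the coins of the decoding map, exceeded with probability at most `1/2` for large `M`, and a
share `c/2` for the edits, exceeded with probability at most `1/4`. -/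
theorem exists_blockFailProb_le {c : ℝ} (hc : 0 < c) :
    ∃ m₀ : ℕ, ∀ M, m₀ ≤ M → ∀ y z : List Bool, y.length = (2 * M + 2) / 3 →
      112 * (editDist y z : ℝ) ^ 2 ≤ c / 2 * M →
      blockFailProb M y z ⌊(1 / 4 + c) * (M : ℝ)⌋₊ ≤ ENNReal.ofReal (3 / 4) := by
  obtain ⟨m₁, hm₁⟩ := eventually_atTop.1
    ((tendsto_selfBound hc).eventually_le_const (show (0 : ℝ) < 1 / 2 by norm_num))
  refine ⟨max m₁ 1, fun M hM y z hy hd => ?_⟩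
  have hM1 : (1 : ℝ) ≤ M := by exact_mod_cast (le_max_right _ _).trans hM
  set K₁ := ⌈(1 / 4 + c / 2) * (M : ℝ)⌉₊
  set K₂ := ⌈c / 2 * (M : ℝ)⌉₊
  have hK₂ : 0 < K₂ := Nat.ceil_pos.2 (by positivity)
  have h1 := selfDistProb_le (u := 1 + c) (by linarith) M y true K₁
  rw [hy] at h1
  have h2 := embDistProb_le M y z K₂
  have h3 : walkBound K₂ (editDist y z) ≤ 1 / 4 :=
    walkBound_le_quarter (by exact_mod_cast hd.trans (Nat.le_ceil _)) hK₂
  have key : blockFailProb M y z ⌊(1 / 4 + c) * (M : ℝ)⌋₊ ≤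
      selfDistProb M y true K₁ + embDistProb M y z K₂ := by
    rw [blockFailProb, selfDistProb, embDistProb, ← expect_add]
    refine expect_mono_support fun r _ => ?_
    rw [← expect_const (embNoisy M r y true) (if K₂ ≤ _ then (1 : ℝ≥0∞) else 0), ← expect_add]
    refine expect_mono_support fun w hw => ?_
    by_cases ha : hamDist w (emb M z r) ≤ ⌊(1 / 4 + c) * (M : ℝ)⌋₊
    · rw [if_pos ha]
      exact zero_le
    by_cases hb : K₁ ≤ hamDist w (embFrom r 0 M y)
    · simp only [hb, if_true]
      split_ifs <;> simp
    by_cases hc' : K₂ ≤ hamDist (embFrom r 0 M y) (embFrom r 0 M z)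
    · simp only [hc', if_true]
      split_ifs <;> simp
    exfalso
    have ht := hamDist_triangle (x := w) (y := embFrom r 0 M y) (z := emb M z r)
      (by rw [length_of_mem_embNoisy hw, length_embFrom]) (by rw [length_embFrom, length_emb])
    rw [not_le, Nat.lt_ceil] at hb hc'
    rw [not_le, Nat.floor_lt (by positivity)] at ha
    rw [emb] at ha ht
    have ht' : (hamDist w (embFrom r 0 M z) : ℝ) ≤ hamDist w (embFrom r 0 M y) +
      hamDist (embFrom r 0 M y) (embFrom r 0 M z) := by exact_mod_cast ht
    linarith
  refine key.trans ((add_le_add (h1.trans (ENNReal.ofReal_le_ofReal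
    (hm₁ M ((le_max_left _ _).trans hM)))) (h2.trans (ENNReal.ofReal_le_ofReal h3))).trans_eq ?_)
  rw [← ENNReal.ofReal_add (by norm_num) (by norm_num)]
  norm_num

/-! ### Lists -/

theorem prod_map_le_pow_countP {α : Type} (l : List α) (f : α → ℝ≥0∞) (p : α → Bool) {q : ℝ≥0∞}
    (h1 : ∀ a ∈ l, f a ≤ 1) (hq : ∀ a ∈ l, p a → f a ≤ q) :
    (l.map f).prod ≤ q ^ l.countP p := by
  induction l with
  | nil => simp
  | cons a l ih =>
    have ih := ih (fun b hb => h1 b (List.mem_cons_of_mem _ hb))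
      fun b hb => hq b (List.mem_cons_of_mem _ hb)
    rw [List.map_cons, List.prod_cons]
    by_cases hp : p a
    · rw [List.countP_cons_of_pos hp, pow_succ']
      exact mul_le_mul' (hq a List.mem_cons_self hp) ih
    · rw [List.countP_cons_of_neg hp]
      exact (mul_le_of_le_one_left' (h1 a List.mem_cons_self)).trans ih

/-- Markov's inequality by counting: each entry with value above `d` contributes at least `d + 1` to
the sum. -/
theorem length_mul_le_sum_add {α : Type} (l : List α) (f : α → ℕ) (d : ℕ) :
    l.length * (d + 1) ≤ (l.map f).sum + l.countP (fun a => f a ≤ d) * (d + 1) := by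
  induction l with
  | nil => simp
  | cons a l ih =>
    rw [List.map_cons, List.sum_cons, List.length_cons, List.countP_cons]
    by_cases h : f a ≤ d
    · simp only [h, decide_true, if_true]
      linarith [Nat.zero_le (f a)]
    · simp only [h, decide_false, Bool.false_eq_true, if_false, add_zero]
      push Not at h
      linarith

theorem expect_uniformBits_xorStr {a : List Bool} (F : List Bool → ℝ≥0∞) :
    (expect (uniformBits a.length) fun e => F (xorStr a e)) = expect (uniformBits a.length) F := by
  induction a generalizing F with
  | nil => simp [uniformBits, iid, expect_pure, xorStr]
  | cons b a ih =>
    rw [List.length_cons, expect_uniformBits_succ, expect_uniformBits_succ]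
    have : ∀ c, (expect (uniformBits a.length) fun l => F (xorStr (b :: a) (c :: l))) =
        expect (uniformBits a.length) fun l => F (xor b c :: l) := fun c =>
      ih fun l => F (xor b c :: l)
    simp only [this]
    cases b <;> simp [expect_coin, add_comm]

theorem pmf_ext_expect {α : Type} {p q : PMF α} (h : ∀ f : α → ℝ≥0∞, expect p f = expect q f) :
    p = q := by
  classical
  ext a
  have key : ∀ p : PMF α, (expect p fun b => if b = a then 1 else 0) = p a := by
    intro p
    rw [expect, tsum_eq_single a (by intro b hb; simp [hb])]
    simp
  rw [← key p, ← key q, h]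

end
end EditPRC

/-! ### From single blocks to the failure of the whole decoder. -/

namespace EditPRC
noncomputable section

open scoped ENNReal

variable {kind : KeyKind} {H : Scheme} {𝓔 : Set Channel}

/-! ### Decoding failures -/

/-- The probability that a codeword is not decoded to `1` when the error pattern is `η`. -/
def patternFailProb (H : Scheme) (κ : ℕ) (η : List Bool) : ℝ≥0∞ :=
  expect (H.keyGen κ) fun k => expect (H.enc κ k.1) fun a => H.dec κ k.2 (xorStr a η) false

/-- The seed of a block and the masked codeword, given the encoded block `y`. -/
def seedAndWord (M : ℕ) (y : List Bool) : PMF (List Bool × List Bool) :=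
  (uniformBits (2 * M)).bind fun r => (embNoisy M r y true).map (Prod.mk r)

/-- A pair of keys with a codeword. -/
def keyAndCodeword (H : Scheme) (κ : ℕ) : PMF ((List Bool × List Bool) × List Bool) :=
  (H.keyGen κ).bind fun k => (H.enc κ k.1).map (Prod.mk k)

/-- The key of a block and the block, given the encoded block, the seed, the masked codeword, the
key pair and the codeword. -/
def assembleBlock (c : List Bool × List Bool × List Bool)
    (a : (List Bool × List Bool) × List Bool) :
    ((List Bool × List Bool) × List Bool × List Bool) × List Bool :=
  ((a.1, c.2.1, xorStr a.2 c.2.2), c.1)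

/-- A block is a uniform string which is independent of the seed, the key pair and the
codeword. -/
theorem blockKeyGen_bind_encBlock (hH : IsPRC kind H 𝓔) (κ : ℕ) :
    ((blockKeyGen H κ).bind fun k => (encBlock H κ (encPart k)).map (Prod.mk k)) =
      ((uniformBits (blockLen H κ)).bind fun y => (seedAndWord (H.len κ) y).map
        (Prod.mk y)).bind fun c => (keyAndCodeword H κ).map (assembleBlock c) := by
  refine pmf_ext_expect fun F => ?_
  simp only [blockKeyGen, encBlock, encPart, seedAndWord, keyAndCodeword, expect_bind, expect_map,
    assembleBlock]
  -- For a fixed codeword `a` the mask is traded for the uniform word `w = a ⊕ e`, from which it is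
  -- recovered as `a ⊕ w`. Then `expect_unemb` draws the block before the word.
  have h1 : ∀ k ∈ (H.keyGen κ).support, ∀ r : List Bool,
      (expect (uniformBits (H.len κ)) fun e => expect (H.enc κ k.1) fun a =>
        expect (unemb (blockLen H κ) (xorStr a e) r) fun y => F ((k, r, e), y)) =
      expect (H.enc κ k.1) fun a => expect (uniformBits (blockLen H κ)) fun y =>
        expect (embNoisy (H.len κ) r y true) fun w => F ((k, r, xorStr a w), y) := by
    intro k hk r
    rw [expect_comm]
    refine expect_congr_support fun a ha => ?_
    have ha' := hH.enc_length κ k.1 (hH.keyGen_length κ k hk).1 a ha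
    rw [← expect_unemb (H.len κ) (blockLen H κ) r fun w y => F ((k, r, xorStr a w), y), ← ha',
      ← expect_uniformBits_xorStr (a := a) fun w => expect (unemb (blockLen H κ) w r) fun x =>
        F ((k, r, xorStr a w), x)]
    refine expect_congr_support fun e he => ?_
    rw [xorStr_self_left (length_of_mem_uniformBits he).symm]
  refine (expect_congr_support fun k hk => congrArg (expect _) (funext fun r => h1 k hk r)).trans ?_
  have h2 : ∀ k : List Bool × List Bool, (expect (uniformBits (2 * H.len κ)) fun r =>
      expect (H.enc κ k.1) fun a => expect (uniformBits (blockLen H κ)) fun y =>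
        expect (embNoisy (H.len κ) r y true) fun w => F ((k, r, xorStr a w), y)) =
      expect (uniformBits (blockLen H κ)) fun y => expect (uniformBits (2 * H.len κ)) fun r =>
        expect (embNoisy (H.len κ) r y true) fun w => expect (H.enc κ k.1) fun a =>
          F ((k, r, xorStr a w), y) := by
    intro k
    rw [expect_comm (uniformBits (blockLen H κ))]
    congr 1
    funext r
    rw [expect_comm]
    congr 1
    funext y
    rw [expect_comm]
  simp only [h2]
  rw [expect_comm]
  congr 1
  funext y
  rw [expect_comm]
  congr 1
  funext r
  rw [expect_comm]

/-- Some part of the received string is decoded unless all blocks have many errors. -/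
theorem expect_dec_le (κ n : ℕ) {δ : ℝ≥0∞} {w₀ d : ℕ} {ys zs : List (List Bool)}
    {vs : List (List Bool × List Bool)} {z' : List Bool} (hzs : zs.length = ys.length)
    (hvs : vs.length = ys.length) (hn : n = blockLen H κ) (hd : d < n)
    (hys : ∀ y ∈ ys, y.length = n) (hw : ∀ v ∈ vs, v.2.length = H.len κ)
    (hδ : ∀ η : List Bool, η.length = H.len κ → η.count true ≤ w₀ → patternFailProb H κ η ≤ δ) :
    (expect (indep ((List.zipWith Prod.mk ys vs).map fun _ => keyAndCodeword H κ)) fun as =>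
      anyAccepts ((windows (zs.flatten ++ z')).flatMap fun z =>
        ((List.zipWith assembleBlock (List.zipWith Prod.mk ys vs) as).map Prod.fst).map
          fun k => windowTest H κ z (decPart k)) false) ≤
      δ + (List.zipWith (fun (p : List Bool × List Bool) (v : List Bool × List Bool) =>
        if editDist p.1 p.2 ≤ d ∧ hamDist v.2 (emb (H.len κ) (fit n p.2) v.1) ≤ w₀ then
          (0 : ℝ≥0∞) else 1) (List.zipWith Prod.mk ys zs) vs).prod := by
  by_cases h : ∃ (t : ℕ) (h1 : t < ys.length) (h2 : t < zs.length) (h3 : t < vs.length),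
      editDist ys[t] zs[t] ≤ d ∧
        hamDist vs[t].2 (emb (H.len κ) (fit n zs[t]) vs[t].1) ≤ w₀
  · refine le_add_right ?_
    obtain ⟨t, h1, h2, h3, hed, hham⟩ := h
    -- The decoder only looks at non-empty windows. An empty piece would be at distance `n > d` from
    -- its block.
    have hne : zs[t] ≠ [] := by
      intro h0
      rw [h0, editDist_nil, hys _ (List.getElem_mem h1)] at hed
      omega
    have hwin := mem_windows_flatten (z' := z') (List.getElem_mem h2) hne
    have hconst : ((List.zipWith Prod.mk ys vs).map fun _ => keyAndCodeword H κ) =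
        List.replicate ys.length (keyAndCodeword H κ) := by
      rw [List.map_const', List.length_zipWith, hvs, min_self]
    rw [hconst, ← iid_eq_indep]
    set e := emb (H.len κ) (fit n zs[t]) vs[t].1 with he
    have hw' := hw _ (List.getElem_mem h3)
    -- Rejection forces the test of `zs[t]` with key `t` to reject. The mask is `a ⊕ w`, so the
    -- tested string is `a ⊕ (w ⊕ e)`: the codeword with an error pattern that was fixed before key
    -- and codeword were drawn.
    have step : ∀ as ∈ (iid (keyAndCodeword H κ) ys.length).support,
        anyAccepts ((windows (zs.flatten ++ z')).flatMap fun z =>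
          ((List.zipWith assembleBlock (List.zipWith Prod.mk ys vs) as).map Prod.fst).map
            fun k => windowTest H κ z (decPart k)) false ≤
          (as[t]?).elim 1 fun a => H.dec κ a.1.2 (xorStr a.2 (xorStr vs[t].2 e)) false := by
      intro as has
      have hla := length_of_mem_iid has
      have h4 : t < as.length := by omega
      rw [List.getElem?_eq_getElem h4, Option.elim_some]
      refine anyAccepts_false_le ?_
      refine List.mem_flatMap.2 ⟨zs[t], hwin, ?_⟩
      rw [List.map_map, List.mem_map]
      refine ⟨assembleBlock (ys[t], vs[t]) as[t], ?_, ?_⟩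
      · rw [List.mem_iff_getElem]
        exact ⟨t, by simp; omega, by simp⟩
      · simp only [Function.comp_apply, assembleBlock, windowTest, decPart]
        rw [← hn, ← he, xorStr_comm e, xorStr_assoc]
    refine (expect_mono_support step).trans ?_
    rw [expect_iid_getElem? _ h1 fun o : Option ((List Bool × List Bool) × List Bool) =>
      o.elim 1 fun a =>
      H.dec κ a.1.2 (xorStr a.2 (xorStr vs[t].2 e)) false]
    have := hδ (xorStr vs[t].2 e) (by rw [length_xorStr] <;> simp [he, length_emb, hw']) hham
    simpa only [patternFailProb, keyAndCodeword, expect_bind, expect_map, Option.elim_some]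
      using this
  -- Without a good block every factor of the product is `1`, and the trivial bound suffices.
  · refine (expect_le_of_support fun as _ => PMF.coe_le_one _ _).trans (le_add_left (le_of_eq ?_))
    refine (List.prod_eq_one fun x hx => ?_).symm
    rw [List.mem_iff_getElem] at hx
    obtain ⟨t, ht, rfl⟩ := hx
    simp only [List.length_zipWith] at ht
    rw [List.getElem_zipWith, List.getElem_zipWith, if_neg]
    intro h'
    exact h ⟨t, by omega, by omega, by omega, h'⟩

/-- The failure splits into `δ`, the failure of the inner code on one good block, and the event that
every block with at most `d` edits has too many errors. There are at least `ℓ κ / 2` such blocks,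
with independent seeds. The factor `2` in front of `d` is the cost of `fit`. -/
theorem decodeFail_le (hH : IsPRC kind H 𝓔) {ℓ : ℕ → ℕ} {κ : ℕ} {E : Channel} {δ : ℝ≥0∞}
    {w₀ d : ℕ} (hd : d < blockLen H κ)
    (hδ : ∀ η : List Bool, η.length = H.len κ → η.count true ≤ w₀ → patternFailProb H κ η ≤ δ)
    (hE : ∀ y : List Bool, y.length = ℓ κ * blockLen H κ →
      2 * editDist y (E y) ≤ ℓ κ * (d + 1))
    {q : ℝ≥0∞} (hq1 : q ≤ 1) (hq : ∀ y z : List Bool, y.length = blockLen H κ →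
      editDist y z ≤ 2 * d → blockFailProb (H.len κ) y z w₀ ≤ q) :
    (((cgkCode H ℓ).keyGen κ).bind fun k => ((cgkCode H ℓ).enc κ k.1).bind fun x =>
      (cgkCode H ℓ).dec κ k.2 (E x)) false ≤ δ + q ^ (ℓ κ / 2) := by
  simp only [bind_apply_eq_expect]
  rw [expect_cgkCode_keyGen]
  set G : List (((List Bool × List Bool) × List Bool × List Bool) × List Bool) → ℝ≥0∞ := fun l =>
    anyAccepts ((windows (E (l.map Prod.snd).flatten)).flatMap fun z =>
      (l.map Prod.fst).map fun k => windowTest H κ z (decPart k)) false with hG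
  have h1 : ∀ ks ∈ (iid (blockKeyGen H κ) (ℓ κ)).support,
      (expect ((cgkCode H ℓ).enc κ (joinParts (ks.map encPart))) fun x =>
        (cgkCode H ℓ).dec κ (joinParts (ks.map decPart)) (E x) false) =
      expect (indep (ks.map fun k => encBlock H κ (encPart k))) fun ys =>
        G (List.zipWith Prod.mk ks ys) := by
    intro ks hks
    rw [cgkCode_enc_joinParts hH hks, expect_map]
    refine expect_congr_support fun ys hys => ?_
    have hl := length_of_mem_indep hys
    rw [List.length_map] at hl
    rw [cgkCode_dec_joinParts hH hks, hG]
    simp only [← List.zip_eq_zipWith]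
    rw [List.map_fst_zip hl.ge, List.map_snd_zip hl.le]
  -- Regroups the sampling: all blocks first, then all seeds and masked words, then all key pairs
  -- and codewords.
  rw [expect_congr_support h1, ← expect_iid_bind_map, blockKeyGen_bind_encBlock hH,
    expect_iid_bind_map, expect_iid_bind_map]
  refine expect_le_of_support fun ys hys => ?_
  have hlen := length_of_mem_iid hys
  have hyl := forall_of_mem_iid (P := fun y : List Bool => y.length = blockLen H κ)
    (fun y hy => length_of_mem_uniformBits hy) hys
  have hfl : ys.flatten.length = ℓ κ * blockLen H κ := by
    rw [List.length_flatten, List.map_congr_left hyl, List.map_const', List.sum_replicate, hlen,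
      smul_eq_mul]
  -- The pieces depend on the blocks alone, hence are fixed while seeds and keys are still random.
  obtain ⟨zs, z', hzs, hz', hsum⟩ := exists_split_editDist ys (E ys.flatten)
  have h2 : ∀ vs ∈ (indep (ys.map (seedAndWord (H.len κ)))).support,
      (expect (indep ((List.zipWith Prod.mk ys vs).map fun _ => keyAndCodeword H κ)) fun as =>
        G (List.zipWith assembleBlock (List.zipWith Prod.mk ys vs) as)) ≤
      δ + (List.zipWith (fun (p : List Bool × List Bool) (v : List Bool × List Bool) =>
        if editDist p.1 p.2 ≤ d ∧
          hamDist v.2 (emb (H.len κ) (fit (blockLen H κ) p.2) v.1) ≤ w₀ then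
          (0 : ℝ≥0∞) else 1) (List.zipWith Prod.mk ys zs) vs).prod := by
    intro vs hvs
    have hvl := length_of_mem_indep hvs
    rw [List.length_map] at hvl
    have hw : ∀ v ∈ vs, v.2.length = H.len κ := by
      have : ∀ (l : List (List Bool)) (vs : List (List Bool × List Bool)),
          vs ∈ (indep (l.map (seedAndWord (H.len κ)))).support →
          ∀ v ∈ vs, v.2.length = H.len κ := by
        intro l
        induction l with
        | nil => intro vs hvs; simp_all [indep]
        | cons y l ih =>
          intro vs hvs
          rw [List.map_cons, indep, PMF.mem_support_bind_iff] at hvs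
          obtain ⟨v, hv, hvs⟩ := hvs
          rw [PMF.mem_support_map_iff] at hvs
          obtain ⟨vs, hvs, rfl⟩ := hvs
          refine List.forall_mem_cons.2 ⟨?_, ih vs hvs⟩
          rw [seedAndWord, PMF.mem_support_bind_iff] at hv
          obtain ⟨r, -, hv⟩ := hv
          rw [PMF.mem_support_map_iff] at hv
          obtain ⟨w, hw, rfl⟩ := hv
          exact length_of_mem_embNoisy hw
      exact this ys vs hvs
    refine (expect_mono_support fun as has => le_of_eq ?_).trans
      (expect_dec_le (z' := z') κ _ hzs hvl rfl hd hyl hw hδ)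
    have hal := length_of_mem_indep has
    rw [List.length_map, List.length_zipWith, hvl, min_self] at hal
    have hsnd : (List.zipWith assembleBlock (List.zipWith Prod.mk ys vs) as).map Prod.snd = ys := by
      refine List.ext_getElem (by simp [hvl, hal]) fun t h1 h2 => ?_
      simp [assembleBlock]
    rw [hG]
    simp only [hsnd, hz']
  refine (expect_mono_support h2).trans ?_
  rw [expect_add, expect_const]
  gcongr
  have h3 : ys.map (seedAndWord (H.len κ)) =
      (List.zipWith Prod.mk ys zs).map fun p => seedAndWord (H.len κ) p.1 := by
    refine List.ext_getElem (by simp [hzs]) fun t h1 h2 => by simp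
  rw [h3, expect_indep_prod]
  refine (prod_map_le_pow_countP _ _ (fun p => editDist p.1 p.2 ≤ d) (q := q)
    (fun p _ => ?_) fun p hp hpd => ?_).trans (pow_le_pow_right_of_le_one' hq1 ?_)
  · exact expect_le_of_support fun v _ => by split_ifs <;> simp
  · obtain ⟨t, ht, rfl⟩ := List.mem_iff_getElem.1 hp
    rw [List.length_zipWith] at ht
    simp only [List.getElem_zipWith, decide_eq_true_eq] at hpd ⊢
    have hyt := hyl _ (List.getElem_mem (show t < ys.length by omega))
    refine le_trans (le_of_eq ?_) (hq ys[t] (fit (blockLen H κ) zs[t]) hyt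
      ((editDist_fit_le hyt).trans (Nat.mul_le_mul_left 2 hpd)))
    simp only [seedAndWord, expect_bind, expect_map, hpd, true_and, blockFailProb]
  -- Blocks with more than `d` edits number at most half of all blocks, since the total is at most
  -- `ℓ (d + 1) / 2`.
  · have h4 := length_mul_le_sum_add (List.zipWith Prod.mk ys zs) (fun p => editDist p.1 p.2) d
    have h5 : (List.zipWith Prod.mk ys zs).map (fun p => editDist p.1 p.2) =
        List.zipWith editDist ys zs := by
      rw [List.map_zipWith]
    rw [h5, List.length_zipWith, hzs, min_self, hlen] at h4
    have h6 := hE _ hfl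
    set g := (List.zipWith Prod.mk ys zs).countP fun p => editDist p.1 p.2 ≤ d
    have h7 : ℓ κ * (d + 1) ≤ 2 * g * (d + 1) := by
      have : 2 * g * (d + 1) = 2 * (g * (d + 1)) := by ring
      omega
    have := Nat.le_of_mul_le_mul_right h7 (Nat.succ_pos d)
    omega

end
end EditPRC

/-! ### Robustness: uniformity over error patterns and the choice of constants. -/

namespace EditPRC
noncomputable section

open scoped ENNReal

variable {kind : KeyKind} {H : Scheme} {𝓔 : Set Channel}

/-! ### Robustness -/

theorem one_sub_decodeProb (S : Scheme) (E : Channel) (κ : ℕ) :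
    1 - S.decodeProb E κ = (((S.keyGen κ).bind fun k => (S.enc κ k.1).bind fun x =>
      S.dec κ k.2 (E x)) false).toReal := by
  rw [Scheme.decodeProb, toReal_bool_false]

theorem xorStr_replicate_false (x : List Bool) : xorStr x (List.replicate x.length false) = x := by
  induction x with
  | nil => rfl
  | cons a x ih =>
    simp only [xorStr] at ih
    simp [xorStr, List.replicate_succ, ih]

/-- The substitution channels to which the given code is robust. -/
abbrev obliviousChannels (ε : ℝ) : Set Channel :=
  {E | ObliviousHamming E ∧ HammingBounded (fun _ => ε) E}

theorem mem_obliviousChannels {ε : ℝ} {e : ℕ → List Bool} (he : ∀ m, (e m).length = m)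
    (hw : ∀ m, ((e m).count true : ℝ) ≤ ε * m) :
    (fun x => xorStr x (e x.length)) ∈ obliviousChannels ε := by
  refine ⟨⟨e, he, fun x => rfl⟩, fun x => ⟨?_, ?_⟩⟩
  · rw [length_xorStr (he _).symm, he]
  · rw [hamDist, xorStr_self_left (he _).symm]
    exact hw _

/-- The codeword length of a robust and sound code is unbounded. -/
theorem IsPRC.tendsto_len {ε : ℝ} (hε : 0 ≤ ε) (hH : IsPRC kind H (obliviousChannels ε)) :
    Tendsto H.len atTop atTop := by
  rw [tendsto_atTop]
  intro m₀
  obtain ⟨σ, hσ, hσ0, hacc⟩ := hH.exists_acceptProb_le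
  have hrob := hH.robust _ (mem_obliviousChannels (e := fun m => List.replicate m false)
    (by simp) (fun m => by
      rw [List.count_replicate]
      simp
      positivity))
  simp only [xorStr_replicate_false] at hrob
  filter_upwards [hσ.eventually_le (show (0 : ℝ) < 1 / (4 * 2 ^ m₀) by positivity),
    hrob.eventually_le (show (0 : ℝ) < 1 / 4 by norm_num)] with κ h1 h2
  by_contra hlt
  push Not at hlt
  -- An unperturbed codeword is one of `2 ^ len` fixed strings, each accepted with probability at
  -- most `σ`. For short codewords this contradicts robustness against the zero pattern.
  have h3 : H.decodeProb (fun x => x) κ ≤ 2 ^ H.len κ * σ κ := by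
    rw [Scheme.decodeProb]
    refine ENNReal.toReal_le_of_le_ofReal (mul_nonneg (by positivity) (hσ0 κ)) ?_
    simp only [bind_apply_eq_expect]
    calc _ ≤ expect (H.keyGen κ) fun k => ∑ f : Fin (H.len κ) → Bool,
          H.dec κ k.2 (List.ofFn f) true := by
          refine expect_mono_support fun k hk => expect_le_of_support fun x hx => ?_
          have hl := hH.enc_length κ k.1 (hH.keyGen_length κ k hk).1 x hx
          have hx' : List.ofFn (fun i : Fin (H.len κ) => x[i]) = x :=
            List.ext_getElem (by simp [hl]) fun t h1 h2 => by simp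
          conv_lhs => rw [← hx']
          exact Finset.single_le_sum (f := fun f : Fin (H.len κ) → Bool =>
            H.dec κ k.2 (List.ofFn f) true) (fun _ _ => zero_le) (Finset.mem_univ _)
      _ = ∑ f : Fin (H.len κ) → Bool, acceptProb H κ (List.ofFn f) := by
          rw [expect_finsetSum]; rfl
      _ ≤ ∑ _f : Fin (H.len κ) → Bool, ENNReal.ofReal (σ κ) :=
          Finset.sum_le_sum fun f _ => hacc κ _ (List.length_ofFn)
      _ = ENNReal.ofReal (2 ^ H.len κ * σ κ) := by
          rw [Finset.sum_const, Finset.card_univ, nsmul_eq_mul, ENNReal.ofReal_mul (by positivity)]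
          simp
  have h4 : (2 : ℝ) ^ H.len κ ≤ 2 ^ m₀ := pow_le_pow_right₀ (by norm_num) hlt.le
  have h5 : (2 : ℝ) ^ H.len κ * σ κ ≤ 2 ^ m₀ * (1 / (4 * 2 ^ m₀)) :=
    mul_le_mul h4 h1 (hσ0 κ) (by positivity)
  have h6 : (2 : ℝ) ^ m₀ * (1 / (4 * 2 ^ m₀)) = 1 / 4 := by field_simp
  linarith

/-- All error patterns of bounded weight are corrected with uniformly overwhelming
probability. -/
theorem IsPRC.exists_patternFailProb_le {ε : ℝ} (hε : 0 ≤ ε)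
    (hH : IsPRC kind H (obliviousChannels ε)) :
    ∃ δ : ℕ → ℝ, Negligible δ ∧ (∀ κ, 0 ≤ δ κ) ∧ ∀ κ η, η.length = H.len κ →
      η.count true ≤ ⌊ε * (H.len κ : ℝ)⌋₊ → patternFailProb H κ η ≤ ENNReal.ofReal (δ κ) := by
  have h : ∀ κ, ∃ η : List Bool,
      (η.length = H.len κ ∧ η.count true ≤ ⌊ε * (H.len κ : ℝ)⌋₊) ∧
      ∀ η', (η'.length = H.len κ ∧ η'.count true ≤ ⌊ε * (H.len κ : ℝ)⌋₊) →
        patternFailProb H κ η' ≤ patternFailProb H κ η := fun κ =>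
    Set.exists_max_image {η : List Bool | η.length = H.len κ ∧
      η.count true ≤ ⌊ε * (H.len κ : ℝ)⌋₊} (patternFailProb H κ)
      ((List.finite_length_eq Bool (H.len κ)).subset fun _ h => h.1)
      ⟨List.replicate (H.len κ) false, List.length_replicate, by simp [List.count_replicate]⟩
  choose η hη hmax using h
  have htop : ∀ κ η, patternFailProb H κ η ≠ ⊤ := by
    intro κ η
    have := PMF.apply_ne_top ((H.keyGen κ).bind fun k => (H.enc κ k.1).bind fun a =>
      H.dec κ k.2 (xorStr a η)) false
    simpa only [bind_apply_eq_expect, patternFailProb] using this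
  refine ⟨fun κ => (patternFailProb H κ (η κ)).toReal, ?_, fun κ => ENNReal.toReal_nonneg,
    fun κ η' h1 h2 => ?_⟩
  swap
  · rw [ENNReal.ofReal_toReal (htop _ _)]
    exact hmax κ η' ⟨h1, h2⟩
  intro c hc
  by_contra hcon
  push Not at hcon
  classical
  -- An oblivious channel has one pattern per length, while many security parameters may share a
  -- length. For each length a single bad parameter is chosen, and its worst pattern is used.
  let bad : ℕ → ℕ → Prop := fun m κ =>
    H.len κ = m ∧ (κ : ℝ) ^ (-c) < (patternFailProb H κ (η κ)).toReal
  let e : ℕ → List Bool := fun m =>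
    if h : ∃ κ, bad m κ then η h.choose else List.replicate m false
  have he : ∀ m, (e m).length = m := by
    intro m
    simp only [e]
    split_ifs with h
    · rw [(hη _).1]; exact h.choose_spec.1
    · exact List.length_replicate
  have hw : ∀ m, ((e m).count true : ℝ) ≤ ε * m := by
    intro m
    simp only [e]
    split_ifs with h
    · have h1 := (hη h.choose).2
      rw [h.choose_spec.1] at h1
      exact (Nat.cast_le.2 h1).trans (Nat.floor_le (by positivity))
    · simp only [List.count_replicate]
      simp
      positivity
  obtain ⟨N, hN⟩ := hH.robust _ (mem_obliviousChannels he hw) c hc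
  -- Codeword lengths tend to infinity, so a bad parameter beyond `N'` shares its length with no
  -- parameter below `N`. The parameter chosen for that length is then at least `N`, where
  -- robustness holds.
  obtain ⟨N', hN'⟩ := eventually_atTop.1
    ((tendsto_atTop.1 (hH.tendsto_len hε)) ((Finset.range N).sup H.len + 1))
  obtain ⟨κ, hκ, hbad⟩ := hcon N'
  have hex : ∃ κ', bad (H.len κ) κ' := ⟨κ, rfl, hbad⟩
  obtain ⟨hl, hlt⟩ := hex.choose_spec
  set κ' := hex.choose with hκ'
  have hκN : N ≤ κ' := by
    by_contra hlt'
    have h1 := Finset.le_sup (f := H.len) (Finset.mem_range.2 (not_le.1 hlt'))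
    have h2 := hN' κ hκ
    omega
  have hfin := hN κ' hκN
  simp only [one_sub_decodeProb, bind_apply_eq_expect] at hfin
  refine absurd hfin (not_le.2 (hlt.trans_eq ?_))
  congr 1
  refine expect_congr_support fun k hk => expect_congr_support fun x hx => ?_
  have hxl := hH.enc_length κ' k.1 (hH.keyGen_length κ' k hk).1 x hx
  have hexl : e x.length = η κ' := by
    rw [hxl, hl]
    simp only [e]
    rw [dif_pos hex]
  rw [hexl]

theorem negligible_pow_of_superlog {ℓ : ℕ → ℕ} {q : ℝ} (hq0 : 0 < q) (hq1 : q < 1)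
    (hℓ : Tendsto (fun κ : ℕ => (ℓ κ : ℝ) / Real.log κ) atTop atTop) :
    Negligible fun κ => q ^ (ℓ κ / 2) := by
  rw [negligible_iff]
  intro c hc
  have hlq : 0 < -Real.log q := by linarith [Real.log_neg hq0 hq1]
  have hlog : Tendsto (fun κ : ℕ => Real.log κ) atTop atTop :=
    Real.tendsto_log_atTop.comp tendsto_natCast_atTop_atTop
  filter_upwards [tendsto_atTop.1 hℓ (1 + 2 * c / -Real.log q), tendsto_atTop.1 hlog 1,
    eventually_gt_atTop 0] with κ h1 h2 h3
  have h3' : (0 : ℝ) < κ := by exact_mod_cast h3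
  rw [le_div_iff₀ (by linarith)] at h1
  have h4 : ℓ κ ≤ 2 * (ℓ κ / 2) + 1 := by omega
  have h4' : (ℓ κ : ℝ) ≤ 2 * (ℓ κ / 2 : ℕ) + 1 := by exact_mod_cast h4
  have h5 : c / -Real.log q * Real.log κ ≤ (ℓ κ / 2 : ℕ) := by
    have : 2 * c / -Real.log q * Real.log κ = 2 * (c / -Real.log q * Real.log κ) := by ring
    linarith
  have h6 : c * Real.log κ ≤ (ℓ κ / 2 : ℕ) * -Real.log q := by
    have := mul_le_mul_of_nonneg_right h5 hlq.le
    rwa [mul_right_comm, div_mul_cancel₀ _ hlq.ne'] at this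
  rw [← Real.rpow_natCast, Real.rpow_def_of_pos hq0, Real.rpow_def_of_pos h3']
  exact Real.exp_le_exp.2 (by linarith)

/-- The number of edits of a bounded edit channel, in terms of the number of blocks and their
length. -/
theorem edit_budget_le {γ c₂ : ℝ} (hγ : 0 < γ) (hc₂ : 0 ≤ c₂) {ℓ n : ℕ} (hn : 0 < n)
    (hℓ : ⌈(n : ℝ) ^ (1 / (2 * γ) - 1)⌉₊ ≤ ℓ) :
    c₂ / ((ℓ * n : ℕ) : ℝ) ^ γ * (ℓ * n : ℕ) ≤ ℓ * (c₂ * √n) := by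
  have hn' : (0 : ℝ) < n := by exact_mod_cast hn
  have h1 : (n : ℝ) ^ (1 / (2 * γ) - 1) ≤ ℓ := Nat.ceil_le.1 hℓ
  -- The lower bound on the number of blocks is chosen for this: the codeword length to the power
  -- `γ` is at least `√n`, so the edit rate is at most `c₂ / √n`.
  have h2 : (n : ℝ) ^ (1 / (2 * γ)) ≤ (ℓ * n : ℕ) := by
    have := mul_le_mul_of_nonneg_right h1 hn'.le
    rw [Real.rpow_sub_one hn'.ne', div_mul_cancel₀ _ hn'.ne'] at this
    exact_mod_cast this
  have h3 : √n ≤ ((ℓ * n : ℕ) : ℝ) ^ γ := by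
    have := Real.rpow_le_rpow (by positivity) h2 hγ.le
    rwa [← Real.rpow_mul hn'.le, show 1 / (2 * γ) * γ = 1 / 2 by field_simp,
      ← Real.sqrt_eq_rpow] at this
  have h4 : 0 < √(n : ℝ) := Real.sqrt_pos.2 hn'
  calc c₂ / ((ℓ * n : ℕ) : ℝ) ^ γ * (ℓ * n : ℕ) ≤ c₂ / √n * (ℓ * n : ℕ) := by gcongr
    _ = ℓ * (c₂ * √n) := by
        push_cast
        nth_rewrite 2 [← Real.mul_self_sqrt hn'.le]
        field_simp

/-- The edit budget is `c₂ √n` per block on average, so the threshold `d = ⌊2 c₂ √n⌋` is met by at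
least half of the blocks. -/
theorem cgkCode_robust {c₁ : ℝ} (hc₁ : 0 < c₁) (hc₁' : c₁ < 1 / 4)
    (hH : IsPRC kind H (obliviousChannels (1 / 4 + c₁))) {γ : ℝ} (hγ : 0 < γ) {ℓ : ℕ → ℕ}
    (hℓ : AdmissibleBlocks γ H ℓ) {c₂ : ℝ} (hc₂ : 0 < c₂) (hc₂' : c₂ ≤ c₁ / 64) {E : Channel}
    (hE : EditBounded (fun x => c₂ / (x : ℝ) ^ γ) E) :
    Negligible fun κ => 1 - (cgkCode H ℓ).decodeProb E κ := by
  obtain ⟨δ, hδ, hδ0, hpat⟩ := hH.exists_patternFailProb_le (by positivity)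
  obtain ⟨m₀, hm₀⟩ := exists_blockFailProb_le hc₁
  refine (hδ.add (negligible_pow_of_superlog (q := 3 / 4) (by norm_num) (by norm_num)
    hℓ.superlog)).mono ?_
  filter_upwards [tendsto_atTop.1 (hH.tendsto_len (by positivity)) (max m₀ 2)] with κ hM
  have hM1 := (le_max_left _ _).trans hM
  have hM2 := (le_max_right _ _).trans hM
  rw [one_sub_decodeProb]
  refine ENNReal.toReal_le_of_le_ofReal (add_nonneg (hδ0 κ) (by positivity)) ?_
  rw [ENNReal.ofReal_add (hδ0 κ) (by positivity), ENNReal.ofReal_pow (by norm_num)]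
  set n := blockLen H κ with hn
  have hn0 : 0 < n := by rw [hn, blockLen]; omega
  have hnM : n ≤ H.len κ := by rw [hn, blockLen]; omega
  have hn' : (1 : ℝ) ≤ n := by exact_mod_cast hn0
  have hnM' : (n : ℝ) ≤ H.len κ := by exact_mod_cast hnM
  have hsq : √(n : ℝ) * √n = n := Real.mul_self_sqrt (by positivity)
  have hs1 : 1 ≤ √(n : ℝ) := Real.one_le_sqrt.2 hn'
  have hdle : (⌊2 * c₂ * √n⌋₊ : ℝ) ≤ 2 * c₂ * √n := Nat.floor_le (by positivity)
  refine decodeFail_le hH (d := ⌊2 * c₂ * √n⌋₊) ?_ (hpat κ) (fun y hy => ?_) ?_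
    (fun y z hy hyz => ?_)
  · rw [Nat.floor_lt (by positivity), ← hn]
    nlinarith
  · have h1 := hE y
    have h2 := edit_budget_le hγ hc₂.le hn0 (hℓ.large κ)
    rw [hy, ← hn] at h1
    have h3 := (Nat.lt_floor_add_one (2 * c₂ * √n)).le
    have h4 : (2 * editDist y (E y) : ℝ) ≤ ℓ κ * (⌊2 * c₂ * √n⌋₊ + 1) := by
      have := mul_le_mul_of_nonneg_left h3 (Nat.cast_nonneg (α := ℝ) (ℓ κ))
      have h5 := h1.trans h2
      linarith
    exact_mod_cast h4
  · rw [← ENNReal.ofReal_one]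
    exact ENNReal.ofReal_le_ofReal (by norm_num)
  · refine hm₀ _ hM1 y z hy ?_
    have h1 : (editDist y z : ℝ) ≤ 2 * (2 * c₂ * √n) := by
      have : (editDist y z : ℝ) ≤ 2 * ⌊2 * c₂ * √n⌋₊ := by exact_mod_cast hyz
      linarith
    have h2 : (editDist y z : ℝ) ^ 2 ≤ (2 * (2 * c₂ * √n)) ^ 2 := by gcongr
    have h3 : (2 * (2 * c₂ * √n)) ^ 2 = 16 * c₂ ^ 2 * n := by
      linear_combination 16 * c₂ ^ 2 * hsq
    -- Since `c₁ < 1/4` and `n ≤ M`, `112 · 16 c₂² n ≤ (1792 / 4096) c₁² M ≤ (c₁ / 2) M`, which fits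
    -- the condition on the edits of one block.
    have h4 : c₂ ^ 2 ≤ (c₁ / 64) ^ 2 := by gcongr
    have h5 : c₂ ^ 2 * n ≤ (c₁ / 64) ^ 2 * H.len κ := by gcongr
    nlinarith [mul_nonneg hc₁.le (Nat.cast_nonneg (α := ℝ) (H.len κ))]

end
end EditPRC

/-! ### Admissible numbers of blocks. -/

namespace EditPRC
noncomputable section

variable {kind : KeyKind} {H : Scheme} {𝓔 : Set Channel}

/-! ### Unary functions computable in polynomial time -/

theorem UnaryPolyTime.of_yields {f : ℕ → ℕ} {P : Prog} {T : ℕ → ℕ} (hP : OracleFree P)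
    (hT : PolyBounded T)
    (h : ∀ κ, Yields (PMF.pure []) P [ones κ] (T κ) 1 (PMF.pure [ones (f κ)])) :
    UnaryPolyTime f := by
  obtain ⟨q, hq⟩ := hT
  refine ⟨P, q, hP, fun κ => ((h κ).mono (hq κ)).computes (out := fun vs => vs.getD 0 [])
    (fun s => rfl) ?_⟩
  rw [PMF.pure_map]
  rfl

theorem unaryPolyTime_id : UnaryPolyTime fun κ => κ :=
  .of_yields (P := .skip) (T := fun _ => 1) trivial (by fun_prop) fun _ =>
    (Exec.straight (P := .skip) trivial rfl).yields_pure 0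

theorem unaryPolyTime_one : UnaryPolyTime fun _ => 1 :=
  .of_yields (P := .seq (.copy 1 0) (.push true 0)) (T := fun _ => 3) ⟨trivial, trivial⟩
    (by fun_prop) fun κ => (Exec.straight (P := .seq (.copy 1 0) (.push true 0))
      (xs := [ones κ, []]) (μ := PMF.pure [ones 1, []]) (by simp [Straight])
      (by simp [denote, ones])).yields_pure (ins := [ones κ]) (m := 1) 1

theorem UnaryPolyTime.add {f g : ℕ → ℕ} (hf : UnaryPolyTime f) (hg : UnaryPolyTime g) :
    UnaryPolyTime fun κ => f κ + g κ := by
  obtain ⟨P, T, hP, hT, h⟩ := hf.exists_prog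
  obtain ⟨Q, S, hQ, hS, h'⟩ := hg.exists_prog
  obtain ⟨C, hC⟩ := yields_append
  have hf' := hf.polyBounded
  refine .of_yields (P := .seq (callProg 2 P [0] [1]) (.seq (callProg 2 Q [0] [0])
      (callProg 2 appendProg [1, 0] [0])))
    (T := fun κ => (T κ + callCost P [0] [1]) + ((S κ + callCost Q [0] [0]) +
      (C * (f κ + 1) + callCost appendProg [1, 0] [0]) + 1) + 1)
    ⟨hP.callProg _ _ _, hQ.callProg _ _ _, oracleFree_appendProg.callProg _ _ _⟩ (by fun_prop)
    fun κ => ?_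
  have e3 := (hC (PMF.pure []) (ones (f κ)) (ones (g κ))).call_pure (K := 2) (ins := [1, 0])
    (outs := [0]) (xs := [ones (g κ), ones (f κ)]) (by simp) (by simp) (by simp)
  rw [length_ones] at e3
  refine (((h _ κ).call_pure (K := 2) (ins := [0]) (outs := [1]) (xs := [ones κ, []])
    (by simp) (by simp) (by simp)).seq_pure (((h' _ κ).call_pure (K := 2) (ins := [0])
    (outs := [0]) (xs := [ones κ, ones (f κ)]) (by simp) (by simp) (by simp)).seq_pure
      e3)).yields_pure 1 |>.congr le_rfl ?_
  simp [readFrom, load, assign, ones]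

theorem UnaryPolyTime.mul {f g : ℕ → ℕ} (hf : UnaryPolyTime f) (hg : UnaryPolyTime g) :
    UnaryPolyTime fun κ => f κ * g κ := by
  obtain ⟨P, T, hP, hT, h⟩ := hf.exists_prog
  obtain ⟨Q, S, hQ, hS, h'⟩ := hg.exists_prog
  obtain ⟨C, hC⟩ := yields_mul
  have hf' := hf.polyBounded
  have hg' := hg.polyBounded
  refine .of_yields (P := .seq (callProg 2 P [0] [1]) (.seq (callProg 2 Q [0] [0])
      (callProg 2 mulProg [1, 0] [0])))
    (T := fun κ => (T κ + callCost P [0] [1]) + ((S κ + callCost Q [0] [0]) +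
      (C * (f κ + 1) * (g κ + 1) + callCost mulProg [1, 0] [0]) + 1) + 1)
    ⟨hP.callProg _ _ _, hQ.callProg _ _ _, OracleFree.callProg (by
      simp [OracleFree, mulProg]) _ _ _⟩ (by fun_prop) fun κ => ?_
  refine (((h _ κ).call_pure (K := 2) (ins := [0]) (outs := [1]) (xs := [ones κ, []])
    (by simp) (by simp) (by simp)).seq_pure (((h' _ κ).call_pure (K := 2) (ins := [0])
    (outs := [0]) (xs := [ones κ, ones (f κ)]) (by simp) (by simp) (by simp)).seq_pure
    ((hC (PMF.pure []) (f κ) (g κ)).call_pure (K := 2) (ins := [1, 0])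
    (outs := [0]) (xs := [ones (g κ), ones (f κ)]) (by simp) (by simp)
    (by simp)))).yields_pure 1 |>.congr le_rfl ?_
  simp [readFrom, load, assign]

theorem UnaryPolyTime.pow {f : ℕ → ℕ} (hf : UnaryPolyTime f) (m : ℕ) :
    UnaryPolyTime fun κ => f κ ^ m := by
  induction m with
  | zero => simpa only [pow_zero] using unaryPolyTime_one
  | succ m ih => simpa only [pow_succ] using ih.mul hf

theorem IsPRC.unaryPolyTime_blockLen (hH : IsPRC kind H 𝓔) : UnaryPolyTime (blockLen H) := by
  obtain ⟨P, T, hP, hT, h⟩ := hH.exists_paramsProg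
  refine .of_yields (P := .seq (callProg 5 P [0] [0, 1, 2, 3, 4]) (.copy 4 0))
    (T := fun κ => (T κ + callCost P [0] [0, 1, 2, 3, 4]) + 1 + 1)
    ⟨hP.callProg _ _ _, trivial⟩ (by fun_prop) fun κ => ?_
  refine (((h _ κ).call_pure (K := 5) (ins := [0]) (outs := [0, 1, 2, 3, 4])
    (xs := [ones κ, [], [], [], []]) (by simp) (by simp) (by simp)).seq_pure
    (Exec.straight (P := .copy 4 0) (by simp [Straight, assign]) rfl)).yields_pure 4
    |>.congr le_rfl ?_
  simp [readFrom, load, assign]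

/-- Increase the counter as long as its image is below the target. -/
def searchStep (g : ℕ → ℕ) (N k : ℕ) : ℕ := if N ≤ g k then k else k + 1

theorem searchStep_iterate {g : ℕ → ℕ} {N : ℕ} (hN : ∃ k, N ≤ g k) (j : ℕ) :
    (searchStep g N)^[j] 0 = min j (Nat.find hN) := by
  induction j with
  | zero => simp
  | succ j ih =>
    rw [Function.iterate_succ_apply', ih, searchStep]
    rcases lt_or_ge j (Nat.find hN) with h | h
    · rw [min_eq_left h.le, if_neg (Nat.find_min hN h), min_eq_left (Nat.succ_le_of_lt h)]
    · rw [min_eq_right h, if_pos (Nat.find_spec hN), min_eq_right (by omega)]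

/-- The search for the least `k` with `N ≤ g k`. -/
def searchProg (PN Pg : Prog) : Prog :=
  .seq (callProg 6 PN [0] [1]) (.seq (.copy 1 2)
    (.seq (.loop 2 (.seq (.pop 2) (.seq (callProg 6 Pg [3] [4])
      (.seq (callProg 6 splitProg [4, 1] [4, 5])
        (.branch 5 .skip (.push true 3) (.push true 3)))))) (.copy 3 0)))

/-- A linear search of exactly `f κ` rounds whose counter stops at the first success; `hfg`
guarantees success by then. The counter never exceeds `f κ`, so `g` is only evaluated at arguments
of polynomial size. -/
theorem UnaryPolyTime.find {f g : ℕ → ℕ} (hf : UnaryPolyTime f) (hg : UnaryPolyTime g)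
    (hfg : ∀ κ, f κ ≤ g (f κ)) :
    UnaryPolyTime fun κ => Nat.find (p := fun k => f κ ≤ g k) ⟨f κ, hfg κ⟩ := by
  obtain ⟨PN, TN, hPN, hTN, hN⟩ := hf.exists_prog
  obtain ⟨Pg, Tg, hPg, ⟨q, hq⟩, hg'⟩ := hg.exists_prog
  obtain ⟨C, hC⟩ := yields_split_ones
  obtain ⟨qg, hqg⟩ := hg.polyBounded
  have hf' := hf.polyBounded
  refine .of_yields (P := searchProg PN Pg) (T := fun κ =>
    (TN κ + callCost PN [0] [1]) + (1 + (f κ * ((1 + ((q.eval (f κ) + callCost Pg [3] [4]) +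
      ((C * (qg.eval (f κ) + 1) + callCost splitProg [4, 1] [4, 5]) + 2 + 1) + 1) + 1) + 1) + 1 + 1
        + 1) + 1) + 1)
    ⟨hPN.callProg _ _ _, trivial, ⟨trivial, hPg.callProg _ _ _,
      oracleFree_splitProg.callProg _ _ _, trivial, trivial, trivial⟩, trivial⟩ (by fun_prop)
    fun κ => ?_
  set N := f κ
  have hloop := Exec.loop_iter (O := PMF.pure []) (r := 2)
    (P := .seq (.pop 2) (.seq (callProg 6 Pg [3] [4])
      (.seq (callProg 6 splitProg [4, 1] [4, 5])
        (.branch 5 .skip (.push true 3) (.push true 3)))))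
    (S := fun m (b : ℕ × List Bool × List Bool) =>
      [ones κ, ones N, ones m, ones b.1, b.2.1, b.2.2])
    (k := fun _ b => PMF.pure (searchStep g N b.1, (ones N).take (g b.1), (ones N).drop (g b.1)))
    (Inv := fun m b => b.1 + m ≤ N)
    (C := 1 + ((q.eval N + callCost Pg [3] [4]) +
      ((C * (qg.eval N + 1) + callCost splitProg [4, 1] [4, 5]) + 2 + 1) + 1) + 1)
    (fun b _ => rfl) (fun m b _ => by simp [ones])
    (fun m b hb => by
      obtain ⟨k, v, w⟩ := b
      simp only at hb
      rw [PMF.pure_map]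
      have e1 := (hg' (PMF.pure []) k).call_pure (K := 6) (ins := [3]) (outs := [4])
        (xs := [ones κ, ones N, ones m, ones k, v, w]) (by simp) (by simp) (by simp)
      have e2 := (hC (PMF.pure []) (g k) (ones N)).call_pure (K := 6) (ins := [4, 1])
        (outs := [4, 5]) (xs := [ones κ, ones N, ones m, ones k, ones (g k), w])
        (by simp) (by simp) (by simp)
      have hk : k ≤ N := by omega
      refine Exec.seq_pure (Exec.straight (P := .pop 2) (by simp [Straight]) rfl)
        ((e1.mono (Nat.add_le_add_right ((hq k).trans (polyEval_mono q hk)) _)).seq_pure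
        ((e2.mono (Nat.add_le_add_right (Nat.mul_le_mul_left C (Nat.succ_le_succ
          ((hqg k).trans (polyEval_mono qg hk)))) _)).seq_pure ?_))
      -- Comparison in unary: `N ≤ g k` exactly when removing `g k` marks from `N` leaves nothing.
      have hd : (ones N).drop (g k) = ones (N - g k) := by simp [ones]
      change Exec _ _ [ones κ, ones N, ones m, ones k, (ones N).take (g k),
        (ones N).drop (g k)] 2 _
      rw [hd]
      by_cases hle : N ≤ g k
      · have : N - g k = 0 := by omega
        rw [this]
        refine Exec.branch_nil rfl (Exec.straight (P := .skip) trivial ?_)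
        simp [denote, searchStep, hle]
      · obtain ⟨j, hj⟩ : ∃ j, N - g k = j + 1 := ⟨N - g k - 1, by omega⟩
        rw [hj]
        refine Exec.branch_true (l := ones j) rfl
          (Exec.straight (P := .push true 3) (by simp [Straight]) ?_)
        simp [denote, searchStep, hle, ones, List.replicate_succ])
    (fun m b hb b' hb' => by
      rw [PMF.support_pure, Set.mem_singleton_iff] at hb'
      subst hb'
      simp only [searchStep]
      split_ifs <;> omega)
    N (0, [], []) (by simp)
  have hiter : ∀ m (b : ℕ × List Bool × List Bool), ∃ c, iterKernel (fun _ b =>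
      PMF.pure (searchStep g N b.1, (ones N).take (g b.1), (ones N).drop (g b.1))) m b =
      PMF.pure ((searchStep g N)^[m] b.1, c) := by
    intro m
    induction m with
    | zero => exact fun b => ⟨b.2, rfl⟩
    | succ m ih =>
      intro b
      obtain ⟨c, hc⟩ := ih (searchStep g N b.1, (ones N).take (g b.1), (ones N).drop (g b.1))
      exact ⟨c, by rw [iterKernel, PMF.pure_bind, hc, Function.iterate_succ_apply]⟩
  obtain ⟨c, hc⟩ := hiter N (0, [], [])
  have hle : Nat.find (p := fun k => N ≤ g k) ⟨N, hfg κ⟩ ≤ N := Nat.find_min' _ (hfg κ)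
  rw [hc, PMF.pure_map, searchStep_iterate ⟨N, hfg κ⟩, min_eq_right hle] at hloop
  refine (((hN _ κ).call_pure (K := 6) (ins := [0]) (outs := [1])
    (xs := [ones κ, [], [], [], [], []]) (by simp) (by simp) (by simp)).seq_pure
    ((Exec.straight (P := .copy 1 2) (by simp [Straight, assign]) rfl).seq_pure
    (hloop.seq_pure (Exec.straight (P := .copy 3 0) (by simp [Straight])
      rfl)))).yields_pure 5 |>.congr le_rfl ?_
  simp [readFrom, load]

/-! ### Admissible numbers of blocks -/

theorem tendsto_div_log_of_le {ℓ : ℕ → ℕ} (h : ∀ κ, κ ≤ ℓ κ) :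
    Tendsto (fun κ : ℕ => (ℓ κ : ℝ) / Real.log κ) atTop atTop := by
  have h1 : Tendsto (fun x : ℝ => x / Real.log x) atTop atTop := by
    have h2 := (Real.tendsto_exp_div_pow_atTop 1).comp Real.tendsto_log_atTop
    refine h2.congr' ?_
    filter_upwards [eventually_gt_atTop 0] with x hx
    simp [Real.exp_log hx]
  refine tendsto_atTop_mono' _ ?_ (h1.comp tendsto_natCast_atTop_atTop)
  filter_upwards [eventually_ge_atTop 1] with κ hκ
  have : (0 : ℝ) ≤ Real.log κ := Real.log_natCast_nonneg κ
  have h2 : (κ : ℝ) ≤ ℓ κ := by exact_mod_cast h κ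
  simp only [Function.comp_apply]
  gcongr

/-- Rounding the exponent up to a natural number makes the power computable, whatever the real `γ`
is; the summand `κ` provides the growth beyond `log κ`. -/
theorem exists_admissibleBlocks (hH : IsPRC kind H 𝓔) {γ : ℝ} (hγ : 0 < γ) (hγ' : γ < 1 / 2) :
    ∃ ℓ, AdmissibleBlocks γ H ℓ := by
  have hx : 0 < 1 / (2 * γ) - 1 := by
    rw [sub_pos, lt_div_iff₀ (by positivity)]; linarith
  set x := 1 / (2 * γ) - 1 with hx'
  refine ⟨fun κ => blockLen H κ ^ ⌈x⌉₊ + κ,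
    (hH.unaryPolyTime_blockLen.pow _).add unaryPolyTime_id, fun κ => ?_,
    tendsto_div_log_of_le fun κ => Nat.le_add_left _ _⟩
  refine le_trans (Nat.ceil_le.2 ?_) (Nat.le_add_right _ _)
  rw [← hx']
  push_cast
  rcases Nat.eq_zero_or_pos (blockLen H κ) with h0 | h0
  · rw [h0, Nat.cast_zero, Real.zero_rpow hx.ne']
    positivity
  · rw [← Real.rpow_natCast]
    exact Real.rpow_le_rpow_of_exponent_le (by exact_mod_cast h0) (Nat.le_ceil x)

/-- For a rational exponent $p/q$, $\lceil n^{p/q}\rceil$ is the least $k$ with $n^p\le k^q$, so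
real powers are avoided and `UnaryPolyTime.find` applies. -/
theorem standardBlocks_admissible (hH : IsPRC kind H 𝓔) {γ : ℝ} (hγ : 0 < γ) (hγ' : γ < 1 / 2)
    (hq : ∃ g : ℚ, (g : ℝ) = γ)
    (hlog : Tendsto (fun κ : ℕ => (standardBlocks γ H κ : ℝ) / Real.log κ) atTop atTop) :
    AdmissibleBlocks γ H (standardBlocks γ H) := by
  refine ⟨?_, fun κ => le_rfl, hlog⟩
  obtain ⟨g, rfl⟩ := hq
  have hx : 0 < 1 / (2 * (g : ℝ)) - 1 := by
    rw [sub_pos, lt_div_iff₀ (by positivity)]; linarith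
  set x : ℚ := 1 / (2 * g) - 1 with hx'
  have hxr : 1 / (2 * (g : ℝ)) - 1 = (x : ℝ) := by rw [hx']; push_cast; ring
  rw [hxr] at hx
  have hx0 : 0 < x := by exact_mod_cast hx
  have hnum : ((x.num.toNat : ℕ) : ℝ) = (x.num : ℝ) := by
    have := Int.toNat_of_nonneg (Rat.num_nonneg.2 hx0.le)
    exact_mod_cast this
  have hden : (0 : ℝ) < x.den := by exact_mod_cast x.den_pos
  have hxd : (x : ℝ) = (x.num.toNat : ℕ) / (x.den : ℝ) := by rw [hnum, ← Rat.cast_def]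
  have hself : ∀ N : ℕ, N ≤ N ^ x.den := fun N => Nat.le_self_pow x.den_nz N
  have key := (hH.unaryPolyTime_blockLen.pow x.num.toNat).find
    (unaryPolyTime_id.pow x.den) fun κ => hself _
  convert key using 2 with κ
  rw [eq_comm, Nat.find_eq_iff]
  have hiff : ∀ k : ℕ, blockLen H κ ^ x.num.toNat ≤ k ^ x.den ↔ standardBlocks g H κ ≤ k := by
    intro k
    rw [standardBlocks, hxr, Nat.ceil_le, hxd, div_eq_mul_inv,
      Real.rpow_mul (Nat.cast_nonneg _), Real.rpow_natCast,
      Real.rpow_inv_le_iff_of_pos (by positivity) (by positivity) hden, Real.rpow_natCast]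
    exact_mod_cast Iff.rfl
  exact ⟨(hiff _).2 le_rfl, fun k hk => by rw [hiff]; omega⟩

end
end EditPRC

/-! ### The hybrid encoder and the simulation of an adversary. -/

namespace EditPRC
noncomputable section

variable {kind : KeyKind} {H : Scheme} {𝓔 : Set Channel} {O : PMF (List Bool)}

/-! ### The hybrid encoder -/

/-- The encoding of a block with index `i` relative to the challenge: a proper encoding for `0`, a
block around the answer of the oracle for `1`, and a uniform string otherwise. -/
def hybridBlock (H : Scheme) (κ : ℕ) (O : PMF (List Bool)) :
    ℕ → List Bool × List Bool × List Bool → PMF (List Bool)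
  | 0, part => encBlock H κ part
  | 1, part => O.bind fun a => unemb (blockLen H κ) (xorStr a part.2.2) part.2.1
  | _ + 2, _ => uniformBits (blockLen H κ)

/-- The encoder in which the blocks before block `i - 1` are uniform, and block `i - 1` is built
from the answer of the oracle. -/
def hybridEnc (H : Scheme) (m κ : ℕ) (O : PMF (List Bool)) (ek : List Bool) (i : ℕ) :
    PMF (List Bool) :=
  concatAll ((List.range m).map fun t =>
    hybridBlock H κ O (i - t) (readPart H (H.encKeyLen κ) κ ek t))

theorem length_of_mem_hybridBlock {κ i : ℕ} {part : List Bool × List Bool × List Bool}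
    {y : List Bool} (h : y ∈ (hybridBlock H κ O i part).support) : y.length = blockLen H κ := by
  rcases i with _ | _ | i
  · exact length_of_mem_encBlock h
  · rw [hybridBlock, PMF.mem_support_bind_iff] at h
    obtain ⟨a, -, h⟩ := h
    exact length_of_mem_unemb h
  · exact length_of_mem_uniformBits h

/-- Encode one block of the hybrid encoder. -/
def hybridBlockProg (PE : Prog) : Prog :=
  .branch 5 (maskedBlockProg (callProg 6 PE [0, 2] [2])) .skip
    (.seq (.pop 5) (.branch 5 (maskedBlockProg (.query 2)) .skip (callProg 6 coinsProg [1] [0])))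

theorem exists_hybridEncProg (hH : IsPRC kind H 𝓔) {ℓ : ℕ → ℕ} (hℓ : UnaryPolyTime ℓ) :
    ∃ (P : Prog) (T : ℕ → ℕ), PolyBounded T ∧ ∀ (O : PMF (List Bool)) (κ : ℕ) (ek : List Bool)
      (i : ℕ), ek.length = ℓ κ * partLen H (H.encKeyLen κ) κ →
        Yields O P [ones κ, ek, ones i] (T κ) 1
          ((hybridEnc H (ℓ κ) κ O ek i).map fun y => [y]) := by
  obtain ⟨PE, TE, hPE, hTE, hE⟩ := hH.exists_encProg
  obtain ⟨T₁, hT₁, h₁⟩ := exists_yields_maskedBlockProg (PE := callProg 6 PE [0, 2] [2])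
    (TE := fun κ => TE κ + callCost PE [0, 2] [2]) hH.polyBounded_len (by fun_prop)
  obtain ⟨T₂, hT₂, h₂⟩ := exists_yields_maskedBlockProg (PE := .query 2)
    (TE := fun κ => 1) hH.polyBounded_len (by fun_prop)
  obtain ⟨C, hC⟩ := yields_coins
  have hn := polyBounded_blockLen hH.polyBounded_len
  obtain ⟨P, T, -, hT, h⟩ := exists_encLoopProg hH hℓ (hybridBlockProg PE)
    (TB := fun κ => T₁ κ + T₂ κ + (C * (blockLen H κ + 1) + callCost coinsProg [1] [0]) + 4)
    (by fun_prop)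
  refine ⟨P, T, hT, fun O κ ek i hek => h O κ (hybridBlock H κ O)
    (fun i key r e hk hr he => ?_)
    (fun i key r e _ _ _ y hy => (length_of_mem_hybridBlock hy).le) ek i hek⟩
  rcases i with _ | _ | i
  · have e1 := h₁ O κ key r e (ones 0) (H.enc κ key) he (Exec.congr
      ((hE O κ key hk).call (K := 6) (ins := [0, 2]) (outs := [2])
        (xs := [ones κ, ones (blockLen H κ), key, r, e, ones 0]) (by simp) (by simp) (by simp))
      le_rfl (by rw [PMF.map_comp]; rfl))
    refine Yields.congr (Exec.yields 0 (Exec.branch_nil (r := 5) rfl e1)) (by omega) ?_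
    simp only [hybridBlock, encBlock, map_eq_bind, PMF.bind_bind, PMF.pure_bind, readFrom, load]
    rfl
  · have e1 := h₂ O κ key r e (ones 0) O he (Exec.straight (by simp [Straight]) rfl)
    have e2 : Exec O (.pop 5) [ones κ, ones (blockLen H κ), key, r, e, ones 1] 1
        (PMF.pure [ones κ, ones (blockLen H κ), key, r, e, ones 0]) :=
      Exec.straight (P := .pop 5) (by simp [Straight]) rfl
    refine Yields.congr (Exec.yields 0 (Exec.branch_true (r := 5) (l := []) rfl
      (e2.seq_pure (Exec.branch_nil (r := 5) rfl e1)))) (by omega) ?_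
    simp only [hybridBlock, map_eq_bind, PMF.bind_bind, PMF.pure_bind, readFrom, load]
    rfl
  · have e1 := (hC O (ones (blockLen H κ))).call (K := 6) (ins := [1]) (outs := [0])
      (xs := [ones κ, ones (blockLen H κ), key, r, e, ones (i + 1)])
      (by simp) (by simp) (by simp)
    have e2 : Exec O (.pop 5) [ones κ, ones (blockLen H κ), key, r, e, ones (i + 2)] 1
        (PMF.pure [ones κ, ones (blockLen H κ), key, r, e, ones (i + 1)]) :=
      Exec.straight (P := .pop 5) (by simp [Straight]) rfl
    rw [length_ones] at e1
    refine Yields.congr (Exec.yields 0 (Exec.branch_true (r := 5) (l := ones (i + 1)) rfl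
      (e2.seq_pure (Exec.branch_true (r := 5) (l := ones i) rfl e1)))) (by omega) ?_
    simp only [hybridBlock, map_eq_bind, PMF.bind_bind, PMF.pure_bind, readFrom, load]
    rfl

/-! ### Simulating an adversary -/

/-- Run the adversary on the input `1^κ` in register `0` and the view in register `3`, where the
oracle is replaced by the program `PO` with the registers `0, 1, 2` as input. -/
def simulateProg (A PO : Prog) : Prog :=
  .seq (.copy 0 5) (.seq (.copy 3 6)
    (.seq (A.embed 5 fun r => callProg (5 + max 2 (regBound A)) PO [0, 1, 2] [5 + r])
      (.seq (.copy 4 0) (.branch 5 .skip .skip (.push true 0)))))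

/-- Registers `0` to `3` hold the data of the simulator, `4` stays empty, the adversary lives from
`5` on, and the oracle program runs above the adversary. The time bound of the adversary holds for
every oracle, so it holds for the simulated one, and each of its steps costs at most one call of
`PO`. -/
theorem Adversary.yields_simulateProg (A : Adversary) {PO : Prog} {C κ i : ℕ}
    {ek view : List Bool} {O' : PMF (List Bool)}
    (hPO : Yields O PO [ones κ, ek, ones i] C 1 (O'.map fun y => [y])) :
    Yields O (simulateProg A.prog PO) [ones κ, ek, ones i, view]
      (A.time.eval (κ + view.length) * (C + callCost PO [0, 1, 2] [0]) + 10) 1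
      ((A.output O' κ view).map fun b => [flagStr b]) := by
  set b := max 2 (regBound A.prog) with hb
  set x := load [ones κ, ek, ones i, view] with hx
  have hev := evals_of_halts (A.halts O' κ view)
  rw [Adversary.output, finalStore]
  set T := A.time.eval (κ + view.length)
  set d := (run O' T ([A.prog], load [ones κ, view])).map Prod.snd with hd
  let F : Store → Store := fun s =>
    joinStore 5 (Function.update x 0 (flagStr (readBit s))) s
  have hbig : ∀ r < b, ∀ s, SuppBelow b s →
      Big O (callProg (5 + b) PO [0, 1, 2] [5 + r]) (joinStore 5 x s)
        (C + callCost PO [0, 1, 2] [0])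
        (O'.map fun a => joinStore 5 x (Function.update s r a)) := by
    intro r hr s hs
    have hins : [0, 1, 2].map (joinStore 5 x s) = [ones κ, ek, ones i] := by
      simp [joinStore, hx, load]
    have := Yields.big_call (O := O) (P := PO) (ins := [0, 1, 2]) (outs := [5 + r])
      (x := joinStore 5 x s) (K := 5 + b) (by rw [hins]; exact hPO) (fun j hj => by
        rw [joinStore, if_neg (by omega)]
        exact hs _ (by omega)) (by simp; omega) (by simp; omega)
    refine this.congr_dist ?_
    rw [PMF.map_comp]
    congr 1
    funext a
    simp only [Function.comp_apply, assignStore, joinStore_update]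
  -- Copying the empty register `4` erases register `0`, after which the output bit is normalised to
  -- a flag.
  have hfin : ∀ s' ∈ d.support, SuppBelow b s' →
      Evals O ([.seq (.copy 4 0) (.branch 5 .skip .skip (.push true 0))], joinStore 5 x s') 5
        (PMF.pure (F s')) := by
    intro s' _ _
    have e1 : Big O (.copy 4 0) (joinStore 5 x s') 1
        (PMF.pure (joinStore 5 (Function.update x 0 []) s')) := by
      refine (big_copy _ 4 0).congr_dist ?_
      rw [joinStore_update_lt _ _ (by norm_num)]
      rfl
    have e5 : (joinStore 5 (Function.update x 0 []) s') 5 = s' 0 := joinStore_add 5 _ s' 0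
    have e2 : Big O (.branch 5 .skip .skip (.push true 0))
        (joinStore 5 (Function.update x 0 []) s') 2 (PMF.pure (F s')) := by
      rcases h : s' 0 with _ | ⟨_ | _, l⟩
      · refine big_of_reduces (Q := .skip) (T := 1) (fun K => by simp only [step, e5, h])
          ((big_skip _).congr_dist ?_)
        simp [F, readBit, h, flagStr]
      · refine big_of_reduces (Q := .skip) (T := 1) (fun K => by simp only [step, e5, h])
          ((big_skip _).congr_dist ?_)
        simp [F, readBit, h, flagStr]
      · refine big_of_reduces (Q := .push true 0) (T := 1) (fun K => by simp only [step, e5, h])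
          (big_of_step fun K => ?_)
        rw [PMF.pure_map]
        simp only [step]
        rw [joinStore_update_lt _ _ (by norm_num), joinStore_lt _ _ (by norm_num)]
        simp [F, readBit, h, flagStr]
    exact ((e1.seq_pure e2).evals).mono (by norm_num)
  have key := hev.embed (O := O) (k := 5) (b := b) (C := C + callCost PO [0, 1, 2] [0])
    (Q := fun r => callProg (5 + b) PO [0, 1, 2] [5 + r]) (x := x)
    (by rw [callCost]; omega) hbig (by
      intro R hR
      rw [List.mem_singleton] at hR
      subst hR
      exact (regsBelow_regBound _).mono (le_max_right _ _))
    (fun r hr => suppBelow_load _ r (by simp; omega))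
    [.seq (.copy 4 0) (.branch 5 .skip .skip (.push true 0))] 5 _ hfin
  have hstart : Evals O ([simulateProg A.prog PO], x)
      (T * (C + callCost PO [0, 1, 2] [0]) + 10) (d.bind fun s' => PMF.pure (F s')) := by
    have e1 : Function.update (Function.update x 5 (x 0)) 6 (x 3) =
        joinStore 5 x (load [ones κ, view]) := by
      funext r
      rcases lt_or_ge r 5 with h | h
      · rw [Function.update_of_ne (by omega), Function.update_of_ne (by omega), joinStore_lt _ _ h]
      · obtain ⟨j, rfl⟩ := Nat.exists_eq_add_of_le h
        rw [joinStore_add]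
        rcases j with _ | _ | j
        · simp [hx, load]
        · simp [hx, load]
        · rw [Function.update_of_ne (by omega), Function.update_of_ne (by omega), hx, load, load,
            List.getD_eq_default _ _ (by simp; omega), List.getD_eq_default _ _ (by simp)]
    have e2 : run O 5 ([simulateProg A.prog PO], x) = PMF.pure ([A.prog.embed 5 fun r =>
        callProg (5 + b) PO [0, 1, 2] [5 + r], .seq (.copy 4 0) (.branch 5 .skip .skip
          (.push true 0))], joinStore 5 x (load [ones κ, view])) := by
      rw [← e1]
      simp only [simulateProg, run, step, PMF.pure_bind]
      rfl
    rw [Evals, show T * (C + callCost PO [0, 1, 2] [0]) + 10 =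
      5 + (T * (C + callCost PO [0, 1, 2] [0]) + 5) by ring, run_add, e2, PMF.pure_bind]
    exact key
  refine ⟨_, hstart, ?_⟩
  rw [PMF.map_bind, map_eq_bind, map_eq_bind, PMF.bind_bind]
  congr 1
  funext s'
  simp [PMF.pure_map, readFrom, F, joinStore]

end
end EditPRC

/-! ### Sampling a random block and planting a challenge key. -/

namespace EditPRC
noncomputable section

open scoped ENNReal

variable {kind : KeyKind} {H : Scheme} {𝓔 : Set Channel} {O : PMF (List Bool)}

/-! ### A random index -/

/-- Halve the first number, and append a random bit to the second one. -/
def indexKernel (_ : ℕ) (b : ℕ × ℕ) : PMF (ℕ × ℕ) :=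
  coin.map fun c => (b.1 / 2, b.2 + b.2 + c.toNat)

/-- A uniform number below the least power of two that exceeds `m`. -/
def randomIndex (m : ℕ) : PMF ℕ := (iterKernel indexKernel m.size (m, 0)).map Prod.snd

/-- Appending `m` fair bits to `b.2` gives a uniform number among the `2 ^ m` with that binary
prefix. -/
theorem expect_iterKernel_indexKernel (m : ℕ) (b : ℕ × ℕ) (f : ℕ → ℝ≥0∞) :
    (expect (iterKernel indexKernel m b) fun b' => f b'.2) =
      (2 ^ m)⁻¹ * ∑ j ∈ Finset.range (2 ^ m), f (b.2 * 2 ^ m + j) := by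
  induction m generalizing b with
  | zero => simp [iterKernel, expect_pure]
  | succ m ih =>
    have hs : (2 : ℕ) ^ (m + 1) = 2 ^ m + 2 ^ m := by ring
    rw [iterKernel, expect_bind, indexKernel, expect_map, expect_coin, ih, ih, hs,
      Finset.sum_range_add, ← mul_add, pow_succ,
      ENNReal.mul_inv (Or.inr (by simp)) (Or.inr (by simp)), mul_comm (_)⁻¹ 2⁻¹, mul_assoc,
      add_comm (Finset.sum _ _)]
    congr 3
    · refine Finset.sum_congr rfl fun j _ => ?_
      congr 1
      simp; ring
    · refine Finset.sum_congr rfl fun j _ => ?_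
      congr 1
      simp; ring

theorem lt_two_pow_size (m : ℕ) : m < 2 ^ m.size := Nat.size_le.1 le_rfl

theorem two_pow_size_le (m : ℕ) : 2 ^ m.size ≤ 2 * m + 1 := by
  rcases h : m.size with _ | p
  · simp
  · have : ¬ m < 2 ^ p := fun h' => by have := Nat.size_le.2 h'; omega
    rw [pow_succ]; omega

theorem size_half {m p : ℕ} (h : m.size = p + 1) : (m / 2).size = p := by
  have h1 := lt_two_pow_size m
  rw [h, pow_succ] at h1
  have h2 : (m / 2).size ≤ p := Nat.size_le.2 (by omega)
  refine le_antisymm h2 ?_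
  by_contra! h3
  have h4 : (m / 2).size ≤ p - 1 := by omega
  have h5 := Nat.size_le.1 h4
  have h6 : m.size ≤ p := Nat.size_le.2 (by
    have : 2 ^ p = 2 ^ (p - 1) * 2 := by rw [← pow_succ]; congr 1; omega
    omega)
  omega

/-- Fair coins cannot sample exactly from an arbitrary range in bounded time, so a power of two is
used and surplus indices count as zero. The price is a factor at most `2m + 1` in the advantage. -/
theorem expect_randomIndex (m : ℕ) (f : ℕ → ℝ≥0∞) (hf : ∀ i, m ≤ i → f i = 0) :
    expect (randomIndex m) f = (2 ^ m.size)⁻¹ * ∑ i ∈ Finset.range m, f i := by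
  rw [randomIndex, expect_map, expect_iterKernel_indexKernel]
  congr 1
  simp only [zero_mul, zero_add]
  refine (Finset.sum_subset (Finset.range_subset_range.2 (lt_two_pow_size m).le)
    fun i _ hi => hf i (by simpa using hi)).symm

/-- Halving removes one binary digit of the counter, so the loop ends after `m.size` rounds.
Doubling appends the unary number to itself. -/
def indexStep : Prog :=
  .seq (callProg 3 halfProg [0] [0]) (.seq (callProg 3 appendProg [1, 1] [1])
    (.seq (.flip 2) (.branch 2 .skip (.pop 2) (.seq (.pop 2) (.push true 1)))))

/-- Sample a random index. -/
def indexProg : Prog := .seq (.loop 0 indexStep) (.copy 1 0)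

/-- The loop invariant of the sampling of an index. -/
def IndexInv (m p : ℕ) (b : ℕ × ℕ) : Prop :=
  b.1.size = p ∧ b.1 ≤ m ∧ (b.2 + 1) * 2 ^ p ≤ 2 * m + 1

theorem IndexInv.step {m p : ℕ} {b b' : ℕ × ℕ} (hb : IndexInv m (p + 1) b)
    (hb' : b' ∈ (indexKernel p b).support) : IndexInv m p b' := by
  obtain ⟨hb1, hb2, hb3⟩ := hb
  rw [indexKernel, PMF.mem_support_map_iff] at hb'
  obtain ⟨c, -, rfl⟩ := hb'
  refine ⟨size_half hb1, (Nat.div_le_self _ _).trans hb2, le_trans ?_ hb3⟩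
  rw [pow_succ, mul_comm (2 ^ p) 2, ← mul_assoc]
  have : c.toNat ≤ 1 := Bool.toNat_le c
  exact Nat.mul_le_mul_right _ (by simp only; omega)

theorem indexInv_start (m : ℕ) : IndexInv m m.size (m, 0) :=
  ⟨rfl, le_rfl, by simpa using two_pow_size_le m⟩

theorem le_of_mem_randomIndex {m i : ℕ} (hi : i ∈ (randomIndex m).support) : i ≤ 2 * m := by
  have key : ∀ p b, IndexInv m p b → ∀ b' ∈ (iterKernel indexKernel p b).support,
      b'.2 ≤ 2 * m := by
    intro p
    induction p with
    | zero =>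
      intro b hb b' hb'
      simp only [iterKernel, PMF.support_pure, Set.mem_singleton_iff] at hb'
      have := hb.2.2
      subst hb'
      omega
    | succ p ih =>
      intro b hb b' hb'
      rw [iterKernel, PMF.mem_support_bind_iff] at hb'
      obtain ⟨c, hc, hb'⟩ := hb'
      exact ih c (hb.step hc) b' hb'
  rw [randomIndex, PMF.mem_support_map_iff] at hi
  obtain ⟨b, hb, rfl⟩ := hi
  exact key m.size (m, 0) (indexInv_start m) b hb

theorem exists_exec_indexStep : ∃ T : ℕ → ℕ, PolyBounded T ∧ ∀ (O : PMF (List Bool)) (m p : ℕ)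
    (b : ℕ × ℕ), IndexInv m (p + 1) b → Exec O indexStep [ones b.1, ones b.2, []] (T m)
      ((indexKernel p b).map fun b' => [ones b'.1, ones b'.2, []]) := by
  obtain ⟨C₁, h₁⟩ := yields_half
  obtain ⟨C₂, h₂⟩ := yields_append
  refine ⟨fun m => (C₁ * (m + 1) + callCost halfProg [0] [0]) +
    ((C₂ * (2 * m + 1) + callCost appendProg [1, 1] [1]) + 6 + 1) + 1, by fun_prop, ?_⟩
  rintro O m p b ⟨hb1, hb2, hb3⟩
  have hb4 : b.2 ≤ 2 * m := by
    have : (b.2 + 1) * 1 ≤ (b.2 + 1) * 2 ^ (p + 1) := Nat.mul_le_mul_left _ Nat.one_le_two_pow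
    omega
  have e1 := (h₁ O b.1).call_pure (K := 3) (ins := [0]) (outs := [0])
    (xs := [ones b.1, ones b.2, []]) (by simp) (by simp) (by simp)
  have e2 := (h₂ O (ones b.2) (ones b.2)).call_pure (K := 3) (ins := [1, 1]) (outs := [1])
    (xs := [ones (b.1 / 2), ones b.2, []]) (by simp) (by simp) (by simp)
  have e3 : Exec O (.seq (.flip 2) (.branch 2 .skip (.pop 2) (.seq (.pop 2) (.push true 1))))
      [ones (b.1 / 2), ones b.2 ++ ones b.2, []] 6
      ((indexKernel p b).map fun b' => [ones b'.1, ones b'.2, []]) := by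
    refine Exec.straight (P := .seq (.flip 2) (.branch 2 .skip (.pop 2)
      (.seq (.pop 2) (.push true 1)))) (by simp [Straight]) ?_
    simp only [denote, indexKernel, map_eq_bind, PMF.bind_bind, PMF.pure_bind]
    congr 1
    funext c
    rcases c <;> simp [ones, List.replicate_succ]
  refine (e1.seq_pure (e2.seq_pure e3)).mono ?_
  rw [length_ones]
  have := Nat.mul_le_mul_left C₁ (Nat.succ_le_succ hb2)
  have := Nat.mul_le_mul_left C₂ (Nat.succ_le_succ hb4)
  simp only [Nat.succ_eq_add_one] at *
  omega

theorem exec_index_loop {m t : ℕ} (hstep : ∀ (p : ℕ) (b : ℕ × ℕ), IndexInv m (p + 1) b →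
    Exec O indexStep [ones b.1, ones b.2, []] t
      ((indexKernel p b).map fun b' => [ones b'.1, ones b'.2, []])) (p : ℕ) (b : ℕ × ℕ)
    (hb : IndexInv m p b) : Exec O (.loop 0 indexStep) [ones b.1, ones b.2, []] (p * (t + 1) + 1)
      ((iterKernel indexKernel p b).map fun b' => [ones b'.1, ones b'.2, []]) := by
  let S : ℕ → ℕ × ℕ → List (List Bool) := fun _ b => [ones b.1, ones b.2, []]
  have h0 : ∀ b, IndexInv m 0 b → (S 0 b).getD 0 [] = [] := by
    rintro b ⟨h, -, -⟩
    rw [Nat.size_eq_zero] at h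
    simp [S, h, ones]
  have h1 : ∀ p b, IndexInv m (p + 1) b → (S (p + 1) b).getD 0 [] ≠ [] := by
    rintro p b ⟨h, -, -⟩
    have : b.1 ≠ 0 := fun h0 => by rw [h0, Nat.size_zero] at h; omega
    simpa [S, ones] using this
  have h2 : ∀ p b, IndexInv m (p + 1) b → Exec O indexStep (S (p + 1) b) t
      ((indexKernel p b).map (S p)) := hstep
  exact Exec.loop_iter h0 h1 h2 (fun p b hb b' hb' => hb.step hb') p b hb

theorem exists_yields_indexProg : ∃ T : ℕ → ℕ, PolyBounded T ∧ ∀ (O : PMF (List Bool)) (m : ℕ),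
    Yields O indexProg [ones m] (T m) 1 ((randomIndex m).map fun i => [ones i]) := by
  obtain ⟨T, hT, hstep⟩ := exists_exec_indexStep
  refine ⟨fun m => m * (T m + 1) + 1 + 1 + 1, by fun_prop, fun O m => ?_⟩
  have h1 := exec_index_loop (hstep O m) m.size (m, 0) (indexInv_start m)
  have h2 : m.size ≤ m := Nat.size_le.2 Nat.lt_two_pow_self
  rw [randomIndex]
  generalize iterKernel indexKernel m.size (m, 0) = d at h1
  generalize m.size = p at h1 h2
  refine Yields.congr (Exec.yields (ins := [ones m]) 2 (Exec.seq_map h1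
    (g := fun b => PMF.pure [ones b.2, ones b.2, []])
    fun b _ => Exec.straight (P := .copy 1 0) (by simp [Straight]) rfl)) ?_ ?_
  · simp only [straightTime]
    gcongr
  · simp only [map_eq_bind, PMF.bind_bind, PMF.pure_bind, readFrom, load]
    rfl

/-! ### Planting a view -/

theorem IsPRC.unaryPolyTime_keyLen_len (hH : IsPRC kind H 𝓔) :
    UnaryPolyTime H.encKeyLen ∧ UnaryPolyTime H.len := by
  obtain ⟨P, T, hP, hT, h⟩ := hH.exists_paramsProg
  have key : ∀ κ, Exec (PMF.pure []) (callProg 5 P [0] [0, 1, 2, 3, 4]) [ones κ, [], [], [], []]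
      (T κ + callCost P [0] [0, 1, 2, 3, 4]) _ := fun κ => (h _ κ).call_pure
    (K := 5) (ins := [0]) (outs := [0, 1, 2, 3, 4]) (by simp) (by simp) (by simp)
  constructor
  · refine .of_yields (P := .seq (callProg 5 P [0] [0, 1, 2, 3, 4]) (.copy 1 0))
      (T := fun κ => (T κ + callCost P [0] [0, 1, 2, 3, 4]) + 1 + 1)
      ⟨hP.callProg _ _ _, trivial⟩ (by fun_prop) fun κ => ?_
    refine ((key κ).seq_pure (Exec.straight (P := .copy 1 0)
      (by simp [Straight, assign]) rfl)).yields_pure 4 |>.congr le_rfl ?_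
    simp [readFrom, load, assign]
  · refine .of_yields (P := .seq (callProg 5 P [0] [0, 1, 2, 3, 4]) (.copy 3 0))
      (T := fun κ => (T κ + callCost P [0] [0, 1, 2, 3, 4]) + 1 + 1)
      ⟨hP.callProg _ _ _, trivial⟩ (by fun_prop) fun κ => ?_
    refine ((key κ).seq_pure (Exec.straight (P := .copy 3 0)
      (by simp [Straight, assign]) rfl)).yields_pure 4 |>.congr le_rfl ?_
    simp [readFrom, load, assign]

/-- The view of an adversary against the construction in which the key of block `i` is replaced by
the given one. -/
def plantView (H : Scheme) (κ : ℕ) : KeyKind → List Bool → ℕ → List Bool → List Bool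
  | .publicKey, ek, i, v =>
    ek.take (i * partLen H (H.encKeyLen κ) κ) ++
      (v ++ (ek.drop (i * partLen H (H.encKeyLen κ) κ)).drop (H.encKeyLen κ))
  | .secretKey, _, _, _ => []

theorem length_plantView_le (κ : ℕ) (kind : KeyKind) (ek : List Bool) (i : ℕ) (v : List Bool) :
    (plantView H κ kind ek i v).length ≤ ek.length + v.length := by
  rcases kind
  · simp [plantView]; omega
  · simp [plantView]

theorem exists_plantViewProg (hH : IsPRC kind H 𝓔) {ℓ : ℕ → ℕ} (hℓ : PolyBounded ℓ)
    (kind' : KeyKind) :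
    ∃ (P : Prog) (T : ℕ → ℕ), PolyBounded T ∧ ∀ (O : PMF (List Bool)) (κ : ℕ) (ek : List Bool)
      (i : ℕ) (v : List Bool), i ≤ 2 * ℓ κ →
        Yields O P [ones κ, ek, ones i, v] (T (κ + v.length)) 1
          (PMF.pure [plantView H κ kind' ek i v]) := by
  rcases kind'
  · obtain ⟨hu₁, hu₂⟩ := hH.unaryPolyTime_keyLen_len
    have hu₃ : UnaryPolyTime fun κ => partLen H (H.encKeyLen κ) κ := by
      have := (hu₁.add (hu₂.add hu₂)).add hu₂
      simpa only [partLen, two_mul] using this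
    obtain ⟨P₁, T₁, -, hT₁, h₁⟩ := hu₃.exists_prog
    obtain ⟨P₂, T₂, -, hT₂, h₂⟩ := hu₁.exists_prog
    obtain ⟨C₃, h₃⟩ := yields_mul
    obtain ⟨C₄, h₄⟩ := yields_split_ones
    obtain ⟨C₅, h₅⟩ := yields_append
    have hp₁ := hu₁.polyBounded
    have hp₃ := hu₃.polyBounded
    obtain ⟨q, hq⟩ : PolyBounded fun κ => (T₁ κ + callCost P₁ [0] [4]) +
      ((C₃ * (2 * ℓ κ + 1) * (partLen H (H.encKeyLen κ) κ + 1) + callCost mulProg [2, 4] [4]) +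
      ((C₄ * (2 * ℓ κ * partLen H (H.encKeyLen κ) κ + 1) + callCost splitProg [4, 1] [5, 1]) +
      ((T₂ κ + callCost P₂ [0] [4]) +
      ((C₄ * (H.encKeyLen κ + 1) + callCost splitProg [4, 1] [6, 1]) +
      ((C₅ * (κ + 1) + callCost appendProg [3, 1] [1]) +
      (C₅ * (2 * ℓ κ * partLen H (H.encKeyLen κ) κ + 1) + callCost appendProg [5, 1] [0]) + 1) + 1)
        + 1) + 1) + 1) + 1 := by fun_prop
    refine ⟨.seq (callProg 7 P₁ [0] [4]) (.seq (callProg 7 mulProg [2, 4] [4])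
      (.seq (callProg 7 splitProg [4, 1] [5, 1]) (.seq (callProg 7 P₂ [0] [4])
      (.seq (callProg 7 splitProg [4, 1] [6, 1]) (.seq (callProg 7 appendProg [3, 1] [1])
      (callProg 7 appendProg [5, 1] [0])))))), fun n => q.eval n + C₅ * (n + 1), by fun_prop, fun O κ ek i v hi => ?_⟩
    set pl := partLen H (H.encKeyLen κ) κ with hpl
    have e1 := (h₁ O κ).call_pure (K := 7) (ins := [0]) (outs := [4])
      (xs := [ones κ, ek, ones i, v, [], [], []]) (by simp) (by simp) (by simp)
    have e2 := (h₃ O i pl).call_pure (K := 7) (ins := [2, 4]) (outs := [4])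
      (xs := [ones κ, ek, ones i, v, ones pl, [], []]) (by simp) (by simp) (by simp)
    have e3 := (h₄ O (i * pl) ek).call_pure (K := 7) (ins := [4, 1]) (outs := [5, 1])
      (xs := [ones κ, ek, ones i, v, ones (i * pl), [], []]) (by simp) (by simp) (by simp)
    have e4 := (h₂ O κ).call_pure (K := 7) (ins := [0]) (outs := [4])
      (xs := [ones κ, ek.drop (i * pl), ones i, v, ones (i * pl), ek.take (i * pl), []])
      (by simp) (by simp) (by simp)
    have e5 := (h₄ O (H.encKeyLen κ) (ek.drop (i * pl))).call_pure (K := 7) (ins := [4, 1])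
      (outs := [6, 1]) (xs := [ones κ, ek.drop (i * pl), ones i, v, ones (H.encKeyLen κ),
        ek.take (i * pl), []]) (by simp) (by simp) (by simp)
    have e6 := (h₅ O v ((ek.drop (i * pl)).drop (H.encKeyLen κ))).call_pure (K := 7)
      (ins := [3, 1]) (outs := [1]) (xs := [ones κ, (ek.drop (i * pl)).drop (H.encKeyLen κ),
        ones i, v, ones (H.encKeyLen κ), ek.take (i * pl),
        (ek.drop (i * pl)).take (H.encKeyLen κ)]) (by simp) (by simp) (by simp)
    have e7 := (h₅ O (ek.take (i * pl)) (v ++ (ek.drop (i * pl)).drop (H.encKeyLen κ))).call_pure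
      (K := 7) (ins := [5, 1]) (outs := [0]) (xs := [ones κ,
        v ++ (ek.drop (i * pl)).drop (H.encKeyLen κ),
        ones i, v, ones (H.encKeyLen κ), ek.take (i * pl),
        (ek.drop (i * pl)).take (H.encKeyLen κ)]) (by simp) (by simp) (by simp)
    refine Yields.congr ((e1.seq_pure (e2.seq_pure (e3.seq_pure (e4.seq_pure (e5.seq_pure
      (e6.seq_pure e7)))))).yields_pure (ins := [ones κ, ek, ones i, v]) 3) ?_ rfl
    have hq1 := (hq κ).trans (polyEval_mono q (Nat.le_add_right κ v.length))
    have b1 : C₃ * (i + 1) * (pl + 1) ≤ C₃ * (2 * ℓ κ + 1) * (pl + 1) := by gcongr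
    have b2 : C₄ * (i * pl + 1) ≤ C₄ * (2 * ℓ κ * pl + 1) := by gcongr
    have b3 : C₅ * (v.length + 1) ≤ C₅ * (κ + v.length + 1) := by gcongr; omega
    have b4 : C₅ * ((ek.take (i * pl)).length + 1) ≤ C₅ * (2 * ℓ κ * pl + 1) := by
      gcongr
      rw [List.length_take]
      exact (min_le_left _ _).trans (by gcongr)
    beta_reduce at hq1 ⊢
    rw [← hpl] at hq1
    omega
  · refine ⟨.copy 4 0, fun _ => 1, by fun_prop, fun O κ ek i v _ => ?_⟩
    exact (Exec.straight (P := .copy 4 0) (xs := [ones κ, ek, ones i, v, []])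
      (by simp [Straight]) rfl).yields_pure (ins := [ones κ, ek, ones i, v]) 1

end
end EditPRC

/-! ### The adversary against the inner code. -/

namespace EditPRC
noncomputable section

open scoped ENNReal

variable {kind : KeyKind} {H : Scheme} {𝓔 : Set Channel} {O : PMF (List Bool)}

/-! ### The reduction -/

theorem exists_adversary {P : Prog} {T : ℕ → ℕ} (hT : PolyBounded T)
    {D : PMF (List Bool) → ℕ → List Bool → PMF Bool}
    (h : ∀ O κ v, Yields O P [ones κ, v] (T (κ + v.length)) 1
      ((D O κ v).map fun b => [flagStr b])) :
    ∃ A : Adversary, ∀ O κ v, A.output O κ v = D O κ v := by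
  obtain ⟨q, hq⟩ := hT
  have h' := fun O κ v => (h O κ v).mono (hq _)
  refine ⟨⟨P, q, fun O κ v => ?_⟩, fun O κ v => ?_⟩
  · obtain ⟨d, hd, -⟩ := h' O κ v
    exact hd.halts
  · obtain ⟨d, hd, hμ⟩ := h' O κ v
    have e1 : finalStore O P (load [ones κ, v]) (q.eval (κ + v.length)) = d := hd.map_snd
    have e2 := congrArg (PMF.map fun vs : List (List Bool) => (vs.headD []).headD false) hμ
    rw [PMF.map_comp, PMF.map_comp] at e2
    simp only [Adversary.output, e1]
    refine Eq.trans e2 ?_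
    have : ((fun vs : List (List Bool) => (vs.headD []).headD false) ∘ fun b => [flagStr b]) =
        id := by
      funext b
      rcases b <;> rfl
    rw [this, PMF.map_id]

/-- The output of the adversary against the given code: it samples a random index `i` and keys of
the construction, plants its view into block `i`, and runs the adversary against the construction
with the hybrid encoder. -/
def reductionOutput (A : Adversary) (kind : KeyKind) (H : Scheme) (ℓ : ℕ → ℕ)
    (O : PMF (List Bool)) (κ : ℕ) (v : List Bool) : PMF Bool :=
  (randomIndex (ℓ κ)).bind fun i => ((cgkCode H ℓ).keyGen κ).bind fun k =>
    if i < ℓ κ then A.output (hybridEnc H (ℓ κ) κ O k.1 (i + 1)) κ (plantView H κ kind k.1 i v)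
    else PMF.pure false

/-- The work is the running time: it must be polynomial for every oracle and every string `v`, valid
key or not, so the simulated adversary is bounded through the length of the planted view. -/
theorem exists_reduction (hH : IsPRC kind H 𝓔) {ℓ : ℕ → ℕ} (hℓ : UnaryPolyTime ℓ)
    (A : Adversary) : ∃ B : Adversary, ∀ O κ v,
      B.output O κ v = reductionOutput A kind H ℓ O κ v := by
  obtain ⟨PL, TL, -, hTL, hL⟩ := hℓ.exists_prog
  obtain ⟨TI, hTI, hI⟩ := exists_yields_indexProg
  obtain ⟨PG, TG, -, hTG, hG⟩ := exists_cgkKeyGenProg hH hℓ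
  obtain ⟨C, hC⟩ := yields_split_ones
  obtain ⟨PV, TV, hTV, hV⟩ := exists_plantViewProg hH hℓ.polyBounded kind
  obtain ⟨PO, TO, hTO, hO⟩ := exists_hybridEncProg hH hℓ
  have hℓ' := hℓ.polyBounded
  have hp₁ := hH.unaryPolyTime_keyLen_len.1.polyBounded
  have hp₂ := hH.unaryPolyTime_keyLen_len.2.polyBounded
  obtain ⟨q₁, hq₁⟩ : PolyBounded fun κ => ℓ κ * partLen H (H.encKeyLen κ) κ := by
    simp only [partLen]; fun_prop
  obtain ⟨q₂, hq₂⟩ : PolyBounded fun κ => TO κ + callCost PO [0, 1, 2] [0] := by fun_prop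
  obtain ⟨q₃, hq₃⟩ : PolyBounded fun κ => (TL κ + callCost PL [0] [2]) +
    ((TI (ℓ κ) + callCost indexProg [2] [3]) + ((TG κ + callCost PG [0] [4, 5]) +
    ((C * (2 * ℓ κ + 1) + callCost splitProg [3, 2] [5, 2]) + 1))) := by fun_prop
  refine exists_adversary (P := .seq (callProg 7 PL [0] [2]) (.seq (callProg 7 indexProg [2] [3])
    (.seq (callProg 7 PG [0] [4, 5]) (.seq (callProg 7 splitProg [3, 2] [5, 2])
    (.branch 2 (.copy 2 0) .skip (.seq (callProg 7 PV [0, 4, 3, 1] [6]) (.seq (.push true 3)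
      (callProg 7 (simulateProg A.prog PO) [0, 4, 3, 6] [0]))))))))
    (T := fun n => q₃.eval n + (TV n + callCost PV [0, 4, 3, 1] [6]) +
      (A.time.eval (n + q₁.eval n) * q₂.eval n + 10 +
        callCost (simulateProg A.prog PO) [0, 4, 3, 6] [0]) + 10) (by fun_prop) ?_
  intro O κ v
  -- Removing `i` marks from `1^ℓ` leaves register `2` non-empty exactly when `i < ℓ κ`, so the next
  -- branch performs the comparison.
  let S : ℕ → List Bool × List Bool → List (List Bool) := fun i k =>
    [ones κ, v, (ones (ℓ κ)).drop i, ones i, k.1, (ones (ℓ κ)).take i, []]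
  have e0 := (hL O κ).call_pure (K := 7) (ins := [0]) (outs := [2])
    (xs := [ones κ, v, [], [], [], [], []]) (by simp) (by simp) (by simp)
  have e1 : Exec O (callProg 7 indexProg [2] [3]) [ones κ, v, ones (ℓ κ), [], [], [], []]
      (TI (ℓ κ) + callCost indexProg [2] [3]) ((randomIndex (ℓ κ)).map fun i =>
        [ones κ, v, ones (ℓ κ), ones i, [], [], []]) :=
    ((hI O (ℓ κ)).call (K := 7) (ins := [2]) (outs := [3])
      (xs := [ones κ, v, ones (ℓ κ), [], [], [], []]) (by simp) (by simp) (by simp)).congr le_rfl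
        (by rw [PMF.map_comp]; rfl)
  have e2 : ∀ i, Exec O (callProg 7 PG [0] [4, 5]) [ones κ, v, ones (ℓ κ), ones i, [], [], []]
      (TG κ + callCost PG [0] [4, 5]) (((cgkCode H ℓ).keyGen κ).map fun k =>
        [ones κ, v, ones (ℓ κ), ones i, k.1, k.2, []]) := fun i =>
    ((hG O κ).call (K := 7) (ins := [0]) (outs := [4, 5])
      (xs := [ones κ, v, ones (ℓ κ), ones i, [], [], []]) (by simp) (by simp) (by simp)).congr
        le_rfl (by rw [PMF.map_comp]; rfl)
  have e3 : ∀ i (k : List Bool × List Bool), Exec O (callProg 7 splitProg [3, 2] [5, 2])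
      [ones κ, v, ones (ℓ κ), ones i, k.1, k.2, []]
      (C * (i + 1) + callCost splitProg [3, 2] [5, 2]) (PMF.pure (S i k)) := fun i k =>
    (hC O i (ones (ℓ κ))).call_pure (K := 7) (ins := [3, 2]) (outs := [5, 2])
      (xs := [ones κ, v, ones (ℓ κ), ones i, k.1, k.2, []]) (by simp) (by simp) (by simp)
  let G : ℕ → List Bool × List Bool → PMF (List (List Bool)) := fun i k =>
    if i < ℓ κ then
      (A.output (hybridEnc H (ℓ κ) κ O k.1 (i + 1)) κ (plantView H κ kind k.1 i v)).map
        fun b => [flagStr b, v, (ones (ℓ κ)).drop i, ones (i + 1), k.1, (ones (ℓ κ)).take i,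
          plantView H κ kind k.1 i v]
    else PMF.pure [[], v, [], ones i, k.1, (ones (ℓ κ)).take i, []]
  have e4 : ∀ i ≤ 2 * ℓ κ, ∀ k ∈ ((cgkCode H ℓ).keyGen κ).support,
      Exec O (.branch 2 (.copy 2 0) .skip (.seq (callProg 7 PV [0, 4, 3, 1] [6])
        (.seq (.push true 3) (callProg 7 (simulateProg A.prog PO) [0, 4, 3, 6] [0])))) (S i k)
        ((TV (κ + v.length) + callCost PV [0, 4, 3, 1] [6]) + (1 +
          (A.time.eval (κ + v.length + q₁.eval (κ + v.length)) * q₂.eval (κ + v.length) + 10 +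
        callCost (simulateProg A.prog PO) [0, 4, 3, 6] [0]) + 1) + 1 + 1) (G i k) := by
    intro i hi k hk
    by_cases hil : i < ℓ κ
    · obtain ⟨l, hl⟩ : ∃ l, (ones (ℓ κ)).drop i = true :: l :=
        ⟨ones (ℓ κ - i - 1), by
          rw [ones, List.drop_replicate, show ℓ κ - i = (ℓ κ - i - 1) + 1 by omega]; rfl⟩
      have hk1 : k.1.length = ℓ κ * partLen H (H.encKeyLen κ) κ :=
        (cgkCode_keyGen_length hH ℓ κ k hk).1
      have f1 := (hV O κ k.1 i v hi).call_pure (K := 7) (ins := [0, 4, 3, 1]) (outs := [6])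
        (xs := S i k) (by simp [S]) (by simp [S]) (by simp [S])
      -- The hybrid encoder expects `i + 1`, so that block `i` meets the value `1` of the decreasing
      -- index.
      have f2 : Exec O (.push true 3) [ones κ, v, (ones (ℓ κ)).drop i, ones i, k.1,
          (ones (ℓ κ)).take i, plantView H κ kind k.1 i v] 1
          (PMF.pure [ones κ, v, (ones (ℓ κ)).drop i, ones (i + 1), k.1,
          (ones (ℓ κ)).take i, plantView H κ kind k.1 i v]) :=
        Exec.straight (P := .push true 3) (by simp [Straight]) rfl
      have f3 := (A.yields_simulateProg (view := plantView H κ kind k.1 i v)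
        (hO O κ k.1 (i + 1) hk1)).call (K := 7) (ins := [0, 4, 3, 6]) (outs := [0])
        (xs := [ones κ, v, (ones (ℓ κ)).drop i, ones (i + 1), k.1,
          (ones (ℓ κ)).take i, plantView H κ kind k.1 i v]) (by simp) (by simp) (by simp)
      refine Exec.congr (Exec.branch_true (r := 2) (l := l) hl (f1.seq_pure (f2.seq_pure f3)))
        ?_ ?_
      · have b1 := hq₂ κ
        have b2 := polyEval_mono q₂ (Nat.le_add_right κ v.length)
        have b3 := hq₁ κ
        have b4 := polyEval_mono q₁ (Nat.le_add_right κ v.length)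
        have b5 := length_plantView_le (H := H) κ kind k.1 i v
        have b6 : A.time.eval (κ + (plantView H κ kind k.1 i v).length) ≤
            A.time.eval (κ + v.length + q₁.eval (κ + v.length)) := by
          refine polyEval_mono A.time ?_
          beta_reduce at *
          omega
        have b7 := Nat.mul_le_mul b6 (b1.trans b2)
        beta_reduce at b7
        omega
      · simp only [G, if_pos hil]
        rw [PMF.map_comp]
        rfl
    · have hd : (ones (ℓ κ)).drop i = [] := by simp [ones, List.drop_replicate]; omega
      refine Exec.congr (Exec.branch_nil (r := 2) (μ := G i k) (T := 1) (by simpa [S] using hd)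
        (Exec.straight (P := .copy 2 0) (by simp [S, Straight]) ?_)) (by omega) rfl
      simp only [G, if_neg hil, S, hd]
      rfl
  refine Yields.congr (Exec.yields (ins := [ones κ, v]) 5 (e0.seq_pure (Exec.seq_map e1
    (g := fun i => ((cgkCode H ℓ).keyGen κ).bind fun k => G i k)
    (T' := (TG κ + callCost PG [0] [4, 5]) + ((C * (2 * ℓ κ + 1) +
      callCost splitProg [3, 2] [5, 2]) + ((TV (κ + v.length) + callCost PV [0, 4, 3, 1] [6]) + (1 +
          (A.time.eval (κ + v.length + q₁.eval (κ + v.length)) * q₂.eval (κ + v.length) + 10 +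
        callCost (simulateProg A.prog PO) [0, 4, 3, 6] [0]) + 1) + 1 + 1) + 1) + 1)
    fun i hi => ?_))) ?_ ?_
  · have hi' := le_of_mem_randomIndex hi
    refine Exec.seq_map (e2 i) fun k hk => Exec.seq_pure ((e3 i k).mono ?_) (e4 i hi' k hk)
    gcongr
  · have := (hq₃ κ).trans (polyEval_mono q₃ (Nat.le_add_right κ v.length))
    beta_reduce at *
    omega
  · rw [reductionOutput]
    simp only [map_eq_bind, PMF.bind_bind]
    congr 1
    funext i
    congr 1
    funext k
    by_cases hil : i < ℓ κ
    · simp only [G, if_pos hil, map_eq_bind, PMF.bind_bind, PMF.pure_bind]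
      rfl
    · simp only [G, if_neg hil, PMF.pure_bind]
      rfl

end
end EditPRC

/-! ### The hybrid argument. -/

namespace EditPRC
noncomputable section

open scoped ENNReal

variable {kind : KeyKind} {H : Scheme} {𝓔 : Set Channel} {O : PMF (List Bool)}

/-! ### The hybrid argument -/

/-- Replacing the first component of one sample by a fresh one does not change the
distribution. -/
theorem expect_iid_modify {α β : Type} (d : PMF α) (D : PMF β) {m i : ℕ} (hi : i < m)
    (F : List (α × β) → ℝ≥0∞) :
    (expect d fun k => expect (iid (d.bind fun a => D.map (Prod.mk a)) m) fun l =>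
      F (l.modify i fun b => (k, b.2))) = expect (iid (d.bind fun a => D.map (Prod.mk a)) m) F := by
  induction m generalizing i F with
  | zero => omega
  | succ m ih =>
    simp only [expect_iid_succ]
    cases i with
    | zero => simp only [List.modify_zero_cons, expect_bind, expect_map, expect_const]
    | succ i =>
      simp only [List.modify_succ_cons]
      rw [expect_comm]
      exact expect_congr_support fun b _ => ih (by omega) fun l => F (b :: l)

theorem blockKeyGen_eq (H : Scheme) (κ : ℕ) :
    blockKeyGen H κ = (H.keyGen κ).bind fun k => ((uniformBits (2 * H.len κ)).bind fun r =>
      (uniformBits (H.len κ)).map fun e => (r, e)).map (Prod.mk k) := by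
  simp only [blockKeyGen, PMF.map_bind, PMF.map_comp]
  rfl

theorem readPart_joinParts {k κ t : ℕ} {ps : List (List Bool × List Bool × List Bool)}
    (h : ∀ p ∈ ps, p.1.length = k ∧ p.2.1.length = 2 * H.len κ ∧ p.2.2.length = H.len κ)
    (ht : t < ps.length) : readPart H k κ (joinParts ps) t = ps[t] := by
  have h1 := congrArg (fun l => l[t]?) (map_readPart_joinParts H k κ ps h)
  simpa [ht] using h1

theorem joinParts_modify {k κ : ℕ} {ps : List (List Bool × List Bool × List Bool)}
    (h : ∀ p ∈ ps, p.1.length = k ∧ p.2.1.length = 2 * H.len κ ∧ p.2.2.length = H.len κ)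
    {i : ℕ} (hi : i < ps.length) (v : List Bool) :
    joinParts (ps.modify i fun p => (v, p.2)) =
      (joinParts ps).take (i * partLen H k κ) ++
        (v ++ ((joinParts ps).drop (i * partLen H k κ)).drop k) := by
  induction ps generalizing i with
  | nil => simp at hi
  | cons p ps ih =>
    obtain ⟨⟨h1, h2, h3⟩, h'⟩ := List.forall_mem_cons.1 h
    cases i with
    | zero =>
      subst h1
      simp [joinParts, List.append_assoc]
    | succ i =>
      have hl : (p.1 ++ p.2.1 ++ p.2.2).length = partLen H k κ := by
        simp [partLen, h1, h2, h3, Nat.add_assoc]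
      have hj : joinParts (p :: ps) = (p.1 ++ p.2.1 ++ p.2.2) ++ joinParts ps := rfl
      rw [List.modify_succ_cons, hj, show joinParts (p :: ps.modify i fun p => (v, p.2)) =
        (p.1 ++ p.2.1 ++ p.2.2) ++ joinParts (ps.modify i fun p => (v, p.2)) from rfl,
        ih h' (by simpa using hi), add_mul, one_mul, add_comm (i * _), ← hl, List.take_append,
        List.drop_append]
      generalize p.1 ++ p.2.1 ++ p.2.2 = q
      rw [List.take_of_length_le (Nat.le_add_right _ _), List.drop_of_length_le
        (Nat.le_add_right _ _), Nat.add_sub_cancel_left, List.nil_append, List.append_assoc]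

/-- The encoder in which the first `j` blocks are uniform. -/
def idealPrefixEnc (H : Scheme) (m κ : ℕ) (ek : List Bool) (j : ℕ) : PMF (List Bool) :=
  concatAll ((List.range m).map fun t =>
    if t < j then uniformBits (blockLen H κ)
    else encBlock H κ (readPart H (H.encKeyLen κ) κ ek t))

theorem uniformBits_add (a b : ℕ) :
    uniformBits (a + b) = (uniformBits a).bind fun x => (uniformBits b).map fun y => x ++ y := by
  induction a with
  | zero =>
    simp only [uniformBits, iid, zero_add, PMF.pure_bind, List.nil_append]
    exact (PMF.map_id _).symm
  | succ a ih =>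
    rw [Nat.succ_add, uniformBits_succ, ih, uniformBits_succ]
    simp only [map_eq_bind, PMF.bind_bind, PMF.pure_bind, List.cons_append]

theorem concatAll_replicate_uniformBits (m n : ℕ) :
    concatAll (List.replicate m (uniformBits n)) = uniformBits (m * n) := by
  induction m with
  | zero => simp [concatAll, uniformBits, iid]
  | succ m ih => rw [List.replicate_succ, concatAll, ih, ← uniformBits_add]; congr 1; ring

theorem idealPrefixEnc_zero (ℓ : ℕ → ℕ) (κ : ℕ) (ek : List Bool) :
    idealPrefixEnc H (ℓ κ) κ ek 0 = (cgkCode H ℓ).enc κ ek := by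
  simp only [idealPrefixEnc, Nat.not_lt_zero, if_false]
  rfl

theorem idealPrefixEnc_self (m κ : ℕ) (ek : List Bool) :
    idealPrefixEnc H m κ ek m = uniformBits (m * blockLen H κ) := by
  rw [idealPrefixEnc, ← concatAll_replicate_uniformBits]
  congr 1
  refine List.ext_getElem (by simp) fun t h _ => ?_
  have : t < m := by simpa using h
  simp [this]

/-- For a fixed mask, exclusive or permutes the strings, and the decoding map preserves uniformity;
so a uniform oracle answer produces a uniform block for every fixed seed and mask. -/
theorem hybridBlock_uniformBits {κ : ℕ} {part : List Bool × List Bool × List Bool}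
    (h : part.2.2.length = H.len κ) :
    hybridBlock H κ (uniformBits (H.len κ)) 1 part = uniformBits (blockLen H κ) := by
  rw [hybridBlock, ← uniformBits_bind_unemb (H.len κ) (blockLen H κ) part.2.1]
  refine pmf_ext_expect fun f => ?_
  rw [expect_bind, expect_bind]
  simp only [xorStr_comm _ part.2.2]
  rw [← h]
  exact expect_uniformBits_xorStr fun a => expect (unemb (blockLen H κ) a part.2.1) f

/-- The relation between the keys before and after planting. -/
theorem hybridEnc_planted {κ i : ℕ} {ps : List (List Bool × List Bool × List Bool)}
    (h : ∀ p ∈ ps, p.1.length = H.encKeyLen κ ∧ p.2.1.length = 2 * H.len κ ∧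
      p.2.2.length = H.len κ) {v : List Bool} (hv : v.length = H.encKeyLen κ)
    (hi : i < ps.length) :
    hybridEnc H ps.length κ (H.enc κ v) (joinParts ps) (i + 1) =
        idealPrefixEnc H ps.length κ (joinParts (ps.modify i fun p => (v, p.2))) i ∧
      hybridEnc H ps.length κ (uniformBits (H.len κ)) (joinParts ps) (i + 1) =
        idealPrefixEnc H ps.length κ (joinParts (ps.modify i fun p => (v, p.2))) (i + 1) := by
  have h' : ∀ p ∈ ps.modify i fun p => (v, p.2), p.1.length = H.encKeyLen κ ∧
      p.2.1.length = 2 * H.len κ ∧ p.2.2.length = H.len κ := by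
    intro p hp
    obtain ⟨t, ht, rfl⟩ := List.getElem_of_mem hp
    rw [List.getElem_modify]
    rw [List.length_modify] at ht
    have := h _ (List.getElem_mem ht)
    split_ifs
    · exact ⟨hv, this.2⟩
    · exact this
  have hread : ∀ t < ps.length, readPart H (H.encKeyLen κ) κ (joinParts ps) t = ps[t]! := by
    intro t ht
    rw [readPart_joinParts h ht, getElem!_pos ps t ht]
  have hread' : ∀ t < ps.length, readPart H (H.encKeyLen κ) κ
      (joinParts (ps.modify i fun p => (v, p.2))) t =
        if i = t then (v, (ps[t]!).2) else ps[t]! := by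
    intro t ht
    rw [readPart_joinParts h' (by simpa using ht), List.getElem_modify, getElem!_pos ps t ht]
  constructor
  · refine congrArg concatAll (List.map_congr_left fun t ht => ?_)
    rw [List.mem_range] at ht
    rw [hread t ht, hread' t ht]
    -- The truncated difference `i + 1 - t` is at least `2` before block `i`, equal to `1` at it and
    -- `0` after it: uniform, challenge and real blocks.
    rcases lt_trichotomy t i with hti | rfl | hti
    · rw [if_pos hti, show i + 1 - t = (i - 1 - t) + 2 by omega]; rfl
    · simp only [lt_irrefl, if_false, if_true, Nat.add_sub_cancel_left]; rfl
    · rw [if_neg (by omega), if_neg (by omega), show i + 1 - t = 0 by omega]; rfl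
  · refine congrArg concatAll (List.map_congr_left fun t ht => ?_)
    rw [List.mem_range] at ht
    rw [hread t ht, hread' t ht]
    rcases lt_trichotomy t i with hti | rfl | hti
    · rw [if_pos (by omega), show i + 1 - t = (i - 1 - t) + 2 by omega]; rfl
    · rw [if_pos (by omega), Nat.add_sub_cancel_left]
      refine hybridBlock_uniformBits ?_
      rw [getElem!_pos ps t ht]
      exact (h _ (List.getElem_mem ht)).2.2
    · rw [if_neg (by omega), if_neg (by omega), show i + 1 - t = 0 by omega]; rfl

/-- The probability that the adversary accepts when the first `j` blocks are uniform. -/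
def hybridProb (A : Adversary) (kind : KeyKind) (H : Scheme) (m κ j : ℕ) : ℝ≥0∞ :=
  expect (iid (blockKeyGen H κ) m) fun ks =>
    A.output (idealPrefixEnc H m κ (joinParts (ks.map encPart)) j) κ
      (kind.view (joinParts (ks.map encPart))) true

theorem map_encPart_modify (ks : List ((List Bool × List Bool) × List Bool × List Bool)) (i : ℕ)
    (k : List Bool × List Bool) :
    (ks.modify i fun b => (k, b.2)).map encPart =
      (ks.map encPart).modify i fun p => (k.1, p.2) := by
  induction ks generalizing i with
  | nil => simp
  | cons b ks ih =>
    cases i with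
    | zero => simp [encPart]
    | succ i => simp [ih]

theorem plantView_eq {κ i : ℕ} {ps : List (List Bool × List Bool × List Bool)}
    (h : ∀ p ∈ ps, p.1.length = H.encKeyLen κ ∧ p.2.1.length = 2 * H.len κ ∧
      p.2.2.length = H.len κ) (hi : i < ps.length) (kind : KeyKind) (v : List Bool) :
    plantView H κ kind (joinParts ps) i (kind.view v) =
      kind.view (joinParts (ps.modify i fun p => (v, p.2))) := by
  cases kind
  · exact (joinParts_modify h hi v).symm
  · rfl

/-- The reduction with a challenge oracle that turns into the encoder with `δ i` uniform blocks
when it is planted into block `i`. -/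
theorem expect_reductionOutput (hH : IsPRC kind H 𝓔) (A : Adversary) (ℓ : ℕ → ℕ) (κ : ℕ)
    (O : List Bool → PMF (List Bool)) (δ : ℕ → ℕ)
    (hO : ∀ (ps : List (List Bool × List Bool × List Bool)) (v : List Bool) (i : ℕ),
      (∀ p ∈ ps, p.1.length = H.encKeyLen κ ∧ p.2.1.length = 2 * H.len κ ∧
        p.2.2.length = H.len κ) → v.length = H.encKeyLen κ → i < ps.length →
      hybridEnc H ps.length κ (O v) (joinParts ps) (i + 1) =
        idealPrefixEnc H ps.length κ (joinParts (ps.modify i fun p => (v, p.2))) (δ i)) :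
    ((H.keyGen κ).bind fun k => reductionOutput A kind H ℓ (O k.1) κ (kind.view k.1)) true =
      (2 ^ (ℓ κ).size)⁻¹ * ∑ i ∈ Finset.range (ℓ κ), hybridProb A kind H (ℓ κ) κ (δ i) := by
  rw [bind_apply_eq_expect]
  simp only [reductionOutput, bind_apply_eq_expect]
  rw [expect_comm, expect_randomIndex]
  · congr 1
    refine Finset.sum_congr rfl fun i hi => ?_
    rw [Finset.mem_range] at hi
    simp only [if_pos hi, expect_cgkCode_keyGen]
    -- The challenge key takes the place of the sampled key of block `i`. It has the same law and is
    -- independent of the rest, so the planted list is distributed like a genuine one.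
    rw [hybridProb, blockKeyGen_eq, ← expect_iid_modify _ _ hi, ← blockKeyGen_eq]
    refine expect_congr_support fun k hk => expect_congr_support fun ks hks => ?_
    have hl : (ks.map encPart).length = ℓ κ := by rw [List.length_map, length_of_mem_iid hks]
    have h : ∀ p ∈ ks.map encPart, p.1.length = H.encKeyLen κ ∧ p.2.1.length = 2 * H.len κ ∧
        p.2.2.length = H.len κ := by
      intro p hp
      rw [List.mem_map] at hp
      obtain ⟨b, hb, rfl⟩ := hp
      have := (forall_of_mem_iid (fun _ => hH.length_of_mem_blockKeyGen) hks b hb).2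
      exact ⟨this.1, this.2.2⟩
    have h1 := hO _ k.1 i h (hH.keyGen_length κ k hk).1 (hl ▸ hi)
    rw [hl] at h1
    rw [map_encPart_modify, ← h1, plantView_eq h (hl ▸ hi)]
  · intro i hi
    simp only [if_neg (not_lt.2 hi)]
    simp [expect_const]

theorem hybridProb_ne_top (A : Adversary) (kind : KeyKind) (H : Scheme) (m κ j : ℕ) :
    hybridProb A kind H m κ j ≠ ⊤ :=
  ne_top_of_le_ne_top ENNReal.one_ne_top
    (expect_le_of_support fun _ _ => PMF.coe_le_one _ _)

/-- The hybrids with `0` and with `ℓ κ` uniform blocks are the real and the ideal experiment. A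
random planted index averages the consecutive differences, so the reduction retains the advantage up
to a polynomial factor. -/
theorem cgkCode_pseudorandom (hH : IsPRC kind H 𝓔) {ℓ : ℕ → ℕ} (hℓ : UnaryPolyTime ℓ)
    (A : Adversary) :
    Negligible fun κ => |(cgkCode H ℓ).realProb kind A κ - (cgkCode H ℓ).idealProb kind A κ| := by
  obtain ⟨B, hB⟩ := exists_reduction hH hℓ A
  have hℓ' := hℓ.polyBounded
  refine ((hH.pseudorandom B).poly_mul (T := fun κ => 2 * ℓ κ + 1) (by fun_prop)).mono
    (Eventually.of_forall fun κ => ?_)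
  have e1 : (cgkCode H ℓ).realProb kind A κ = (hybridProb A kind H (ℓ κ) κ 0).toReal := by
    rw [Scheme.realProb, bind_apply_eq_expect, expect_cgkCode_keyGen, hybridProb]
    simp only [idealPrefixEnc_zero]
  have e2 : (cgkCode H ℓ).idealProb kind A κ = (hybridProb A kind H (ℓ κ) κ (ℓ κ)).toReal := by
    rw [Scheme.idealProb, bind_apply_eq_expect, expect_cgkCode_keyGen, hybridProb]
    simp only [idealPrefixEnc_self]
    rfl
  have e3 : H.realProb kind B κ = ((2 : ℝ) ^ (ℓ κ).size)⁻¹ *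
      ∑ i ∈ Finset.range (ℓ κ), (hybridProb A kind H (ℓ κ) κ i).toReal := by
    rw [Scheme.realProb]
    simp only [hB]
    rw [expect_reductionOutput hH A ℓ κ (H.enc κ) (fun i => i)
      fun ps v i h hv hi => (hybridEnc_planted h hv hi).1, ENNReal.toReal_mul,
      ENNReal.toReal_sum fun i _ => hybridProb_ne_top _ _ _ _ _ _]
    simp
  have e4 : H.idealProb kind B κ = ((2 : ℝ) ^ (ℓ κ).size)⁻¹ *
      ∑ i ∈ Finset.range (ℓ κ), (hybridProb A kind H (ℓ κ) κ (i + 1)).toReal := by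
    rw [Scheme.idealProb]
    simp only [hB]
    rw [expect_reductionOutput hH A ℓ κ (fun _ => uniformBits (H.len κ)) (fun i => i + 1)
      fun ps v i h hv hi => (hybridEnc_planted h hv hi).2, ENNReal.toReal_mul,
      ENNReal.toReal_sum fun i _ => hybridProb_ne_top _ _ _ _ _ _]
    simp
  have h2 : ((2 : ℝ) ^ (ℓ κ).size) ≤ 2 * ℓ κ + 1 := by exact_mod_cast two_pow_size_le (ℓ κ)
  -- The two sums differ by a shift of the index and telescope.
  have h3 : H.realProb kind B κ - H.idealProb kind B κ = ((2 : ℝ) ^ (ℓ κ).size)⁻¹ *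
      ((cgkCode H ℓ).realProb kind A κ - (cgkCode H ℓ).idealProb kind A κ) := by
    rw [e1, e2, e3, e4, ← mul_sub, ← Finset.sum_sub_distrib,
      Finset.sum_range_sub' fun i => (hybridProb A kind H (ℓ κ) κ i).toReal]
  have h4 : (0 : ℝ) < 2 ^ (ℓ κ).size := by positivity
  have h5 : |(cgkCode H ℓ).realProb kind A κ - (cgkCode H ℓ).idealProb kind A κ| =
      (2 : ℝ) ^ (ℓ κ).size * |H.realProb kind B κ - H.idealProb kind B κ| := by
    rw [h3, abs_mul, abs_of_pos (inv_pos.2 h4), mul_inv_cancel_left₀ h4.ne']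
  rw [h5]
  push_cast
  gcongr

end
end EditPRC

/-! ### Assembly of the code. -/

namespace EditPRC
noncomputable section

variable {kind : KeyKind} {H : Scheme} {𝓔 : Set Channel}

/-! ### The code -/

theorem cgkCode_secret (hH : IsPRC kind H 𝓔) (ℓ : ℕ → ℕ) (h : kind = .secretKey) (κ : ℕ) :
    ∀ k ∈ ((cgkCode H ℓ).keyGen κ).support, k.1 = k.2 := by
  intro k hk
  simp only [cgkCode, PMF.mem_support_map_iff] at hk
  obtain ⟨ks, hks, rfl⟩ := hk
  refine congrArg List.flatten (List.map_congr_left fun b hb => ?_)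
  have := (forall_of_mem_iid (fun _ => hH.length_of_mem_blockKeyGen) hks b hb).1
  rw [hH.secret h κ _ this]

theorem cgkCode_isPRC {c₁ : ℝ} (hc₁ : 0 < c₁) (hc₁' : c₁ < 1 / 4)
    (hH : IsPRC kind H (obliviousChannels (1 / 4 + c₁))) {γ : ℝ} (hγ : 0 < γ) {ℓ : ℕ → ℕ}
    (hℓ : AdmissibleBlocks γ H ℓ) {c₂ : ℝ} (hc₂ : 0 < c₂) (hc₂' : c₂ ≤ c₁ / 64) :
    IsPRC kind (cgkCode H ℓ) {E | EditBounded (fun x => c₂ / (x : ℝ) ^ γ) E} where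
  keyGen_length := cgkCode_keyGen_length hH ℓ
  enc_length κ ek _ := cgkCode_enc_length H ℓ κ ek
  secret := cgkCode_secret hH ℓ
  keyGen_ppt := (cgkCode_ppt hH hℓ.polyTime).1
  enc_ppt := (cgkCode_ppt hH hℓ.polyTime).2.1
  dec_ppt := (cgkCode_ppt hH hℓ.polyTime).2.2
  robust _ hE := cgkCode_robust hc₁ hc₁' hH hγ hℓ hc₂ hc₂' hE
  sound := cgkCode_sound hH hℓ.polyTime
  pseudorandom := cgkCode_pseudorandom hH hℓ.polyTime

end
end EditPRC

theorem mainTheorem1 (c₁ : ℝ) (hc₁ : 0 < c₁) (hc₁' : c₁ < 1 / 4) :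
    ∃ C₂ : ℝ, 0 < C₂ ∧ C₂ ≤ 1 ∧
      ∀ (γ : ℝ), 0 < γ → γ < 1 / 2 →
      ∀ (kind : KeyKind) (H : Scheme),
        IsPRC kind H {E | ObliviousHamming E ∧ HammingBounded (fun _ => 1 / 4 + c₁) E} →
        -- every admissible number of blocks gives a code of the same kind
        (∀ ℓ : ℕ → ℕ, AdmissibleBlocks γ H ℓ →
          ∀ c₂ : ℝ, 0 < c₂ → c₂ ≤ C₂ →
            IsPRC kind (cgkCode H ℓ) {E | EditBounded (fun x => c₂ / (x : ℝ) ^ γ) E}) ∧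
        -- the standard number of blocks is admissible if `γ` is rational and it outgrows `log κ`
        ((∃ g : ℚ, (g : ℝ) = γ) →
          Tendsto (fun κ : ℕ => (standardBlocks γ H κ : ℝ) / Real.log κ) atTop atTop →
          AdmissibleBlocks γ H (standardBlocks γ H)) ∧
        -- there is always an admissible number of blocks
        (∃ ℓ : ℕ → ℕ, AdmissibleBlocks γ H ℓ) := by
  -- The constant `c₁ / 64` is what the random walk bound tolerates in `cgkCode_robust`; it does not
  -- depend on `γ` or on the code.
  refine ⟨c₁ / 64, by positivity, by linarith, fun γ hγ hγ' kind H hH =>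
    ⟨fun ℓ hℓ c₂ hc₂ hc₂' => cgkCode_isPRC hc₁ hc₁' hH hγ hℓ hc₂ hc₂',
      fun hq hlog => standardBlocks_admissible hH hγ hγ' hq hlog,
      exists_admissibleBlocks hH hγ hγ'⟩⟩
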